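/- Consider the following synchronous parallel machine. It has a shared memory of finitely many arrays of integer words and of real words, with concurrent reads and exclusive writes. An elementary operation is: reading a word, addition, truncated subtraction, multiplication, integer division with remainder and comparison of integer words, addition, subtraction and comparison of real words, or writing a word. Integer words hold values below $(n+1)^c$ for a constant $c$ (so they have $O(\log n)$ bits); real words hold arbitrary real numbers. A program is a fixed finite sequence of conditionals, loops and parallel statements "for all $0\le i<k$ in parallel"; in a parallel statement each of the $k$ processors computes one word by a constant number of elementary operations from the memory contents before the statement, after which all results are written simultaneously. The work is the total number of operations performed by all processors; the depth is the number of parallel steps until the last processor has finished. Theorem. There is a deterministic parallel algorithm (a single program $P$ and absolute constants $c$ and $K$) with the following property. Let $G$ be a weighted directed graph without parallel edges (self-loops are allowed), with $n\ge 2$ vertices, $m$ edges and real edge weights, given as a list of edges, and let $h$ be a real number with $1\le h\le n$. On input $(G,\lfloor h\rfloor)$ the program $P$ halts and correctly decides whether $G$ contains a negative cycle (a simple directed cycle whose edge weights have a negative sum), with work at most $$K\left(m n \log^2 n + n^3 h^{-3}\log^7 n + n^2 h\log^{11} n\right)$$ and depth at most $$K\left(h+\log^{11} n\right).$$ -/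

import Mathlib

/-!
## Weighted directed graphs
-/

/-- A weighted directed graph with vertex set `{0, …, n-1}` and exactly `m` edges, given by an
enumeration of its edges. Distinct edges have distinct pairs (tail, head); self-loops are allowed
and the weights are arbitrary real numbers. -/
structure WeightedDigraph (n m : ℕ) where
  /-- tail of an edge -/
  src : Fin m → Fin n
  /-- head of an edge -/
  tgt : Fin m → Fin n
  /-- weight of an edge -/
  weight : Fin m → ℝ
  /-- there are no parallel edges -/
  simple : Function.Injective fun e => (src e, tgt e)

/-- `G` contains a (simple, directed) cycle of negative total weight. The cycle has the `k + 1 ≥ 1`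
edges `e 0, …, e k`; the addition in `Fin (k + 1)` is cyclic, so the last edge leads back to the
tail of the first one. -/
def WeightedDigraph.HasNegativeCycle {n m : ℕ} (G : WeightedDigraph n m) : Prop :=
  ∃ (k : ℕ) (e : Fin (k + 1) → Fin m),
    (∀ i, G.tgt (e i) = G.src (e (i + 1))) ∧
    (Function.Injective fun i => G.src (e i)) ∧
    ∑ i, G.weight (e i) < 0

namespace Par

/-!
## A parallel machine model with work and depth

Programs for a synchronous parallel machine with a shared memory (concurrent reads, exclusive
writes). The memory consists of arrays of integer words and arrays of real words. In one parallel
statement any number of processors `i = 0, …, k-1` each compute one word out of the present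
memory contents by a bounded number of elementary operations, and then all of them write
simultaneously. Integer words take values below a bound `W`, which is going to be a fixed power of
the input size, i.e. they have `O(log n)` bits. Real words can only be added, subtracted and
compared.
-/

/-- Shared memory: cell `p` of the integer array `a` is `nat a p`, cell `p` of the real array `a`
is `real a p`. -/
structure Mem where
  /-- integer words -/
  nat : ℕ → ℕ → ℕ
  /-- real words -/
  real : ℕ → ℕ → ℝ

/-- Integer expressions. Truth values are `0` and `1`. -/
inductive NExp where
  /-- a literal -/
  | const (c : ℕ)
  /-- the index of the processor that evaluates the expression -/
  | idx
  /-- the word in cell `e` of the integer array `a` -/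
  | read (a : ℕ) (e : NExp)
  | add (e f : NExp)
  /-- truncated subtraction -/
  | sub (e f : NExp)
  | mul (e f : NExp)
  /-- quotient of the integer division (`0` for the divisor `0`) -/
  | div (e f : NExp)
  /-- remainder of the integer division -/
  | mod (e f : NExp)
  /-- comparison `e ≤ f` of two integers -/
  | le (e f : NExp)
  /-- comparison of two real words: cell `e` of the real array `a` is at most cell `f` of the real
  array `b` -/
  | realLe (a : ℕ) (e : NExp) (b : ℕ) (f : NExp)

/-- Real expressions. -/
inductive RExp where
  | zero
  /-- the word in cell `e` of the real array `a` -/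
  | read (a : ℕ) (e : NExp)
  | add (r s : RExp)
  | sub (r s : RExp)

/-- Number of elementary operations in the evaluation of an integer expression. -/
def NExp.size : NExp → ℕ
  | .const _ => 1
  | .idx => 1
  | .read _ e => e.size + 1
  | .add e f => e.size + f.size + 1
  | .sub e f => e.size + f.size + 1
  | .mul e f => e.size + f.size + 1
  | .div e f => e.size + f.size + 1
  | .mod e f => e.size + f.size + 1
  | .le e f => e.size + f.size + 1
  | .realLe _ e _ f => e.size + f.size + 1

/-- Number of elementary operations in the evaluation of a real expression. -/
def RExp.size : RExp → ℕ
  | .zero => 1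
  | .read _ e => e.size + 1
  | .add r s => r.size + s.size + 1
  | .sub r s => r.size + s.size + 1

open Classical in
/-- Value of an integer expression for processor `i` in the memory `σ`. Literals and results of
arithmetic operations are reduced modulo the word bound `W`. -/
noncomputable def NExp.eval (W : ℕ) (σ : Mem) (i : ℕ) : NExp → ℕ
  | .const c => c % W
  | .idx => i
  | .read a e => σ.nat a (e.eval W σ i)
  | .add e f => (e.eval W σ i + f.eval W σ i) % W
  | .sub e f => e.eval W σ i - f.eval W σ i
  | .mul e f => (e.eval W σ i * f.eval W σ i) % W
  | .div e f => e.eval W σ i / f.eval W σ i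
  | .mod e f => e.eval W σ i % f.eval W σ i
  | .le e f => if e.eval W σ i ≤ f.eval W σ i then 1 else 0
  | .realLe a e b f => if σ.real a (e.eval W σ i) ≤ σ.real b (f.eval W σ i) then 1 else 0

/-- Value of a real expression for processor `i` in the memory `σ`. -/
noncomputable def RExp.eval (W : ℕ) (σ : Mem) (i : ℕ) : RExp → ℝ
  | .zero => 0
  | .read a e => σ.real a (e.eval W σ i)
  | .add r s => r.eval W σ i + s.eval W σ i
  | .sub r s => r.eval W σ i - s.eval W σ i

/-- Programs. -/
inductive Prog where
  | skip
  /-- for all `i < k` in parallel: if `g ≠ 0`, then cell `p` of the integer array `a` gets the value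
  `v` (where `g`, `p`, `v` may use the processor index `i`) -/
  | parNat (k g : NExp) (a : ℕ) (p : NExp) (v : NExp)
  /-- the same with a real array and a real value -/
  | parReal (k g : NExp) (a : ℕ) (p : NExp) (v : RExp)
  | seq (P Q : Prog)
  /-- if `g ≠ 0` then `P` else `Q` -/
  | cond (g : NExp) (P Q : Prog)
  /-- while `g ≠ 0` do `P` -/
  | loop (g : NExp) (P : Prog)

/-- The active processors are those `i < k` with `act i`. Exclusive writes: no two active processors
write to the same cell. -/
def Exclusive (k : ℕ) (act : ℕ → Prop) (addr : ℕ → ℕ) : Prop :=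
  ∀ i j, i < k → j < k → act i → act j → addr i = addr j → i = j

open Classical in
/-- The array `old` after every active processor `i < k` has written `val i` into cell `addr i`. -/
noncomputable def scatter {α : Type} (k : ℕ) (act : ℕ → Prop) (addr : ℕ → ℕ) (val : ℕ → α)
    (old : ℕ → α) : ℕ → α := fun p =>
  if hp : ∃ i, i < k ∧ act i ∧ addr i = p then val (Nat.find hp) else old p

/-- `Run W P σ τ w d`: with the word bound `W`, the program `P` started in the memory `σ` halts in the
memory `τ`, the processors have performed `w` operations in total (work), and the number of parallel
steps was `d` (depth). A program that violates the exclusive-write condition has no run. -/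
inductive Run (W : ℕ) : Prog → Mem → Mem → ℕ → ℕ → Prop where
  | skip (σ : Mem) : Run W .skip σ σ 0 0
  | parNat (k g : NExp) (a : ℕ) (p v : NExp) (σ : Mem)
      (hex : Exclusive (k.eval W σ 0) (fun i => g.eval W σ i ≠ 0) (fun i => p.eval W σ i)) :
      Run W (.parNat k g a p v) σ
        (Mem.mk (Function.update σ.nat a
          (scatter (k.eval W σ 0) (fun i => g.eval W σ i ≠ 0) (fun i => p.eval W σ i)
            (fun i => v.eval W σ i) (σ.nat a))) σ.real)
        (k.size + k.eval W σ 0 * (g.size + p.size + v.size + 1))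
        (k.size + (g.size + p.size + v.size + 1))
  | parReal (k g : NExp) (a : ℕ) (p : NExp) (v : RExp) (σ : Mem)
      (hex : Exclusive (k.eval W σ 0) (fun i => g.eval W σ i ≠ 0) (fun i => p.eval W σ i)) :
      Run W (.parReal k g a p v) σ
        (Mem.mk σ.nat (Function.update σ.real a
          (scatter (k.eval W σ 0) (fun i => g.eval W σ i ≠ 0) (fun i => p.eval W σ i)
            (fun i => v.eval W σ i) (σ.real a))))
        (k.size + k.eval W σ 0 * (g.size + p.size + v.size + 1))
        (k.size + (g.size + p.size + v.size + 1))
  | seq {P Q : Prog} {σ τ υ : Mem} {w d w' d' : ℕ}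
      (hP : Run W P σ τ w d) (hQ : Run W Q τ υ w' d') :
      Run W (.seq P Q) σ υ (w + w') (d + d')
  | condTrue {g : NExp} {P Q : Prog} {σ τ : Mem} {w d : ℕ}
      (hg : g.eval W σ 0 ≠ 0) (hP : Run W P σ τ w d) :
      Run W (.cond g P Q) σ τ (g.size + w) (g.size + d)
  | condFalse {g : NExp} {P Q : Prog} {σ τ : Mem} {w d : ℕ}
      (hg : g.eval W σ 0 = 0) (hQ : Run W Q σ τ w d) :
      Run W (.cond g P Q) σ τ (g.size + w) (g.size + d)
  | loopTrue {g : NExp} {P : Prog} {σ τ υ : Mem} {w d w' d' : ℕ}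
      (hg : g.eval W σ 0 ≠ 0) (hP : Run W P σ τ w d) (hL : Run W (.loop g P) τ υ w' d') :
      Run W (.loop g P) σ υ (g.size + w + w') (g.size + d + d')
  | loopFalse {g : NExp} {P : Prog} {σ : Mem} (hg : g.eval W σ 0 = 0) :
      Run W (.loop g P) σ σ g.size g.size

/-- Input encoding: `n`, `m` and `h` are in the cells 0, 1, 2 of the integer array 0, the tails and
heads of the edges `0, …, m-1` in the integer arrays 1 and 2, their weights in the real array 0.
Every other word is 0. -/
def input {n m : ℕ} (G : WeightedDigraph n m) (h : ℕ) : Mem where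
  nat := fun a p =>
    if a = 0 then (if p = 0 then n else if p = 1 then m else if p = 2 then h else 0)
    else if a = 1 then (if hp : p < m then (G.src ⟨p, hp⟩ : ℕ) else 0)
    else if a = 2 then (if hp : p < m then (G.tgt ⟨p, hp⟩ : ℕ) else 0)
    else 0
  real := fun a p => if a = 0 then (if hp : p < m then G.weight ⟨p, hp⟩ else 0) else 0

/-- The answer of a program, in cell 3 of the integer array 0 when it halts. -/
def Mem.answer (σ : Mem) : ℕ := σ.nat 0 3

end Par

/-!
Number the vertices of `G` from `1` to `n` and add a source `0` with edges of weight `0` to all of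
them (`wmat`). If there is no negative cycle, then the distances from the source form a potential
`p` with `p (tgt e) ≤ p (src e) + weight e` for all edges `e`; conversely, such a potential rules out
negative cycles. So the program computes numbers that are the distances from the source if there is
no negative cycle, and answers whether some edge violates the inequality. Correctness of all steps
before this test is needed only under the assumption `NoNeg` that no closed walk is negative
(`noNeg_wmat`, `hopDist_source_edge`, `not_hasNegativeCycle_of_potential`); the bounds on work and
depth hold always. Below, `N = n + 1`, `ℓ` is the rounded binary logarithm of `N`, and a "shortest
walk" is one with the fewest edges among those of least weight.

**Hubs.** A hub set for the distance `g` (`IsHubSet`) meets every shortest walk with at least `g`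
edges within its first `g` edges. All vertices form a hub set for `g = 1`. From a hub set of size
`O(ℓ N / g)` for `g` one gets such a set for `4 g` (`IsHubSet.step`, `scaleP_spec`): compute
distances along walks with at most `3 g` edges from all hubs layer by layer, recover the walks
between hubs from the parents in the layers, and choose a set of `O(ℓ N / g)` vertices that hits the
first `2 g` vertices of each of these walks that is long enough. Any long shortest walk meets an old
hub, and between `2 g - 1` and `3 g` edges later a second one; the new set hits the part in between.

**Hitting sets.** The hitting set is the union of `2 ℓ + 1` sets with at most `2 ^ ℓ / s` vertices,
where `s = 2 g`, each of which hits half of the remaining walks. Such a set is found by halving the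
vertex set until only that many vertices remain (`greedyP_spec`). If it has been divided by `q` so
far, `singles` is the number of incidences of walks with the current set, and `pairs` the number of
pairs of these on a common walk, then the potential `s * q * singles - q ^ 2 * pairs` can
be kept from decreasing while `q` doubles (`potential_step`): it suffices to split the set in such a
way that at most half of the pairs stay together, and to keep the better side. The splitting is by a
linear form in the bits of the vertex labels over the field with two elements, whose coefficients
are fixed one by one (`split_bit`). At `q = s` the potential bounds the number of walks that are hit,
as `k - k (k - 1) / 2 ≤ 1` (`singles_le_pairs_add_hits`).

**Distances.** The hub distance is increased until `4 g ℓ > h`, so that `g ℓ ≤ h + ℓ` and there are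
`O(ℓ ^ 2 N / h)` hubs. A last computation by layers gives the distances from all hubs along walks
with at most `g` edges. Squaring the matrix of those between hubs `ℓ + 1` times over the tropical
semiring turns them into the lengths of shortest chains of hubs (`IsHubSet.chain`), and the distances
from the source, which is always a hub, are those of a chain followed by a walk with at most `g`
edges (`inf_hubDist`).

**Resources.** All three computations rest on one program that relaxes all listed edges for a number
of rows at once (`relaxP_spec`). It scans blocks of `ℓ` edges sequentially and combines the blocks by
doubling, which takes work `O(M + ℓ N)` per row for `M` edges, and depth `O(ℓ)`. Thus each of the at
most `ℓ` scales costs `O(ℓ N M + ℓ ^ 6 N ^ 2)` and depth `O(ℓ g + ℓ ^ 4)`, and the squarings cost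
`O(ℓ (ℓ ^ 2 N / h) ^ 3)` besides. Programs are verified by a logic with resource bounds (`Spec`), in
which expressions are evaluated without overflow: all stored words are at most
`B = 100 * (2 ^ ℓ) ^ 6`, so that expressions with at most `250` operations stay below
`(n + 1) ^ 4251` (`good_clog`).
-/

/-! ### Program logic for the parallel machine -/

namespace Par

instance : Add NExp := ⟨NExp.add⟩
instance : Sub NExp := ⟨NExp.sub⟩
instance : Mul NExp := ⟨NExp.mul⟩
instance : Div NExp := ⟨NExp.div⟩
instance : Mod NExp := ⟨NExp.mod⟩
instance (k : ℕ) : OfNat NExp k := ⟨NExp.const k⟩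
instance : Add RExp := ⟨RExp.add⟩

/-- The scalar stored in cell `0` of the integer array `a`. -/
def sc (a : ℕ) : NExp := .read a (.const 0)

/-- The index of the processor. -/
def ix : NExp := .idx

/-- Truth value of `e < f`. -/
def NExp.lt (e f : NExp) : NExp := .le (e + 1) f

/-- Truth value of `e = f`. -/
def NExp.eq (e f : NExp) : NExp := .le e f * .le f e

/-- Negation of a truth value. -/
def NExp.no (e : NExp) : NExp := 1 - e

/-- Value of an integer expression over the natural numbers, without the word bound. -/
noncomputable def NExp.ev (σ : Mem) (i : ℕ) : NExp → ℕ
  | .const c => c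
  | .idx => i
  | .read a e => σ.nat a (e.ev σ i)
  | .add e f => e.ev σ i + f.ev σ i
  | .sub e f => e.ev σ i - f.ev σ i
  | .mul e f => e.ev σ i * f.ev σ i
  | .div e f => e.ev σ i / f.ev σ i
  | .mod e f => e.ev σ i % f.ev σ i
  | .le e f => if e.ev σ i ≤ f.ev σ i then 1 else 0
  | .realLe a e b f => if σ.real a (e.ev σ i) ≤ σ.real b (f.ev σ i) then 1 else 0

/-- Value of a real expression whose addresses are evaluated without the word bound. -/
noncomputable def RExp.ev (σ : Mem) (i : ℕ) : RExp → ℝ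
  | .zero => 0
  | .read a e => σ.real a (e.ev σ i)
  | .add r s => r.ev σ i + s.ev σ i
  | .sub r s => r.ev σ i - s.ev σ i

section ev
variable (σ : Mem) (i : ℕ) (e f : NExp)
@[simp] lemma ev_ofNat (k : ℕ) : NExp.ev σ i (no_index (OfNat.ofNat k : NExp)) =
    (OfNat.ofNat k : ℕ) := rfl
@[simp] lemma ev_add : (e + f).ev σ i = e.ev σ i + f.ev σ i := rfl
@[simp] lemma ev_sub : (e - f).ev σ i = e.ev σ i - f.ev σ i := rfl
@[simp] lemma ev_mul : (e * f).ev σ i = e.ev σ i * f.ev σ i := rfl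
@[simp] lemma ev_div : (e / f).ev σ i = e.ev σ i / f.ev σ i := rfl
@[simp] lemma ev_mod : (e % f).ev σ i = e.ev σ i % f.ev σ i := rfl
@[simp] lemma ev_sc (a : ℕ) : (sc a).ev σ i = σ.nat a 0 := rfl
@[simp] lemma ev_read (a : ℕ) : (NExp.read a e).ev σ i = σ.nat a (e.ev σ i) := rfl
@[simp] lemma ev_ix : ix.ev σ i = i := rfl
@[simp] lemma ev_lt : (NExp.lt e f).ev σ i = if e.ev σ i < f.ev σ i then 1 else 0 := rfl
@[simp] lemma ev_le : (NExp.le e f).ev σ i = if e.ev σ i ≤ f.ev σ i then 1 else 0 := rfl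
@[simp] lemma ev_eq : (NExp.eq e f).ev σ i = if e.ev σ i = f.ev σ i then 1 else 0 := by
  show (if e.ev σ i ≤ f.ev σ i then 1 else 0) * (if f.ev σ i ≤ e.ev σ i then 1 else 0) = _
  split_ifs <;> omega
@[simp] lemma ev_no : (NExp.no e).ev σ i = 1 - e.ev σ i := rfl
@[simp] lemma ev_realLe (a b : ℕ) : (NExp.realLe a e b f).ev σ i =
    if σ.real a (e.ev σ i) ≤ σ.real b (f.ev σ i) then 1 else 0 := rfl
@[simp] lemma rev_zero : RExp.zero.ev σ i = 0 := rfl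
@[simp] lemma rev_read (a : ℕ) : (RExp.read a e).ev σ i = σ.real a (e.ev σ i) := rfl
@[simp] lemma rev_add (r s : RExp) : (r + s).ev σ i = r.ev σ i + s.ev σ i := rfl
end ev

/-- All literals are at most `100`. -/
def NExp.lits : NExp → Bool
  | .const c => decide (c ≤ 100)
  | .idx => true
  | .read _ e => e.lits
  | .add e f => e.lits && f.lits
  | .sub e f => e.lits && f.lits
  | .mul e f => e.lits && f.lits
  | .div e f => e.lits && f.lits
  | .mod e f => e.lits && f.lits
  | .le e f => e.lits && f.lits
  | .realLe _ e _ f => e.lits && f.lits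

/-- Expressions with few operations and small literals. -/
def NExp.ok (e : NExp) : Bool := e.lits && decide (e.size ≤ 250)

/-- All literals in addresses are at most `100`. -/
def RExp.lits : RExp → Bool
  | .zero => true
  | .read _ e => e.lits
  | .add r s => r.lits && s.lits
  | .sub r s => r.lits && s.lits

/-- Real expressions with few operations and small literals. -/
def RExp.ok (e : RExp) : Bool := e.lits && decide (e.size ≤ 250)

/-- All integer words are at most `B`. -/
def Bdd (B : ℕ) (σ : Mem) : Prop := ∀ a p, σ.nat a p ≤ B

/-- The word bound `W` is so large compared with the bound `B` on the stored words that the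
evaluation of an expression with at most `250` operations never overflows. -/
class Good (W B : ℕ) : Prop where
  hundred_le : 100 ≤ B
  pow_lt : B ^ 250 < W

section eval
variable {W B : ℕ} [hg : Good W B] {σ : Mem} {i : ℕ}

/-- An expression of size `s` with small literals has a value of at most `B ^ s`: multiplication is the
operation that lets values grow fastest. -/
lemma NExp.ev_le_pow (hB : 100 ≤ B) (hσ : Bdd B σ) (hi : i ≤ B) (e : NExp) (he : e.lits = true) :
    e.ev σ i ≤ B ^ e.size := by
  have one (k : ℕ) : 1 ≤ B ^ k := Nat.one_le_pow _ _ (by omega)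
  have mono {a b : ℕ} (h : a ≤ b) : B ^ a ≤ B ^ b := Nat.pow_le_pow_right (by omega) h
  have self (k : ℕ) (hk : 1 ≤ k) : B ≤ B ^ k := by simpa using mono hk
  induction e with
  | const c => simp [NExp.lits] at he; simp [NExp.size, NExp.ev]; omega
  | idx => simpa [NExp.size, NExp.ev] using hi
  | read a e _ => exact (hσ _ _).trans (self _ (by simp [NExp.size]))
  | add e f ihe ihf =>
    simp only [NExp.lits, Bool.and_eq_true] at he
    have h1 := ihe he.1
    have h2 := ihf he.2
    have h3 : B ^ e.size ≤ B ^ (e.size + f.size) := mono (by omega)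
    have h4 : B ^ f.size ≤ B ^ (e.size + f.size) := mono (by omega)
    simp only [NExp.size, NExp.ev, pow_succ B (e.size + f.size)]
    nlinarith [one (e.size + f.size)]
  | sub e f ihe ihf =>
    simp only [NExp.lits, Bool.and_eq_true] at he
    have h1 := ihe he.1
    have h3 : B ^ e.size ≤ B ^ (e.size + f.size + 1) := mono (by omega)
    simp only [NExp.size, NExp.ev]; omega
  | mul e f ihe ihf =>
    simp only [NExp.lits, Bool.and_eq_true] at he
    have h3 : B ^ (e.size + f.size) ≤ B ^ (e.size + f.size + 1) := mono (by omega)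
    exact ((Nat.mul_le_mul (ihe he.1) (ihf he.2)).trans (by rw [← pow_add])).trans h3
  | div e f ihe ihf =>
    simp only [NExp.lits, Bool.and_eq_true] at he
    exact (Nat.div_le_self _ _).trans ((ihe he.1).trans (mono (by simp [NExp.size]; omega)))
  | mod e f ihe ihf =>
    simp only [NExp.lits, Bool.and_eq_true] at he
    exact (Nat.mod_le _ _).trans ((ihe he.1).trans (mono (by simp [NExp.size]; omega)))
  | le e f _ _ =>
    simp only [NExp.ev]; split_ifs
    · exact one _
    · exact Nat.zero_le _
  | realLe a e b f _ _ =>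
    simp only [NExp.ev]; split_ifs
    · exact one _
    · exact Nat.zero_le _

/-- Without overflow, the bounded evaluation of the machine agrees with the unbounded one. -/
lemma NExp.eval_eq_of_size (hσ : Bdd B σ) (hi : i ≤ B) (e : NExp) (he : e.lits = true)
    (hs : e.size ≤ 250) : e.eval W σ i = e.ev σ i := by
  have hB : 100 ≤ B := hg.hundred_le
  have lt (e : NExp) (he : e.lits = true) (hs : e.size ≤ 250) : e.ev σ i < W :=
    ((NExp.ev_le_pow hB hσ hi e he).trans (Nat.pow_le_pow_right (by omega) hs)).trans_lt
      hg.pow_lt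
  induction e with
  | const c => exact Nat.mod_eq_of_lt (lt _ he hs)
  | idx => rfl
  | read a e ih =>
    simp only [NExp.eval, NExp.ev]; rw [ih he (by simp [NExp.size] at hs; omega)]
  | add e f ihe ihf =>
    have := lt _ he hs
    simp only [NExp.lits, Bool.and_eq_true] at he
    simp only [NExp.size] at hs
    simp only [NExp.eval, NExp.ev] at this ⊢
    rw [ihe he.1 (by omega), ihf he.2 (by omega), Nat.mod_eq_of_lt this]
  | mul e f ihe ihf =>
    have := lt _ he hs
    simp only [NExp.lits, Bool.and_eq_true] at he
    simp only [NExp.size] at hs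
    simp only [NExp.eval, NExp.ev] at this ⊢
    rw [ihe he.1 (by omega), ihf he.2 (by omega), Nat.mod_eq_of_lt this]
  | sub e f ihe ihf | div e f ihe ihf | mod e f ihe ihf | le e f ihe ihf =>
    simp only [NExp.lits, Bool.and_eq_true] at he
    simp only [NExp.size] at hs
    simp only [NExp.eval, NExp.ev]
    rw [ihe he.1 (by omega), ihf he.2 (by omega)]
  | realLe a e b f ihe ihf =>
    simp only [NExp.lits, Bool.and_eq_true] at he
    simp only [NExp.size] at hs
    simp only [NExp.eval, NExp.ev]
    rw [ihe he.1 (by omega), ihf he.2 (by omega)]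

lemma NExp.eval_eq (hσ : Bdd B σ) (hi : i ≤ B) {e : NExp} (he : e.ok = true) :
    e.eval W σ i = e.ev σ i := by
  simp only [NExp.ok, Bool.and_eq_true, decide_eq_true_eq] at he
  exact NExp.eval_eq_of_size hσ hi e he.1 he.2

lemma RExp.eval_eq_of_size (hσ : Bdd B σ) (hi : i ≤ B) (e : RExp) (he : e.lits = true)
    (hs : e.size ≤ 250) : e.eval W σ i = e.ev σ i := by
  induction e with
  | zero => rfl
  | read a e =>
    simp only [RExp.eval, RExp.ev]
    rw [NExp.eval_eq_of_size hσ hi e he (by simp [RExp.size] at hs; omega)]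
  | add r s ihr ihs | sub r s ihr ihs =>
    simp only [RExp.lits, Bool.and_eq_true] at he
    simp only [RExp.size] at hs
    simp only [RExp.eval, RExp.ev]
    rw [ihr he.1 (by omega), ihs he.2 (by omega)]

lemma RExp.eval_eq (hσ : Bdd B σ) (hi : i ≤ B) {e : RExp} (he : e.ok = true) :
    e.eval W σ i = e.ev σ i := by
  simp only [RExp.ok, Bool.and_eq_true, decide_eq_true_eq] at he
  exact RExp.eval_eq_of_size hσ hi e he.1 he.2
end eval

/-- Whether the program contains a statement that writes to the integer array `a`. -/
def Prog.wN (a : ℕ) : Prog → Bool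
  | .skip => false
  | .parNat _ _ b _ _ => a == b
  | .parReal _ _ _ _ _ => false
  | .seq P Q => P.wN a || Q.wN a
  | .cond _ P Q => P.wN a || Q.wN a
  | .loop _ P => P.wN a

/-- Whether the program contains a statement that writes to the real array `a`. -/
def Prog.wR (a : ℕ) : Prog → Bool
  | .skip => false
  | .parNat _ _ _ _ _ => false
  | .parReal _ _ b _ _ => a == b
  | .seq P Q => P.wR a || Q.wR a
  | .cond _ P Q => P.wR a || Q.wR a
  | .loop _ P => P.wR a

/-- The memories agree on all arrays that the program does not write to. -/
structure Agree (P : Prog) (σ τ : Mem) : Prop where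
  n : ∀ a, P.wN a = false → τ.nat a = σ.nat a
  r : ∀ a, P.wR a = false → τ.real a = σ.real a

lemma Agree.refl (P : Prog) (σ : Mem) : Agree P σ σ := ⟨fun _ _ => rfl, fun _ _ => rfl⟩

lemma Agree.trans {P : Prog} {σ τ υ : Mem} (h : Agree P σ τ) (h' : Agree P τ υ) : Agree P σ υ :=
  ⟨fun a ha => (h'.n a ha).trans (h.n a ha), fun a ha => (h'.r a ha).trans (h.r a ha)⟩

lemma Agree.seqL {P Q : Prog} {σ τ : Mem} (h : Agree P σ τ) : Agree (P.seq Q) σ τ :=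
  ⟨fun a ha => h.n a (by simp [Prog.wN] at ha; exact ha.1),
    fun a ha => h.r a (by simp [Prog.wR] at ha; exact ha.1)⟩

lemma Agree.seqR {P Q : Prog} {σ τ : Mem} (h : Agree Q σ τ) : Agree (P.seq Q) σ τ :=
  ⟨fun a ha => h.n a (by simp [Prog.wN] at ha; exact ha.2),
    fun a ha => h.r a (by simp [Prog.wR] at ha; exact ha.2)⟩

/-- A run only changes arrays that its program writes to. -/
lemma Run.agree {W : ℕ} {P : Prog} {σ τ : Mem} {w d : ℕ} (h : Run W P σ τ w d) :
    Agree P σ τ := by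
  induction h with
  | skip σ => exact Agree.refl _ _
  | parNat k g a p v σ hex =>
    refine ⟨fun b hb => ?_, fun _ _ => rfl⟩
    simp only [Prog.wN, beq_eq_false_iff_ne] at hb
    simp [Function.update_of_ne hb]
  | parReal k g a p v σ hex =>
    refine ⟨fun _ _ => rfl, fun b hb => ?_⟩
    simp only [Prog.wR, beq_eq_false_iff_ne] at hb
    simp [Function.update_of_ne hb]
  | seq _ _ h1 h2 => exact h1.seqL.trans h2.seqR
  | condTrue _ _ h => exact ⟨h.seqL.n, h.seqL.r⟩
  | condFalse _ _ h => exact ⟨h.seqR.n, h.seqR.r⟩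
  | loopTrue _ _ _ h1 h2 => exact ⟨fun a ha => (h2.n a ha).trans (h1.n a ha),
      fun a ha => (h2.r a ha).trans (h1.r a ha)⟩
  | loopFalse _ => exact Agree.refl _ _

section scatter
variable {α : Type} {k : ℕ} {act : ℕ → Prop} {addr : ℕ → ℕ} {val : ℕ → α} {old : ℕ → α}

lemma scatter_written (hex : Exclusive k act addr) {i : ℕ} (hi : i < k) (ha : act i) :
    scatter k act addr val old (addr i) = val i := by
  have h : ∃ j, j < k ∧ act j ∧ addr j = addr i := ⟨i, hi, ha, rfl⟩
  classical
  unfold scatter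
  rw [dif_pos h]
  obtain ⟨h1, h2, h3⟩ := Nat.find_spec h
  rw [hex _ i h1 hi h2 ha h3]

lemma scatter_kept {q : ℕ} (h : ∀ i < k, act i → addr i ≠ q) :
    scatter k act addr val old q = old q := by
  unfold scatter
  rw [dif_neg]
  rintro ⟨i, h1, h2, h3⟩
  exact h i h1 h2 h3

lemma scatter_le {val old : ℕ → ℕ} {B : ℕ} (hv : ∀ i < k, act i → val i ≤ B)
    (ho : ∀ q, old q ≤ B) (q : ℕ) : scatter k act addr val old q ≤ B := by
  classical
  unfold scatter
  split_ifs with h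
  · obtain ⟨h1, h2, -⟩ := Nat.find_spec h
    exact hv _ h1 h2
  · exact ho q
end scatter

/-- Total correctness with resource bounds: started in the memory `σ` with words at most `B`, the
program `P` halts in a memory with words at most `B` that satisfies `Q`. Work and depth are
counted in units of `2000` operations, enough for each processor in one statement. -/
def Spec (W B : ℕ) (P : Prog) (σ : Mem) (w d : ℕ) (Q : Mem → Prop) : Prop :=
  Bdd B σ → ∃ τ w' d', Run W P σ τ w' d' ∧ w' ≤ 2000 * w ∧ d' ≤ 2000 * d ∧ Bdd B τ ∧ Q τ

/-- The assignment `x := e` for a scalar, stored in cell `0` of the array `x`. -/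
def setS (x : ℕ) (e : NExp) : Prog := .parNat 1 1 x ix e

/-- The loop `for x = 0, …, c - 1 do P` over the scalar `x`, with the bound in the scalar `c`. -/
def forP (x c : ℕ) (P : Prog) : Prog :=
  .seq (setS x 0) (.loop (.lt (sc x) (sc c)) (.seq P (setS x (sc x + 1))))

infixr:60 " ;; " => Prog.seq

section rules
variable {W B : ℕ} {σ : Mem} {P P' : Prog} {w d w' d' : ℕ} {Q Q' : Mem → Prop}

/-- In the consequence rule, the postcondition may use that only the arrays written by the program have
changed. -/
lemma Spec.mono (h : Spec W B P σ w d Q) (hw : w ≤ w') (hd : d ≤ d')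
    (hQ : ∀ τ, Agree P σ τ → Bdd B τ → Q τ → Q' τ) : Spec W B P σ w' d' Q' := by
  intro hσ
  obtain ⟨τ, a, b, h1, h2, h3, h4, h5⟩ := h hσ
  exact ⟨τ, a, b, h1, by omega, by omega, h4, hQ τ h1.agree h4 h5⟩

lemma Spec.bdd (h : Bdd B σ → Spec W B P σ w d Q) : Spec W B P σ w d Q := fun hσ => h hσ hσ

lemma Spec.seq (h : Spec W B P σ w d Q)
    (h' : ∀ τ, Agree P σ τ → Q τ → Spec W B P' τ w' d' Q') :
    Spec W B (P ;; P') σ (w + w') (d + d') Q' := by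
  intro hσ
  obtain ⟨τ, a, b, h1, h2, h3, h4, h5⟩ := h hσ
  obtain ⟨υ, a', b', h1', h2', h3', h4', h5'⟩ := h' τ h1.agree h5 h4
  exact ⟨υ, _, _, .seq h1 h1', by omega, by omega, h4', h5'⟩

variable [hg : Good W B]

/-- A parallel statement with `K` processors that writes integer words: all active processors see the
old memory, their addresses are distinct, and all cells that are not addressed are kept. -/
lemma Spec.parN {k g p v : NExp} {a : ℕ} (K : ℕ) (hk : k.ev σ 0 = K) (hK : K ≤ B)
    (hok : (k.ok && g.ok && p.ok && v.ok) = true)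
    (hex : ∀ i j, i < K → j < K → g.ev σ i ≠ 0 → g.ev σ j ≠ 0 → p.ev σ i = p.ev σ j → i = j)
    (hv : ∀ i < K, g.ev σ i ≠ 0 → v.ev σ i ≤ B) :
    Spec W B (.parNat k g a p v) σ (K + 1) 1 (fun τ =>
      (∀ i < K, g.ev σ i ≠ 0 → τ.nat a (p.ev σ i) = v.ev σ i) ∧
      ∀ q, (∀ i < K, g.ev σ i ≠ 0 → p.ev σ i ≠ q) → τ.nat a q = σ.nat a q) := by
  intro hσ
  simp only [Bool.and_eq_true] at hok
  obtain ⟨⟨⟨ok, og⟩, op⟩, ov⟩ := hok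
  have ek : k.eval W σ 0 = K := by rw [NExp.eval_eq hσ (Nat.zero_le _) ok, hk]
  have eg {i} (hi : i < K) : g.eval W σ i = g.ev σ i := NExp.eval_eq hσ (by omega) og
  have ep {i} (hi : i < K) : p.eval W σ i = p.ev σ i := NExp.eval_eq hσ (by omega) op
  have ev {i} (hi : i < K) : v.eval W σ i = v.ev σ i := NExp.eval_eq hσ (by omega) ov
  have hex' : Exclusive (k.eval W σ 0) (fun i => g.eval W σ i ≠ 0) (fun i => p.eval W σ i) := by
    intro i j hi hj
    rw [ek] at hi hj
    simp only [eg hi, eg hj, ep hi, ep hj]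
    exact hex i j hi hj
  simp only [NExp.ok, Bool.and_eq_true, decide_eq_true_eq] at ok og op ov
  refine ⟨_, _, _, .parNat k g a p v σ hex', ?_, ?_, ?_, ?_, ?_⟩
  · rw [ek]
    have : K * (g.size + p.size + v.size + 1) ≤ K * 901 := Nat.mul_le_mul_left _ (by omega)
    omega
  · omega
  · intro b q
    by_cases hb : b = a
    · subst hb
      simp only [Function.update_self]
      refine scatter_le ?_ (hσ b) q
      intro i hi
      rw [ek] at hi
      rw [eg hi, ev hi]
      exact hv i hi
    · simp only [Function.update_of_ne hb]
      exact hσ b q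
  · intro i hi hgi
    simp only [Function.update_self]
    rw [← ep hi, ← ev hi]
    exact scatter_written (addr := fun i => p.eval W σ i) hex' (by rwa [ek])
      (by simpa only [eg hi] using hgi)
  · intro q hq
    simp only [Function.update_self]
    refine scatter_kept fun i hi => ?_
    rw [ek] at hi
    rw [eg hi, ep hi]
    exact hq i hi

/-- The counterpart of `Spec.parN` for statements that write real words, which need no size bound. -/
lemma Spec.parR {k g p : NExp} {v : RExp} {a : ℕ} (K : ℕ) (hk : k.ev σ 0 = K) (hK : K ≤ B)
    (hok : (k.ok && g.ok && p.ok && v.ok) = true)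
    (hex : ∀ i j, i < K → j < K → g.ev σ i ≠ 0 → g.ev σ j ≠ 0 → p.ev σ i = p.ev σ j → i = j) :
    Spec W B (.parReal k g a p v) σ (K + 1) 1 (fun τ =>
      (∀ i < K, g.ev σ i ≠ 0 → τ.real a (p.ev σ i) = v.ev σ i) ∧
      ∀ q, (∀ i < K, g.ev σ i ≠ 0 → p.ev σ i ≠ q) → τ.real a q = σ.real a q) := by
  intro hσ
  simp only [Bool.and_eq_true] at hok
  obtain ⟨⟨⟨ok, og⟩, op⟩, ov⟩ := hok
  have ek : k.eval W σ 0 = K := by rw [NExp.eval_eq hσ (Nat.zero_le _) ok, hk]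
  have eg {i} (hi : i < K) : g.eval W σ i = g.ev σ i := NExp.eval_eq hσ (by omega) og
  have ep {i} (hi : i < K) : p.eval W σ i = p.ev σ i := NExp.eval_eq hσ (by omega) op
  have ev {i} (hi : i < K) : v.eval W σ i = v.ev σ i := RExp.eval_eq hσ (by omega) ov
  have hex' : Exclusive (k.eval W σ 0) (fun i => g.eval W σ i ≠ 0) (fun i => p.eval W σ i) := by
    intro i j hi hj
    rw [ek] at hi hj
    simp only [eg hi, eg hj, ep hi, ep hj]
    exact hex i j hi hj
  simp only [NExp.ok, RExp.ok, Bool.and_eq_true, decide_eq_true_eq] at ok og op ov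
  refine ⟨_, _, _, .parReal k g a p v σ hex', ?_, ?_, hσ, ?_, ?_⟩
  · rw [ek]
    have : K * (g.size + p.size + v.size + 1) ≤ K * 901 := Nat.mul_le_mul_left _ (by omega)
    omega
  · omega
  · intro i hi hgi
    simp only [Function.update_self]
    rw [← ep hi, ← ev hi]
    exact scatter_written (addr := fun i => p.eval W σ i) hex' (by rwa [ek])
      (by simpa only [eg hi] using hgi)
  · intro q hq
    simp only [Function.update_self]
    refine scatter_kept fun i hi => ?_
    rw [ek] at hi
    rw [eg hi, ep hi]
    exact hq i hi

/-- Every processor writes to the cell of its own index. -/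
lemma Spec.parNi {k g v : NExp} {a : ℕ} (K : ℕ) (hk : k.ev σ 0 = K) (hK : K ≤ B)
    (hok : (k.ok && g.ok && v.ok) = true) (hv : ∀ i < K, g.ev σ i ≠ 0 → v.ev σ i ≤ B) :
    Spec W B (.parNat k g a ix v) σ (K + 1) 1 (fun τ => ∀ q, τ.nat a q =
      if q < K ∧ g.ev σ q ≠ 0 then v.ev σ q else σ.nat a q) := by
  simp only [Bool.and_eq_true] at hok
  refine (Spec.parN K hk hK (p := ix) (by simp [hok]; rfl) (fun i j _ _ _ _ h => h) hv).mono le_rfl le_rfl ?_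
  intro τ _ _ ⟨h1, h2⟩ q
  split_ifs with h
  · exact h1 q h.1 h.2
  · exact h2 q fun i hi hgi hiq => h (by simp at hiq; subst hiq; exact ⟨hi, hgi⟩)

/-- Every processor writes to the cell of its own index. -/
lemma Spec.parRi {k g : NExp} {v : RExp} {a : ℕ} (K : ℕ) (hk : k.ev σ 0 = K) (hK : K ≤ B)
    (hok : (k.ok && g.ok && v.ok) = true) :
    Spec W B (.parReal k g a ix v) σ (K + 1) 1 (fun τ => ∀ q, τ.real a q =
      if q < K ∧ g.ev σ q ≠ 0 then v.ev σ q else σ.real a q) := by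
  simp only [Bool.and_eq_true] at hok
  refine (Spec.parR K hk hK (p := ix) (by simp [hok]; rfl) (fun i j _ _ _ _ h => h)).mono le_rfl le_rfl ?_
  intro τ _ _ ⟨h1, h2⟩ q
  split_ifs with h
  · exact h1 q h.1 h.2
  · exact h2 q fun i hi hgi hiq => h (by simp at hiq; subst hiq; exact ⟨hi, hgi⟩)

lemma Spec.setS {x : ℕ} {e : NExp} (hok : e.ok = true) (hv : e.ev σ 0 ≤ B) :
    Spec W B (setS x e) σ 2 1 (fun τ => τ.nat x 0 = e.ev σ 0) := by
  have hB := hg.hundred_le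
  refine (Spec.parNi (a := x) (g := 1) (v := e) 1 rfl (by omega) (by rw [hok]; rfl) ?_).mono
    le_rfl le_rfl ?_
  · intro i hi _
    have : i = 0 := by omega
    subst this; exact hv
  · intro τ _ _ h
    have := h 0
    simpa using this

/-- Loops, with an invariant indexed by the number of completed iterations. -/
lemma Spec.loop {g : NExp} (T : ℕ) (I : ℕ → Mem → Prop) (w d : ℕ → ℕ) (hok : g.ok = true)
    (h0 : I 0 σ)
    (hs : ∀ i < T, ∀ τ, Agree P σ τ → I i τ →
      g.ev τ 0 ≠ 0 ∧ Spec W B P τ (w i) (d i) (I (i + 1)))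
    (he : ∀ τ, Agree P σ τ → I T τ → g.ev τ 0 = 0) :
    Spec W B (.loop g P) σ (∑ i ∈ Finset.range T, (w i + 1) + 1)
      (∑ i ∈ Finset.range T, (d i + 1) + 1) (I T) := by
  have key : ∀ k i, i + k = T → ∀ τ, Agree P σ τ → I i τ →
      Spec W B (.loop g P) τ (∑ j ∈ Finset.range k, (w (i + j) + 1) + 1)
        (∑ j ∈ Finset.range k, (d (i + j) + 1) + 1) (I T) := by
    intro k
    have hs250 : g.size ≤ 250 := by
      simp only [NExp.ok, Bool.and_eq_true, decide_eq_true_eq] at hok; exact hok.2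
    induction k with
    | zero =>
      intro i hi τ hτ hI hb
      obtain rfl : i = T := by omega
      exact ⟨τ, _, _, .loopFalse (by rw [NExp.eval_eq hb (Nat.zero_le _) hok]; exact he τ hτ hI),
        by simp; omega, by simp; omega, hb, hI⟩
    | succ k ih =>
      intro i hi τ hτ hI hb
      obtain ⟨hg1, hS⟩ := hs i (by omega) τ hτ hI
      obtain ⟨τ', w1, d1, r1, hw1, hd1, hb1, hI1⟩ := hS hb
      obtain ⟨τ'', w2, d2, r2, hw2, hd2, hb2, hI2⟩ :=
        ih (i + 1) (by omega) τ' (hτ.trans r1.agree) hI1 hb1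
      refine ⟨τ'', _, _, .loopTrue (by rwa [NExp.eval_eq hb (Nat.zero_le _) hok]) r1 r2, ?_, ?_,
        hb2, hI2⟩
      · rw [Finset.sum_range_succ']
        simp only [add_zero, add_assoc, add_comm 1] at hw2 ⊢
        omega
      · rw [Finset.sum_range_succ']
        simp only [add_zero, add_assoc, add_comm 1] at hd2 ⊢
        omega
  simpa using key T 0 (by omega) σ (Agree.refl _ _) h0

lemma Spec.loop_const {g : NExp} (T : ℕ) (I : ℕ → Mem → Prop) (hok : g.ok = true)
    (h0 : I 0 σ)
    (hs : ∀ i < T, ∀ τ, Agree P σ τ → I i τ → g.ev τ 0 ≠ 0 ∧ Spec W B P τ w d (I (i + 1)))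
    (he : ∀ τ, Agree P σ τ → I T τ → g.ev τ 0 = 0) :
    Spec W B (.loop g P) σ (T * (w + 1) + 1) (T * (d + 1) + 1) (I T) := by
  simpa using Spec.loop (P := P) T I (fun _ => w) (fun _ => d) hok h0 hs he

/-- Loops over a scalar. The body may not write to the loop variable or the bound, and the invariant
may not depend on the loop variable. -/
lemma Spec.forP {x c : ℕ} (T : ℕ) (I : ℕ → Mem → Prop) (hT : σ.nat c 0 = T)
    (hc : (P.wN c || c == x) = false) (hx : P.wN x = false)
    (hI : ∀ i τ τ', (∀ a, a ≠ x → τ'.nat a = τ.nat a) → τ'.real = τ.real → I i τ → I i τ')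
    (h0 : I 0 σ)
    (hs : ∀ i < T, ∀ τ, Agree (forP x c P) σ τ → τ.nat x 0 = i → I i τ →
      Spec W B P τ w d (I (i + 1))) :
    Spec W B (forP x c P) σ (T * (w + 3) + 3) (T * (d + 2) + 2) (I T) := by
  simp only [Bool.or_eq_false_iff, beq_eq_false_iff_ne] at hc
  have stable : ∀ i τ τ' e, Agree (Par.setS x e) τ τ' → I i τ → I i τ' := fun i τ τ' e h =>
    hI i τ τ' (fun a ha => h.n a (by simpa [Par.setS, Prog.wN] using ha))
      (funext fun a => h.r a rfl)
  refine Spec.mono (w := 2 + (T * ((w + 2) + 1) + 1)) (d := 1 + (T * ((d + 1) + 1) + 1))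
    (Spec.seq (Spec.setS (e := 0) rfl (Nat.zero_le _)) fun τ hτ h0' => ?_) (by ring_nf; omega)
    (by ring_nf; omega) (Q := I T) (fun τ _ _ h => h)
  apply Spec.bdd
  intro hB
  have hTB : T ≤ B := by
    rw [← hT, ← hτ.n c (by simpa [Par.setS, Prog.wN] using hc.2)]; exact hB _ _
  refine (Spec.loop_const (P := P ;; Par.setS x (sc x + 1)) T (fun i τ => I i τ ∧ τ.nat x 0 = i)
    rfl ⟨stable 0 σ τ _ hτ h0, h0'⟩ ?_ ?_).mono le_rfl le_rfl fun _ _ _ h => h.1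
  · intro i hi τ1 hA ⟨h1, h2⟩
    have hcT : τ1.nat c 0 = T := by
      rw [hA.n c (by simpa [Par.setS, Prog.wN] using hc), hτ.n c (by simpa [Par.setS, Prog.wN]
        using hc.2), hT]
    refine ⟨by simp [hcT, h2, hi], ?_⟩
    have hA' : Agree (Par.forP x c P) σ τ1 := (hτ.seqL).trans
      (Agree.seqR (Q := .loop (.lt (sc x) (sc c)) (.seq P (Par.setS x (sc x + 1)))) ⟨hA.n, hA.r⟩)
    refine Spec.seq (hs i hi τ1 hA' h2 h1) fun τ2 hA2 h3 => ?_
    have hx2 : τ2.nat x 0 = i := by rw [hA2.n x hx, h2]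
    refine (Spec.setS (e := sc x + 1) rfl (by simp [hx2]; omega)).mono le_rfl le_rfl ?_
    intro τ3 hA3 _ h4
    exact ⟨stable _ _ _ _ hA3 h3, by rw [h4]; simp [hx2]⟩
  · intro τ1 hA ⟨h1, h2⟩
    have hcT : τ1.nat c 0 = T := by
      rw [hA.n c (by simpa [Par.setS, Prog.wN] using hc), hτ.n c (by simpa [Par.setS, Prog.wN]
        using hc.2), hT]
    simp [hcT, h2]
end rules

end Par

/-! ### Distances along walks with a bounded number of edges, and hubs -/

namespace Par

/-- Least weight of a walk from `u` to `v` with at most `k` edges, in the graph on the vertices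
below `N` with weight matrix `w`; the value is `⊤` if there is no such walk. -/
noncomputable def hopDist (N : ℕ) (w : ℕ → ℕ → WithTop ℝ) : ℕ → ℕ → ℕ → WithTop ℝ
  | 0, u, v => if u = v then 0 else ⊤
  | k + 1, u, v => min (hopDist N w k u v)
      ((Finset.range N).inf fun x => hopDist N w k u x + w x v)

section hop
variable {N : ℕ} {w : ℕ → ℕ → WithTop ℝ}
local notation "D" => hopDist N w

lemma hopDist_self_zero (u : ℕ) : D 0 u u = 0 := by simp [hopDist]

lemma hopDist_succ_le (k u v : ℕ) : D (k + 1) u v ≤ D k u v := min_le_left _ _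

lemma hopDist_succ_le_edge {x : ℕ} (hx : x < N) (k u v : ℕ) :
    D (k + 1) u v ≤ D k u x + w x v :=
  (min_le_right _ _).trans (Finset.inf_le (f := fun x => D k u x + w x v) (by simpa using hx))

lemma hopDist_anti {j k : ℕ} (h : j ≤ k) (u v : ℕ) : D k u v ≤ D j u v := by
  induction h with
  | refl => exact le_rfl
  | step _ ih => exact (hopDist_succ_le _ _ _).trans ih

lemma le_hopDist_succ {k u v : ℕ} {c : WithTop ℝ} (h1 : c ≤ D k u v)
    (h2 : ∀ x < N, c ≤ D k u x + w x v) : c ≤ D (k + 1) u v :=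
  le_min h1 (Finset.le_inf fun x hx => h2 x (by simpa using hx))

lemma hopDist_succ_cases {k u v : ℕ} (h : D (k + 1) u v < D k u v) :
    ∃ x < N, D (k + 1) u v = D k u x + w x v := by
  by_contra! hne
  have : ∀ x < N, D (k + 1) u v < D k u x + w x v :=
    fun x hx => lt_of_le_of_ne (hopDist_succ_le_edge hx k u v) (hne x hx)
  have h3 : D (k + 1) u v < D (k + 1) u v :=
    lt_min h ((Finset.lt_inf_iff (lt_of_lt_of_le h le_top)).2
      fun x hx => this x (by simpa using hx))
  exact lt_irrefl _ h3

lemma hopDist_add_le {x : ℕ} (j k u v : ℕ) : D (j + k) u v ≤ D j u x + D k x v := by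
  induction k generalizing v with
  | zero =>
    by_cases h : x = v
    · subst h; simp [hopDist_self_zero]
    · simp [hopDist, h]
  | succ k ih =>
    by_cases h : D (k + 1) x v < D k x v
    · obtain ⟨y, hy, e⟩ := hopDist_succ_cases h
      rw [e, ← add_assoc, ← add_assoc]
      refine (hopDist_succ_le_edge hy (j + k) u v).trans ?_
      gcongr
      exact ih y
    · rw [le_antisymm (hopDist_succ_le _ _ _) (not_lt.1 h)]
      exact (hopDist_succ_le _ _ _).trans (ih v)

/-- A walk `x 0, x 1, …, x k` from `u` along which the distances from `u` are attained and each
vertex is reached for the first time: `x (i + 1)` is strictly farther with only `i` edges. -/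
structure StrictWalk (N : ℕ) (w : ℕ → ℕ → WithTop ℝ) (u k : ℕ) (x : ℕ → ℕ) : Prop where
  start : x 0 = u
  lt : ∀ i ≤ k, x i < N
  eq : ∀ i < k, hopDist N w (i + 1) u (x (i + 1)) = hopDist N w i u (x i) + w (x i) (x (i + 1))
  strict : ∀ i < k, hopDist N w (i + 1) u (x (i + 1)) < hopDist N w i u (x (i + 1))

lemma exists_strictWalk {u v k : ℕ} (hu : u < N) (hv : v < N)
    (h : ∀ j, k = j + 1 → D (j + 1) u v < D j u v) (h0 : k = 0 → u = v) :
    ∃ x, StrictWalk N w u k x ∧ x k = v := by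
  induction k generalizing v with
  | zero => exact ⟨fun _ => u, ⟨rfl, fun _ _ => hu, by simp, by simp⟩, h0 rfl⟩
  | succ k ih =>
    have hlt := h k rfl
    obtain ⟨y, hy, e⟩ := hopDist_succ_cases hlt
    have hytop : D k u y ≠ ⊤ := by
      intro ht
      rw [ht, top_add] at e
      exact absurd (lt_of_lt_of_le hlt le_top) (by rw [e]; exact lt_irrefl _)
    have hwtop : w y v ≠ ⊤ := by
      intro ht
      rw [ht, add_top] at e
      exact absurd (lt_of_lt_of_le hlt le_top) (by rw [e]; exact lt_irrefl _)
    obtain ⟨x, hx, hxk⟩ := ih hy (by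
        rintro j rfl
        refine lt_of_le_of_ne (hopDist_succ_le _ _ _) fun he => ?_
        rw [he] at e
        exact absurd (hopDist_succ_le_edge hy j u v) (not_le.2 (e ▸ hlt))) (by
        rintro rfl
        by_contra hne
        exact hytop (by simp [hopDist, hne]))
    refine ⟨fun i => if i ≤ k then x i else v, ⟨by simp [hx.start], ?_, ?_, ?_⟩, by simp⟩
    · intro i hi
      by_cases hik : i ≤ k
      · simpa [hik] using hx.lt i hik
      · simpa [hik] using hv
    · intro i hi
      by_cases hik : i < k
      · simpa [hik.le, Nat.succ_le_of_lt hik] using hx.eq i hik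
      · obtain rfl : i = k := by omega
        simpa [hxk] using e
    · intro i hi
      by_cases hik : i < k
      · simpa [hik.le, Nat.succ_le_of_lt hik] using hx.strict i hik
      · obtain rfl : i = k := by omega
        simpa using hlt

lemma StrictWalk.sub_le {u k : ℕ} {x : ℕ → ℕ} (hx : StrictWalk N w u k x) {i j : ℕ} (hij : i ≤ j)
    (hj : j ≤ k) : D i u (x i) + D (j - i) (x i) (x j) ≤ D j u (x j) := by
  induction j with
  | zero => obtain rfl : i = 0 := by omega
            simp [hopDist_self_zero]
  | succ j ih =>
    rcases Nat.lt_or_ge j i with h | h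
    · obtain rfl : i = j + 1 := by omega
      simp [hopDist_self_zero]
    · rw [hx.eq j (by omega), Nat.succ_sub h]
      calc D i u (x i) + D (j - i + 1) (x i) (x (j + 1))
          ≤ D i u (x i) + (D (j - i) (x i) (x j) + w (x j) (x (j + 1))) := by
            gcongr
            exact hopDist_succ_le_edge (hx.lt j (by omega)) _ _ _
        _ ≤ _ := by
            rw [← add_assoc]
            gcongr
            exact ih h (by omega)

lemma StrictWalk.ne {u k : ℕ} {x : ℕ → ℕ} (hx : StrictWalk N w u k x) {i j : ℕ} (hij : i < j)
    (hj : j ≤ k) (hnn : 0 ≤ D (j - i) (x i) (x i)) : x i ≠ x j := by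
  intro he
  have h1 := hx.sub_le hij.le hj
  obtain ⟨j, rfl⟩ : ∃ j', j = j' + 1 := ⟨j - 1, by omega⟩
  have h2 := hx.strict j (by omega)
  rw [← he] at h1 h2
  have h3 : D j u (x i) ≤ D i u (x i) := hopDist_anti (by omega) _ _
  have h4 : D i u (x i) ≤ D i u (x i) + D (j + 1 - i) (x i) (x i) :=
    le_add_of_nonneg_right hnn
  exact absurd (h4.trans h1) (not_le.2 (lt_of_lt_of_le h2 h3))

/-- All closed walks have nonnegative weight. -/
def NoNeg (N : ℕ) (w : ℕ → ℕ → WithTop ℝ) : Prop := ∀ k, ∀ u < N, 0 ≤ hopDist N w k u u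

/-- If there is a closed walk of negative weight, then there is a simple one. -/
lemma exists_simple_of_not_noNeg (h : ¬ NoNeg N w) : ∃ (k : ℕ) (x : ℕ → ℕ),
    (∀ i ≤ k + 1, x i < N) ∧ x (k + 1) = x 0 ∧ (∀ i j, i < j → j ≤ k → x i ≠ x j) ∧
    ∑ i ∈ Finset.range (k + 1), w (x i) (x (i + 1)) < 0 := by
  classical
  have hex : ∃ k, ∃ u < N, D k u u < 0 := by
    unfold NoNeg at h; push Not at h; exact h
  obtain ⟨u, hu, hneg⟩ := Nat.find_spec hex
  set k := Nat.find hex with hk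
  have hmin : ∀ j < k, ∀ v < N, 0 ≤ D j v v := fun j hj v hv => by
    have := Nat.find_min hex hj
    push Not at this
    exact this v hv
  obtain ⟨k', hk'⟩ : ∃ k', k = k' + 1 := by
    rcases Nat.eq_zero_or_pos k with h0 | h0
    · rw [h0, hopDist_self_zero] at hneg; exact absurd hneg (lt_irrefl _)
    · exact ⟨k - 1, by omega⟩
  rw [hk'] at hneg hmin
  obtain ⟨x, hx, hxk⟩ := exists_strictWalk (k := k' + 1) hu hu
    (fun j hj => by
      obtain rfl : k' = j := by omega
      exact lt_of_lt_of_le hneg (hmin _ (by omega) u hu)) (by simp)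
  have hsum : ∀ j ≤ k' + 1, D j u (x j) = ∑ i ∈ Finset.range j, w (x i) (x (i + 1)) := by
    intro j hj
    induction j with
    | zero => simp [hx.start, hopDist_self_zero]
    | succ j ih => rw [Finset.sum_range_succ, hx.eq j (by omega), ih (by omega)]
  refine ⟨k', x, hx.lt, by rw [hxk, hx.start], fun i j hij hj => ?_, ?_⟩
  · exact hx.ne hij (by omega) (hmin _ (by omega) _ (hx.lt i (by omega)))
  · rw [← hsum _ le_rfl, hxk]; exact hneg

/-- Without negative closed walks, no walk is shorter than the best one with at most `N` edges: a
shorter one with the least number of edges would have distinct vertices. -/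
lemma NoNeg.stable (h : NoNeg N w) {u v k : ℕ} (hu : u < N) (hv : v < N) :
    D N u v ≤ D k u v := by
  have hstep : ∀ j, N ≤ j + 1 → ∀ v < N, D (j + 1) u v = D j u v := by
    intro j hj v hv
    by_contra hne
    have hlt := lt_of_le_of_ne (hopDist_succ_le j u v) hne
    obtain ⟨x, hx, -⟩ := exists_strictWalk (k := j + 1) hu hv
      (fun j' hj' => by obtain rfl : j = j' := by omega
                        exact hlt) (by simp)
    have hinj : ∀ i ∈ Finset.range (N + 1), ∀ i' ∈ Finset.range (N + 1), x i = x i' → i = i' := by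
      intro i hi i' hi' he
      simp only [Finset.mem_range] at hi hi'
      rcases lt_trichotomy i i' with h' | h' | h'
      · exact absurd he (hx.ne h' (by omega) (h _ _ (hx.lt i (by omega))))
      · exact h'
      · exact absurd he.symm (hx.ne h' (by omega) (h _ _ (hx.lt i' (by omega))))
    have := Finset.card_le_card_of_injOn (s := Finset.range (N + 1)) (t := Finset.range N) x
      (fun i hi => by
        have hi : i < N + 1 := by simpa using hi
        simpa using hx.lt i (by omega))
      (fun i hi i' hi' => hinj i hi i' hi')
    simp at this
  rcases le_total k N with hk | hk
  · exact hopDist_anti hk u v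
  · induction k, hk using Nat.le_induction with
    | base => exact le_rfl
    | succ k hk ih => rw [hstep k (by omega) v hv]; exact ih

/-- `k` is the least number of edges of a shortest walk from `u` to `v`. -/
structure IsHop (N : ℕ) (w : ℕ → ℕ → WithTop ℝ) (u v k : ℕ) : Prop where
  eq : hopDist N w k u v = hopDist N w N u v
  ne_top : hopDist N w N u v ≠ ⊤
  min : ∀ j < k, hopDist N w j u v ≠ hopDist N w N u v

/-- `x` lies on a shortest walk from `u` to `v` with the least number `i + j` of edges, with `i`
edges before and `j` edges after `x`. -/
structure OnWalk (N : ℕ) (w : ℕ → ℕ → WithTop ℝ) (u x v i j : ℕ) : Prop where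
  left : IsHop N w u x i
  right : IsHop N w x v j
  total : IsHop N w u v (i + j)
  add : hopDist N w N u x + hopDist N w N x v = hopDist N w N u v

lemma exists_isHop {u v : ℕ} (h : D N u v ≠ ⊤) : ∃ k ≤ N, IsHop N w u v k := by
  classical
  have hex : ∃ k, D k u v = D N u v := ⟨N, rfl⟩
  exact ⟨Nat.find hex, Nat.find_min' hex rfl, Nat.find_spec hex, h, fun j hj => Nat.find_min hex hj⟩

lemma IsHop.unique {u v k k' : ℕ} (h : IsHop N w u v k) (h' : IsHop N w u v k') : k = k' := by
  rcases lt_trichotomy k k' with hk | hk | hk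
  · exact absurd h.eq (h'.min k hk)
  · exact hk
  · exact absurd h'.eq (h.min k' hk)

lemma IsHop.le {u v k : ℕ} (h : IsHop N w u v k) : k ≤ N := by
  by_contra hk
  exact h.min N (by omega) rfl

lemma isHop_self (h : NoNeg N w) {u : ℕ} (hu : u < N) : IsHop N w u u 0 := by
  have h0 : D N u u = 0 := le_antisymm ((hopDist_anti (Nat.zero_le N) u u).trans
    (hopDist_self_zero u).le) (h N u hu)
  exact ⟨by rw [h0, hopDist_self_zero], by rw [h0]; simp, by simp⟩

lemma NoNeg.tri (h : NoNeg N w) {u x v : ℕ} (hu : u < N) (hv : v < N) :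
    D N u v ≤ D N u x + D N x v := (h.stable hu hv).trans (hopDist_add_le N N u v)

/-- If the vertex `x` splits a shortest walk with the fewest edges by its length, then both parts are
shortest walks with the fewest edges. -/
lemma onWalk_of_le (h : NoNeg N w) {u x v i j : ℕ} (hu : u < N) (hx : x < N) (hv : v < N)
    (hk : IsHop N w u v (i + j)) (hle : D i u x + D j x v ≤ D N u v) : OnWalk N w u x v i j := by
  have h1 := h.stable (k := i) hu hx
  have h2 := h.stable (k := j) hx hv
  have h3 := h.tri (x := x) hu hv
  have hT := hk.ne_top
  have hsum : D N u x + D N x v = D N u v := le_antisymm ((add_le_add h1 h2).trans hle) h3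
  have hi : D i u x ≠ ⊤ := by
    intro he; rw [he, top_add, top_le_iff] at hle; exact hT hle
  have hj : D j x v ≠ ⊤ := by
    intro he; rw [he, add_top, top_le_iff] at hle; exact hT hle
  have hi' : D N u x ≠ ⊤ := ne_top_of_le_ne_top hi h1
  have hj' : D N x v ≠ ⊤ := ne_top_of_le_ne_top hj h2
  have key : D i u x = D N u x ∧ D j x v = D N x v := by
    rw [← hsum] at hle
    lift D i u x to ℝ using hi with a
    lift D j x v to ℝ using hj with b
    lift D N u x to ℝ using hi' with a'
    lift D N x v to ℝ using hj' with b'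
    norm_cast at *
    constructor <;> linarith
  refine ⟨⟨key.1, hi', fun t ht he => ?_⟩, ⟨key.2, hj', fun t ht he => ?_⟩, hk, hsum⟩
  · refine hk.min (t + j) (by omega) (le_antisymm ?_ (h.stable hu hv))
    exact (hopDist_add_le t j u v).trans (by rw [he, key.2, hsum])
  · refine hk.min (i + t) (by omega) (le_antisymm ?_ (h.stable hu hv))
    exact (hopDist_add_le i t u v).trans (by rw [he, key.1, hsum])

lemma OnWalk.comp (h : NoNeg N w) {u a b v i j i' j' : ℕ} (hu : u < N) (hb : b < N) (hv : v < N)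
    (h1 : OnWalk N w u a v i j) (h2 : OnWalk N w a b v i' j') :
    OnWalk N w u b v (i + i') j' := by
  have hj : j = i' + j' := h1.right.unique h2.total
  subst hj
  refine onWalk_of_le h hu hb hv (by rw [add_assoc]; exact h1.total) ?_
  calc D (i + i') u b + D j' b v ≤ (D i u a + D i' a b) + D j' b v := by
        gcongr; exact hopDist_add_le i i' u b
    _ = D N u v := by rw [h1.left.eq, h2.left.eq, h2.right.eq, add_assoc, h2.add, h1.add]

lemma OnWalk.restrict (h : NoNeg N w) {u a b v i j i' j' : ℕ} (hu : u < N) (ha : a < N)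
    (hv : v < N) (h1 : OnWalk N w u b v i j) (h2 : OnWalk N w u a b i' j') :
    OnWalk N w u a v i' (j' + j) := by
  have hj : i = i' + j' := h1.left.unique h2.total
  subst hj
  refine onWalk_of_le h hu ha hv (by rw [← add_assoc]; exact h1.total) ?_
  calc D i' u a + D (j' + j) a v ≤ D i' u a + (D j' a b + D j b v) := by
        gcongr; exact hopDist_add_le j' j a v
    _ = D N u v := by rw [h2.left.eq, h2.right.eq, h1.right.eq, ← add_assoc, h2.add, h1.add]

lemma StrictWalk.onWalk (h : NoNeg N w) {u v k : ℕ} {x : ℕ → ℕ} (hx : StrictWalk N w u k x)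
    (hxk : x k = v) (hk : IsHop N w u v k) {i : ℕ} (hi : i ≤ k) :
    OnWalk N w u (x i) v i (k - i) := by
  have hu : u < N := hx.start ▸ hx.lt 0 (Nat.zero_le _)
  have hv : v < N := hxk ▸ hx.lt k le_rfl
  refine onWalk_of_le h hu (hx.lt i hi) hv (by rwa [Nat.add_sub_cancel' hi]) ?_
  rw [← hk.eq, ← hxk]
  exact hx.sub_le hi le_rfl

/-- Every shortest walk with at least `h` edges can be chosen so that it meets the set `H` within
its first `h` edges, after the first vertex. -/
def IsHubSet (N : ℕ) (w : ℕ → ℕ → WithTop ℝ) (H : ℕ → Prop) (h : ℕ) : Prop :=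
  ∀ u < N, ∀ v < N, ∀ k, IsHop N w u v k → h ≤ k →
    ∃ b < N, H b ∧ ∃ i j, OnWalk N w u b v i j ∧ 0 < i ∧ i ≤ h

lemma isHubSet_all (h : NoNeg N w) {H : ℕ → Prop} (hH : ∀ v < N, H v) : IsHubSet N w H 1 := by
  intro u hu v hv k hk h1
  obtain ⟨k, rfl⟩ : ∃ k', k = k' + 1 := ⟨k - 1, by omega⟩
  obtain ⟨x, hx, hxk⟩ := exists_strictWalk (k := k + 1) hu hv (fun j hj => by
    obtain rfl : k = j := by omega
    exact lt_of_le_of_ne (hopDist_succ_le _ _ _)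
      fun he => hk.min k (by omega) (he ▸ hk.eq)) (by simp)
  exact ⟨x 1, hx.lt 1 (by omega), hH _ (hx.lt 1 (by omega)), 1, _,
    hx.onWalk h hxk hk (by omega), by omega, le_rfl⟩

/-- Along a shortest walk that starts at a hub, there is a hub in any window of `h` vertices. -/
lemma IsHubSet.window (h : NoNeg N w) {H : ℕ → Prop} {g : ℕ} (hg : 1 ≤ g) (hH : IsHubSet N w H g)
    {a v k : ℕ} (ha : a < N) (hv : v < N) (haH : H a) (hk : IsHop N w a v k) (r : ℕ)
    (hr : r + g ≤ k + 1) :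
    ∃ b < N, H b ∧ ∃ i j, OnWalk N w a b v i j ∧ r ≤ i ∧ i < r + g := by
  induction r with
  | zero =>
    refine ⟨a, ha, haH, 0, k, onWalk_of_le h ha ha hv (by simpa using hk) ?_, le_rfl, by omega⟩
    rw [hopDist_self_zero, zero_add, hk.eq]
  | succ r ih =>
    obtain ⟨b, hb, hbH, i, j, hij, h1, h2⟩ := ih (by omega)
    have := hij.total.unique hk
    by_cases hi : r + 1 ≤ i
    · exact ⟨b, hb, hbH, i, j, hij, hi, by omega⟩
    · obtain ⟨c, hc, hcH, i', j', hij', h3, h4⟩ := hH b hb v hv j hij.right (by omega)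
      exact ⟨c, hc, hcH, i + i', j', hij.comp h ha hc hv hij', by omega, by omega⟩

/-- If the set `H'` meets the first `s` vertices of some shortest walk between any two hubs that
have about `s` edges between them, then it is a hub set at the next coarser scale. -/
lemma IsHubSet.step (h : NoNeg N w) {H H' : ℕ → Prop} {g : ℕ} (hg : 1 ≤ g)
    (hH : IsHubSet N w H g)
    (hit : ∀ a < N, ∀ b < N, H a → H b → ∀ k, IsHop N w a b k → 2 * g ≤ k + 1 → k ≤ 3 * g →
      ∃ c < N, H' c ∧ ∃ i j, OnWalk N w a c b i j ∧ i < 2 * g) :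
    IsHubSet N w H' (4 * g) := by
  intro u hu v hv k hk hgk
  obtain ⟨a, ha, haH, i, j, hij, h1, h2⟩ := hH u hu v hv k hk (by omega)
  have hij' := hij.total.unique hk
  obtain ⟨b, hb, hbH, i2, j2, hij2, h3, h4⟩ :=
    hH.window h hg ha hv haH hij.right (2 * g - 1) (by omega)
  obtain ⟨c, hc, hcH, i3, j3, hij3, h5⟩ := hit a ha b hb haH hbH i2 hij2.left (by omega) (by omega)
  have h6 := hij2.restrict h ha hc hv hij3
  exact ⟨c, hc, hcH, _, _, hij.comp h hu hc hv h6, by omega, by omega⟩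

/-- A chain of hub-to-hub distances reaches, in `t` doublings, either the last hub of a shortest
walk or at least `2 ^ t` edges. -/
lemma IsHubSet.chain (h : NoNeg N w) {H : ℕ → Prop} {g : ℕ} (hH : IsHubSet N w H g)
    (Q : ℕ → ℕ → ℕ → WithTop ℝ)
    (hQ0 : ∀ a < N, ∀ b < N, H a → H b → Q 0 a b ≤ D g a b)
    (hQ : ∀ t, ∀ a < N, ∀ b < N, ∀ c < N, H a → H b → H c → Q (t + 1) a c ≤ Q t a b + Q t b c)
    (t : ℕ) {a v k : ℕ} (ha : a < N) (hv : v < N) (haH : H a) (hk : IsHop N w a v k) :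
    ∃ b < N, H b ∧ ∃ i j, OnWalk N w a b v i j ∧ Q t a b ≤ D N a b ∧ (j < g ∨ 2 ^ t ≤ i) := by
  have hd {a : ℕ} (ha : a < N) : D N a a = 0 := by
    rw [← (isHop_self h ha).eq, hopDist_self_zero]
  have hQs : ∀ t, ∀ a < N, H a → Q t a a ≤ 0 := by
    intro t
    induction t with
    | zero =>
      intro a ha haH
      exact (hQ0 a ha a ha haH haH).trans ((hopDist_anti (Nat.zero_le g) a a).trans
        (hopDist_self_zero a).le)
    | succ t ih =>
      intro a ha haH
      exact (hQ t a ha a ha a ha haH haH haH).trans (add_nonpos (ih a ha haH) (ih a ha haH))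
  induction t generalizing a k with
  | zero =>
    by_cases hkg : k < g
    · refine ⟨a, ha, haH, 0, k, onWalk_of_le h ha ha hv (by simpa using hk) ?_, ?_, Or.inl hkg⟩
      · rw [hopDist_self_zero, zero_add, hk.eq]
      · rw [hd ha]; exact hQs 0 a ha haH
    · obtain ⟨b, hb, hbH, i, j, hij, h1, h2⟩ := hH a ha v hv k hk (by omega)
      refine ⟨b, hb, hbH, i, j, hij, ?_, Or.inr (by rw [pow_zero]; exact h1)⟩
      exact (hQ0 a ha b hb haH hbH).trans ((hopDist_anti h2 a b).trans hij.left.eq.le)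
  | succ t ih =>
    obtain ⟨b, hb, hbH, i, j, hij, h1, h2⟩ := ih ha haH hk
    rcases h2 with h2 | h2
    · refine ⟨b, hb, hbH, i, j, hij, ?_, Or.inl h2⟩
      calc Q (t + 1) a b ≤ Q t a b + Q t b b := hQ t a ha b hb b hb haH hbH hbH
        _ ≤ Q t a b + 0 := by gcongr; exact hQs t b hb hbH
        _ ≤ _ := by rw [add_zero]; exact h1
    · obtain ⟨c, hc, hcH, i', j', hij', h1', h2'⟩ := ih hb hbH hij.right
      refine ⟨c, hc, hcH, _, _, hij.comp h ha hc hv hij', ?_, ?_⟩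
      · have hpre : D N a c = D N a b + D N b c := by
          have e1 := (hij.comp h ha hc hv hij').add
          have e2 := hij.add
          have e3 := hij'.add
          rw [← e3, ← e1, ← add_assoc] at e2
          exact ((WithTop.add_right_inj hij'.right.ne_top).1 e2).symm
        rw [hpre]
        exact (hQ t a ha b hb c hc haH hbH hcH).trans (add_le_add h1 h1')
      · rcases h2' with h3 | h3
        · exact Or.inl h3
        · exact Or.inr (by rw [pow_succ]; omega)
end hop

end Par

/-! ### Splitting a vertex set so that few pairs stay together -/

namespace Par
open Finset

/-- One bit of the splitting. The pairs `(u i, v i)` whose labels agree above the bit `pw` and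
differ there are decided by the coefficient of this bit, which is chosen so that at most half of
them stay together. -/
lemma split_bit (P : Finset ℕ) (u v lab bt bt' : ℕ → ℕ) (pw : ℕ) {E F : ℕ} (f : ℕ)
    (hu : ∀ i ∈ P, bt (u i) < 2) (hv : ∀ i ∈ P, bt (v i) < 2)
    (hE : E = #{i ∈ P | lab (u i) / (2 * pw) = lab (v i) / (2 * pw) ∧
      lab (u i) / pw ≠ lab (v i) / pw ∧ bt (u i) = bt (v i)})
    (hF : F = #{i ∈ P | lab (u i) / (2 * pw) = lab (v i) / (2 * pw) ∧
      lab (u i) / pw ≠ lab (v i) / pw ∧ bt (u i) ≠ bt (v i)})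
    (hf : f = if F < E then 1 else 0)
    (hu' : ∀ i ∈ P, bt' (u i) = (bt (u i) + f * (lab (u i) / pw)) % 2)
    (hv' : ∀ i ∈ P, bt' (v i) = (bt (v i) + f * (lab (v i) / pw)) % 2)
    (inv : 2 * #{i ∈ P | lab (u i) / pw = lab (v i) / pw ∧ bt (u i) = bt (v i)} ≤
      #{i ∈ P | lab (u i) / pw = lab (v i) / pw}) :
    2 * #{i ∈ P | lab (u i) / (2 * pw) = lab (v i) / (2 * pw) ∧ bt' (u i) = bt' (v i)} ≤
      #{i ∈ P | lab (u i) / (2 * pw) = lab (v i) / (2 * pw)} := by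
  have hdd (x : ℕ) : x / (2 * pw) = x / pw / 2 := by rw [mul_comm, Nat.div_div_eq_div_mul]
  simp only [hdd] at hE hF ⊢
  have h1 : #{i ∈ P | lab (u i) / pw / 2 = lab (v i) / pw / 2} =
      #{i ∈ P | lab (u i) / pw = lab (v i) / pw} + (E + F) := by
    rw [hE, hF]
    simp only [card_filter, ← sum_add_distrib]
    refine sum_congr rfl fun i _ => ?_
    by_cases a : lab (u i) / pw = lab (v i) / pw
    · simp [a]
    · by_cases b : lab (u i) / pw / 2 = lab (v i) / pw / 2 <;>
        by_cases c : bt (u i) = bt (v i) <;> simp [a, b, c]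
  have h2 : #{i ∈ P | lab (u i) / pw / 2 = lab (v i) / pw / 2 ∧ bt' (u i) = bt' (v i)} =
      #{i ∈ P | lab (u i) / pw = lab (v i) / pw ∧ bt (u i) = bt (v i)} +
        (if F < E then F else E) := by
    have h3 : (if F < E then F else E) = #{i ∈ P | lab (u i) / pw / 2 = lab (v i) / pw / 2 ∧
        lab (u i) / pw ≠ lab (v i) / pw ∧ ((bt (u i) = bt (v i)) ↔ ¬ F < E)} := by
      split_ifs with h
      · refine hF.trans ?_; congr 1; ext i; simp [h]
      · refine hE.trans ?_; congr 1; ext i; simp [h]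
    rw [h3]
    simp only [card_filter, ← sum_add_distrib]
    refine sum_congr rfl fun i hi => ?_
    rw [hu' i hi, hv' i hi]
    have hui := hu i hi
    have hvi := hv i hi
    generalize lab (u i) / pw = a at *
    generalize lab (v i) / pw = b at *
    generalize bt (u i) = c at *
    generalize bt (v i) = d at *
    by_cases h : F < E
    · simp only [h, if_true, not_true, iff_false] at hf ⊢
      subst hf
      rw [one_mul, one_mul]
      by_cases h4 : a = b
      · subst h4
        have : ((c + a) % 2 = (d + a) % 2) ↔ c = d := by omega
        simp [this]
      · by_cases h5 : a / 2 = b / 2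
        · have : ((c + a) % 2 = (d + b) % 2) ↔ ¬ c = d := by omega
          simp [h4, h5, this]
        · simp [h4, h5]
    · simp only [h, if_false, not_false_iff, iff_true] at hf ⊢
      subst hf
      have : ((c + 0 * a) % 2 = (d + 0 * b) % 2) ↔ c = d := by omega
      simp only [this]
      by_cases h4 : a = b
      · simp [h4]
      · simp [h4]
  rw [h1, h2]
  split_ifs <;> omega

/-- The alive index pairs `x < y < s` of two vertices of a path that both lie in `S`. Paths are
numbered by `j < M`, and `pt x j` is the vertex number `x` of the path `j`. A triple `(j, x, y)` is
encoded as the number `(j * s + x) * s + y`. -/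
noncomputable def pairsIn (M s : ℕ) (al : ℕ → Prop) (pt : ℕ → ℕ → ℕ) (S : ℕ → Prop) : Finset ℕ :=
  open Classical in
  {i ∈ range (M * (s * s)) | al (i / (s * s)) ∧ i / s % s < i % s ∧
    S (pt (i / s % s) (i / (s * s))) ∧ S (pt (i % s) (i / (s * s)))}

/-- The alive vertices of paths that lie in `S`, as triples `(j, x, x)`. -/
noncomputable def singlesIn (M s : ℕ) (al : ℕ → Prop) (pt : ℕ → ℕ → ℕ) (S : ℕ → Prop) :
    Finset ℕ :=
  open Classical in
  {i ∈ range (M * (s * s)) | al (i / (s * s)) ∧ i / s % s = i % s ∧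
    S (pt (i / s % s) (i / (s * s)))}

lemma sum_range_mul {α : Type*} [AddCommMonoid α] (a b : ℕ) (f : ℕ → ℕ → α) :
    ∑ i ∈ range (a * b), f (i / b) (i % b) = ∑ i ∈ range a, ∑ j ∈ range b, f i j := by
  induction a with
  | zero => simp
  | succ a ih =>
    rw [Nat.succ_mul, sum_range_add, ih, sum_range_succ]
    congr 1
    refine sum_congr rfl fun j hj => ?_
    have hj : j < b := by simpa using hj
    congr 1
    · rw [mul_comm, Nat.mul_add_div (by omega), Nat.div_eq_of_lt hj, add_zero]
    · rw [mul_comm, Nat.mul_add_mod, Nat.mod_eq_of_lt hj]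

lemma sum_range_triple {α : Type*} [AddCommMonoid α] (a s : ℕ) (f : ℕ → ℕ → ℕ → α) :
    ∑ i ∈ range (a * (s * s)), f (i / (s * s)) (i / s % s) (i % s) =
      ∑ i ∈ range a, ∑ x ∈ range s, ∑ y ∈ range s, f i x y := by
  have h1 := sum_range_mul a (s * s) (fun i j => f i (j / s) (j % s))
  simp only [sum_range_mul s s] at h1
  rw [← h1]
  refine sum_congr rfl fun i _ => ?_
  rw [Nat.mod_mul_right_div_self, Nat.mod_mul_left_mod]

section potential
variable {M s : ℕ} {al : ℕ → Prop} {pt : ℕ → ℕ → ℕ} {S : ℕ → Prop}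

lemma card_pairsIn [DecidablePred al] [DecidablePred S] : #(pairsIn M s al pt S) =
    ∑ j ∈ range M, ∑ x ∈ range s, ∑ y ∈ range s,
      if al j ∧ x < y ∧ S (pt x j) ∧ S (pt y j) then 1 else 0 := by
  rw [← sum_range_triple M s
    (fun j x y => if al j ∧ x < y ∧ S (pt x j) ∧ S (pt y j) then 1 else 0), pairsIn, card_filter]
  refine sum_congr rfl fun i _ => ?_
  congr 1

lemma card_singlesIn [DecidablePred al] [DecidablePred S] : #(singlesIn M s al pt S) =
    ∑ j ∈ range M, ∑ x ∈ range s, if al j ∧ S (pt x j) then 1 else 0 := by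
  have h := sum_range_triple M s (fun j x y => if al j ∧ x = y ∧ S (pt x j) then 1 else 0)
  rw [singlesIn, card_filter]
  calc _ = ∑ i ∈ range (M * (s * s)), (fun j x y => if al j ∧ x = y ∧ S (pt x j) then 1 else 0)
            (i / (s * s)) (i / s % s) (i % s) := by
        refine sum_congr rfl fun i _ => ?_
        congr 1
    _ = _ := h
    _ = _ := by
        refine sum_congr rfl fun j _ => sum_congr rfl fun x hx => ?_
        rw [sum_eq_single x]
        · simp
        · intro y _ hy; simp [hy.symm]
        · intro h; exact absurd hx h

open Classical in
/-- With all vertices in `S`, the potential is at least half of its maximal value. -/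
lemma potential_start (hS : ∀ j < M, al j → ∀ x < s, S (pt x j)) :
    #{j ∈ range M | al j} * (s * s) + 2 * #(pairsIn M s al pt S) ≤
      2 * (s * #(singlesIn M s al pt S)) := by
  have h1 : s * #(singlesIn M s al pt S) = #{j ∈ range M | al j} * (s * s) := by
    rw [card_singlesIn, card_filter, sum_mul, mul_sum]
    refine sum_congr rfl fun j hj => ?_
    by_cases ha : al j
    · rw [sum_congr rfl (g := fun _ => 1) fun x hx => by
        simp [ha, hS j (by simpa using hj) ha x (by simpa using hx)]]
      simp [ha]
    · simp [ha]
  have h2 : 2 * #(pairsIn M s al pt S) ≤ #{j ∈ range M | al j} * (s * s) := by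
    rw [card_pairsIn, card_filter, sum_mul, mul_sum]
    refine sum_le_sum fun j _ => ?_
    by_cases ha : al j
    · simp only [ha, true_and, if_true, one_mul]
      rw [two_mul]
      nth_rewrite 2 [sum_comm]
      rw [← sum_add_distrib]
      calc _ ≤ ∑ x ∈ range s, ∑ y ∈ range s, 1 := by
            refine sum_le_sum fun x _ => ?_
            rw [← sum_add_distrib]
            refine sum_le_sum fun y _ => ?_
            split_ifs <;> omega
        _ = _ := by simp
    · simp [ha]
  omega

open Classical in
/-- A path that contains `k` vertices of `S` contributes `k - k (k - 1) / 2 ≤ 1`. -/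
lemma singles_le_pairs_add_hits : #(singlesIn M s al pt S) ≤ #(pairsIn M s al pt S) +
    #{j ∈ range M | al j ∧ ∃ x < s, S (pt x j)} := by
  rw [card_singlesIn, card_pairsIn, card_filter, ← sum_add_distrib]
  refine sum_le_sum fun j _ => ?_
  by_cases ha : al j
  · simp only [ha, true_and]
    set k := ∑ x ∈ range s, (if S (pt x j) then 1 else 0) with hk
    set p := ∑ x ∈ range s, ∑ y ∈ range s, (if x < y ∧ S (pt x j) ∧ S (pt y j) then 1 else 0)
      with hp
    have h1 : k * k = 2 * p + k := by
      have : k * k = ∑ x ∈ range s, ∑ y ∈ range s, (if S (pt x j) ∧ S (pt y j) then 1 else 0) := by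
        rw [hk, sum_mul_sum]
        refine sum_congr rfl fun x _ => sum_congr rfl fun y _ => ?_
        by_cases a : S (pt x j) <;> by_cases b : S (pt y j) <;> simp [a, b]
      have hsw : p = ∑ x ∈ range s, ∑ y ∈ range s,
          (if y < x ∧ S (pt y j) ∧ S (pt x j) then 1 else 0) := by rw [hp, sum_comm]
      rw [this, two_mul]
      nth_rewrite 2 [hsw]
      rw [hp, hk, ← sum_add_distrib, ← sum_add_distrib]
      refine sum_congr rfl fun x hx => ?_
      have h0 : (if S (pt x j) then 1 else 0) =
          ∑ y ∈ range s, if x = y ∧ S (pt x j) then 1 else 0 := by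
        rw [sum_eq_single x]
        · simp
        · intro y _ hy; simp [hy.symm]
        · intro h; exact absurd hx h
      rw [h0, ← sum_add_distrib, ← sum_add_distrib]
      refine sum_congr rfl fun y _ => ?_
      rcases lt_trichotomy x y with h | h | h
      · simp [h, h.ne, h.not_gt]
      · subst h; simp
      · simp [h, h.ne', h.not_gt, and_comm]
    split_ifs with h
    · rcases Nat.lt_or_ge k 3 with h3 | h3
      · interval_cases k <;> omega
      · nlinarith
    · have : k = 0 := by
        rw [hk]
        refine sum_eq_zero fun x hx => ?_
        rw [if_neg]
        intro hs
        exact h ⟨x, by simpa using hx, hs⟩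
      omega
  · simp [ha]

/-- One round of halving: keep the side `c` of the splitting `bt` with the smaller cost. The
potential `s * q * singles - q ^ 2 * pairs` does not decrease while `q` doubles. -/
lemma potential_step {q : ℕ} {bt : ℕ → ℕ} {c c0 c1 : ℕ}
    (hbt : ∀ i ∈ singlesIn M s al pt S, bt (pt (i / s % s) (i / (s * s))) < 2)
    (hhalf : 2 * #{i ∈ pairsIn M s al pt S | bt (pt (i / s % s) (i / (s * s))) =
      bt (pt (i % s) (i / (s * s)))} ≤ #(pairsIn M s al pt S))
    (h0 : c0 = 2 * q * #(pairsIn M s al pt fun v => S v ∧ bt v = 0) +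
      s * #(singlesIn M s al pt fun v => S v ∧ bt v = 1))
    (h1 : c1 = 2 * q * #(pairsIn M s al pt fun v => S v ∧ bt v = 1) +
      s * #(singlesIn M s al pt fun v => S v ∧ bt v = 0))
    (hc : c = if c1 < c0 then 1 else 0) :
    (s * q * #(singlesIn M s al pt S) - q ^ 2 * #(pairsIn M s al pt S) : ℤ) ≤
      s * (2 * q) * #(singlesIn M s al pt fun v => S v ∧ bt v = c) -
        (2 * q) ^ 2 * #(pairsIn M s al pt fun v => S v ∧ bt v = c) := by
  classical
  have e1 : #(singlesIn M s al pt fun v => S v ∧ bt v = 0) +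
      #(singlesIn M s al pt fun v => S v ∧ bt v = 1) = #(singlesIn M s al pt S) := by
    unfold singlesIn at hbt ⊢
    simp only [card_filter, ← sum_add_distrib]
    refine sum_congr rfl fun i hi => ?_
    by_cases a : al (i / (s * s)) ∧ i / s % s = i % s ∧ S (pt (i / s % s) (i / (s * s)))
    · have := hbt i (mem_filter.2 ⟨hi, a⟩)
      obtain ⟨a1, a2, a3⟩ := a
      interval_cases h : bt (pt (i / s % s) (i / (s * s))) <;> simp_all
    · rw [if_neg a, if_neg (by tauto), if_neg (by tauto)]
  have e2 : #(pairsIn M s al pt fun v => S v ∧ bt v = 0) +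
      #(pairsIn M s al pt fun v => S v ∧ bt v = 1) ≤
      #{i ∈ pairsIn M s al pt S | bt (pt (i / s % s) (i / (s * s))) =
        bt (pt (i % s) (i / (s * s)))} := by
    unfold pairsIn
    rw [filter_filter]
    simp only [card_filter, ← sum_add_distrib]
    refine sum_le_sum fun i hi => ?_
    split_ifs with h1 h2 h3 h3 h3 h3 <;> first | omega | skip
    · exact absurd ⟨⟨h1.1, h1.2.1, h1.2.2.1.1, h1.2.2.2.1⟩, h1.2.2.1.2.trans h1.2.2.2.2.symm⟩ h3
    · rename_i h4
      exact absurd ⟨⟨h4.1, h4.2.1, h4.2.2.1.1, h4.2.2.2.1⟩, h4.2.2.1.2.trans h4.2.2.2.2.symm⟩ h3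
  have hq : (0 : ℤ) ≤ q := Int.natCast_nonneg q
  generalize #{i ∈ pairsIn M s al pt S | bt (pt (i / s % s) (i / (s * s))) =
        bt (pt (i % s) (i / (s * s)))} = m at *
  subst hc
  generalize #(pairsIn M s al pt S) = p at *
  generalize #(singlesIn M s al pt S) = g at *
  have key : (s * g - q * p : ℤ) ≤
      s * 2 * #(singlesIn M s al pt fun v => S v ∧ bt v = if c1 < c0 then 1 else 0) -
        4 * q * #(pairsIn M s al pt fun v => S v ∧ bt v = if c1 < c0 then 1 else 0) := by
    split_ifs with h
    all_goals
      generalize #(pairsIn M s al pt fun v => S v ∧ bt v = 0) = p0 at *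
      generalize #(pairsIn M s al pt fun v => S v ∧ bt v = 1) = p1 at *
      generalize #(singlesIn M s al pt fun v => S v ∧ bt v = 0) = g0 at *
      generalize #(singlesIn M s al pt fun v => S v ∧ bt v = 1) = g1 at *
      have e4 : (q * (2 * (p0 + p1)) : ℤ) ≤ q * p := by
        apply mul_le_mul_of_nonneg_left _ hq; norm_cast; omega
      subst e1 h0 h1
      zify at h
      push_cast
      nlinarith
  nlinarith [mul_le_mul_of_nonneg_left key hq]
end potential

/-- A set whose elements have distinct labels below `L` has at most `L` elements. -/
lemma card_le_of_labels {N L : ℕ} {S : ℕ → Prop} [DecidablePred S] {lab : ℕ → ℕ}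
    (hinj : ∀ u < N, ∀ v < N, S u → S v → lab u = lab v → u = v)
    (hlt : ∀ v < N, S v → lab v < L) : #{v ∈ range N | S v} ≤ L := by
  have := card_le_card_of_injOn (s := {v ∈ range N | S v}) (t := range L) lab
    (fun v hv => by
      have hv : v < N ∧ S v := by simpa using hv
      simpa using hlt v hv.1 hv.2)
    (fun u hu v hv h => by
      have hu : u < N ∧ S u := by simpa using hu
      have hv : v < N ∧ S v := by simpa using hv
      exact hinj u hu.1 v hv.1 hu.2 hv.2 h)
  simpa using this

end Par

/-! ### Summation by doubling -/

namespace Par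
open Finset

/-- scalar: number of summands -/
def LEN : ℕ := 21
/-- array of summands, replaced by their suffix sums -/
def V : ℕ := 20
/-- scalar: current power of two in a summation -/
def PV : ℕ := 22

/-- Replaces `V` by its suffix sums. -/
def sumP : Prog :=
  setS PV 1 ;; .loop (.lt (sc PV) (sc LEN))
    (.parNat (sc LEN) 1 V ix (.read V ix + .lt (ix + sc PV) (sc LEN) * .read V (ix + sc PV)) ;;
      setS PV (2 * sc PV))

section
variable {W B : ℕ} [hg : Good W B] {σ : Mem}

lemma Good.hundred_le_bound (W B : ℕ) [hg : Good W B] : 100 ≤ B := hg.hundred_le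

/-- The standard doubling scheme: after `k` rounds the cell `i` holds the sum of `2 ^ k` summands. -/
lemma sumP_spec {len T : ℕ} (f : ℕ → ℕ) (hlen : σ.nat LEN 0 = len) (hT : len ≤ 2 ^ T)
    (h2 : 2 * len ≤ B) (hV : ∀ i < len, σ.nat V i = f i) (hB : ∑ j ∈ range len, f j ≤ B) :
    Spec W B sumP σ (T * (len + 4) + 3) (T * 3 + 2)
      (fun τ => ∀ i < len, τ.nat V i = ∑ j ∈ Ico i len, f j) := by
  have h100 := Good.hundred_le_bound W B
  have hTc : Nat.clog 2 len ≤ T := Nat.clog_le_of_le_pow hT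
  refine Spec.mono (w := 2 + (Nat.clog 2 len * (((len + 1) + 2) + 1) + 1))
    (d := 1 + (Nat.clog 2 len * ((1 + 1) + 1) + 1)) ?_ ?_ ?_ (fun τ _ _ h => h)
  rotate_left
  · have := Nat.mul_le_mul_right (len + 4) hTc; ring_nf at this ⊢; omega
  · omega
  have hle (i k : ℕ) (hk : k ≤ len) : ∑ j ∈ Ico i k, f j ≤ B :=
    (sum_le_sum_of_subset (fun j hj => by
    rw [mem_Ico] at hj; rw [mem_range]; omega)).trans hB
  refine Spec.seq (Spec.setS (e := 1) rfl (by rw [ev_ofNat]; omega)) fun τ hτ h1 => ?_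
  refine (Spec.loop_const (Nat.clog 2 len) (fun t υ => υ.nat PV 0 = 2 ^ t ∧
    ∀ i < len, υ.nat V i = ∑ j ∈ Ico i (min (i + 2 ^ t) len), f j) rfl ?_ ?_ ?_).mono
    le_rfl le_rfl ?_
  · refine ⟨by simpa using h1, fun i hi => ?_⟩
    rw [hτ.n V rfl, hV i hi, pow_zero, min_eq_left (by omega)]
    simp
  · intro t ht υ hA ⟨hp, hI⟩
    have hl : υ.nat LEN 0 = len := by rw [hA.n LEN rfl, hτ.n LEN rfl, hlen]
    have hlt : 2 ^ t < len := (Nat.lt_clog_iff_pow_lt (by norm_num)).1 ht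
    have hval : ∀ i < len, υ.nat V i + (if i + 2 ^ t < len then 1 else 0) * υ.nat V (i + 2 ^ t) =
        ∑ j ∈ Ico i (min (i + 2 ^ (t + 1)) len), f j := by
      intro i hi
      rw [hI i hi]
      split_ifs with h
      · rw [hI _ h, one_mul, min_eq_left h.le,
          sum_Ico_consecutive _ (by omega) (by rw [le_min_iff]; omega), pow_succ]
        congr 2; congr 1; ring
      · rw [zero_mul, add_zero, min_eq_right (by omega), min_eq_right (by rw [pow_succ]; omega)]
    refine ⟨by simp [hp, hl, hlt], ?_⟩
    refine Spec.seq (w := len + 1) (w' := 2) (d := 1) (d' := 1) (Spec.parNi len (by simp [hl]) (by omega) rfl ?_) fun υ1 hA1 hV1 => ?_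
    · intro i hi _
      simp only [ev_add, ev_read, ev_ix, ev_mul, ev_lt, ev_sc, hl, hp]
      rw [hval i hi]
      exact hle _ _ (min_le_right _ _)
    · have hp1 : υ1.nat PV 0 = 2 ^ t := by rw [hA1.n PV rfl, hp]
      refine (Spec.setS (e := 2 * sc PV) rfl (by simp [hp1]; omega)).mono le_rfl le_rfl ?_
      intro υ2 hA2 _ h3
      refine ⟨by rw [h3]; simp [hp1, pow_succ]; ring, fun i hi => ?_⟩
      rw [hA2.n V rfl, hV1 i, if_pos ⟨hi, by simp⟩]
      simp only [ev_add, ev_read, ev_ix, ev_mul, ev_lt, ev_sc, hl, hp]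
      exact hval i hi
  · intro υ hA ⟨hp, _⟩
    have hl : υ.nat LEN 0 = len := by rw [hA.n LEN rfl, hτ.n LEN rfl, hlen]
    have := Nat.le_pow_clog (b := 2) (by norm_num) len
    simp [hp, hl]; omega
  · intro υ _ _ ⟨_, hI⟩ i hi
    have := Nat.le_pow_clog (b := 2) (by norm_num) len
    rw [hI i hi, min_eq_right (by omega)]
end

/-! ### Relaxation of all edges -/

/-- `a` encodes the leftmost position of a finite minimum of `ev` in the interval `[lo, hi)`: it
is that position plus one, and `0` if all values are infinite. -/
def IsLMin (ev : ℕ → WithTop ℝ) (lo hi a : ℕ) : Prop :=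
  (a = 0 ∧ ∀ r, lo ≤ r → r < hi → ev r = ⊤) ∨
  ∃ r, a = r + 1 ∧ lo ≤ r ∧ r < hi ∧ ev r ≠ ⊤ ∧ (∀ r', lo ≤ r' → r' < hi → ev r ≤ ev r') ∧
    ∀ r', lo ≤ r' → r' < r → ev r < ev r'

/-- The leftmost minimum of two adjacent ranges. The two flags and one comparison of real words that
the machine evaluates decide which of the two candidates is kept. -/
lemma IsLMin.append {ev : ℕ → WithTop ℝ} {X : ℕ → ℝ} (hX : ∀ r, ev r ≠ ⊤ → ev r = X r)
    {lo mid hi a b c : ℕ} (ha : IsLMin ev lo mid a) (hb : IsLMin ev mid hi b) (h1 : lo ≤ mid)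
    (h2 : mid ≤ hi)
    (hc : c = if b ≠ 0 ∧ (a = 0 ∨ ¬ X (a - 1) ≤ X (b - 1)) then b else a) : IsLMin ev lo hi c := by
  rcases hb with ⟨rfl, hb⟩ | ⟨s, rfl, hs1, hs2, hs3, hs4, hs5⟩
  · simp only [ne_eq, not_true, false_and, if_false] at hc
    subst hc
    rcases ha with ⟨rfl, ha⟩ | ⟨r, rfl, hr1, hr2, hr3, hr4, hr5⟩
    · refine Or.inl ⟨rfl, fun r h3 h4 => ?_⟩
      rcases Nat.lt_or_ge r mid with h | h
      · exact ha r h3 h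
      · exact hb r h h4
    · refine Or.inr ⟨r, rfl, hr1, by omega, hr3, fun r' h3 h4 => ?_, hr5⟩
      rcases Nat.lt_or_ge r' mid with h | h
      · exact hr4 r' h3 h
      · rw [hb r' h h4]; exact le_top
  · rcases ha with ⟨rfl, ha⟩ | ⟨r, rfl, hr1, hr2, hr3, hr4, hr5⟩
    · simp only [ne_eq, Nat.add_eq_zero_iff, one_ne_zero, and_false, not_false_iff, true_or,
        and_self, if_true] at hc
      subst hc
      have hlt : ∀ r', lo ≤ r' → r' < mid → ev s < ev r' := fun r' h3 h4 => by
        rw [ha r' h3 h4]; exact lt_of_le_of_ne le_top hs3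
      refine Or.inr ⟨s, rfl, by omega, hs2, hs3, fun r' h3 h4 => ?_, fun r' h3 h4 => ?_⟩
      · rcases Nat.lt_or_ge r' mid with h | h
        · exact (hlt r' h3 h).le
        · exact hs4 r' h h4
      · rcases Nat.lt_or_ge r' mid with h | h
        · exact hlt r' h3 h
        · exact hs5 r' h h4
    · have hcmp : X r ≤ X s ↔ ev r ≤ ev s := by rw [hX r hr3, hX s hs3]; norm_cast
      simp only [ne_eq, Nat.add_eq_zero_iff, one_ne_zero, and_false, not_false_iff, false_or,
        true_and, Nat.add_sub_cancel, hcmp] at hc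
      by_cases h : ev r ≤ ev s
      · rw [if_neg (not_not.2 h)] at hc
        subst hc
        refine Or.inr ⟨r, rfl, hr1, by omega, hr3, fun r' h3 h4 => ?_, hr5⟩
        rcases Nat.lt_or_ge r' mid with h' | h'
        · exact hr4 r' h3 h'
        · exact h.trans (hs4 r' h' h4)
      · rw [if_pos h] at hc
        subst hc
        rw [not_le] at h
        refine Or.inr ⟨s, rfl, by omega, hs2, hs3, fun r' h3 h4 => ?_, fun r' h3 h4 => ?_⟩
        · rcases Nat.lt_or_ge r' mid with h' | h'
          · exact h.le.trans (hr4 r' h3 h')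
          · exact hs4 r' h' h4
        · rcases Nat.lt_or_ge r' mid with h' | h'
          · exact lt_of_lt_of_le h (hr4 r' h3 h')
          · exact hs5 r' h' h4

/-- The first and the last block of a vertex may also contain edges into other vertices; these count as
infinite. -/
lemma IsLMin.clip {ev : ℕ → WithTop ℝ} {lo hi x y a : ℕ} (hx : x ≤ lo) (hy : hi ≤ y)
    (h : IsLMin (fun r => if lo ≤ r ∧ r < hi then ev r else ⊤) x y a) : IsLMin ev lo hi a := by
  rcases h with ⟨rfl, h⟩ | ⟨r, rfl, h1, h2, h3, h4, h5⟩
  · refine Or.inl ⟨rfl, fun r h1 h2 => ?_⟩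
    have := h r (by omega) (by omega)
    simpa only [h1, h2, and_self, if_true] using this
  · by_cases hr : lo ≤ r ∧ r < hi
    · simp only [hr, and_self, if_true] at h3 h4 h5
      refine Or.inr ⟨r, rfl, hr.1, hr.2, h3, fun r' h6 h7 => ?_, fun r' h6 h7 => ?_⟩
      · have := h4 r' (by omega) (by omega)
        rwa [if_pos ⟨h6, h7⟩] at this
      · have := h5 r' (by omega) (by omega)
        rwa [if_pos ⟨h6, by omega⟩] at this
    · simp only [hr, if_false] at h3; exact absurd rfl h3

lemma IsLMin.single {ev : ℕ → WithTop ℝ} (r : ℕ) [Decidable (ev r = ⊤)] :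
    IsLMin ev r (r + 1) (if ev r = ⊤ then 0 else r + 1) := by
  by_cases h : ev r = ⊤
  · rw [if_pos h]
    refine Or.inl ⟨rfl, fun r' h1 h2 => ?_⟩
    obtain rfl : r' = r := by omega
    exact h
  · rw [if_neg h]
    refine Or.inr ⟨r, rfl, le_rfl, by omega, h, fun r' h1 h2 => ?_, fun r' h1 h2 => by omega⟩
    obtain rfl : r' = r := by omega
    exact le_rfl

/-- scalar: the logarithm `ℓ` -/
def LG : ℕ := 3
/-- scalar: number of rows -/
def ROWS : ℕ := 8
/-- scalar: number of vertices of the graph whose edges are relaxed -/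
def NV : ℕ := 9
/-- scalar: number of listed edges -/
def ME : ℕ := 10
/-- scalar: number of blocks of edges -/
def ZB : ℕ := 11
/-- tails of the listed edges -/
def SRC : ℕ := 12
/-- first position of the edges into a vertex -/
def ST : ℕ := 13
/-- head of the edges in a block -/
def OWN : ℕ := 14
/-- finiteness of the weights of the listed edges -/
def WF : ℕ := 15
/-- position, plus one, of the best edge of a block -/
def AM : ℕ := 16
/-- `0` at vertices with infinite value, otherwise the parent plus one -/
def CP : ℕ := 17
/-- scalar: width of the combined blocks -/
def PW : ℕ := 18
/-- scalar: loop variable over the positions in a block -/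
def JJ : ℕ := 19
/-- real: weights of the listed edges -/
def WT : ℕ := 1
/-- real: lengths of the walks that end with a given edge -/
def XC : ℕ := 2
/-- real: current values of the vertices -/
def CR : ℕ := 3

/-- `e` holds the position plus one of a better edge than `f` for the row `b`; `f` may be `0`. -/
def better (b e f : NExp) : NExp :=
  .eq f 0 + .no (.realLe XC (b * sc ME + (f - 1)) XC (b * sc ME + (e - 1)))

/-- For every row and every vertex `v`, the value of `v` becomes the least sum of the value of the
tail and the weight over the edges into `v`. The edges are listed in blocks of `ℓ` edges with the
same head; each block is scanned by one processor, then blocks are combined by doubling. -/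
def relaxP : Prog :=
  .parReal (sc ROWS * sc ME) 1 XC ix
    (.read CR (ix / sc ME * sc NV + .read SRC (ix % sc ME)) + .read WT (ix % sc ME)) ;;
  .parNat (sc ROWS * sc ZB) 1 AM ix 0 ;;
  forP JJ LG (
    let b := ix / sc ZB
    let z := ix % sc ZB
    let v := NExp.read OWN z
    let r := (z - v) * sc LG + sc JJ
    .parNat (sc ROWS * sc ZB)
      (.le (.read ST v) r * .lt r (.read ST (v + 1)) * .read WF r *
        .read CP (b * sc NV + .read SRC r) * better b (r + 1) (.read AM ix))
      AM ix (r + 1)) ;;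
  setS PW 1 ;;
  .loop (.lt (sc PW) (sc ZB)) (
    .parNat (sc ROWS * sc ZB)
      (.le (ix % sc ZB + sc PW) (.read ST (.read OWN (ix % sc ZB) + 1) / sc LG +
          .read OWN (ix % sc ZB)) * .read AM (ix + sc PW) *
        better (ix / sc ZB) (.read AM (ix + sc PW)) (.read AM ix))
      AM ix (.read AM (ix + sc PW)) ;;
    setS PW (2 * sc PW)) ;;
  (let a := NExp.read AM (ix / sc NV * sc ZB + (.read ST (ix % sc NV) / sc LG + ix % sc NV))
   .parNat (sc ROWS * sc NV) 1 CP ix (.lt 0 a * (.read SRC (a - 1) + 1)) ;;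
   .parReal (sc ROWS * sc NV) 1 CR ix (.read XC (ix / sc NV * sc ME + (a - 1))))

/-- The memory holds a list of `M` edges sorted by their heads, which are below `nv`. -/
structure EdgeList (ℓ nv M : ℕ) (σ : Mem) : Prop where
  lgEq : σ.nat LG 0 = ℓ
  pos : 1 ≤ ℓ
  nvEq : σ.nat NV 0 = nv
  meEq : σ.nat ME 0 = M
  zbEq : σ.nat ZB 0 = M / ℓ + nv
  mono : ∀ v < nv, σ.nat ST v ≤ σ.nat ST (v + 1)
  last : σ.nat ST nv = M
  own : ∀ v < nv, ∀ z, σ.nat ST v / ℓ + v ≤ z → z ≤ σ.nat ST (v + 1) / ℓ + v → σ.nat OWN z = v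

/-- Length of the walk of the row `b` that ends with the listed edge `r`. -/
noncomputable def edgeVal (σ : Mem) (nv b r : ℕ) : WithTop ℝ :=
  if σ.nat WF r ≠ 0 ∧ σ.nat CP (b * nv + σ.nat SRC r) ≠ 0 then
    ((σ.real CR (b * nv + σ.nat SRC r) + σ.real WT r : ℝ) : WithTop ℝ) else ⊤

lemma EdgeList.congr {ℓ nv M : ℕ} {σ τ : Mem} (h : EdgeList ℓ nv M σ)
    (e : ∀ a ∈ [LG, NV, ME, ZB, ST, OWN], τ.nat a = σ.nat a) : EdgeList ℓ nv M τ := by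
  simp only [List.mem_cons, List.not_mem_nil, or_false, forall_eq_or_imp, forall_eq] at e
  obtain ⟨e1, e2, e3, e4, e5, e6⟩ := e
  exact ⟨by rw [e1, h.lgEq], h.pos, by rw [e2, h.nvEq], by rw [e3, h.meEq], by rw [e4, h.zbEq],
    by rw [e5]; exact h.mono, by rw [e5]; exact h.last, by rw [e5, e6]; exact h.own⟩

lemma EdgeList.le {ℓ nv M : ℕ} {σ : Mem} (h : EdgeList ℓ nv M σ) {v : ℕ} (hv : v ≤ nv) :
    σ.nat ST v ≤ M := by
  rw [← h.last]
  obtain ⟨k, rfl⟩ := Nat.exists_eq_add_of_le hv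
  have := h.mono
  clear h
  induction k with
  | zero => exact le_rfl
  | succ k ih =>
    exact (ih (by omega) (fun u hu => this u (by omega))).trans (this (v + k) (by omega))

lemma div_mul_add {a b c : ℕ} (h : c < b) : (a * b + c) / b = a := by
  rw [mul_comm, Nat.mul_add_div (by omega), Nat.div_eq_of_lt h, add_zero]

lemma mod_mul_add {a b c : ℕ} (h : c < b) : (a * b + c) % b = c := by
  rw [mul_comm, Nat.mul_add_mod, Nat.mod_eq_of_lt h]

lemma mul_add_lt {a b c d : ℕ} (h : c < b) (ha : a < d) : a * b + c < d * b := by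
  calc a * b + c < (a + 1) * b := by rw [Nat.succ_mul]; omega
    _ ≤ d * b := Nat.mul_le_mul_right _ ha

section
variable {W B : ℕ} [hg : Good W B] {σ : Mem}

/-- Work `O(ρ M)` for the scan of the blocks, plus `O(T)` operations for each of the `M / ℓ + nv` blocks
of each row in the doubling: with `T = O(ℓ)` the logarithmic factor is absorbed by the length `ℓ` of
the blocks, up to a term `O(ρ ℓ nv)`. -/
lemma relaxP_spec {ℓ nv M ρ T : ℕ} (hE : EdgeList ℓ nv M σ) (hρ : σ.nat ROWS 0 = ρ)
    (hT : M / ℓ + nv ≤ 2 ^ T) (b1 : ρ * M ≤ B) (b2 : ρ * (M / ℓ + nv) ≤ B) (b3 : ρ * nv ≤ B)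
    (b4 : 2 * (M + nv) + 2 ≤ B) (b5 : ∀ r < M, σ.nat SRC r < B) :
    Spec W B relaxP σ (ρ * M + (ℓ + T + 1) * (ρ * (M / ℓ + nv) + 4) + 2 * (ρ * nv) + 12)
      (3 * ℓ + 3 * T + 10)
      (fun τ => ∀ b < ρ, ∀ v < nv, ∃ a,
        IsLMin (edgeVal σ nv b) (σ.nat ST v) (σ.nat ST (v + 1)) a ∧
        τ.nat CP (b * nv + v) = (if a = 0 then 0 else σ.nat SRC (a - 1) + 1) ∧
        (a ≠ 0 → (τ.real CR (b * nv + v) : WithTop ℝ) = edgeVal σ nv b (a - 1))) := by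
  classical
  obtain ⟨lg, pos, nvE, me, zb, mono, last, own⟩ := id hE
  set Z := M / ℓ + nv with hZ
  set st := σ.nat ST with hst
  have stle : ∀ v ≤ nv, st v ≤ M := fun v hv => hE.le hv
  have h100 := Good.hundred_le_bound W B
  have hMl : M / ℓ ≤ M := Nat.div_le_self _ _
  -- the blocks of the vertex `v` are `head v, …, tail v`
  have tailZ : ∀ v < nv, st (v + 1) / ℓ + v < Z := fun v hv => by
    have := Nat.div_le_div_right (c := ℓ) (stle (v + 1) hv)
    omega
  have headtail : ∀ v < nv, st v / ℓ + v ≤ st (v + 1) / ℓ + v := fun v hv => by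
    have := Nat.div_le_div_right (c := ℓ) (mono v hv); omega
  -- values clipped to the edges into `v`
  set evc : ℕ → ℕ → ℕ → WithTop ℝ := fun b v r =>
    if st v ≤ r ∧ r < st (v + 1) then edgeVal σ nv b r else ⊤ with hevc
  set X : ℕ → ℕ → ℝ := fun b r => σ.real CR (b * nv + σ.nat SRC r) + σ.real WT r with hXdef
  have hXev : ∀ b v r, evc b v r ≠ ⊤ → evc b v r = X b r := by
    intro b v r h
    simp only [hevc, edgeVal] at h ⊢
    split_ifs at h ⊢ <;> simp_all
  have hevtop : ∀ b v r, evc b v r = ⊤ ↔ ¬ (st v ≤ r ∧ r < st (v + 1) ∧ σ.nat WF r ≠ 0 ∧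
      σ.nat CP (b * nv + σ.nat SRC r) ≠ 0) := by
    intro b v r
    simp only [hevc, edgeVal]
    split_ifs <;> simp_all
  clear_value evc
  refine Spec.mono (w := (ρ * M + 1) + ((ρ * Z + 1) + ((ℓ * ((ρ * Z + 1) + 3) + 3) + (2 +
      ((Nat.clog 2 Z * (((ρ * Z + 1) + 2) + 1) + 1) + ((ρ * nv + 1) + (ρ * nv + 1)))))))
    (d := 1 + (1 + ((ℓ * (1 + 2) + 2) + (1 + ((Nat.clog 2 Z * ((1 + 1) + 1) + 1) + (1 + 1))))))
    ?_ ?_ ?_ (fun τ _ _ h => h)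
  rotate_left
  · have := Nat.mul_le_mul_right (ρ * Z + 4) (Nat.clog_le_of_le_pow hT)
    simp only [Nat.add_mul, one_mul] at this ⊢
    have e : ℓ * (ρ * Z + 1 + 3) = ℓ * (ρ * Z + 4) := rfl
    have e' : Nat.clog 2 Z * (ρ * Z + 1 + 2 + 1) = Nat.clog 2 Z * (ρ * Z + 4) := rfl
    omega
  · have := Nat.clog_le_of_le_pow hT; omega
  -- lengths of the walks that end with each edge
  refine Spec.seq (Spec.parRi (ρ * M) (by simp [hρ, me]) b1 rfl) fun τ1 hA1 h1 => ?_
  have hX1 : ∀ b < ρ, ∀ r < M, τ1.real XC (b * M + r) = X b r := by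
    intro b hb r hr
    rw [h1, if_pos ⟨mul_add_lt hr hb, by simp⟩]
    simp [me, nvE, div_mul_add hr, mod_mul_add hr, hXdef]
  refine Spec.seq (Spec.parNi (ρ * Z) (by simp [hA1.n ROWS rfl, hA1.n ZB rfl, hρ, zb]) b2 rfl
    (by simp)) fun τ2 hA2 h2 => ?_
  have hA12 : ∀ a, a ≠ AM → τ2.nat a = σ.nat a := fun a ha => by
    rw [hA2.n a (by simpa [Prog.wN] using ha), hA1.n a rfl]
  have cmp : ∀ τ : Mem, τ.real XC = τ1.real XC → τ.nat ME = σ.nat ME → ∀ e f b i,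
      ∀ w : NExp, w.ev τ i = b → b < ρ → e.ev τ i ≤ M → f.ev τ i ≤ M → e.ev τ i ≠ 0 →
      ((better w e f).ev τ i ≠ 0 ↔
        (f.ev τ i = 0 ∨ ¬ X b (f.ev τ i - 1) ≤ X b (e.ev τ i - 1))) := by
    intro τ hx hm e f b i w hw hb he hf he0
    by_cases hf0 : f.ev τ i = 0
    · simp [better, hf0]
    · simp only [better, ev_add, ev_eq, ev_no, ev_realLe, ev_mul, ev_sc, ev_sub, ev_ofNat, hw, hm,
        me, hx, hf0, false_or]
      rw [hX1 b hb _ (by omega), hX1 b hb _ (by omega)]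
      split_ifs <;> simp_all
  have amle : ∀ {b v lo hi a}, v < nv → IsLMin (evc b v) lo hi a → a ≤ M := by
    rintro b v lo hi a hv (⟨rfl, -⟩ | ⟨r, rfl, -, -, h, -⟩)
    · exact Nat.zero_le _
    · rw [ne_eq, hevtop, not_not] at h
      exact (Nat.succ_le_of_lt h.2.1).trans (stle (v + 1) hv)
  -- scan the blocks
  refine Spec.seq (Spec.forP ℓ (fun J τ => ∀ b < ρ, ∀ v < nv, ∀ z, st v / ℓ + v ≤ z →
      z ≤ st (v + 1) / ℓ + v →
      IsLMin (evc b v) ((z - v) * ℓ) ((z - v) * ℓ + J) (τ.nat AM (b * Z + z)))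
    (by rw [hA12 LG (by decide), lg]) rfl rfl ?_ ?_ ?_) fun τ3 hA3 h3 => ?_
  · intro i τ τ' hn _ h
    rw [hn AM (by decide)]; exact h
  · intro b hb v hv z hz1 hz2
    have hzZ : z < Z := lt_of_le_of_lt hz2 (tailZ v hv)
    rw [h2, if_pos ⟨mul_add_lt hzZ hb, by simp⟩]
    exact Or.inl ⟨rfl, fun r h4 h5 => by omega⟩
  · intro J hJ τ hA hJJ hI
    have hn : ∀ a, a ≠ AM → a ≠ JJ → τ.nat a = σ.nat a := fun a ha ha' => by
      rw [hA.n a (by simp [forP, setS, Prog.wN, ha, ha']), hA12 a ha]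
    have hrX : τ.real XC = τ1.real XC := by rw [hA.r XC rfl, hA2.r XC rfl]
    refine Spec.bdd fun hτB => ?_
    refine (Spec.parNi (ρ * Z) (by
      simp [hn ROWS (by decide) (by decide), hn ZB (by decide) (by decide), hρ, zb]) b2 rfl
      ?_).mono
      le_rfl le_rfl ?_
    · intro i hi hgi
      simp only [ev_mul, ne_eq, mul_eq_zero, not_or] at hgi
      obtain ⟨⟨⟨⟨-, hg2⟩, -⟩, -⟩, -⟩ := hgi
      simp only [ev_lt, ite_eq_right_iff, one_ne_zero, imp_false, not_not] at hg2
      rw [ev_add, ev_ofNat]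
      exact (Nat.succ_le_of_lt hg2).trans (hτB _ _)
    · intro τ' hA' _ h' b hb v hv z hz1 hz2
      have hzZ : z < Z := lt_of_le_of_lt hz2 (tailZ v hv)
      have hI' := hI b hb v hv z hz1 hz2
      set r := (z - v) * ℓ + J with hr
      have hr0 := IsLMin.single (ev := evc b v) r
      refine hI'.append (hXev b v) hr0 (by omega) (by omega) ?_
      have ha := amle hv hI'
      have hrM : evc b v r ≠ ⊤ → r + 1 ≤ M := fun h => by
        rw [ne_eq, hevtop, not_not] at h
        exact (Nat.succ_le_of_lt h.2.1).trans (stle (v + 1) hv)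
      rw [h']
      simp only [mul_add_lt hzZ hb, true_and, ev_mul, ne_eq, mul_eq_zero, not_or, ev_le, ev_lt,
        ev_read, ev_add, ev_sub, ev_div, ev_mod, ev_sc, ev_ix,
        hn ZB (by decide) (by decide), hn OWN (by decide) (by decide), hn LG (by decide) (by decide),
        hn ST (by decide) (by decide), hn WF (by decide) (by decide), hn CP (by decide) (by decide),
        hn NV (by decide) (by decide), hn SRC (by decide) (by decide), zb, lg, nvE, hJJ,
        div_mul_add hzZ, mod_mul_add hzZ, own v hv z hz1 hz2, ev_ofNat, ← hr, ← hst]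
      by_cases hfin : evc b v r = ⊤
      · rw [if_pos hfin]
        simp only [not_true, false_and, if_false]
        rw [if_neg]
        rw [hevtop] at hfin
        simp only [ite_eq_right_iff, one_ne_zero, imp_false, not_not]
        tauto
      · have hc := cmp τ hrX (hn ME (by decide) (by decide)) (((ix % sc ZB) - .read OWN (ix % sc ZB)) * sc LG + sc JJ + 1)
          (.read AM ix) b (b * Z + z) (ix / sc ZB) (by
            simp [hn ZB (by decide) (by decide), zb, div_mul_add hzZ]) hb (by
            simp [hn ZB (by decide) (by decide), hn OWN (by decide) (by decide),
              hn LG (by decide) (by decide), zb, lg, mod_mul_add hzZ, own v hv z hz1 hz2, hJJ]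
            exact hrM hfin) ha (by simp)
        rw [if_neg hfin]
        simp only [ev_add, ev_sub, ev_mul, ev_read, ev_mod, ev_sc, ev_ix, ev_ofNat,
          hn ZB (by decide) (by decide), hn OWN (by decide) (by decide),
          hn LG (by decide) (by decide), zb, lg, mod_mul_add hzZ, own v hv z hz1 hz2, hJJ,
          ← hr] at hc
        rw [hevtop, not_not] at hfin
        refine if_congr ?_ rfl rfl
        have hc' := hc
        simp only [Nat.add_sub_cancel, ne_eq] at hc' ⊢
        rw [hc']
        simp [hfin]
  -- combine the blocks of each vertex
  have hA13 : ∀ a, a ≠ AM → a ≠ JJ → τ3.nat a = σ.nat a := fun a ha ha' => by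
    rw [hA3.n a (by simp [forP, setS, Prog.wN, ha, ha']), hA12 a ha]
  refine Spec.seq (Spec.setS (e := 1) rfl (by rw [ev_ofNat]; omega)) fun τ4 hA4 h4 => ?_
  have hA14 : ∀ a, a ≠ AM → a ≠ JJ → a ≠ PW → τ4.nat a = σ.nat a := fun a ha ha' ha2 => by
    rw [hA4.n a (by simp [setS, Prog.wN, ha2]), hA13 a ha ha']
  refine Spec.seq (Spec.loop_const (Nat.clog 2 Z) (fun t τ => τ.nat PW 0 = 2 ^ t ∧
    ∀ b < ρ, ∀ v < nv, ∀ z, st v / ℓ + v ≤ z → z ≤ st (v + 1) / ℓ + v →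
      IsLMin (evc b v) ((z - v) * ℓ) ((min (z + 2 ^ t) (st (v + 1) / ℓ + v + 1) - v) * ℓ)
        (τ.nat AM (b * Z + z))) rfl ?_ ?_ ?_) fun τ5 hA5 h5 => ?_
  · refine ⟨by simpa using h4, fun b hb v hv z hz1 hz2 => ?_⟩
    have := h3 b hb v hv z hz1 hz2
    have hvz : v ≤ z := le_trans (Nat.le_add_left _ _) hz1
    rw [hA4.n AM rfl, pow_zero, min_eq_left (Nat.add_le_add_right hz2 1)]
    have e : (z - v) * ℓ + ℓ = (z + 1 - v) * ℓ := by
      rw [show z + 1 - v = (z - v) + 1 by omega, Nat.succ_mul]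
    rwa [← e]
  · intro t ht τ hA ⟨hp, hI⟩
    have hn : ∀ a, a ≠ AM → a ≠ JJ → a ≠ PW → τ.nat a = σ.nat a := fun a ha ha' ha2 => by
      rw [hA.n a (by simp [setS, Prog.wN, ha, ha2]), hA14 a ha ha' ha2]
    have hrX : τ.real XC = τ1.real XC := by
      rw [hA.r XC rfl, hA4.r XC rfl, hA3.r XC rfl, hA2.r XC rfl]
    have hlt : 2 ^ t < Z := (Nat.lt_clog_iff_pow_lt (by norm_num)).1 ht
    have hZB : τ.nat ZB 0 = Z := by rw [hn ZB (by decide) (by decide) (by decide), zb]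
    refine ⟨by simp [hp, hZB, hlt], Spec.bdd fun hτB => ?_⟩
    refine Spec.seq (w := ρ * Z + 1) (w' := 2) (d := 1) (d' := 1) (Spec.parNi (ρ * Z) (by
      simp [hn ROWS (by decide) (by decide) (by decide), hZB, hρ]) b2 rfl
      (fun i _ _ => hτB _ _)) fun τ' hA' h' => ?_
    have hp1 : τ'.nat PW 0 = 2 ^ t := by rw [hA'.n PW rfl, hp]
    refine (Spec.setS (e := 2 * sc PW) rfl (by
      simp only [ev_mul, ev_sc, ev_ofNat, hp1]; omega)).mono le_rfl le_rfl ?_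
    intro τ'' hA'' _ h''
    refine ⟨by rw [h'']; simp [hp1, pow_succ]; ring, fun b hb v hv z hz1 hz2 => ?_⟩
    have hzZ : z < Z := lt_of_le_of_lt hz2 (tailZ v hv)
    have hI1 := hI b hb v hv z hz1 hz2
    rw [hA''.n AM rfl, h']
    simp only [mul_add_lt hzZ hb, true_and, ev_mul, ne_eq, mul_eq_zero, not_or, ev_le,
      ev_read, ev_add, ev_div, ev_mod, ev_sc, ev_ix, hn OWN (by decide) (by decide) (by decide),
      hn LG (by decide) (by decide) (by decide), hn ST (by decide) (by decide) (by decide), hZB, lg,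
      mod_mul_add hzZ, own v hv z hz1 hz2, ev_ofNat, ← hst, hp]
    by_cases hz : z + 2 ^ t ≤ st (v + 1) / ℓ + v
    · have hI2 := hI b hb v hv (z + 2 ^ t) (by omega) hz
      rw [min_eq_left (by omega)] at hI1
      rw [pow_succ, show z + 2 ^ t * 2 = z + 2 ^ t + 2 ^ t by ring]
      rw [← add_assoc] at hI2
      refine hI1.append (hXev b v) hI2 (Nat.mul_le_mul_right _ (by omega))
        (Nat.mul_le_mul_right _ (Nat.sub_le_sub_right (by rw [le_min_iff]; omega) _)) ?_
      refine if_congr ?_ rfl rfl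
      by_cases h0 : τ.nat AM (b * Z + z + 2 ^ t) = 0
      · simp [h0]
      · have hc := cmp τ hrX (hn ME (by decide) (by decide) (by decide))
          (.read AM (ix + sc PW)) (.read AM ix) b (b * Z + z) (ix / sc ZB)
          (by simp [hZB, div_mul_add hzZ]) hb
          (by simpa [hp] using amle hv hI2) (by simpa using amle hv hI1) (by simpa [hp] using h0)
        simp only [ev_read, ev_add, ev_sc, ev_ix, hp, ne_eq] at hc
        rw [hc]
        simp [h0, hz]
    · rw [if_neg (by simp [hz]), pow_succ]
      rw [min_eq_right (by omega)] at hI1 ⊢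
      exact hI1
  · intro τ hA ⟨hp, _⟩
    have := Nat.le_pow_clog (b := 2) (by norm_num) Z
    have hZB : τ.nat ZB 0 = Z := by
      rw [hA.n ZB rfl, hA14 ZB (by decide) (by decide) (by decide), zb]
    simp [hp, hZB]; omega
  obtain ⟨-, h5⟩ := h5
  have hn : ∀ a, a ≠ AM → a ≠ JJ → a ≠ PW → τ5.nat a = σ.nat a := fun a ha ha' ha2 => by
    rw [hA5.n a (by simp [setS, Prog.wN, ha, ha2]), hA14 a ha ha' ha2]
  have hmin : ∀ b < ρ, ∀ v < nv,
      IsLMin (edgeVal σ nv b) (st v) (st (v + 1)) (τ5.nat AM (b * Z + (st v / ℓ + v))) := by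
    intro b hb v hv
    have h := h5 b hb v hv (st v / ℓ + v) le_rfl (headtail v hv)
    have hp := Nat.le_pow_clog (b := 2) (by norm_num) Z
    have := tailZ v hv
    rw [min_eq_right (by generalize st v / ℓ = x; omega), Nat.add_sub_cancel,
      show st (v + 1) / ℓ + v + 1 - v = st (v + 1) / ℓ + 1 by
        generalize st (v + 1) / ℓ = x; omega] at h
    have h' : evc b v = fun r => if st v ≤ r ∧ r < st (v + 1) then edgeVal σ nv b r else ⊤ := by
      rw [hevc]
    rw [h'] at h
    refine h.clip (Nat.div_mul_le_self _ _) ?_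
    have := Nat.lt_div_mul_add (a := st (v + 1)) (b := ℓ) (by omega)
    rw [Nat.succ_mul]; omega
  have amle' : ∀ b < ρ, ∀ v < nv, τ5.nat AM (b * Z + (st v / ℓ + v)) ≤ M := by
    intro b hb v hv
    rcases hmin b hb v hv with ⟨h, -⟩ | ⟨r, h, -, h6, -⟩
    · omega
    · have := stle (v + 1) hv; omega
  have decode : ∀ i < ρ * nv, ∃ b < ρ, ∃ v < nv, i = b * nv + v := fun i hi => by
    have hnv : 0 < nv := Nat.pos_of_ne_zero fun h => by simp [h] at hi
    exact ⟨i / nv, Nat.div_lt_of_lt_mul (by rwa [mul_comm]), i % nv, Nat.mod_lt _ hnv,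
      (Nat.div_add_mod' i nv).symm⟩
  have hnvv := hn NV (by decide) (by decide) (by decide)
  have hzbv := hn ZB (by decide) (by decide) (by decide)
  have hstv := hn ST (by decide) (by decide) (by decide)
  have hlgv := hn LG (by decide) (by decide) (by decide)
  have hsrc := hn SRC (by decide) (by decide) (by decide)
  refine Spec.seq (Spec.parNi (ρ * nv) (by
    simp [hn ROWS (by decide) (by decide) (by decide), hnvv, nvE, hρ]) b3 rfl ?_)
    fun τ6 hA6 h6 => ?_
  · intro i hi _
    obtain ⟨b, hb, v, hv, rfl⟩ := decode i hi
    have := amle' b hb v hv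
    simp only [ev_mul, ev_lt, ev_ofNat, ev_read, ev_add, ev_div, ev_mod, ev_sc, ev_ix, ev_sub, hnvv,
      hzbv, hstv, hlgv, hsrc, nvE, zb, lg, div_mul_add hv, mod_mul_add hv, ← hst]
    split_ifs with h
    · have := b5 (τ5.nat AM (b * Z + (st v / ℓ + v)) - 1) (by omega)
      omega
    · omega
  refine (Spec.parRi (ρ * nv) (by
    simp [hA6.n ROWS rfl, hA6.n NV rfl, hn ROWS (by decide) (by decide) (by decide), hnvv, nvE, hρ])
    b3 rfl).mono le_rfl le_rfl ?_
  intro τ7 hA7 _ h7 b hb v hv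
  refine ⟨_, hmin b hb v hv, ?_, fun h0 => ?_⟩
  · rw [hA7.n CP rfl, h6, if_pos ⟨mul_add_lt hv hb, by simp⟩]
    simp only [ev_mul, ev_lt, ev_ofNat, ev_read, ev_add, ev_div, ev_mod, ev_sc, ev_ix, ev_sub, hnvv,
      hzbv, hstv, hlgv, hsrc, nvE, zb, lg, div_mul_add hv, mod_mul_add hv, ← hst]
    by_cases h : τ5.nat AM (b * Z + (st v / ℓ + v)) = 0
    · simp [h]
    · rw [if_pos (by omega), if_neg h, one_mul]
  · rw [h7, if_pos ⟨mul_add_lt hv hb, by simp⟩]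
    simp only [rev_read, ev_mul, ev_ofNat, ev_read, ev_add, ev_div, ev_mod, ev_sc, ev_ix, ev_sub,
      hA6.n NV rfl, hA6.n ZB rfl, hA6.n ST rfl, hA6.n LG rfl, hA6.n AM rfl, hA6.n ME rfl, hnvv,
      hzbv, hstv, hlgv, nvE, zb, lg, div_mul_add hv, mod_mul_add hv, ← hst,
      hn ME (by decide) (by decide) (by decide), me]
    have hr := amle' b hb v hv
    rw [hA6.r XC rfl, hA5.r XC rfl, hA4.r XC rfl, hA3.r XC rfl, hA2.r XC rfl,
      hX1 b hb _ (by omega)]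
    rcases hmin b hb v hv with ⟨h, -⟩ | ⟨r, h, -, -, h9, -⟩
    · exact absurd h h0
    · rw [h, Nat.add_sub_cancel]
      unfold edgeVal at h9 ⊢
      split_ifs at h9 ⊢ with h10
      · rfl
      · exact absurd rfl h9
end

end Par

/-! ### Sorting the edges by their heads -/

namespace Par
open Finset

/-- scalar: the number of vertices, including the source -/
def NN : ℕ := 5
/-- scalar: the least power of two that is at least the number of vertices -/
def EE : ℕ := 4
/-- scalar: more than the number of listed edges into any vertex -/
def DD : ℕ := 43
/-- adjacency matrix: weight index plus one, `0` if there is no edge -/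
def MX : ℕ := 44

/-- Computes the number of blocks and the head of each block. -/
def blocksP : Prog :=
  setS ZB (sc ME / sc LG + sc NV) ;;
  .parNat (sc NV * sc DD)
    (.le (.read ST (ix / sc DD) / sc LG + ix % sc DD) (.read ST (ix / sc DD + 1) / sc LG))
    OWN (.read ST (ix / sc DD) / sc LG + ix / sc DD + ix % sc DD) (ix / sc DD)

lemma count_suffix (p : ℕ → Prop) [DecidablePred p] {i len : ℕ} (h : i ≤ len) :
    (∑ j ∈ Ico 0 len, if p j then 1 else 0) - (∑ j ∈ Ico i len, if p j then 1 else 0) =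
      Nat.count p i := by
  rw [← sum_Ico_consecutive _ (Nat.zero_le i) h, Nat.add_sub_cancel, Nat.count_eq_card_filter_range,
    card_filter, range_eq_Ico]

lemma exists_of_lt_count (p : ℕ → Prop) [DecidablePred p] {r k : ℕ} (h : r < Nat.count p k) :
    ∃ q < k, p q ∧ Nat.count p q = r := by
  induction k with
  | zero => simp at h
  | succ k ih =>
    rcases Nat.lt_or_ge r (Nat.count p k) with h1 | h1
    · obtain ⟨q, hq, h2⟩ := ih h1
      exact ⟨q, by omega, h2⟩
    · rw [Nat.count_succ] at h
      by_cases hk : p k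
      · rw [if_pos hk] at h
        exact ⟨k, by omega, hk, by omega⟩
      · rw [if_neg hk] at h; omega

section
variable {W B : ℕ} [hg : Good W B] {σ : Mem}

/-- The block number `st v / ℓ + v + j` is assigned to `v` for all `j` that keep it within the range of
blocks of `v`; the shift by `v` makes the ranges of different vertices disjoint. -/
lemma blocksP_spec {ℓ nv M dd : ℕ} (lg : σ.nat LG 0 = ℓ) (pos : 1 ≤ ℓ) (hnv : σ.nat NV 0 = nv)
    (me : σ.nat ME 0 = M) (hdd : σ.nat DD 0 = dd) (mono : ∀ v < nv, σ.nat ST v ≤ σ.nat ST (v + 1))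
    (last : σ.nat ST nv = M) (deg : ∀ v < nv, σ.nat ST (v + 1) < σ.nat ST v + dd)
    (b1 : M + nv ≤ B) (b2 : nv * dd ≤ B) :
    Spec W B blocksP σ (nv * dd + 3) 2 (EdgeList ℓ nv M) := by
  set st := σ.nat ST with hst
  have hMl : M / ℓ ≤ M := Nat.div_le_self _ _
  refine Spec.mono (w := 2 + (nv * dd + 1)) (d := 1 + 1) ?_ (by omega) (by omega) (fun _ _ _ h => h)
  refine Spec.seq (Spec.setS rfl (by simp only [ev_add, ev_div, ev_sc, lg, me, hnv]; omega))
    fun τ1 hA1 h1 => ?_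
  have hn : ∀ a, a ≠ ZB → τ1.nat a = σ.nat a := fun a ha => hA1.n a (by simpa [setS, Prog.wN])
  have headmono : ∀ v v', v ≤ v' → v' ≤ nv → st v / ℓ ≤ st v' / ℓ := by
    intro v v' h h'
    induction v', h using Nat.le_induction with
    | base => exact le_rfl
    | succ k hk ih => exact (ih (by omega)).trans (Nat.div_le_div_right (mono k (by omega)))
  have dec : ∀ i < nv * dd, i / dd < nv ∧ i % dd < dd ∧ i = i / dd * dd + i % dd := fun i hi => by
    have hd : 0 < dd := Nat.pos_of_ne_zero fun h => by simp [h] at hi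
    exact ⟨Nat.div_lt_of_lt_mul (by rwa [mul_comm]), Nat.mod_lt _ hd, (Nat.div_add_mod' i dd).symm⟩
  have hev : ∀ i, i < nv * dd → NExp.ev τ1 i (.le (.read ST (ix / sc DD) / sc LG + ix % sc DD)
      (.read ST (ix / sc DD + 1) / sc LG)) ≠ 0 → st (i / dd) / ℓ + i % dd ≤ st (i / dd + 1) / ℓ := by
    intro i hi h
    simpa [hn DD (by decide), hn ST (by decide), hn LG (by decide), hdd, lg, ← hst] using h
  refine (Spec.parN (nv * dd) (by simp [hn NV (by decide), hn DD (by decide), hnv, hdd]) b2 rfl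
    ?_ ?_).mono le_rfl le_rfl ?_
  · intro i j hi hj hgi hgj he
    have h1 := hev i hi hgi
    have h2 := hev j hj hgj
    simp only [ev_add, ev_div, ev_read, ev_ix, ev_sc, ev_mod, hn DD (by decide), hn ST (by decide),
      hn LG (by decide), hdd, lg, ← hst] at he
    obtain ⟨hi1, hi2, hi3⟩ := dec i hi
    obtain ⟨hj1, hj2, hj3⟩ := dec j hj
    have hvv : i / dd = j / dd := by
      rcases lt_trichotomy (i / dd) (j / dd) with h | h | h
      · have := headmono (i / dd + 1) (j / dd) h hj1.le
        generalize st (i / dd + 1) / ℓ = x1 at *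
        generalize st (i / dd) / ℓ = x2 at *
        generalize st (j / dd) / ℓ = x3 at *
        generalize i / dd = a at *
        generalize j / dd = b at *
        omega
      · exact h
      · have := headmono (j / dd + 1) (i / dd) h hi1.le
        generalize st (j / dd + 1) / ℓ = x1 at *
        generalize st (i / dd) / ℓ = x2 at *
        generalize st (j / dd) / ℓ = x3 at *
        generalize i / dd = a at *
        generalize j / dd = b at *
        omega
    rw [hvv] at he
    rw [hi3, hj3, hvv]
    congr 1
    exact Nat.add_left_cancel he
  · intro i hi _
    have := (dec i hi).1
    simp only [ev_div, ev_ix, ev_sc, hn DD (by decide), hdd]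
    omega
  · intro τ2 hA2 _ h2
    have hn2 : ∀ a, a ≠ OWN → a ≠ ZB → τ2.nat a = σ.nat a := fun a ha ha' => by
      rw [hA2.n a (by simpa [Prog.wN] using ha), hn a ha']
    refine ⟨by rw [hn2 LG (by decide) (by decide), lg], pos,
      by rw [hn2 NV (by decide) (by decide), hnv], by rw [hn2 ME (by decide) (by decide), me],
      by rw [hA2.n ZB rfl, h1]; simp [lg, me, hnv], by rw [hn2 ST (by decide) (by decide)]; exact mono,
      by rw [hn2 ST (by decide) (by decide)]; exact last, ?_⟩
    rw [hn2 ST (by decide) (by decide), ← hst]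
    intro v hv z hz1 hz2
    obtain ⟨q, rfl⟩ := Nat.exists_eq_add_of_le hz1
    have hq : st v / ℓ + q ≤ st (v + 1) / ℓ := by omega
    have hqd : q < dd := by
      have h3 := deg v hv
      have h5 : st (v + 1) / ℓ ≤ st v / ℓ + (st (v + 1) - st v) := by
        have h6 := mono v hv
        calc st (v + 1) / ℓ ≤ (st v + (st (v + 1) - st v) * ℓ) / ℓ := by
              apply Nat.div_le_div_right
              have := Nat.le_mul_of_pos_right (st (v + 1) - st v) pos
              omega
          _ = _ := Nat.add_mul_div_right _ _ (by omega)
      have h6 := mono v hv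
      generalize st (v + 1) / ℓ = x at *
      generalize st v / ℓ = y at *
      omega
    have h3 := h2.1 (v * dd + q) (mul_add_lt hqd hv)
    simp only [ev_add, ev_div, ev_read, ev_ix, ev_sc, ev_mod, ev_le, hn DD (by decide), ev_ofNat,
      hn ST (by decide), hn LG (by decide), hdd, lg, ← hst, div_mul_add hqd, mod_mul_add hqd, hq,
      if_true, ne_eq, one_ne_zero, not_false_iff, true_implies] at h3
    exact h3
end

/-- The weight matrix of `G` with a source `0` added, from which edges of weight `0` lead to all
other vertices; the vertex `v` of `G` has the number `v + 1`. -/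
noncomputable def wmat {n m : ℕ} (G : WeightedDigraph n m) (u v : ℕ) : WithTop ℝ :=
  open Classical in
  if u = 0 ∧ 1 ≤ v ∧ v ≤ n then 0
  else if h : ∃ e, (G.src e : ℕ) + 1 = u ∧ (G.tgt e : ℕ) + 1 = v then (G.weight h.choose : ℝ)
  else ⊤

section wmat
variable {n m : ℕ} (G : WeightedDigraph n m)

lemma wmat_source {v : ℕ} (h1 : 1 ≤ v) (h2 : v ≤ n) : wmat G 0 v = 0 := by simp [wmat, h1, h2]

lemma wmat_edge (e : Fin m) : wmat G (G.src e + 1) (G.tgt e + 1) = (G.weight e : ℝ) := by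
  have h : ∃ e', (G.src e' : ℕ) + 1 = G.src e + 1 ∧ (G.tgt e' : ℕ) + 1 = G.tgt e + 1 :=
    ⟨e, rfl, rfl⟩
  rw [wmat, if_neg (by simp), dif_pos h]
  have hs := h.choose_spec
  have : h.choose = e := G.simple (by
    simp only [Prod.mk.injEq]; exact ⟨Fin.ext (by omega), Fin.ext (by omega)⟩)
  rw [this]

lemma wmat_cases {u v : ℕ} (h : wmat G u v ≠ ⊤) : (u = 0 ∧ 1 ≤ v ∧ v ≤ n) ∨
    ∃ e, u = G.src e + 1 ∧ v = G.tgt e + 1 := by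
  unfold wmat at h
  split_ifs at h with h1 h2
  · exact Or.inl h1
  · obtain ⟨e, h3, h4⟩ := h2
    exact Or.inr ⟨e, h3.symm, h4.symm⟩
  · exact absurd rfl h
end wmat

/-- The memory holds the sorted list of the finite entries of the weight matrix `w` of a graph with
`N` vertices; the first listed edge into each vertex is a loop of weight `0`, which makes a walk
stay where it is. -/
structure GraphList (w : ℕ → ℕ → WithTop ℝ) (ℓ N M : ℕ) (σ : Mem) : Prop where
  list : EdgeList ℓ N M σ
  lt : ∀ v < N, σ.nat ST v < σ.nat ST (v + 1)
  staySrc : ∀ v < N, σ.nat SRC (σ.nat ST v) = v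
  stayWt : ∀ v < N, σ.real WT (σ.nat ST v) = 0
  edge : ∀ v < N, ∀ r, σ.nat ST v < r → r < σ.nat ST (v + 1) →
    σ.nat SRC r < N ∧ w (σ.nat SRC r) v = σ.real WT r
  exists_edge : ∀ v < N, ∀ u < N, w u v ≠ ⊤ →
    ∃ r, σ.nat ST v < r ∧ r < σ.nat ST (v + 1) ∧ σ.nat SRC r = u
  fin : ∀ r < M, σ.nat WF r ≠ 0
  srcLt : ∀ r < M, σ.nat SRC r < N

lemma GraphList.congr {w : ℕ → ℕ → WithTop ℝ} {ℓ N M : ℕ} {σ τ : Mem} (h : GraphList w ℓ N M σ)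
    (e : ∀ a ∈ [LG, NV, ME, ZB, ST, OWN, SRC, WF], τ.nat a = σ.nat a)
    (e' : τ.real WT = σ.real WT) : GraphList w ℓ N M τ := by
  have hl := h.list.congr (τ := τ) (fun a ha => e a (by
    simp only [List.mem_cons, List.not_mem_nil, or_false] at ha ⊢; tauto))
  simp only [List.mem_cons, List.not_mem_nil, or_false, forall_eq_or_imp, forall_eq] at e
  obtain ⟨-, -, -, -, e5, -, e7, e8⟩ := e
  exact ⟨hl, by rw [e5]; exact h.lt, by rw [e5, e7]; exact h.staySrc,
    by rw [e5, e']; exact h.stayWt, by rw [e5, e7, e']; exact h.edge,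
    by rw [e5, e7]; exact h.exists_edge, by rw [e8]; exact h.fin, by rw [e7]; exact h.srcLt⟩

/-- Fills the adjacency matrix. -/
def matrixP : Prog :=
  .parNat (.read 0 1) 1 MX ((.read 2 ix + 1) * (sc NN + 1) + (.read 1 ix + 2)) (ix + 1) ;;
  .parNat (sc 0) 1 MX ((ix + 1) * (sc NN + 1) + 1) (.read 0 1 + 1) ;;
  .parNat (sc NN + 1) 1 MX (ix * (sc NN + 1) + 0) (.read 0 1 + 1)

/-- Lists the entries of the adjacency matrix row by row. -/
def listP : Prog :=
  setS LEN (sc NN * (sc NN + 1) + 1) ;;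
  .parNat (sc LEN) 1 V ix (.lt 0 (.read MX ix)) ;;
  sumP ;;
  setS ME (.read V 0 - 1) ;;
  setS NV (sc NN) ;;
  .parNat (sc NN + 1) 1 ST ix (.read V 0 - .read V (ix * (sc NN + 1))) ;;
  .parNat (sc LEN) (.read MX ix) SRC (.read V 0 - .read V ix)
    (.eq (ix % (sc NN + 1)) 0 * (ix / (sc NN + 1)) + (ix % (sc NN + 1) - 1)) ;;
  .parReal (sc LEN) (.read MX ix) WT (.read V 0 - .read V ix) (.read 0 (.read MX ix - 1)) ;;
  .parNat (sc ME) 1 WF ix 1 ;;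
  setS DD (sc NN + 2) ;;
  blocksP

/-- The adjacency matrix of `G` with source and with a loop at each of the vertices `0, …, n + 1`,
the last of which serves as a sentinel. -/
structure IsMatrix {n m : ℕ} (G : WeightedDigraph n m) (mx : ℕ → ℕ) : Prop where
  edge : ∀ e : Fin m, mx ((G.tgt e + 1) * (n + 2) + (G.src e + 2)) = e + 1
  source : ∀ i < n, mx ((i + 1) * (n + 2) + 1) = m + 1
  stay : ∀ v ≤ n + 1, mx (v * (n + 2)) = m + 1
  only : ∀ q, mx q ≠ 0 → (∃ e : Fin m, q = (G.tgt e + 1) * (n + 2) + (G.src e + 2)) ∨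
    (∃ i < n, q = (i + 1) * (n + 2) + 1) ∨ ∃ v ≤ n + 1, q = v * (n + 2)

lemma card_edges_le {n m : ℕ} (G : WeightedDigraph n m) : m ≤ n * n := by
  simpa using Fintype.card_le_of_injective _ G.simple

section
variable {W B : ℕ} [hg : Good W B] {σ : Mem}

lemma eq_and_eq_of_mul_add {a b c d k : ℕ} (h : a * k + b = c * k + d) (hb : b < k) (hd : d < k) :
    a = c ∧ b = d := by
  have h1 := div_mul_add (a := a) hb
  have h2 := mod_mul_add (a := a) hb
  rw [h, div_mul_add hd] at h1
  rw [h, mod_mul_add hd] at h2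
  exact ⟨h1.symm, h2.symm⟩

/-- The row of the matrix belongs to the head of an edge, so that reading it row by row sorts the edges
by their heads; the column `0` holds the loops that make walks stay, the column `1` the source. -/
lemma matrixP_spec {n m : ℕ} (G : WeightedDigraph n m) (hNN : σ.nat NN 0 = n + 1)
    (hn : σ.nat 0 0 = n) (hm : σ.nat 0 1 = m) (hs : ∀ e : Fin m, σ.nat 1 e = G.src e)
    (ht : ∀ e : Fin m, σ.nat 2 e = G.tgt e) (h0 : ∀ q, σ.nat MX q = 0)
    (b : m + n + 2 ≤ B) :
    Spec W B matrixP σ (m + 2 * n + 5) 3 (fun τ => IsMatrix G (τ.nat MX)) := by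
  refine Spec.mono (w := (m + 1) + ((n + 1) + ((n + 2) + 1))) (d := 1 + (1 + 1)) ?_ (by omega)
    (by omega) (fun _ _ _ h => h)
  refine Spec.seq (Spec.parN m (by simp [hm]) (by omega) rfl ?_ ?_) fun τ1 hA1 h1 => ?_
  · intro i j hi hj _ _ h
    simp only [ev_add, ev_mul, ev_read, ev_ix, ev_ofNat, ev_sc, hNN, hs ⟨i, hi⟩, ht ⟨i, hi⟩,
      hs ⟨j, hj⟩, ht ⟨j, hj⟩] at h
    have := eq_and_eq_of_mul_add h (by have := (G.src ⟨i, hi⟩).2; omega)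
      (by have := (G.src ⟨j, hj⟩).2; omega)
    have h2 := G.simple (a₁ := ⟨i, hi⟩) (a₂ := ⟨j, hj⟩) (by
      simp only [Prod.mk.injEq]; exact ⟨Fin.ext (by omega), Fin.ext (by omega)⟩)
    simpa using h2
  · intro i hi _; simp only [ev_add, ev_ix, ev_ofNat]; omega
  have e1 : τ1.nat NN 0 = n + 1 := by rw [hA1.n NN rfl, hNN]
  have e2 : τ1.nat 0 0 = n := by rw [hA1.n 0 rfl, hn]
  have e3 : τ1.nat 0 1 = m := by rw [hA1.n 0 rfl, hm]
  refine Spec.seq (Spec.parN n (by simp [e2]) (by omega) rfl ?_ ?_) fun τ2 hA2 h2 => ?_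
  · intro i j hi hj _ _ h
    simp only [ev_add, ev_mul, ev_ix, ev_ofNat, ev_sc, e1] at h
    have := eq_and_eq_of_mul_add h (by omega) (by omega)
    omega
  · intro i hi _; simp only [ev_add, ev_read, ev_ofNat, e3]; omega
  have e4 : τ2.nat NN 0 = n + 1 := by rw [hA2.n NN rfl, e1]
  have e5 : τ2.nat 0 1 = m := by rw [hA2.n 0 rfl, e3]
  refine (Spec.parN (n + 2) (by simp [e4]) (by omega) rfl ?_ ?_).mono le_rfl le_rfl ?_
  · intro i j hi hj _ _ h
    simp only [ev_add, ev_mul, ev_ix, ev_ofNat, ev_sc, e4] at h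
    have := eq_and_eq_of_mul_add h (by omega) (by omega)
    omega
  · intro i hi _; simp only [ev_add, ev_read, ev_ofNat, e5]; omega
  intro τ3 hA3 _ h3
  simp only [ev_add, ev_mul, ev_read, ev_ix, ev_ofNat, ev_sc, hNN, e1, e4, e3, e5, ne_eq,
    one_ne_zero, not_false_iff, true_implies] at h1 h2 h3
  refine ⟨fun e => ?_, fun i hi => ?_, fun v hv => ?_, fun q hq => ?_⟩
  · have he := (G.src e).2
    rw [h3.2 _ (fun i hi h => by
        have := eq_and_eq_of_mul_add h (by omega) (by omega); omega),
      h2.2 _ (fun i hi h => by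
        have := eq_and_eq_of_mul_add h (by omega) (by omega); omega)]
    have := h1.1 e e.2
    rwa [hs, ht] at this
  · rw [h3.2 _ (fun i hi h => by
        have := eq_and_eq_of_mul_add h (by omega) (by omega); omega)]
    exact h2.1 i hi
  · exact h3.1 v (by omega)
  · by_cases c3 : ∃ v ≤ n + 1, q = v * (n + 2)
    · exact Or.inr (Or.inr c3)
    by_cases c2 : ∃ i < n, q = (i + 1) * (n + 2) + 1
    · exact Or.inr (Or.inl c2)
    left
    rw [h3.2 q (fun i hi h => c3 ⟨i, by omega, h.symm⟩),
      h2.2 q (fun i hi h => c2 ⟨i, hi, h.symm⟩)] at hq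
    by_contra hc
    apply hq
    rw [h1.2 q (fun i hi h => hc ⟨⟨i, hi⟩, by rw [← h, hs ⟨i, hi⟩, ht ⟨i, hi⟩]⟩), h0]

/-- The rank of a matrix entry in the list determines its place. -/
lemma graphList_of_ranks {n m ℓ : ℕ} (G : WeightedDigraph n m) {mx : ℕ → ℕ} (hmx : IsMatrix G mx)
    {τ : Mem} {M : ℕ} (rk : ℕ → ℕ) (hrk : ∀ q, rk q = Nat.count (fun j => mx j ≠ 0) q)
    (hL : EdgeList ℓ (n + 1) M τ) (hST : ∀ v ≤ n + 1, τ.nat ST v = rk (v * (n + 2)))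
    (hSRC : ∀ q ≤ (n + 1) * (n + 2), mx q ≠ 0 → τ.nat SRC (rk q) =
      (if q % (n + 2) = 0 then 1 else 0) * (q / (n + 2)) + (q % (n + 2) - 1))
    (hWT : ∀ q ≤ (n + 1) * (n + 2), mx q ≠ 0 → τ.real WT (rk q) =
      if h : mx q - 1 < m then G.weight ⟨mx q - 1, h⟩ else 0)
    (hWF : ∀ r < M, τ.nat WF r ≠ 0) : GraphList (wmat G) ℓ (n + 1) M τ := by
  have mono : ∀ a b, a ≤ b → rk a ≤ rk b := fun a b h => by
    rw [hrk, hrk]; exact Nat.count_monotone _ h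
  have smono : ∀ a b, mx a ≠ 0 → a < b → rk a < rk b := fun a b h h' => by
    rw [hrk, hrk]; exact Nat.count_strict_mono h h'
  have hM : rk ((n + 1) * (n + 2)) = M := by rw [← hL.last, hST _ le_rfl]
  have row : ∀ v < n + 1, ∀ c < n + 2, v * (n + 2) + c < (n + 1) * (n + 2) := fun v hv c hc =>
    mul_add_lt hc hv
  have stay : ∀ v ≤ n + 1, mx (v * (n + 2)) ≠ 0 := fun v hv => by rw [hmx.stay v hv]; omega
  have find : ∀ v < n + 1, ∀ r, τ.nat ST v < r → r < τ.nat ST (v + 1) →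
      ∃ c, 0 < c ∧ c < n + 2 ∧ mx (v * (n + 2) + c) ≠ 0 ∧ rk (v * (n + 2) + c) = r := by
    intro v hv r h1 h2
    rw [hST v hv.le] at h1
    rw [hST (v + 1) (by omega), hrk] at h2
    obtain ⟨q, hq, hp, hr⟩ := exists_of_lt_count _ h2
    rw [← hrk] at hr
    have hlt : v * (n + 2) < q := by
      by_contra h
      have := mono q _ (not_lt.1 h); omega
    rw [Nat.succ_mul] at hq
    exact ⟨q - v * (n + 2), by omega, by omega, by rwa [Nat.add_sub_cancel' hlt.le],
      by rwa [Nat.add_sub_cancel' hlt.le]⟩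
  have entry : ∀ v < n + 1, ∀ c, 0 < c → c < n + 2 → mx (v * (n + 2) + c) ≠ 0 →
      τ.nat SRC (rk (v * (n + 2) + c)) = c - 1 ∧
        wmat G (c - 1) v = τ.real WT (rk (v * (n + 2) + c)) := by
    intro v hv c hc hc' hp
    have hle := (row v hv c hc').le
    refine ⟨by rw [hSRC _ hle hp, mod_mul_add hc', if_neg (by omega)]; omega, ?_⟩
    rw [hWT _ hle hp]
    rcases hmx.only _ hp with ⟨e, he⟩ | ⟨i, hi, he⟩ | ⟨u, hu, he⟩
    · have hmxe := hmx.edge e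
      rw [← he] at hmxe
      obtain ⟨h1, h2⟩ := eq_and_eq_of_mul_add he hc' (by have := (G.src e).2; omega)
      rw [hmxe, Nat.add_sub_cancel, dif_pos e.2, h1, h2]
      exact wmat_edge G e
    · have hmxe := hmx.source i hi
      rw [← he] at hmxe
      obtain ⟨h1, h2⟩ := eq_and_eq_of_mul_add he hc' (by omega)
      rw [hmxe, Nat.add_sub_cancel, dif_neg (lt_irrefl _), h1, h2]
      exact_mod_cast wmat_source G (by omega) (by omega)
    · obtain ⟨h1, h2⟩ := eq_and_eq_of_mul_add (d := 0) (by rw [add_zero]; exact he) hc' (by omega)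
      omega
  refine ⟨hL, fun v hv => ?_, fun v hv => ?_, fun v hv => ?_, fun v hv r h1 h2 => ?_,
    fun v hv u hu hw => ?_, hWF, fun r hr => ?_⟩
  · rw [hST v hv.le, hST (v + 1) (by omega)]
    exact smono _ _ (stay v hv.le) (Nat.mul_lt_mul_of_pos_right (by omega) (by omega))
  · rw [hST v hv.le, hSRC _ (by have := row v hv 0 (by omega); omega) (stay v hv.le)]
    simp
  · rw [hST v hv.le, hWT _ (by have := row v hv 0 (by omega); omega) (stay v hv.le),
      hmx.stay v hv.le, Nat.add_sub_cancel, dif_neg (lt_irrefl _)]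
  · obtain ⟨c, hc1, hc2, hc3, rfl⟩ := find v hv r h1 h2
    obtain ⟨h3, h4⟩ := entry v hv c hc1 hc2 hc3
    rw [h3]
    exact ⟨by omega, h4⟩
  · have hp : mx (v * (n + 2) + (u + 1)) ≠ 0 := by
      rcases wmat_cases G hw with ⟨rfl, h1, h2⟩ | ⟨e, rfl, rfl⟩
      · obtain ⟨v, rfl⟩ : ∃ v', v = v' + 1 := ⟨v - 1, by omega⟩
        have := hmx.source v (by omega)
        simpa using this ▸ Nat.succ_ne_zero m
      · have := hmx.edge e
        rw [add_assoc, this]; omega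
    refine ⟨rk (v * (n + 2) + (u + 1)), ?_, ?_, ?_⟩
    · rw [hST v hv.le]; exact smono _ _ (stay v hv.le) (by omega)
    · rw [hST (v + 1) (by omega), Nat.succ_mul]; exact smono _ _ hp (by omega)
    · rw [(entry v hv (u + 1) (by omega) (by omega) hp).1]; omega
  · rw [← hM, hrk] at hr
    obtain ⟨q, hq, hp, hr⟩ := exists_of_lt_count _ hr
    rw [← hrk] at hr
    rw [← hr, hSRC q hq.le hp]
    have h1 : q % (n + 2) < n + 2 := Nat.mod_lt _ (by omega)
    have h2 : q / (n + 2) < n + 1 := Nat.div_lt_of_lt_mul (by rwa [mul_comm])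
    split_ifs with h
    · omega
    · omega

lemma card_entries_le {n m : ℕ} (G : WeightedDigraph n m) {mx : ℕ → ℕ} (hmx : IsMatrix G mx)
    (q : ℕ) : Nat.count (fun j => mx j ≠ 0) q ≤ m + 2 * n + 2 := by
  rw [Nat.count_eq_card_filter_range]
  have hsub : ({j ∈ range q | mx j ≠ 0} : Finset ℕ) ⊆
      (univ.image fun e : Fin m => (G.tgt e + 1 : ℕ) * (n + 2) + (G.src e + 2)) ∪
      ((range n).image fun i => (i + 1) * (n + 2) + 1) ∪
      ((range (n + 2)).image fun v => v * (n + 2)) := by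
    intro j hj
    simp only [mem_filter] at hj
    simp only [mem_union, mem_image, mem_univ, true_and, mem_range]
    rcases hmx.only j hj.2 with ⟨e, he⟩ | ⟨i, hi, he⟩ | ⟨v, hv, he⟩
    · exact Or.inl (Or.inl ⟨e, he.symm⟩)
    · exact Or.inl (Or.inr ⟨i, hi, he.symm⟩)
    · exact Or.inr ⟨v, by omega, he.symm⟩
  refine (card_le_card hsub).trans ?_
  refine (card_union_le _ _).trans ?_
  have h1 := card_union_le (univ.image fun e : Fin m => (G.tgt e + 1 : ℕ) * (n + 2) + (G.src e + 2))
    ((range n).image fun i => (i + 1) * (n + 2) + 1)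
  have h2 := card_image_le (s := (univ : Finset (Fin m)))
    (f := fun e : Fin m => (G.tgt e + 1 : ℕ) * (n + 2) + (G.src e + 2))
  have h3 := card_image_le (s := range n) (f := fun i => (i + 1) * (n + 2) + 1)
  have h4 := card_image_le (s := range (n + 2)) (f := fun v => v * (n + 2))
  simp only [card_univ, Fintype.card_fin, card_range] at h2 h3 h4
  omega
end

end Par

namespace Par
open Finset

section
variable {W B : ℕ} [hg : Good W B] {σ : Mem}

/-- The suffix sums of the indicator of the nonzero entries give each entry its place in the list. -/
lemma listP_spec {n m ℓ T len : ℕ} (G : WeightedDigraph n m) (hNN : σ.nat NN 0 = n + 1)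
    (hlg : σ.nat LG 0 = ℓ) (pos : 1 ≤ ℓ) (hmx : IsMatrix G (σ.nat MX))
    (hw : ∀ p, σ.real 0 p = if h : p < m then G.weight ⟨p, h⟩ else 0)
    (hlen : len = (n + 1) * (n + 2) + 1) (hT : len ≤ 2 ^ T) (b : 4 * len + m + 2 * n + 10 ≤ B) :
    Spec W B listP σ (T * (len + 4) + 10 * len + 30) (T * 3 + 20) (fun τ =>
      ∃ M ≤ m + 2 * n + 1, GraphList (wmat G) ℓ (n + 1) M τ ∧ τ.nat DD 0 = n + 3) := by
  set mx := σ.nat MX with hmxdef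
  set f : ℕ → ℕ := fun j => if mx j ≠ 0 then 1 else 0 with hf
  set rk : ℕ → ℕ := fun q => Nat.count (fun j => mx j ≠ 0) q with hrk
  have hrkle : ∀ q, rk q ≤ m + 2 * n + 2 := fun q => card_entries_le G hmx q
  set M := rk ((n + 1) * (n + 2)) with hM
  have hlast : mx ((n + 1) * (n + 2)) ≠ 0 := by rw [hmx.stay (n + 1) le_rfl]; omega
  have hlenrk : rk len = M + 1 := by
    rw [hlen, hrk]
    show Nat.count _ _ = _
    rw [Nat.count_succ, if_pos hlast]
  have hM1 : M ≤ m + 2 * n + 1 := by have := hrkle len; omega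
  have hle1 : ∀ j, f j ≤ 1 := fun j => by simp only [hf]; split_ifs <;> omega
  have hMlen : M ≤ len := by
    have h : rk len ≤ len := Nat.count_le _
    omega
  have hprod : (n + 1) * (n + 3) ≤ 2 * len := by rw [hlen]; nlinarith
  have hnlen : n + 2 ≤ len := by rw [hlen]; nlinarith
  refine Spec.mono (w := 2 + ((len + 1) + ((T * (len + 4) + 3) + (2 + (2 + ((n + 2 + 1) +
    ((len + 1) + ((len + 1) + ((M + 1) + (2 + ((n + 1) * (n + 3) + 3)))))))))))
    (d := 1 + (1 + ((T * 3 + 2) + (1 + (1 + (1 + (1 + (1 + (1 + (1 + 2)))))))))) ?_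
    (by omega) (by omega) (fun _ _ _ h => h)
  refine Spec.seq (Spec.setS rfl (by simp only [ev_add, ev_mul, ev_sc, hNN, ev_ofNat]; show (n + 1) * (n + 2) + 1 ≤ B; omega))
    fun τ1 hA1 h1 => ?_
  have c1 : τ1.nat LEN 0 = len := by rw [h1, hlen]; simp [hNN]
  have c2 : τ1.nat MX = mx := hA1.n MX rfl
  refine Spec.seq (Spec.parNi len (by simp [c1]) (by omega) rfl ?_) fun τ2 hA2 h2 => ?_
  · intro i _ _; simp only [ev_lt]; split_ifs <;> omega
  have c3 : ∀ i < len, τ2.nat V i = f i := fun i hi => by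
    rw [h2, if_pos ⟨hi, by simp⟩]
    simp only [ev_lt, ev_ofNat, ev_read, ev_ix, c2, hf, Nat.pos_iff_ne_zero]
  refine Spec.seq (sumP_spec f (by rw [hA2.n LEN rfl, c1]) hT (by omega) c3 ?_) fun τ3 hA3 h3 => ?_
  · calc ∑ j ∈ range len, f j ≤ ∑ j ∈ range len, 1 := sum_le_sum fun j _ => hle1 j
      _ ≤ B := by simp; omega
  have hn3 : ∀ a, a ≠ LEN → a ≠ V → a ≠ PV → τ3.nat a = σ.nat a := fun a ha hb hc => by
    rw [hA3.n a (by simp [sumP, setS, Prog.wN, hb, hc]), hA2.n a (by simp [Prog.wN, hb]),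
      hA1.n a (by simp [setS, Prog.wN, ha])]
  have hV0 : τ3.nat V 0 = M + 1 := by
    have e := count_suffix (fun j => mx j ≠ 0) (le_refl len)
    rw [Ico_self, sum_empty, Nat.sub_zero] at e
    rw [h3 0 (by omega)]
    exact e.trans hlenrk
  have hVrk : ∀ q < len, τ3.nat V 0 - τ3.nat V q = rk q := fun q hq => by
    rw [h3 0 (by omega), h3 q hq]
    exact count_suffix (fun j => mx j ≠ 0) hq.le
  refine Spec.seq (Spec.setS rfl (by simp only [ev_sub, ev_read, ev_ofNat, hV0]; omega))
    fun τ4 hA4 h4 => ?_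
  refine Spec.seq (Spec.setS rfl (by
    simp only [ev_sc, hA4.n NN rfl, hn3 NN (by decide) (by decide) (by decide), hNN]; omega))
    fun τ5 hA5 h5 => ?_
  have n5 : ∀ a, a ≠ ME → a ≠ NV → τ5.nat a = τ3.nat a := fun a ha hb => by
    rw [hA5.n a (by simp [setS, Prog.wN, hb]), hA4.n a (by simp [setS, Prog.wN, ha])]
  have nn5 : τ5.nat NN 0 = n + 1 := by
    rw [n5 NN (by decide) (by decide), hn3 NN (by decide) (by decide) (by decide), hNN]
  have v5 := n5 V (by decide) (by decide)
  have rowlt : ∀ v < n + 2, v * (n + 2) < len := fun v hv => by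
    rw [hlen]
    exact Nat.lt_succ_of_le (Nat.mul_le_mul_right _ (by omega))
  refine Spec.seq (Spec.parNi (n + 2) (by simp [nn5]) (by omega) rfl ?_) fun τ6 hA6 h6 => ?_
  · intro i hi _
    simp only [ev_sub, ev_read, ev_ofNat, ev_mul, ev_ix, ev_add, ev_sc, nn5, v5]
    rw [hV0]; omega
  have n6 : ∀ a, a ≠ ME → a ≠ NV → a ≠ ST → τ6.nat a = τ3.nat a := fun a ha hb hc => by
    rw [hA6.n a (by simp [Prog.wN, hc]), n5 a ha hb]
  have nn6 : τ6.nat NN 0 = n + 1 := by rw [hA6.n NN rfl, nn5]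
  have v6 := n6 V (by decide) (by decide) (by decide)
  have mx6 : τ6.nat MX = mx := by
    rw [n6 MX (by decide) (by decide) (by decide), hn3 MX (by decide) (by decide) (by decide)]
  have len6 : τ6.nat LEN 0 = len := by
    rw [n6 LEN (by decide) (by decide) (by decide), hA3.n LEN rfl, hA2.n LEN rfl, c1]
  have inj : ∀ i j, i < len → j < len → mx i ≠ 0 → mx j ≠ 0 → rk i = rk j → i = j :=
    fun i j _ _ hi hj h => Nat.count_injective (p := fun j => mx j ≠ 0) hi hj h
  refine Spec.seq (Spec.parN len (by simp [len6]) (by omega) rfl ?_ ?_) fun τ7 hA7 h7 => ?_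
  · intro i j hi hj hgi hgj h
    simp only [ev_read, ev_ix, mx6] at hgi hgj
    simp only [ev_sub, ev_read, ev_ofNat, ev_ix, v6, hVrk i hi, hVrk j hj] at h
    exact inj i j hi hj hgi hgj h
  · intro i hi _
    simp only [ev_add, ev_mul, ev_eq, ev_mod, ev_ix, ev_sc, nn6, ev_ofNat, ev_div, ev_sub]
    have := Nat.div_le_self i (n + 1 + 1)
    have := Nat.mod_le i (n + 1 + 1)
    split_ifs <;> omega
  refine Spec.seq (Spec.parR len (by simp [hA7.n LEN rfl, len6]) (by omega) rfl ?_)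
    fun τ8 hA8 h8 => ?_
  · intro i j hi hj hgi hgj h
    simp only [ev_read, ev_ix, hA7.n MX rfl, mx6] at hgi hgj
    simp only [ev_sub, ev_read, ev_ofNat, ev_ix, hA7.n V rfl, v6, hVrk i hi, hVrk j hj] at h
    exact inj i j hi hj hgi hgj h
  have me8 : τ8.nat ME 0 = M := by
    rw [hA8.n ME rfl, hA7.n ME rfl, hA6.n ME rfl, hA5.n ME rfl, h4]
    simp [hV0]
  refine Spec.seq (Spec.parNi M (by simp [me8]) (by omega) rfl (by simp; omega))
    fun τ9 hA9 h9 => ?_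
  have nn9 : τ9.nat NN 0 = n + 1 := by rw [hA9.n NN rfl, hA8.n NN rfl, hA7.n NN rfl, nn6]
  refine Spec.seq (Spec.setS rfl (by simp only [ev_add, ev_sc, nn9, ev_ofNat]; omega))
    fun τ10 hA10 h10 => ?_
  have n10 : ∀ a, a ≠ SRC → a ≠ WF → a ≠ DD → τ10.nat a = τ6.nat a := fun a ha hb hc => by
    rw [hA10.n a (by simp [setS, Prog.wN, hc]), hA9.n a (by simp [Prog.wN, hb]), hA8.n a rfl,
      hA7.n a (by simp [Prog.wN, ha])]
  have dd10 : τ10.nat DD 0 = n + 3 := by rw [h10]; simp [nn9]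
  have st10 : ∀ v ≤ n + 1, τ10.nat ST v = rk (v * (n + 2)) := fun v hv => by
    rw [n10 ST (by decide) (by decide) (by decide), h6, if_pos ⟨by omega, by simp⟩]
    simp only [ev_sub, ev_read, ev_ofNat, ev_mul, ev_ix, ev_add, ev_sc, nn5, v5]
    exact hVrk _ (rowlt v (by omega))
  have rkstep : ∀ v < n + 1, rk (v * (n + 2)) ≤ rk ((v + 1) * (n + 2)) ∧
      rk ((v + 1) * (n + 2)) ≤ rk (v * (n + 2)) + (n + 2) := fun v hv => by
    constructor
    · exact Nat.count_monotone _ (Nat.mul_le_mul_right _ (by omega))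
    · simp only [hrk]
      rw [Nat.succ_mul, Nat.count_add]
      have : Nat.count (fun k => mx (v * (n + 2) + k) ≠ 0) (n + 2) ≤ n + 2 := Nat.count_le _
      omega
  refine (blocksP_spec (ℓ := ℓ) (nv := n + 1) (M := M) (dd := n + 3) ?_ pos ?_ ?_ dd10 ?_ ?_ ?_
    (by omega) (by omega)).mono le_rfl le_rfl ?_
  · rw [n10 LG (by decide) (by decide) (by decide), n6 LG (by decide) (by decide) (by decide),
      hn3 LG (by decide) (by decide) (by decide), hlg]
  · rw [n10 NV (by decide) (by decide) (by decide), hA6.n NV rfl, h5]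
    simp [hA4.n NN rfl, hn3 NN (by decide) (by decide) (by decide), hNN]
  · rw [n10 ME (by decide) (by decide) (by decide), ← me8, hA8.n ME rfl, hA7.n ME rfl]
  · intro v hv
    rw [st10 v (by omega), st10 (v + 1) (by omega)]
    exact (rkstep v hv).1
  · rw [st10 _ le_rfl]
  · intro v hv
    rw [st10 v (by omega), st10 (v + 1) (by omega)]
    have := (rkstep v hv).2
    omega
  · intro τ hA _ hL
    refine ⟨M, hM1, graphList_of_ranks G hmx rk (fun q => rfl) hL ?_ ?_ ?_ ?_, ?_⟩
    · intro v hv; rw [hA.n ST rfl, st10 v hv]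
    · intro q hq hp
      have := h7.1 q (by omega) (by simpa only [ev_read, ev_ix, mx6] using hp)
      simp only [ev_add, ev_mul, ev_eq, ev_mod, ev_ix, ev_sc, nn6, ev_ofNat, ev_div, ev_sub,
        ev_read, v6, hVrk q (by omega)] at this
      rw [hA.n SRC rfl, hA10.n SRC rfl, hA9.n SRC rfl, hA8.n SRC rfl, this]
    · intro q hq hp
      have := h8.1 q (by omega) (by simpa only [ev_read, ev_ix, hA7.n MX rfl, mx6] using hp)
      simp only [ev_ix, ev_ofNat, ev_sub, rev_read, hA7.n MX rfl, mx6,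
        ev_read, hA7.n V rfl, v6, hVrk q (by omega)] at this
      rw [hA.r WT rfl, hA10.r WT rfl, hA9.r WT rfl, this, ← hw]
      rw [hA7.r 0 rfl, hA6.r 0 rfl, hA5.r 0 rfl, hA4.r 0 rfl, hA3.r 0 rfl, hA2.r 0 rfl, hA1.r 0 rfl]
    · intro r hr
      rw [hA.n WF rfl, hA10.n WF rfl, h9, if_pos ⟨hr, by simp⟩]
      simp
    · rw [hA.n DD rfl, dd10]
end

/-- Computes the number of vertices and its rounded logarithm. -/
def logP : Prog :=
  setS NN (sc 0 + 1) ;; setS LG 0 ;; setS EE 1 ;;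
  .loop (.lt (sc EE) (sc NN)) (setS EE (2 * sc EE) ;; setS LG (sc LG + 1))

section
variable {W B : ℕ} [hg : Good W B] {σ : Mem}

lemma logP_spec {n : ℕ} (hn : σ.nat 0 0 = n) (b : 2 * (n + 1) ≤ B) :
    Spec W B logP σ (Nat.clog 2 (n + 1) * 5 + 7) (Nat.clog 2 (n + 1) * 3 + 4) (fun τ =>
      τ.nat NN 0 = n + 1 ∧ τ.nat LG 0 = Nat.clog 2 (n + 1) ∧
      τ.nat EE 0 = 2 ^ Nat.clog 2 (n + 1)) := by
  have h100 := Good.hundred_le_bound W B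
  set L := Nat.clog 2 (n + 1) with hL
  refine Spec.mono (w := 2 + (2 + (2 + (L * ((2 + 2) + 1) + 1))))
    (d := 1 + (1 + (1 + (L * ((1 + 1) + 1) + 1)))) ?_ (by omega) (by omega)
    (fun _ _ _ h => h)
  refine Spec.seq (Spec.setS rfl (by simp only [ev_add, ev_sc, hn, ev_ofNat]; omega))
    fun τ1 hA1 h1 => ?_
  refine Spec.seq (Spec.setS rfl (by rw [ev_ofNat]; omega)) fun τ2 hA2 h2 => ?_
  refine Spec.seq (Spec.setS rfl (by rw [ev_ofNat]; omega)) fun τ3 hA3 h3 => ?_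
  have nn : τ3.nat NN 0 = n + 1 := by rw [hA3.n NN rfl, hA2.n NN rfl, h1]; simp [hn]
  refine (Spec.loop_const L (fun t τ => τ.nat EE 0 = 2 ^ t ∧ τ.nat LG 0 = t) rfl ?_ ?_ ?_).mono
    le_rfl le_rfl ?_
  · exact ⟨by rw [h3]; simp, by rw [hA3.n LG rfl, h2]; simp⟩
  · intro t ht τ hA ⟨he, hl⟩
    have hlt : 2 ^ t < n + 1 := (Nat.lt_clog_iff_pow_lt (by norm_num)).1 ht
    have htt : t < 2 ^ t := Nat.lt_two_pow_self
    refine ⟨by simp [hA.n NN rfl, nn, he]; omega, ?_⟩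
    refine Spec.seq (w := 2) (w' := 2) (d := 1) (d' := 1) (Spec.setS rfl (by
      simp only [ev_mul, ev_sc, ev_ofNat, he]; omega)) fun τ' hA' h' => ?_
    refine (Spec.setS rfl (by simp only [ev_add, ev_sc, ev_ofNat, hA'.n LG rfl, hl]; omega)).mono
      le_rfl le_rfl ?_
    intro τ'' hA'' _ h''
    refine ⟨by rw [hA''.n EE rfl, h']; simp [he, pow_succ]; ring, by
      rw [h'']; simp [hA'.n LG rfl, hl]⟩
  · intro τ hA ⟨he, _⟩
    have := Nat.le_pow_clog (b := 2) (by norm_num) (n + 1)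
    rw [← hL] at this
    simp [hA.n NN rfl, nn, he]; omega
  · intro τ hA _ ⟨he, hl⟩
    exact ⟨by rw [hA.n NN rfl, nn], hl, he⟩
end

end Par

/-! ### Distances from the hubs layer by layer, and shortest walks between hubs -/

namespace Par
open Finset

/-- scalar: the hub distance -/
def HH : ℕ := 6
/-- scalar: number of hubs -/
def BB : ℕ := 7
/-- scalar: loop variable over the layers -/
def KK : ℕ := 23
/-- scalar: number of layers -/
def LL : ℕ := 24
/-- parents of all layers -/
def PF : ℕ := 25
/-- list of the hubs -/
def HB : ℕ := 26
/-- current vertices of the backtracked walks -/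
def CUR : ℕ := 27
/-- the backtracked walks -/
def PT : ℕ := 28
/-- truth values: walks that are still to be hit -/
def AL : ℕ := 29

/-- An extended real number, stored as a finiteness flag and a real word. -/
noncomputable def extVal (f : ℕ → ℕ) (r : ℕ → ℝ) (p : ℕ) : WithTop ℝ :=
  if f p ≠ 0 then (r p : WithTop ℝ) else ⊤

/-- `a` encodes the parent of `v` in layer `k + 1` of the distances from `u`: it is `0` if `v` is
not reached, and otherwise the parent plus one. The parent is `v` itself unless `v` gets closer in
this layer. -/
def IsParent (N : ℕ) (w : ℕ → ℕ → WithTop ℝ) (k u v a : ℕ) : Prop :=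
  (a = 0 ∧ hopDist N w (k + 1) u v = ⊤) ∨ ∃ x < N, a = x + 1 ∧ hopDist N w (k + 1) u v ≠ ⊤ ∧
    ((x = v ∧ hopDist N w (k + 1) u v = hopDist N w k u v) ∨
      (hopDist N w (k + 1) u v < hopDist N w k u v ∧
        hopDist N w (k + 1) u v = hopDist N w k u x + w x v))

section pure
variable {N : ℕ} {w : ℕ → ℕ → WithTop ℝ}
local notation "D" => hopDist N w

/-- Relaxing all edges leads from one layer to the next. -/
lemma GraphList.relax {ℓ M k u b v a : ℕ} {σ : Mem} (hG : GraphList w ℓ N M σ)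
    (hval : ∀ x < N, extVal (σ.nat CP) (σ.real CR) (b * N + x) = D k u x) (hv : v < N)
    (h : IsLMin (edgeVal σ N b) (σ.nat ST v) (σ.nat ST (v + 1)) a) :
    IsParent N w k u v (if a = 0 then 0 else σ.nat SRC (a - 1) + 1) ∧
    (a ≠ 0 → edgeVal σ N b (a - 1) = D (k + 1) u v) := by
  have hlt := hG.lt v hv
  have hM : σ.nat ST (v + 1) ≤ M := hG.list.le hv
  have val : ∀ r < M, edgeVal σ N b r = D k u (σ.nat SRC r) + (σ.real WT r : WithTop ℝ) := by
    intro r hr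
    rw [← hval _ (hG.srcLt r hr), edgeVal, extVal]
    by_cases h : σ.nat CP (b * N + σ.nat SRC r) = 0
    · rw [if_neg (by tauto), if_neg (by tauto), top_add]
    · rw [if_pos ⟨hG.fin r hr, h⟩, if_pos h]; norm_cast
  have stay : edgeVal σ N b (σ.nat ST v) = D k u v := by
    rw [val _ (by omega), hG.staySrc v hv, hG.stayWt v hv]
    simp
  have edge : ∀ r, σ.nat ST v < r → r < σ.nat ST (v + 1) →
      edgeVal σ N b r = D k u (σ.nat SRC r) + w (σ.nat SRC r) v := fun r h1 h2 => by
    rw [val _ (by omega), (hG.edge v hv r h1 h2).2]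
  have ge : ∀ r, σ.nat ST v ≤ r → r < σ.nat ST (v + 1) → D (k + 1) u v ≤ edgeVal σ N b r := by
    intro r h1 h2
    rcases h1.eq_or_lt with h1 | h1
    · rw [← h1, stay]; exact hopDist_succ_le _ _ _
    · rw [edge r h1 h2]; exact hopDist_succ_le_edge (hG.edge v hv r h1 h2).1 _ _ _
  have le : ∀ c, (∀ r, σ.nat ST v ≤ r → r < σ.nat ST (v + 1) → c ≤ edgeVal σ N b r) →
      c ≤ D (k + 1) u v := by
    intro c hc
    refine le_hopDist_succ (stay ▸ hc _ le_rfl hlt) fun x hx => ?_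
    by_cases hw : w x v = ⊤
    · rw [hw, add_top]; exact le_top
    · obtain ⟨r, h1, h2, h3⟩ := hG.exists_edge v hv x hx hw
      have := hc r h1.le h2
      rwa [edge r h1 h2, h3] at this
  rcases h with ⟨rfl, h⟩ | ⟨r, rfl, h1, h2, h3, h4, h5⟩
  · refine ⟨Or.inl ⟨rfl, top_le_iff.1 (le _ fun r h1 h2 => (h r h1 h2).ge)⟩, fun h => absurd rfl h⟩
  · have heq : edgeVal σ N b r = D (k + 1) u v := le_antisymm (le _ h4) (ge r h1 h2)
    simp only [Nat.add_sub_cancel, Nat.add_eq_zero_iff, one_ne_zero, and_false, if_false]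
    refine ⟨Or.inr ⟨_, hG.srcLt r (by omega), rfl, heq ▸ h3, ?_⟩, fun _ => heq⟩
    rcases h1.eq_or_lt with h1 | h1
    · left
      rw [← h1, hG.staySrc v hv]
      exact ⟨rfl, by rw [← heq, ← h1, stay]⟩
    · right
      exact ⟨by rw [← heq, ← stay]; exact h5 _ le_rfl h1, by rw [← heq, edge r h1 h2]⟩

/-- A walk `y 0, …, y L` from `u` obtained by following the parents through all layers. -/
structure IsPath (N : ℕ) (w : ℕ → ℕ → WithTop ℝ) (u L : ℕ) (y : ℕ → ℕ) : Prop where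
  start : y 0 = u
  lt : ∀ k ≤ L, y k < N
  step : ∀ k < L, (y k = y (k + 1) ∧
      hopDist N w (k + 1) u (y (k + 1)) = hopDist N w k u (y (k + 1))) ∨
    (hopDist N w (k + 1) u (y (k + 1)) < hopDist N w k u (y (k + 1)) ∧
      hopDist N w (k + 1) u (y (k + 1)) = hopDist N w k u (y k) + w (y k) (y (k + 1)))

/-- Parents pointers lead back to `u` from every vertex at finite distance. -/
lemma isPath_of_parents {u L : ℕ} {y : ℕ → ℕ} (hlt : y L < N) (hfin : D L u (y L) ≠ ⊤)
    (hpar : ∀ k < L, ∃ a, (y (k + 1) < N → IsParent N w k u (y (k + 1)) a) ∧ y k = a - 1) :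
    IsPath N w u L y := by
  have key : ∀ k ≤ L, y (L - k) < N ∧ D (L - k) u (y (L - k)) ≠ ⊤ := by
    intro k
    induction k with
    | zero => exact fun _ => ⟨hlt, hfin⟩
    | succ k ih =>
      intro hk
      obtain ⟨h1, h2⟩ := ih (by omega)
      obtain ⟨a, h3, h4⟩ := hpar (L - (k + 1)) (by omega)
      rw [show L - (k + 1) + 1 = L - k by omega] at h3
      have h3 := h3 h1
      have e : L - (k + 1) + 1 = L - k := by omega
      rcases h3 with ⟨-, h⟩ | ⟨x, hx, rfl, -, h⟩
      · rw [e] at h; exact absurd h h2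
      · rw [e] at h
        rw [h4, Nat.add_sub_cancel]
        refine ⟨hx, fun htop => h2 ?_⟩
        rcases h with ⟨rfl, h⟩ | ⟨-, h⟩
        · rw [h, htop]
        · rw [h, htop, top_add]
  have key' : ∀ k ≤ L, y k < N ∧ D k u (y k) ≠ ⊤ := fun k hk => by
    have := key (L - k) (by omega)
    rwa [show L - (L - k) = k by omega] at this
  refine ⟨?_, fun k hk => (key' k hk).1, fun k hk => ?_⟩
  · by_contra h
    refine (key' 0 (by omega)).2 ?_
    simp only [hopDist]
    rw [if_neg fun h' => h h'.symm]
  · obtain ⟨a, h3, h4⟩ := hpar k hk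
    rcases h3 (key' (k + 1) hk).1 with ⟨-, h⟩ | ⟨x, hx, rfl, -, h⟩
    · exact absurd h (key' (k + 1) hk).2
    · rw [Nat.add_sub_cancel] at h4; rw [h4]; exact h

/-- If a walk makes a real step from position `k - 1` to `k`, it has been moving all the time. -/
lemma IsPath.strictWalk {u L : ℕ} {y : ℕ → ℕ} (h : IsPath N w u L y) {k : ℕ} (hk : k ≤ L)
    (hlast : ∀ j, k = j + 1 → D (j + 1) u (y (j + 1)) < D j u (y (j + 1))) :
    StrictWalk N w u k y := by
  have key : ∀ i < k, D (k - i) u (y (k - i)) < D (k - i - 1) u (y (k - i)) := by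
    intro i
    induction i with
    | zero =>
      intro hi
      have := hlast (k - 1) (by omega)
      rwa [show k - 1 + 1 = k by omega] at this
    | succ i ih =>
      intro hi
      have h1 := ih (by omega)
      obtain ⟨j, hj⟩ : ∃ j, k - (i + 1) = j + 1 := ⟨k - (i + 1) - 1, by omega⟩
      rw [show k - i = j + 2 by omega] at h1
      rw [hj]
      simp only [Nat.add_sub_cancel, show j + 2 - 1 = j + 1 by omega] at h1 ⊢
      rcases h.step (j + 1) (by omega) with ⟨-, h2⟩ | ⟨-, h2⟩
      · exact absurd h2 h1.ne
      · rcases h.step j (by omega) with ⟨-, h3⟩ | ⟨h3, -⟩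
        · refine absurd (h2 ▸ h1) (not_lt.2 ?_)
          rw [h3]
          exact hopDist_succ_le_edge (h.lt _ (by omega)) _ _ _
        · exact h3
  have key' : ∀ i < k, D (i + 1) u (y (i + 1)) < D i u (y (i + 1)) := fun i hi => by
    have := key (k - (i + 1)) (by omega)
    rwa [show k - (k - (i + 1)) = i + 1 by omega, Nat.add_sub_cancel] at this
  refine ⟨h.start, fun i hi => h.lt i (by omega), fun i hi => ?_, key'⟩
  rcases h.step i (by omega) with ⟨-, h2⟩ | ⟨-, h2⟩
  · exact absurd h2 (key' i hi).ne
  · exact h2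

/-- The walk arrives after the least number of edges of a shortest walk, and stays there. -/
lemma IsPath.arrive (hnn : NoNeg N w) {u L : ℕ} {y : ℕ → ℕ} (h : IsPath N w u L y) {k : ℕ}
    (hk : k ≤ L) (hop : IsHop N w u (y L) k) : y k = y L ∧ StrictWalk N w u k y := by
  have hu : u < N := h.start ▸ h.lt 0 (by omega)
  have hconst : ∀ j, k ≤ j → D j u (y L) = D N u (y L) := fun j hj =>
    le_antisymm ((hopDist_anti hj u (y L)).trans hop.eq.le) (hnn.stable hu (h.lt L le_rfl))
  have key : ∀ i, k + i ≤ L → y (L - i) = y L := by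
    intro i
    induction i with
    | zero => intro _; rfl
    | succ i ih =>
      intro hi
      have h1 := ih (by omega)
      have h2 := h.step (L - (i + 1)) (by omega)
      rw [show L - (i + 1) + 1 = L - i by omega, h1, hconst (L - i) (by omega),
        hconst (L - (i + 1)) (by omega)] at h2
      rcases h2 with ⟨h2, -⟩ | ⟨h2, -⟩
      · exact h2
      · exact absurd h2 (lt_irrefl _)
  have hyk : y k = y L := by
    have := key (L - k) (by omega)
    rwa [show L - (L - k) = k by omega] at this
  refine ⟨hyk, h.strictWalk hk fun j hj => ?_⟩
  subst hj
  rw [hyk]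
  refine lt_of_le_of_ne (hopDist_succ_le _ _ _) fun he => hop.min j (by omega) ?_
  rw [← he, hop.eq]
end pure

/-- Computes, for every hub, the distances along walks with at most `0, 1, …, L` edges, together
with the parents in all layers. -/
def layersP : Prog :=
  setS ROWS (sc BB) ;;
  .parNat (sc BB * sc NN) 1 CP ix (.eq (.read HB (ix / sc NN)) (ix % sc NN)) ;;
  .parReal (sc BB * sc NN) 1 CR ix .zero ;;
  forP KK LL (relaxP ;;
    .parNat (sc BB * sc NN) 1 PF (sc KK * (sc BB * sc NN) + ix) (.read CP ix))

section
variable {W B : ℕ} [hg : Good W B] {σ : Mem}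

/-- One relaxation for each layer, simultaneously for all hubs. -/
lemma layersP_spec {w : ℕ → ℕ → WithTop ℝ} {ℓ N M β L T : ℕ} (hG : GraphList w ℓ N M σ)
    (hNN : σ.nat NN 0 = N) (hβ : σ.nat BB 0 = β) (hL : σ.nat LL 0 = L)
    (hT : M / ℓ + N ≤ 2 ^ T) (b1 : β * M ≤ B) (b2 : β * (M / ℓ + N) ≤ B)
    (b4 : 2 * (M + N) + 2 ≤ B) (b6 : β * N ≤ B) :
    Spec W B layersP σ
      (L * (β * M + (ℓ + T + 1) * (β * (M / ℓ + N) + 4) + 3 * (β * N) + 16) + 2 * (β * N) + 7)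
      (L * (3 * ℓ + 3 * T + 13) + 5)
      (fun τ => (∀ b < β, ∀ v < N, extVal (τ.nat CP) (τ.real CR) (b * N + v) =
          hopDist N w L (σ.nat HB b) v) ∧
        ∀ k < L, ∀ b < β, ∀ v < N,
          IsParent N w k (σ.nat HB b) v (τ.nat PF (k * (β * N) + (b * N + v)))) := by
  have h100 := Good.hundred_le_bound W B
  have hβB : σ.nat BB 0 ≤ B → β ≤ B := fun h => hβ ▸ h
  refine Spec.bdd fun hB => ?_
  refine Spec.mono (w := 2 + ((β * N + 1) + ((β * N + 1) + (L * (((β * M + (ℓ + T + 1) *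
    (β * (M / ℓ + N) + 4) + 2 * (β * N) + 12) + (β * N + 1)) + 3) + 3))))
    (d := 1 + (1 + (1 + (L * ((3 * ℓ + 3 * T + 10 + 1) + 2) + 2)))) ?_
    (by rw [show (β * M + (ℓ + T + 1) * (β * (M / ℓ + N) + 4) + 2 * (β * N) + 12) + (β * N + 1) + 3
          = β * M + (ℓ + T + 1) * (β * (M / ℓ + N) + 4) + 3 * (β * N) + 16 by ring]; omega)
    (by rw [show (3 * ℓ + 3 * T + 10 + 1) + 2 = 3 * ℓ + 3 * T + 13 by ring]; omega)
    (fun _ _ _ h => h)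
  refine Spec.seq (Spec.setS rfl (hB _ _)) fun τ1 hA1 h1 => ?_
  refine Spec.seq (Spec.parNi (β * N) (by simp [hA1.n BB rfl, hA1.n NN rfl, hβ, hNN]) b6 rfl ?_)
    fun τ2 hA2 h2 => ?_
  · intro i _ _; rw [ev_eq]; split_ifs <;> omega
  refine Spec.seq (Spec.parRi (β * N) (by
    simp [hA2.n BB rfl, hA1.n BB rfl, hA2.n NN rfl, hA1.n NN rfl, hβ, hNN]) b6 rfl)
    fun τ3 hA3 h3 => ?_
  have n3 : ∀ a, a ≠ ROWS → a ≠ CP → τ3.nat a = σ.nat a := fun a ha hb => by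
    rw [hA3.n a rfl, hA2.n a (by simp [Prog.wN, hb]), hA1.n a (by simp [setS, Prog.wN, ha])]
  have rows3 : τ3.nat ROWS 0 = β := by rw [hA3.n ROWS rfl, hA2.n ROWS rfl, h1]; simp [hβ]
  refine (Spec.forP (P := relaxP ;; _) L (fun k τ =>
    (∀ b < β, ∀ v < N, extVal (τ.nat CP) (τ.real CR) (b * N + v) =
          hopDist N w k (σ.nat HB b) v) ∧
        ∀ j < k, ∀ b < β, ∀ v < N,
          IsParent N w j (σ.nat HB b) v (τ.nat PF (j * (β * N) + (b * N + v))))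
    (by rw [n3 LL (by decide) (by decide), hL]) rfl rfl ?_ ?_ ?_).mono le_rfl le_rfl
    (fun _ _ _ h => h)
  · intro k τ τ' hn hr h
    rw [hn CP (by decide), hn PF (by decide), hr]
    exact h
  · refine ⟨fun b hb v hv => ?_, fun j hj => absurd hj (Nat.not_lt_zero _)⟩
    have hlt := mul_add_lt hv hb
    rw [extVal, hA3.n CP rfl, h2, h3]
    simp only [hlt, true_and, ev_ofNat, ne_eq, one_ne_zero, not_false_iff, if_true, ev_eq, ev_read, ev_div, ev_mod, ev_ix, ev_sc, hA1.n NN rfl, hNN, hA1.n HB rfl,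
      div_mul_add hv, mod_mul_add hv, rev_zero, hopDist]
    by_cases h : σ.nat HB b = v <;> simp [h]
  · intro k hk τ hA hkk ⟨hI1, hI2⟩
    have n4 : ∀ a, a ≠ ROWS → a ≠ CP → (forP KK LL (relaxP ;;
        .parNat (sc BB * sc NN) 1 PF (sc KK * (sc BB * sc NN) + ix) (.read CP ix))).wN a = false →
        τ.nat a = σ.nat a := fun a ha hb hc => by rw [hA.n a hc, n3 a ha hb]
    have hG' : GraphList w ℓ N M τ := hG.congr (by
      simp only [List.mem_cons, List.not_mem_nil, or_false, forall_eq_or_imp, forall_eq]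
      refine ⟨?_, ?_, ?_, ?_, ?_, ?_, ?_, ?_⟩ <;> exact n4 _ (by decide) (by decide) rfl)
      (by rw [hA.r WT rfl, hA3.r WT rfl, hA2.r WT rfl, hA1.r WT rfl])
    refine Spec.seq (w := β * M + (ℓ + T + 1) * (β * (M / ℓ + N) + 4) + 2 * (β * N) + 12)
      (w' := β * N + 1) (d := 3 * ℓ + 3 * T + 10) (d' := 1)
      (relaxP_spec hG'.list (by rw [hA.n ROWS rfl, rows3]) hT b1 b2 b6 b4 (fun r hr => by
        have := hG'.srcLt r hr; omega)) fun τ4 hA4 h4 => ?_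
    have k4 : τ4.nat KK 0 = k := by rw [hA4.n KK rfl, hkk]
    have β4 : τ4.nat BB 0 = β := by rw [hA4.n BB rfl, n4 BB (by decide) (by decide) rfl, hβ]
    have N4 : τ4.nat NN 0 = N := by rw [hA4.n NN rfl, n4 NN (by decide) (by decide) rfl, hNN]
    refine (Spec.bdd fun hB4 => Spec.parN (β * N) (by simp [β4, N4]) b6 rfl ?_ ?_).mono
      le_rfl le_rfl ?_
    · intro i j _ _ _ _ h
      simp only [ev_add, ev_mul, ev_sc, ev_ix] at h; omega
    · intro i _ _; exact hB4 _ _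
    intro τ5 hA5 _ ⟨h5, h5'⟩
    simp only [ev_add, ev_mul, ev_sc, ev_ix, k4, β4, N4, ev_ofNat, ev_read] at h5 h5'
    have rel : ∀ b < β, ∀ v < N, IsParent N w k (σ.nat HB b) v (τ4.nat CP (b * N + v)) ∧
        extVal (τ4.nat CP) (τ4.real CR) (b * N + v) = hopDist N w (k + 1) (σ.nat HB b) v := by
      intro b hb v hv
      obtain ⟨a, g1, g2, g3⟩ := h4 b hb v hv
      obtain ⟨g4, g5⟩ := hG'.relax (fun x hx => hI1 b hb x hx) hv g1
      refine ⟨g2 ▸ g4, ?_⟩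
      rw [extVal, g2]
      by_cases ha : a = 0
      · rw [if_pos ha] at g4 ⊢
        rcases g4 with ⟨-, g4⟩ | ⟨x, -, g4, -⟩
        · rw [g4]; simp
        · omega
      · rw [if_neg ha, if_pos (by omega), g3 ha, g5 ha]
    refine ⟨fun b hb v hv => ?_, fun j hj b hb v hv => ?_⟩
    · rw [hA5.n CP rfl, hA5.r CR rfl]; exact (rel b hb v hv).2
    · have hlt := mul_add_lt hv hb
      rcases Nat.lt_succ_iff_lt_or_eq.1 hj with hj' | rfl
      · rw [h5' _ fun i hi _ => ?_, hA4.n PF rfl]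
        · exact hI2 j hj' b hb v hv
        · have : (j + 1) * (β * N) ≤ k * (β * N) := Nat.mul_le_mul_right _ hj'
          rw [Nat.succ_mul] at this; omega
      · rw [h5 _ hlt (by simp)]
        exact (rel b hb v hv).1
end

/-- Follows the parents back from hub to hub, and marks the pairs of hubs whose walk still moves
at its last position that is used. -/
def pathsP : Prog :=
  .parNat (sc BB * sc BB) 1 CUR ix (.read HB (ix % sc BB)) ;;
  forP KK LL (
    .parNat (sc BB * sc BB) 1 CUR ix (.read PF ((sc LL - 1 - sc KK) * (sc BB * sc NN) +
      (ix / sc BB * sc NN + .read CUR ix)) - 1) ;;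
    .parNat (sc BB * sc BB) 1 PT ((sc LL - 1 - sc KK) * (sc BB * sc BB) + ix) (.read CUR ix)) ;;
  .parNat (sc BB * sc BB) 1 AL ix
    (.lt 0 (.read CP (ix / sc BB * sc NN + .read HB (ix % sc BB))) *
      .no (.eq (.read PT ((2 * sc HH - 1) * (sc BB * sc BB) + ix))
        (.read PT ((2 * sc HH - 2) * (sc BB * sc BB) + ix))))

section
variable {W B : ℕ} [hg : Good W B] {σ : Mem}

/-- The walk is a sequence of `L` steps, some of which stay in place. It moves at the step `2 * g - 1`
only if it has been moving until then, so the marked walks start with `2 * g` distinct vertices. -/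
lemma pathsP_spec {w : ℕ → ℕ → WithTop ℝ} {N β L g : ℕ}
    (hNN : σ.nat NN 0 = N) (hβ : σ.nat BB 0 = β) (hL : σ.nat LL 0 = L) (hgg : σ.nat HH 0 = g)
    (hHB : ∀ b < β, σ.nat HB b < N)
    (hval : ∀ b < β, ∀ v < N, extVal (σ.nat CP) (σ.real CR) (b * N + v) =
      hopDist N w L (σ.nat HB b) v)
    (hpar : ∀ k < L, ∀ b < β, ∀ v < N,
      IsParent N w k (σ.nat HB b) v (σ.nat PF (k * (β * N) + (b * N + v))))
    (b1 : β * β ≤ B) :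
    Spec W B pathsP σ (L * (2 * (β * β) + 5) + 2 * (β * β) + 5) (L * 4 + 4) (fun τ =>
      ∀ a < β, ∀ b < β,
        (hopDist N w L (σ.nat HB a) (σ.nat HB b) ≠ ⊤ →
          ∃ y, IsPath N w (σ.nat HB a) L y ∧ y L = σ.nat HB b ∧
            ∀ k < L, τ.nat PT (k * (β * β) + (a * β + b)) = y k) ∧
        τ.nat AL (a * β + b) ≤ 1 ∧
        (τ.nat AL (a * β + b) ≠ 0 ↔ hopDist N w L (σ.nat HB a) (σ.nat HB b) ≠ ⊤ ∧
          τ.nat PT ((2 * g - 1) * (β * β) + (a * β + b)) ≠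
            τ.nat PT ((2 * g - 2) * (β * β) + (a * β + b)))) := by
  have h100 := Good.hundred_le_bound W B
  refine Spec.bdd fun hB => ?_
  refine Spec.mono (w := (β * β + 1) + ((L * (((β * β + 1) + (β * β + 1)) + 3) + 3) + (β * β + 1)))
    (d := 1 + ((L * ((1 + 1) + 2) + 2) + 1)) ?_
    (by rw [show β * β + 1 + (β * β + 1) + 3 = 2 * (β * β) + 5 by ring]; omega)
    (by omega) (fun _ _ _ h => h)
  refine Spec.seq (Spec.parNi (β * β) (by simp [hβ]) b1 rfl (fun _ _ _ => hB _ _))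
    fun τ1 hA1 h1 => ?_
  -- `y k` is the vertex number `L - k` of the walk number `i`
  set pos : ℕ → ℕ → ℕ := fun i => Nat.rec (σ.nat HB (i % β)) fun k c =>
    σ.nat PF ((L - 1 - k) * (β * N) + (i / β * N + c)) - 1 with hpos
  have pos_succ : ∀ i k, pos i (k + 1) =
      σ.nat PF ((L - 1 - k) * (β * N) + (i / β * N + pos i k)) - 1 := fun i k => rfl
  have pos_zero : ∀ i, pos i 0 = σ.nat HB (i % β) := fun i => rfl
  clear_value pos
  refine Spec.seq (Spec.forP (P := .parNat _ _ _ _ _ ;; _) L (fun k τ =>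
    (∀ i < β * β, τ.nat CUR i = pos i k) ∧
      ∀ j < k, ∀ i < β * β, τ.nat PT ((L - 1 - j) * (β * β) + i) = pos i (j + 1))
    (by rw [hA1.n LL rfl, hL]) rfl rfl ?_ ?_ ?_) fun τ2 hA2 ⟨h2, h2'⟩ => ?_
  · intro k τ τ' hn hr h
    rw [hn CUR (by decide), hn PT (by decide)]
    exact h
  · refine ⟨fun i hi => ?_, fun j hj => absurd hj (Nat.not_lt_zero _)⟩
    rw [h1, if_pos ⟨hi, by simp⟩, pos_zero]
    simp [hβ]
  · intro k hk τ hA hkk ⟨hI1, hI2⟩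
    have e1 : τ.nat BB 0 = β := by rw [hA.n BB rfl, hA1.n BB rfl, hβ]
    have e2 : τ.nat NN 0 = N := by rw [hA.n NN rfl, hA1.n NN rfl, hNN]
    have e3 : τ.nat LL 0 = L := by rw [hA.n LL rfl, hA1.n LL rfl, hL]
    have e4 : τ.nat PF = σ.nat PF := by rw [hA.n PF rfl, hA1.n PF rfl]
    refine Spec.seq (w := β * β + 1) (w' := β * β + 1) (d := 1) (d' := 1)
      (Spec.bdd fun hB' => Spec.parNi (β * β) (by simp [e1]) b1 rfl ?_) fun τ' hA' h' => ?_
    · intro i _ _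
      simp only [ev_sub, ev_read]
      exact (Nat.sub_le _ _).trans (hB' _ _)
    have c' : ∀ i < β * β, τ'.nat CUR i = pos i (k + 1) := fun i hi => by
      rw [h', if_pos ⟨hi, by simp⟩, pos_succ]
      simp only [ev_sub, ev_read, ev_add, ev_mul, ev_sc, ev_ix, ev_div, ev_ofNat, e1, e2, e3, e4,
        hkk, hI1 i hi]
    refine (Spec.bdd fun hB' => Spec.parN (β * β) (by simp [hA'.n BB rfl, e1]) b1 rfl ?_
      (fun _ _ _ => hB' _ _)).mono le_rfl le_rfl ?_
    · intro i j _ _ _ _ h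
      simp only [ev_add, ev_mul, ev_sc, ev_ix, ev_sub, ev_ofNat] at h; omega
    intro τ'' hA'' _ ⟨h3, h3'⟩
    simp only [ev_add, ev_sub, ev_mul, ev_sc, ev_ix, hA'.n KK rfl, hA'.n LL rfl, hA'.n BB rfl, hkk,
      e1, e3, ev_ofNat, ev_read] at h3 h3'
    refine ⟨fun i hi => by rw [hA''.n CUR rfl, c' i hi], fun j hj i hi => ?_⟩
    rcases Nat.lt_succ_iff_lt_or_eq.1 hj with hj' | rfl
    · rw [h3' _ fun i' hi' _ => ?_, hA'.n PT rfl]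
      · exact hI2 j hj' i hi
      · have : (L - 1 - k + 1) * (β * β) ≤ (L - 1 - j) * (β * β) :=
          Nat.mul_le_mul_right _ (by omega)
        rw [Nat.succ_mul] at this; omega
    · rw [h3 _ hi (by simp), c' i hi]
  · have n2 : ∀ a, a ≠ CUR → a ≠ PT → a ≠ KK → τ2.nat a = σ.nat a := fun a ha hb hc => by
      rw [hA2.n a (by simp [forP, setS, Prog.wN, ha, hb, hc]), hA1.n a (by simp [Prog.wN, ha])]
    have e1 : τ2.nat BB 0 = β := by rw [n2 BB (by decide) (by decide) (by decide), hβ]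
    have e2 : τ2.nat NN 0 = N := by rw [n2 NN (by decide) (by decide) (by decide), hNN]
    have e3 : τ2.nat HH 0 = g := by rw [n2 HH (by decide) (by decide) (by decide), hgg]
    have e4 : τ2.nat HB = σ.nat HB := n2 HB (by decide) (by decide) (by decide)
    have e5 : τ2.nat CP = σ.nat CP := n2 CP (by decide) (by decide) (by decide)
    have le1 : ∀ i, NExp.ev τ2 i
        (.lt 0 (.read CP (ix / sc BB * sc NN + .read HB (ix % sc BB))) *
        .no (.eq (.read PT ((2 * sc HH - 1) * (sc BB * sc BB) + ix))
        (.read PT ((2 * sc HH - 2) * (sc BB * sc BB) + ix)))) ≤ 1 := fun i => by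
      rw [ev_mul, ev_lt, ev_no, ev_eq]
      split_ifs <;> simp
    refine (Spec.parNi (β * β) (by simp [e1]) b1 rfl (fun i _ _ => (le1 i).trans (by omega))).mono
      le_rfl le_rfl ?_
    intro τ3 hA3 _ h3 a ha b hb
    have hi := mul_add_lt hb ha
    have hpt : τ3.nat PT = τ2.nat PT := hA3.n PT rfl
    refine ⟨fun hfin => ?_, ?_, ?_⟩
    · refine ⟨fun k => pos (a * β + b) (L - k), isPath_of_parents ?_ ?_ ?_, ?_, ?_⟩
      · simp only [Nat.sub_self, pos_zero, mod_mul_add hb]; exact hHB b hb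
      · simpa only [Nat.sub_self, pos_zero, mod_mul_add hb] using hfin
      · intro k hk
        obtain ⟨j, hj⟩ : ∃ j, L - k = j + 1 := ⟨L - k - 1, by omega⟩
        refine ⟨_, fun h => hpar k hk a ha _ h, ?_⟩
        rw [hj, pos_succ, show L - 1 - j = k by omega, show L - (k + 1) = j by omega,
          div_mul_add hb]
      · simp only [Nat.sub_self, pos_zero, mod_mul_add hb]
      · intro k hk
        have := h2' (L - 1 - k) (by omega) _ hi
        rw [show L - 1 - (L - 1 - k) = k by omega, show L - 1 - k + 1 = L - k by omega] at this
        rw [hpt, this]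
    · rw [h3, if_pos ⟨hi, by simp⟩]; exact le1 _
    · rw [h3, if_pos ⟨hi, by simp⟩, ← hval a ha _ (hHB b hb), extVal]
      simp only [ev_mul, ev_lt, ev_ofNat, ev_read, ev_add, ev_div, ev_mod, ev_sc, ev_ix, ev_no,
        ev_eq, ev_sub, e1, e2, e3, e4, e5, div_mul_add hb, mod_mul_add hb, hpt]
      by_cases x : σ.nat CP (a * N + σ.nat HB b) = 0
      · simp [x]
      · by_cases y : τ2.nat PT ((2 * g - 1) * (β * β) + (a * β + b)) =
          τ2.nat PT ((2 * g - 2) * (β * β) + (a * β + b)) <;> simp [x, y, Nat.pos_of_ne_zero]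
end

/-- What the marked walks are good for: the first `s` vertices of a marked walk are distinct, and
they lie on a shortest walk if its length is right. -/
structure Paths (N : ℕ) (w : ℕ → ℕ → WithTop ℝ) (s L β : ℕ) (hb : ℕ → ℕ) (al : ℕ → ℕ)
    (pt : ℕ → ℕ) : Prop where
  lt : ∀ i < β * β, al i ≠ 0 → ∀ x < s, pt (x * (β * β) + i) < N
  inj : ∀ i < β * β, al i ≠ 0 → ∀ x y, x < y → y < s →
    pt (x * (β * β) + i) ≠ pt (y * (β * β) + i)
  on : ∀ a < β, ∀ b < β, ∀ k, IsHop N w (hb a) (hb b) k → s ≤ k + 1 → k ≤ L →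
    al (a * β + b) ≠ 0 ∧ ∀ i < s,
      OnWalk N w (hb a) (pt (i * (β * β) + (a * β + b))) (hb b) i (k - i)

/-- A walk that moves at its step `s - 1` has not stayed in place before, so its first `s` vertices are
distinct. In the absence of negative cycles, the walks between hubs at the right distance are
shortest walks with the fewest edges. -/
lemma paths_of_isPath {N : ℕ} {w : ℕ → ℕ → WithTop ℝ} (hnn : NoNeg N w) {s L β : ℕ} {hb al pt : ℕ → ℕ}
    (hs : 2 ≤ s) (hsL : s ≤ L) (hlt : ∀ b < β, hb b < N)
    (h : ∀ a < β, ∀ b < β,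
        (hopDist N w L (hb a) (hb b) ≠ ⊤ → ∃ y, IsPath N w (hb a) L y ∧ y L = hb b ∧
            ∀ k < L, pt (k * (β * β) + (a * β + b)) = y k) ∧
        (al (a * β + b) ≠ 0 ↔ hopDist N w L (hb a) (hb b) ≠ ⊤ ∧
          pt ((s - 1) * (β * β) + (a * β + b)) ≠ pt ((s - 2) * (β * β) + (a * β + b)))) :
    Paths N w s L β hb al pt := by
  have strict : ∀ i < β * β, al i ≠ 0 → ∃ y u, StrictWalk N w u (s - 1) y ∧
      ∀ x < s, pt (x * (β * β) + i) = y x := by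
    intro i hi hal
    have hb0 : 0 < β := Nat.pos_of_ne_zero (by rintro rfl; omega)
    have h1 : i / β < β := Nat.div_lt_of_lt_mul hi
    have h2 : i % β < β := Nat.mod_lt _ hb0
    have h3 : i / β * β + i % β = i := Nat.div_add_mod' i β
    obtain ⟨h4, h5⟩ := h _ h1 _ h2
    rw [h3] at h4 h5
    obtain ⟨h6, h7⟩ := h5.1 hal
    obtain ⟨y, hy, -, hpt⟩ := h4 h6
    rw [hpt _ (by omega), hpt _ (by omega)] at h7
    refine ⟨y, _, hy.strictWalk (by omega) fun j hj => ?_, fun x hx => hpt x (by omega)⟩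
    rw [show s - 2 = j by omega, hj] at h7
    rcases hy.step j (by omega) with ⟨h8, -⟩ | ⟨h8, -⟩
    · exact absurd h8.symm h7
    · exact h8
  refine ⟨fun i hi hal x hx => ?_, fun i hi hal x y hxy hy => ?_, fun a ha b hb' k hk h1 h2 => ?_⟩
  · obtain ⟨z, u, hz, hpt⟩ := strict i hi hal
    rw [hpt x hx]; exact hz.lt x (by omega)
  · obtain ⟨z, u, hz, hpt⟩ := strict i hi hal
    rw [hpt x (by omega), hpt y hy]
    exact hz.ne hxy (by omega) (hnn _ _ (hz.lt x (by omega)))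
  · obtain ⟨h4, h5⟩ := h a ha b hb'
    have hfin : hopDist N w L (hb a) (hb b) ≠ ⊤ :=
      ne_top_of_le_ne_top (hk.eq ▸ hk.ne_top) (hopDist_anti h2 _ _)
    obtain ⟨y, hy, hyL, hpt⟩ := h4 hfin
    obtain ⟨h6, h7⟩ := hy.arrive hnn h2 (hyL ▸ hk)
    refine ⟨h5.2 ⟨hfin, ?_⟩, fun i hi => ?_⟩
    · rw [hpt _ (by omega), hpt _ (by omega)]
      exact (h7.ne (by omega) (by omega) (hnn _ _ (h7.lt _ (by omega)))).symm
    · rw [hpt _ (by omega)]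
      exact h7.onWalk hnn (h6.trans hyL) hk (by omega)

end Par

/-! ### Deterministic hitting sets -/

namespace Par
open Finset

/-- scalar: number of vertices of a walk that may be used to hit it -/
def SP : ℕ := 30
/-- truth values: the current set of vertices -/
def SS : ℕ := 31
/-- labels of the vertices -/
def LB : ℕ := 32
/-- side of the vertices in the current splitting -/
def BT : ℕ := 33
/-- scalar: number of parts into which the vertices have been split -/
def QQ : ℕ := 34
/-- scalar: current bit of the labels, as a power of two -/
def BW : ℕ := 35
/-- scalar: result of a summation -/
def F0 : ℕ := 36
/-- scalar: outcome of the comparison of two sums -/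
def FL : ℕ := 37
/-- truth values: the new hubs -/
def NB : ℕ := 38
/-- scalar: loop variable over the greedy rounds -/
def IT : ℕ := 39
/-- scalar: loop variable over the positions in a walk -/
def XX : ℕ := 40
/-- scalar: number of greedy rounds -/
def RR : ℕ := 41
/-- first vertices of the index pairs of all walks -/
def VX : ℕ := 45
/-- second vertices of the index pairs of all walks -/
def VY : ℕ := 46

lemma ind_mul (a b : Prop) [Decidable a] [Decidable b] :
    (if a then 1 else 0) * (if b then 1 else 0) = (if a ∧ b then 1 else 0 : ℕ) := by
  by_cases a <;> by_cases b <;> simp [*]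

lemma ind_not (a : Prop) [Decidable a] :
    1 - (if a then 1 else 0) = (if ¬ a then 1 else 0 : ℕ) := by
  by_cases a <;> simp [*]

/-- Sums up the values of an expression. -/
def countP (e : NExp) : Prog := .parNat (sc LEN) 1 V ix e ;; sumP

/-- Whether processor `i` stands for an index pair with both vertices in the set. -/
def pairE : NExp :=
  .lt 0 (.read AL (ix / (sc SP * sc SP)) * .read SS (.read VX ix) * .read SS (.read VY ix)) *
    .lt (ix / sc SP % sc SP) (ix % sc SP)

/-- Whether processor `i` stands for a single index with its vertex in the set. -/
def singleE : NExp :=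
  .lt 0 (.read AL (ix / (sc SP * sc SP)) * .read SS (.read VX ix)) *
    .eq (ix / sc SP % sc SP) (ix % sc SP)

/-- Label of the vertex `e`, shifted by the position of the current bit and one more if `k = 2`. -/
def labE (k : NExp) (e : NExp) : NExp := .read LB e / (k * sc BW)

/-- Decides the coefficient of one bit of the splitting. -/
def bitP : Prog :=
  countP (pairE * (.eq (labE 2 (.read VX ix)) (labE 2 (.read VY ix)) *
    (.no (.eq (labE 1 (.read VX ix)) (labE 1 (.read VY ix))) *
    .eq (.read BT (.read VX ix)) (.read BT (.read VY ix))))) ;;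
  setS F0 (.read V 0) ;;
  countP (pairE * (.eq (labE 2 (.read VX ix)) (labE 2 (.read VY ix)) *
    (.no (.eq (labE 1 (.read VX ix)) (labE 1 (.read VY ix))) *
    .no (.eq (.read BT (.read VX ix)) (.read BT (.read VY ix)))))) ;;
  setS FL (.lt (.read V 0) (sc F0)) ;;
  .parNat (sc NN) 1 BT ix ((.read BT ix + sc FL * labE 1 ix) % 2) ;;
  setS BW (2 * sc BW)

/-- Cost of keeping the side `k` of the splitting. -/
def costE (k : NExp) : NExp :=
  pairE * (.eq (.read BT (.read VX ix)) k * .eq (.read BT (.read VY ix)) k) * (2 * sc QQ) +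
    singleE * .eq (.read BT (.read VX ix)) (1 - k) * sc SP

/-- Splits the current set into two parts and keeps the better one. -/
def halveP : Prog :=
  .parNat (sc NN) 1 BT ix (.read LB ix % 2) ;;
  setS BW 2 ;;
  .loop (.lt (sc BW) (sc EE)) bitP ;;
  countP (costE 0) ;;
  setS F0 (.read V 0) ;;
  countP (costE 1) ;;
  setS FL (.lt (.read V 0) (sc F0)) ;;
  .parNat (sc NN) 1 SS ix (.read SS ix * .eq (.read BT ix) (sc FL)) ;;
  .parNat (sc NN) 1 LB ix (.read LB ix / 2) ;;
  setS QQ (2 * sc QQ)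

/-- One greedy round: finds a small set that hits half of the remaining walks, adds it to the new
hubs and removes the walks it hits. -/
def greedyP : Prog :=
  .parNat (sc NN) 1 SS ix 1 ;;
  .parNat (sc NN) 1 LB ix ix ;;
  setS QQ 1 ;;
  .loop (.lt (sc QQ) (sc SP)) halveP ;;
  .parNat (sc NN) 1 NB ix (.lt 0 (.read NB ix + .read SS ix)) ;;
  forP XX SP (.parNat (sc BB * sc BB) 1 AL ix
    (.read AL ix * .no (.read SS (.read PT (sc XX * (sc BB * sc BB) + ix)))))

/-- Finds a small set of vertices that contains the vertex `0` and hits all walks. -/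
def hitP : Prog :=
  setS SP (2 * sc HH) ;;
  setS LEN (sc BB * sc BB * (sc SP * sc SP)) ;;
  .parNat (sc LEN) 1 VX ix
    (.read PT (ix / sc SP % sc SP * (sc BB * sc BB) + ix / (sc SP * sc SP))) ;;
  .parNat (sc LEN) 1 VY ix (.read PT (ix % sc SP * (sc BB * sc BB) + ix / (sc SP * sc SP))) ;;
  .parNat (sc NN) 1 NB ix (.eq ix 0) ;;
  setS RR (2 * sc LG + 1) ;;
  forP IT RR greedyP

/-- Data that stay fixed while a hitting set is computed. -/
structure HitData (N ℓ s β : ℕ) (pt : ℕ → ℕ) (σ : Mem) : Prop where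
  nn : σ.nat NN 0 = N
  bb : σ.nat BB 0 = β
  sp : σ.nat SP 0 = s
  ee : σ.nat EE 0 = 2 ^ ℓ
  len : σ.nat LEN 0 = β * β * (s * s)
  pts : σ.nat PT = pt
  vx : ∀ i < β * β * (s * s), σ.nat VX i = pt (i / s % s * (β * β) + i / (s * s))
  vy : ∀ i < β * β * (s * s), σ.nat VY i = pt (i % s * (β * β) + i / (s * s))

lemma HitData.congr {N ℓ s β : ℕ} {pt : ℕ → ℕ} {σ τ : Mem} (h : HitData N ℓ s β pt σ)
    (e : ∀ a ∈ [NN, BB, SP, EE, LEN, PT, VX, VY], τ.nat a = σ.nat a) : HitData N ℓ s β pt τ := by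
  simp only [List.mem_cons, List.not_mem_nil, or_false, forall_eq_or_imp, forall_eq] at e
  obtain ⟨e1, e2, e3, e4, e5, e6, e7, e8⟩ := e
  exact ⟨by rw [e1, h.nn], by rw [e2, h.bb], by rw [e3, h.sp], by rw [e4, h.ee], by rw [e5, h.len],
    by rw [e6, h.pts], by rw [e7]; exact h.vx, by rw [e8]; exact h.vy⟩

lemma HitData.agree {N ℓ s β : ℕ} {pt : ℕ → ℕ} {σ τ : Mem} {P : Prog} (h : HitData N ℓ s β pt σ)
    (hA : Agree P σ τ) (e : ([NN, BB, SP, EE, LEN, PT, VX, VY].any fun a => P.wN a) = false) :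
    HitData N ℓ s β pt τ :=
  h.congr fun a ha => hA.n a (by
    simp only [List.any_eq_false] at e
    simpa using e a ha)

/-- At most half of the pairs whose labels agree above the bit `pw` are on the same side. -/
def Halved (P : Finset ℕ) (u v lab bt : ℕ → ℕ) (pw : ℕ) : Prop :=
  2 * #{i ∈ P | lab (u i) / pw = lab (v i) / pw ∧ bt (u i) = bt (v i)} ≤
    #{i ∈ P | lab (u i) / pw = lab (v i) / pw}

section
variable {W B : ℕ} [hg : Good W B] {σ : Mem}

lemma countP_spec {e : NExp} {Λ T : ℕ} (f : ℕ → ℕ) (he : e.ok = true) (hlen : σ.nat LEN 0 = Λ)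
    (h0 : 0 < Λ) (hT : Λ ≤ 2 ^ T) (h2 : 2 * Λ ≤ B) (hf : ∀ i < Λ, e.ev σ i = f i)
    (hs : ∑ j ∈ range Λ, f j ≤ B) :
    Spec W B (countP e) σ ((T + 1) * (Λ + 4)) (T * 3 + 3)
      (fun τ => τ.nat V 0 = ∑ j ∈ range Λ, f j) := by
  refine Spec.mono (w := (Λ + 1) + (T * (Λ + 4) + 3)) (d := 1 + (T * 3 + 2)) ?_ (by
    rw [Nat.succ_mul]; omega) (by omega) (fun _ _ _ h => h)
  refine Spec.seq (Spec.parNi Λ (by simp [hlen]) (by omega) (by rw [he]; rfl) ?_) fun τ1 hA1 h1 => ?_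
  · intro i hi _
    rw [hf i hi]
    exact (single_le_sum (f := f) (fun _ _ => Nat.zero_le _) (mem_range.2 hi)).trans hs
  refine (sumP_spec f (by rw [hA1.n LEN rfl, hlen]) hT h2 (fun i hi => ?_) hs).mono le_rfl le_rfl ?_
  · rw [h1, if_pos ⟨hi, by simp⟩, hf i hi]
  · intro τ _ _ h
    rw [h 0 h0, range_eq_Ico]
end

lemma card_filter_pairsIn {M s : ℕ} {al S : ℕ → Prop} {pt : ℕ → ℕ → ℕ} {p : ℕ → Prop}
    [DecidablePred al] [DecidablePred S] [DecidablePred p] : #{i ∈ pairsIn M s al pt S | p i} = ∑ i ∈ range (M * (s * s)),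
      if ((al (i / (s * s)) ∧ S (pt (i / s % s) (i / (s * s))) ∧ S (pt (i % s) (i / (s * s)))) ∧
        i / s % s < i % s) ∧ p i then 1 else 0 := by
  rw [pairsIn, filter_filter, card_filter]
  refine sum_congr rfl fun i _ => ?_
  congr 1
  exact propext (by tauto)

section
variable {W B : ℕ} [hg : Good W B] {σ : Mem} {N ℓ s β : ℕ} {pt : ℕ → ℕ}

/-- Vertex number `x` of the walk `j`. -/
def vert (β : ℕ) (pt : ℕ → ℕ) (x j : ℕ) : ℕ := pt (x * (β * β) + j)

/-- The index pairs of all remaining walks within the current set. -/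
noncomputable def curPairs (s β : ℕ) (pt : ℕ → ℕ) (σ : Mem) : Finset ℕ :=
  pairsIn (β * β) s (fun j => σ.nat AL j ≠ 0) (vert β pt) (fun v => σ.nat SS v ≠ 0)

/-- The indices of all remaining walks within the current set. -/
noncomputable def curSingles (s β : ℕ) (pt : ℕ → ℕ) (σ : Mem) : Finset ℕ :=
  singlesIn (β * β) s (fun j => σ.nat AL j ≠ 0) (vert β pt) (fun v => σ.nat SS v ≠ 0)

lemma HitData.pairE_ev (h : HitData N ℓ s β pt σ) {i : ℕ} (hi : i < β * β * (s * s)) :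
    pairE.ev σ i = if (σ.nat AL (i / (s * s)) ≠ 0 ∧
      σ.nat SS (vert β pt (i / s % s) (i / (s * s))) ≠ 0 ∧
      σ.nat SS (vert β pt (i % s) (i / (s * s))) ≠ 0) ∧ i / s % s < i % s then 1 else 0 := by
  simp only [pairE, ev_mul, ev_lt, ev_ofNat, ev_read, ev_div, ev_ix, ev_sc, ev_mod, h.sp, h.vx i hi,
    h.vy i hi, ind_mul, vert]
  refine if_congr ?_ rfl rfl
  rw [Nat.pos_iff_ne_zero]
  simp only [ne_eq, mul_eq_zero, not_or]
  tauto

lemma HitData.singleE_ev (h : HitData N ℓ s β pt σ) {i : ℕ} (hi : i < β * β * (s * s)) :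
    singleE.ev σ i = if σ.nat AL (i / (s * s)) ≠ 0 ∧ i / s % s = i % s ∧
      σ.nat SS (vert β pt (i / s % s) (i / (s * s))) ≠ 0 then 1 else 0 := by
  simp only [singleE, ev_mul, ev_lt, ev_ofNat, ev_read, ev_div, ev_ix, ev_sc, ev_mod, h.sp,
    h.vx i hi, ind_mul, vert, ev_eq]
  refine if_congr ?_ rfl rfl
  rw [Nat.pos_iff_ne_zero]
  simp only [ne_eq, mul_eq_zero, not_or]
  tauto

/-- The splitting is by a linear form over the field with two elements in the bits of the labels; the
coefficient of each bit is decided by `split_bit`. -/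
lemma bitP_spec (h : HitData N ℓ s β pt σ) {T pw : ℕ} (h0 : 0 < β * β * (s * s))
    (hT : β * β * (s * s) ≤ 2 ^ T) (h2 : 2 * (β * β * (s * s)) ≤ B) (hN : N ≤ B)
    (hpw : σ.nat BW 0 = pw) (hpB : 2 * pw ≤ B) (hbt : ∀ v < N, σ.nat BT v < 2) :
    Spec W B bitP σ ((2 * T + 2) * (β * β * (s * s) + 4) + N + 7) (6 * T + 10) (fun τ =>
      τ.nat BW 0 = 2 * pw ∧
      (∃ f, ∀ v < N, τ.nat BT v = (σ.nat BT v + f * (σ.nat LB v / pw)) % 2) ∧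
      ((∀ i ∈ curPairs s β pt σ, σ.nat VX i < N ∧ σ.nat VY i < N) →
        Halved (curPairs s β pt σ) (σ.nat VX) (σ.nat VY) (σ.nat LB) (σ.nat BT) pw →
        Halved (curPairs s β pt σ) (σ.nat VX) (σ.nat VY) (σ.nat LB) (τ.nat BT) (2 * pw))) := by
  have h100 := Good.hundred_le_bound W B
  set Λ := β * β * (s * s) with hΛ
  have le1 : ∀ f : ℕ → ℕ, (∀ i, f i ≤ 1) → ∑ i ∈ range Λ, f i ≤ B := fun f hf => by
    calc ∑ i ∈ range Λ, f i ≤ ∑ i ∈ range Λ, 1 := sum_le_sum fun i _ => hf i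
      _ ≤ B := by simp; omega
  refine Spec.mono (w := (T + 1) * (Λ + 4) + (2 + ((T + 1) * (Λ + 4) + (2 + ((N + 1) + 2)))))
    (d := (T * 3 + 3) + (1 + ((T * 3 + 3) + (1 + (1 + 1))))) ?_ (by
      have e : (2 * T + 2) * (Λ + 4) = 2 * ((T + 1) * (Λ + 4)) := by ring
      omega) (by omega)
    (fun _ _ _ h => h)
  set fE : ℕ → ℕ := fun i => if ((σ.nat AL (i / (s * s)) ≠ 0 ∧
      σ.nat SS (vert β pt (i / s % s) (i / (s * s))) ≠ 0 ∧
      σ.nat SS (vert β pt (i % s) (i / (s * s))) ≠ 0) ∧ i / s % s < i % s) ∧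
      (σ.nat LB (σ.nat VX i) / (2 * pw) = σ.nat LB (σ.nat VY i) / (2 * pw) ∧
        σ.nat LB (σ.nat VX i) / pw ≠ σ.nat LB (σ.nat VY i) / pw ∧
        σ.nat BT (σ.nat VX i) = σ.nat BT (σ.nat VY i)) then 1 else 0 with hfE
  set fF : ℕ → ℕ := fun i => if ((σ.nat AL (i / (s * s)) ≠ 0 ∧
      σ.nat SS (vert β pt (i / s % s) (i / (s * s))) ≠ 0 ∧
      σ.nat SS (vert β pt (i % s) (i / (s * s))) ≠ 0) ∧ i / s % s < i % s) ∧
      (σ.nat LB (σ.nat VX i) / (2 * pw) = σ.nat LB (σ.nat VY i) / (2 * pw) ∧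
        σ.nat LB (σ.nat VX i) / pw ≠ σ.nat LB (σ.nat VY i) / pw ∧
        σ.nat BT (σ.nat VX i) ≠ σ.nat BT (σ.nat VY i)) then 1 else 0 with hfF
  have hE1 : ∀ i, fE i ≤ 1 := fun i => by simp only [hfE]; split_ifs <;> omega
  have hF1 : ∀ i, fF i ≤ 1 := fun i => by simp only [hfF]; split_ifs <;> omega
  refine Spec.seq (countP_spec fE rfl h.len h0 hT h2 (fun i hi => ?_) (le1 _ hE1)) fun τ1 hA1 h1 => ?_
  · rw [ev_mul, h.pairE_ev hi]
    simp only [labE, ev_mul, ev_eq, ev_no, ind_mul, ind_not]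
    refine if_congr ?_ rfl rfl
    simp only [ev_read, ev_div, ev_mul, ev_ix, ev_sc, ev_ofNat, hpw, one_mul, ne_eq]
  have hV0 : NExp.ev τ1 0 (.read V 0) = ∑ i ∈ range Λ, fE i := h1
  refine Spec.seq (Spec.setS rfl (by rw [hV0]; exact le1 _ hE1)) fun τ2 hA2 h2' => ?_
  have n2 : ∀ a, a ≠ V → a ≠ PV → a ≠ F0 → τ2.nat a = σ.nat a := fun a ha hb hc => by
    rw [hA2.n a (by simp [setS, Prog.wN, hc]),
      hA1.n a (by simp [countP, sumP, setS, Prog.wN, ha, hb])]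
  have hD2 : HitData N ℓ s β pt τ2 := (h.agree hA1 rfl).agree hA2 rfl
  refine Spec.seq (countP_spec fF rfl hD2.len h0 hT h2 (fun i hi => ?_) (le1 _ hF1))
    fun τ3 hA3 h3 => ?_
  · rw [ev_mul, hD2.pairE_ev hi]
    simp only [labE, ev_mul, ev_eq, ev_no, ind_mul, ind_not]
    refine if_congr ?_ rfl rfl
    simp only [ev_read, ev_div, ev_mul, ev_ix, ev_sc, ev_ofNat,
      n2 BW (by decide) (by decide) (by decide), n2 AL (by decide) (by decide) (by decide),
      n2 SS (by decide) (by decide) (by decide), n2 LB (by decide) (by decide) (by decide),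
      n2 BT (by decide) (by decide) (by decide), n2 VX (by decide) (by decide) (by decide),
      n2 VY (by decide) (by decide) (by decide), hpw, one_mul, ne_eq]
  refine Spec.seq (Spec.setS rfl (by rw [ev_lt]; split_ifs <;> omega)) fun τ4 hA4 h4 => ?_
  have n4 : ∀ a, a ≠ V → a ≠ PV → a ≠ F0 → a ≠ FL → τ4.nat a = σ.nat a := fun a ha hb hc hd => by
    rw [hA4.n a (by simp [setS, Prog.wN, hd]),
      hA3.n a (by simp [countP, sumP, setS, Prog.wN, ha, hb]), n2 a ha hb hc]
  have hfl : τ4.nat FL 0 = if ∑ i ∈ range Λ, fF i < ∑ i ∈ range Λ, fE i then 1 else 0 := by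
    rw [h4]
    simp only [ev_lt, ev_read, ev_ofNat, ev_sc, h3, hA3.n F0 rfl, h2', h1]
  refine Spec.seq (Spec.parNi N (by
    simp [n4 NN (by decide) (by decide) (by decide) (by decide), h.nn]) hN rfl ?_)
    fun τ5 hA5 h5 => ?_
  · intro i _ _
    rw [ev_mod, ev_ofNat]
    have := Nat.mod_lt (NExp.ev τ4 i (.read BT ix + sc FL * labE 1 ix)) (show 0 < 2 by omega)
    omega
  have bt5 : ∀ v < N, τ5.nat BT v = (σ.nat BT v + τ4.nat FL 0 * (σ.nat LB v / pw)) % 2 := by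
    intro v hv
    rw [h5, if_pos ⟨hv, by simp⟩]
    simp only [labE, ev_mod, ev_add, ev_read, ev_ix, ev_mul, ev_sc, ev_div, ev_ofNat, one_mul,
      n4 BT (by decide) (by decide) (by decide) (by decide),
      n4 LB (by decide) (by decide) (by decide) (by decide),
      n4 BW (by decide) (by decide) (by decide) (by decide), hpw]
  have bw5 : τ5.nat BW 0 = pw := by
    rw [hA5.n BW rfl, n4 BW (by decide) (by decide) (by decide) (by decide), hpw]
  refine (Spec.setS rfl (by simp [bw5]; omega)).mono le_rfl le_rfl ?_
  intro τ6 hA6 _ h6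
  refine ⟨by rw [h6]; simp [bw5], ⟨_, fun v hv => by rw [hA6.n BT rfl, bt5 v hv]⟩, fun hok hH => ?_⟩
  refine split_bit _ _ _ _ _ _ pw (τ4.nat FL 0) (fun i hi => hbt _ (hok i hi).1)
    (fun i hi => hbt _ (hok i hi).2) (E := ∑ i ∈ range Λ, fE i) (F := ∑ i ∈ range Λ, fF i)
    ?_ ?_ hfl (fun i hi => ?_) (fun i hi => ?_) hH
  · rw [curPairs, card_filter_pairsIn]
  · rw [curPairs, card_filter_pairsIn]
  · rw [hA6.n BT rfl, bt5 _ (hok i hi).1]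
  · rw [hA6.n BT rfl, bt5 _ (hok i hi).2]

/-- On all marked walks, the first `s` vertices are distinct vertices of the graph. -/
def WalksOk (N s β : ℕ) (pt al : ℕ → ℕ) : Prop :=
  ∀ j < β * β, al j ≠ 0 → (∀ x < s, vert β pt x j < N) ∧
    ∀ x y, x < y → y < s → vert β pt x j ≠ vert β pt y j

lemma idx_lt {M s i : ℕ} (hi : i < M * (s * s)) : i / (s * s) < M ∧ i / s % s < s ∧ i % s < s := by
  have hs : 0 < s := Nat.pos_of_ne_zero (by rintro rfl; simp at hi)
  exact ⟨Nat.div_lt_of_lt_mul (by rwa [mul_comm] at hi), Nat.mod_lt _ hs, Nat.mod_lt _ hs⟩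

lemma pairsIn_congr {M s : ℕ} {al S S' : ℕ → Prop} {pt : ℕ → ℕ → ℕ}
    (h : ∀ j < M, al j → ∀ x < s, (S (pt x j) ↔ S' (pt x j))) :
    pairsIn M s al pt S = pairsIn M s al pt S' := by
  classical
  refine filter_congr fun i hi => ?_
  obtain ⟨h1, h2, h3⟩ := idx_lt (mem_range.1 hi)
  by_cases ha : al (i / (s * s))
  · rw [h _ h1 ha _ h2, h _ h1 ha _ h3]
  · simp [ha]

lemma singlesIn_congr {M s : ℕ} {al S S' : ℕ → Prop} {pt : ℕ → ℕ → ℕ}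
    (h : ∀ j < M, al j → ∀ x < s, (S (pt x j) ↔ S' (pt x j))) :
    singlesIn M s al pt S = singlesIn M s al pt S' := by
  classical
  refine filter_congr fun i hi => ?_
  obtain ⟨h1, h2, h3⟩ := idx_lt (mem_range.1 hi)
  by_cases ha : al (i / (s * s))
  · rw [h _ h1 ha _ h2]
  · simp [ha]

lemma HitData.costE_ev (h : HitData N ℓ s β pt σ) {k : NExp} {c q : ℕ} (hk : ∀ i, k.ev σ i = c)
    (hq : σ.nat QQ 0 = q) {i : ℕ} (hi : i < β * β * (s * s)) :
    (costE k).ev σ i = (if ((σ.nat AL (i / (s * s)) ≠ 0 ∧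
      σ.nat SS (vert β pt (i / s % s) (i / (s * s))) ≠ 0 ∧
      σ.nat SS (vert β pt (i % s) (i / (s * s))) ≠ 0) ∧ i / s % s < i % s) ∧
      σ.nat BT (vert β pt (i / s % s) (i / (s * s))) = c ∧
      σ.nat BT (vert β pt (i % s) (i / (s * s))) = c then 1 else 0) * (2 * q) +
      (if (σ.nat AL (i / (s * s)) ≠ 0 ∧ i / s % s = i % s ∧
        σ.nat SS (vert β pt (i / s % s) (i / (s * s))) ≠ 0) ∧
        σ.nat BT (vert β pt (i / s % s) (i / (s * s))) = 1 - c then 1 else 0) * s := by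
  simp only [costE, ev_add, ev_mul]
  rw [h.pairE_ev hi, h.singleE_ev hi]
  simp only [ev_eq, ind_mul]
  simp only [ev_read, ev_ix, ev_sc, ev_ofNat, ev_sub, hk, hq, h.sp, h.vx i hi, h.vy i hi, vert]
  rfl

lemma HitData.sum_costE (h : HitData N ℓ s β pt σ) {k : NExp} {c q : ℕ} (hk : ∀ i, k.ev σ i = c)
    (hq : σ.nat QQ 0 = q) : ∑ i ∈ range (β * β * (s * s)), (costE k).ev σ i =
      2 * q * #(pairsIn (β * β) s (fun j => σ.nat AL j ≠ 0) (vert β pt)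
        fun v => σ.nat SS v ≠ 0 ∧ σ.nat BT v = c) +
      s * #(singlesIn (β * β) s (fun j => σ.nat AL j ≠ 0) (vert β pt)
        fun v => σ.nat SS v ≠ 0 ∧ σ.nat BT v = 1 - c) := by
  rw [sum_congr rfl fun i hi => h.costE_ev hk hq (mem_range.1 hi), sum_add_distrib, ← sum_mul,
    ← sum_mul]
  refine congrArg₂ _ ?_ ?_
  · rw [mul_comm (2 * q), pairsIn, card_filter]
    congr 1
    refine sum_congr rfl fun i _ => ?_
    congr 1
    exact propext (by tauto)
  · rw [mul_comm s (Finset.card _), singlesIn, card_filter]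
    congr 1
    refine sum_congr rfl fun i _ => ?_
    congr 1
    exact propext (by tauto)

lemma HitData.sum_costE_le (h : HitData N ℓ s β pt σ) {k : NExp} {c q : ℕ}
    (hk : ∀ i, k.ev σ i = c) (hq : σ.nat QQ 0 = q) :
    ∑ i ∈ range (β * β * (s * s)), (costE k).ev σ i ≤ β * β * (s * s) * (2 * q + s) := by
  rw [sum_congr rfl fun i hi => h.costE_ev hk hq (mem_range.1 hi)]
  calc _ ≤ ∑ i ∈ range (β * β * (s * s)), (2 * q + s) := by
        refine sum_le_sum fun i _ => Nat.add_le_add ?_ ?_ <;> split_ifs <;> simp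
    _ = _ := by simp

/-- One halving of the current set: the potential does not decrease, and the halved labels still
distinguish the vertices of the set. -/
lemma halveP_spec (h : HitData N ℓ s β pt σ) {T q : ℕ} (h0 : 0 < β * β * (s * s))
    (hT : β * β * (s * s) ≤ 2 ^ T) (h2 : 2 * (β * β * (s * s)) ≤ B) (hN : N ≤ B) (hℓ : 1 ≤ ℓ)
    (hℓB : 2 ^ ℓ ≤ B) (hq : σ.nat QQ 0 = q) (hqB : β * β * (s * s) * (2 * q + s) ≤ B)
    (hqB' : 2 * q ≤ B) (hLB : ∀ v < N, σ.nat LB v < 2 ^ ℓ)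
    (hinj : ∀ u < N, ∀ v < N, σ.nat SS u ≠ 0 → σ.nat SS v ≠ 0 → σ.nat LB u = σ.nat LB v → u = v) :
    Spec W B halveP σ ((ℓ + 1) * ((2 * T + 2) * (β * β * (s * s) + 4) + N + 8) + 3 * N + 20)
      ((ℓ + 1) * (6 * T + 11) + 10) (fun τ =>
      τ.nat QQ 0 = 2 * q ∧ (∀ v < N, τ.nat LB v = σ.nat LB v / 2) ∧
      (∀ u < N, ∀ v < N, τ.nat SS u ≠ 0 → τ.nat SS v ≠ 0 → τ.nat LB u = τ.nat LB v → u = v) ∧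
      (WalksOk N s β pt (σ.nat AL) →
        (s * q * #(curSingles s β pt σ) - q ^ 2 * #(curPairs s β pt σ) : ℤ) ≤
          s * (2 * q) * #(curSingles s β pt τ) - (2 * q) ^ 2 * #(curPairs s β pt τ))) := by
  have h100 := Good.hundred_le_bound W B
  set Λ := β * β * (s * s) with hΛ
  set bw := (2 * T + 2) * (Λ + 4) + N + 7 with hbw
  refine Spec.bdd fun hB => ?_
  refine Spec.mono (w := (N + 1) + (2 + (((ℓ - 1) * (bw + 1) + 1) + ((T + 1) * (Λ + 4) + (2 +
    ((T + 1) * (Λ + 4) + (2 + ((N + 1) + ((N + 1) + 2)))))))))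
    (d := 1 + (1 + (((ℓ - 1) * ((6 * T + 10) + 1) + 1) + ((T * 3 + 3) + (1 + ((T * 3 + 3) +
      (1 + (1 + (1 + 1))))))))) ?_ ?_ ?_ (fun _ _ _ h => h)
  rotate_left
  · have e : (2 * T + 2) * (Λ + 4) = 2 * ((T + 1) * (Λ + 4)) := by ring
    have e' : (ℓ + 1) * ((2 * T + 2) * (Λ + 4) + N + 8) = (ℓ - 1) * (bw + 1) + 2 * (bw + 1) := by
      rw [← Nat.add_mul]; congr 1; omega
    omega
  · have e' : (ℓ + 1) * (6 * T + 11) = (ℓ - 1) * (6 * T + 10 + 1) + 2 * (6 * T + 11) := by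
      rw [show 6 * T + 10 + 1 = 6 * T + 11 by omega, ← Nat.add_mul]; congr 1; omega
    omega
  refine Spec.seq (Spec.parNi N (by simp [h.nn]) hN rfl ?_) fun τ1 hA1 h1 => ?_
  · intro i _ _; exact (Nat.mod_le _ _).trans (hB _ _)
  refine Spec.seq (Spec.setS rfl (by rw [ev_ofNat]; omega)) fun τ2 hA2 h2' => ?_
  have hD2 : HitData N ℓ s β pt τ2 := (h.agree hA1 rfl).agree hA2 rfl
  have n2 : ∀ a, a ≠ BT → a ≠ BW → τ2.nat a = σ.nat a := fun a ha hb => by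
    rw [hA2.n a (by simp [setS, Prog.wN, hb]), hA1.n a (by simp [Prog.wN, ha])]
  have bt2 : ∀ v < N, τ2.nat BT v = σ.nat LB v % 2 := fun v hv => by
    rw [hA2.n BT rfl, h1, if_pos ⟨hv, by simp⟩]; simp
  -- the vertices of the pairs are distinct, so their labels are
  have pok : WalksOk N s β pt (σ.nat AL) → ∀ i ∈ curPairs s β pt σ,
      (σ.nat VX i < N ∧ σ.nat VY i < N) ∧ σ.nat LB (σ.nat VX i) ≠ σ.nat LB (σ.nat VY i) := by
    intro hok i hi
    simp only [curPairs, pairsIn, mem_filter, mem_range] at hi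
    obtain ⟨hi, hal, hxy, hx, hy⟩ := hi
    obtain ⟨i1, i2, i3⟩ := idx_lt hi
    obtain ⟨h3, h4⟩ := hok _ i1 hal
    rw [h.vx i hi, h.vy i hi]
    exact ⟨⟨h3 _ i2, h3 _ i3⟩, fun he => h4 _ _ hxy i3 (hinj _ (h3 _ i2) _ (h3 _ i3) hx hy he)⟩
  refine Spec.seq (Spec.loop_const (w := bw) (d := 6 * T + 10) (ℓ - 1) (fun t τ =>
    τ.nat BW 0 = 2 ^ (t + 1) ∧ (∀ v < N, τ.nat BT v < 2) ∧
    (∀ u < N, ∀ v < N, σ.nat LB u / 2 = σ.nat LB v / 2 → τ.nat BT u = τ.nat BT v →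
      σ.nat LB u % 2 = σ.nat LB v % 2) ∧
    (WalksOk N s β pt (σ.nat AL) → Halved (curPairs s β pt σ) (σ.nat VX) (σ.nat VY) (σ.nat LB)
      (τ.nat BT) (2 ^ (t + 1)))) rfl ?_ ?_ ?_) fun τ3 hA3 ⟨hw3, hb3, hi3, hH3⟩ => ?_
  · refine ⟨by rw [h2']; simp, fun v hv => ?_, fun u hu v hv _ he => ?_, fun hok => ?_⟩
    · rw [bt2 v hv]; exact Nat.mod_lt _ (by omega)
    · rwa [bt2 u hu, bt2 v hv] at he
    · unfold Halved
      rw [show #{i ∈ curPairs s β pt σ | σ.nat LB (σ.nat VX i) / 2 ^ (0 + 1) =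
        σ.nat LB (σ.nat VY i) / 2 ^ (0 + 1) ∧ τ2.nat BT (σ.nat VX i) = τ2.nat BT (σ.nat VY i)} = 0
        from ?_]
      · omega
      · rw [card_eq_zero, filter_eq_empty_iff]
        intro i hi ⟨he, he'⟩
        obtain ⟨⟨h3, h4⟩, h5⟩ := pok hok i hi
        rw [bt2 _ h3, bt2 _ h4] at he'
        simp only [zero_add, pow_one] at he
        omega
  · intro t ht τ hA ⟨hw, hb, hi, hH⟩
    have hpw : 2 ^ (t + 1) < 2 ^ ℓ := Nat.pow_lt_pow_right (by omega) (by omega)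
    have hpw2 : 2 * 2 ^ (t + 1) ≤ 2 ^ ℓ := by
      rw [← pow_succ']; exact Nat.pow_le_pow_right (by omega) (by omega)
    have hD : HitData N ℓ s β pt τ := hD2.agree hA rfl
    refine ⟨by simp [hw, hD.ee, hpw], ?_⟩
    have n : ∀ a, bitP.wN a = false → a ≠ BT → a ≠ BW → τ.nat a = σ.nat a := fun a hc ha hb => by
      rw [hA.n a hc, n2 a ha hb]
    have e1 : curPairs s β pt τ = curPairs s β pt σ := by
      unfold curPairs
      rw [n AL rfl (by decide) (by decide), n SS rfl (by decide) (by decide)]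
    refine (bitP_spec hD h0 hT h2 hN hw (by omega) hb).mono le_rfl le_rfl ?_
    intro τ' hA' _ ⟨hw', ⟨f, hf⟩, hH'⟩
    rw [e1, n VX rfl (by decide) (by decide), n VY rfl (by decide) (by decide),
      n LB rfl (by decide) (by decide)] at hH'
    rw [n LB rfl (by decide) (by decide)] at hf
    refine ⟨by rw [hw']; ring, fun v hv => ?_, fun u hu v hv he he' => hi u hu v hv he ?_,
      fun hok => ?_⟩
    · rw [hf v hv]; exact Nat.mod_lt _ (by omega)
    · rw [hf u hu, hf v hv] at he'
      have e : σ.nat LB u / 2 ^ (t + 1) = σ.nat LB v / 2 ^ (t + 1) := by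
        rw [pow_succ', ← Nat.div_div_eq_div_mul, ← Nat.div_div_eq_div_mul, he]
      rw [e] at he'
      have := hb u hu
      have := hb v hv
      omega
    · rw [show 2 ^ (t + 1 + 1) = 2 * 2 ^ (t + 1) by ring]
      exact hH' (fun i hi => (pok hok i hi).1) (hH hok)
  · intro τ hA ⟨hw, _⟩
    rw [ev_lt, ev_sc, ev_sc, hw, hA.n EE rfl, hD2.ee, show ℓ - 1 + 1 = ℓ by omega]
    simp
  rw [show ℓ - 1 + 1 = ℓ by omega] at hH3
  have n3 : ∀ a, bitP.wN a = false → a ≠ BT → a ≠ BW → τ3.nat a = σ.nat a := fun a hc ha hb => by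
      rw [hA3.n a hc, n2 a ha hb]
  have hD3 : HitData N ℓ s β pt τ3 := hD2.agree (P := bitP) ⟨hA3.n, hA3.r⟩ rfl
  have q3 : τ3.nat QQ 0 = q := by rw [n3 QQ rfl (by decide) (by decide), hq]
  refine Spec.seq (countP_spec _ rfl hD3.len h0 hT h2 (fun _ _ => rfl)
    ((hD3.sum_costE_le (c := 0) (fun _ => rfl) q3).trans hqB)) fun τ4 hA4 h4 => ?_
  rw [hD3.sum_costE (c := 0) (fun _ => rfl) q3] at h4
  refine Spec.bdd fun hB4 => Spec.seq (Spec.setS rfl (hB4 _ _)) fun τ5 hA5 h5 => ?_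
  have hD5 : HitData N ℓ s β pt τ5 := (hD3.agree hA4 rfl).agree hA5 rfl
  have n5 : ∀ a, a ≠ V → a ≠ PV → a ≠ F0 → τ5.nat a = τ3.nat a := fun a ha hb hc => by
    rw [hA5.n a (by simp [setS, Prog.wN, hc]),
      hA4.n a (by simp [countP, sumP, setS, Prog.wN, ha, hb])]
  have q5 : τ5.nat QQ 0 = q := by rw [n5 QQ (by decide) (by decide) (by decide), q3]
  refine Spec.seq (countP_spec _ rfl hD5.len h0 hT h2 (fun _ _ => rfl)
    ((hD5.sum_costE_le (c := 1) (fun _ => rfl) q5).trans hqB)) fun τ6 hA6 h6 => ?_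
  rw [hD5.sum_costE (c := 1) (fun _ => rfl) q5, n5 AL (by decide) (by decide) (by decide),
    n5 SS (by decide) (by decide) (by decide), n5 BT (by decide) (by decide) (by decide)] at h6
  refine Spec.seq (Spec.setS rfl (by rw [ev_lt]; split_ifs <;> omega)) fun τ7 hA7 h7 => ?_
  have n7 : ∀ a, a ≠ V → a ≠ PV → a ≠ F0 → a ≠ FL → τ7.nat a = τ3.nat a := fun a ha hb hc hd => by
    rw [hA7.n a (by simp [setS, Prog.wN, hd]),
      hA6.n a (by simp [countP, sumP, setS, Prog.wN, ha, hb]), n5 a ha hb hc]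
  have hD7 : HitData N ℓ s β pt τ7 := (hD5.agree hA6 rfl).agree hA7 rfl
  have f0 : τ6.nat F0 0 = τ4.nat V 0 := by rw [hA6.n F0 rfl, h5]; rfl
  have h7 : τ7.nat FL 0 = if τ6.nat V 0 < τ4.nat V 0 then 1 else 0 := by
    rw [h7, ev_lt, ev_read, ev_ofNat, ev_sc, f0]
  refine Spec.bdd fun hB7 => Spec.seq (Spec.parNi N (by simp [hD7.nn]) hN rfl ?_)
    fun τ8 hA8 h8 => ?_
  · intro i _ _
    rw [ev_mul, ev_eq]
    split_ifs
    · rw [mul_one]; exact hB7 _ _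
    · omega
  have n8 : ∀ a, bitP.wN a = false → a ≠ BT → a ≠ BW → a ≠ SS → τ8.nat a = σ.nat a :=
    fun a hc ha hb hd => by
      have ha' : ∀ b, bitP.wN b = true → a ≠ b := fun b hb he => by rw [he, hb] at hc; simp at hc
      rw [hA8.n a (by simp [Prog.wN, hd]), n7 a (ha' _ rfl) (ha' _ rfl) (ha' _ rfl) (ha' _ rfl),
        n3 a hc ha hb]
  have ss8 : ∀ v < N, (τ8.nat SS v ≠ 0 ↔ σ.nat SS v ≠ 0 ∧ τ3.nat BT v = τ7.nat FL 0) := by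
    intro v hv
    rw [h8, if_pos ⟨hv, by simp⟩]
    simp only [ev_mul, ev_eq]
    rw [ev_read, ev_read, ev_ix, ev_sc, n7 BT (by decide) (by decide) (by decide) (by decide),
      n7 SS (by decide) (by decide) (by decide) (by decide), n3 SS rfl (by decide) (by decide)]
    by_cases h : τ3.nat BT v = τ7.nat FL 0 <;> simp [h]
  refine Spec.bdd fun hB8 => Spec.seq (Spec.parNi N (by simp [hA8.n NN rfl, hD7.nn]) hN rfl ?_)
    fun τ9 hA9 h9 => ?_
  · intro i _ _; exact (Nat.div_le_self _ _).trans (hB8 _ _)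
  have lb9 : ∀ v < N, τ9.nat LB v = σ.nat LB v / 2 := fun v hv => by
    rw [h9, if_pos ⟨hv, by simp⟩]
    simp [n8 LB rfl (by decide) (by decide) (by decide)]
  have q9 : τ9.nat QQ 0 = q := by
    rw [hA9.n QQ rfl, n8 QQ rfl (by decide) (by decide) (by decide), hq]
  refine (Spec.setS rfl (by simp [q9, hqB'])).mono le_rfl le_rfl ?_
  intro τ hA _ hτ
  have e1 : τ.nat SS = τ8.nat SS := by rw [hA.n SS rfl, hA9.n SS rfl]
  have e2 : τ.nat AL = σ.nat AL := by
    rw [hA.n AL rfl, hA9.n AL rfl, n8 AL rfl (by decide) (by decide) (by decide)]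
  have e3 : ∀ v < N, τ.nat LB v = σ.nat LB v / 2 := fun v hv => by rw [hA.n LB rfl, lb9 v hv]
  refine ⟨by rw [hτ]; simp [q9], e3, fun u hu v hv hsu hsv he => ?_, fun hok => ?_⟩
  · rw [e3 u hu, e3 v hv] at he
    rw [e1, ss8 u hu] at hsu
    rw [e1, ss8 v hv] at hsv
    have := hi3 u hu v hv he (hsu.2.trans hsv.2.symm)
    exact hinj u hu v hv hsu.1 hsv.1 (by omega)
  · have hS : ∀ j < β * β, τ.nat AL j ≠ 0 → ∀ x < s, (τ.nat SS (vert β pt x j) ≠ 0 ↔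
        σ.nat SS (vert β pt x j) ≠ 0 ∧ τ3.nat BT (vert β pt x j) = τ7.nat FL 0) := by
      intro j hj ha x hx
      rw [e2] at ha
      rw [e1, ss8 _ ((hok j hj ha).1 x hx)]
    have eS : curSingles s β pt τ = _ := singlesIn_congr
      (S' := fun v => σ.nat SS v ≠ 0 ∧ τ3.nat BT v = τ7.nat FL 0) hS
    have eP : curPairs s β pt τ = _ := pairsIn_congr
      (S' := fun v => σ.nat SS v ≠ 0 ∧ τ3.nat BT v = τ7.nat FL 0) hS
    rw [eS, eP, e2]
    rw [n3 AL rfl (by decide) (by decide), n3 SS rfl (by decide) (by decide)] at h4 h6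
    refine potential_step (bt := τ3.nat BT) ?_ ?_ h4 h6 h7
    · intro i hi
      simp only [singlesIn, mem_filter, mem_range] at hi
      obtain ⟨hi, hal, -, -⟩ := hi
      obtain ⟨i1, i2, -⟩ := idx_lt hi
      exact hb3 _ ((hok _ i1 hal).1 _ i2)
    · have hH := hH3 hok
      unfold Halved at hH
      have hz : ∀ i ∈ curPairs s β pt σ, σ.nat LB (σ.nat VX i) / 2 ^ ℓ = 0 ∧
          σ.nat LB (σ.nat VY i) / 2 ^ ℓ = 0 := fun i hi => by
        obtain ⟨⟨h3, h4⟩, -⟩ := pok hok i hi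
        exact ⟨Nat.div_eq_of_lt (hLB _ h3), Nat.div_eq_of_lt (hLB _ h4)⟩
      rw [filter_true_of_mem (s := curPairs s β pt σ) (p := fun i => σ.nat LB (σ.nat VX i) / 2 ^ ℓ =
        σ.nat LB (σ.nat VY i) / 2 ^ ℓ) fun i hi => by rw [(hz i hi).1, (hz i hi).2]] at hH
      refine le_trans (Nat.mul_le_mul_left 2 (card_le_card fun i hi => ?_)) hH
      simp only [mem_filter] at hi ⊢
      refine ⟨hi.1, by rw [(hz i hi.1).1, (hz i hi.1).2], ?_⟩
      have hr : i < Λ := by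
        have := hi.1
        simp only [pairsIn, mem_filter, mem_range] at this
        exact this.1
      rw [h.vx i hr, h.vy i hr]
      exact hi.2
end

end Par

namespace Par
open Finset

section
variable {W B : ℕ} [hg : Good W B] {σ : Mem} {N ℓ s β : ℕ} {pt : ℕ → ℕ}

lemma WalksOk.mono {al al' : ℕ → ℕ} (h : WalksOk N s β pt al)
    (hle : ∀ j < β * β, al' j ≠ 0 → al j ≠ 0) : WalksOk N s β pt al' :=
  fun j hj ha => h j hj (hle j hj ha)

/-- Work of one halving. -/
def halveW (ℓ T Λ N : ℕ) : ℕ := (ℓ + 1) * ((2 * T + 2) * (Λ + 4) + N + 8) + 3 * N + 20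

/-- Depth of one halving. -/
def halveD (ℓ T : ℕ) : ℕ := (ℓ + 1) * (6 * T + 11) + 10

/-- A greedy round hits half of the remaining walks with at most `2 ^ ℓ / s` vertices. -/
lemma greedyP_spec (h : HitData N ℓ s β pt σ) {T t : ℕ} (hβ : 0 < β)
    (hT : β * β * (s * s) ≤ 2 ^ T) (hs : s = 2 ^ t) (ht : t ≤ ℓ) (hℓ : 1 ≤ ℓ) (hN : N ≤ 2 ^ ℓ)
    (b1 : β * β * (s * s) * (3 * s) ≤ B) (b2 : 2 * 2 ^ ℓ ≤ B) (b3 : β * β ≤ B) :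
    Spec W B greedyP σ (ℓ * (halveW ℓ T (β * β * (s * s)) N + 1) + 3 * N + s * (β * β + 4) + 9)
      (ℓ * (halveD ℓ T + 1) + 3 * s + 7) (fun τ =>
      #{v ∈ range N | τ.nat NB v ≠ 0} ≤ #{v ∈ range N | σ.nat NB v ≠ 0} + 2 ^ (ℓ - t) ∧
      (∀ v < N, σ.nat NB v ≠ 0 → τ.nat NB v ≠ 0) ∧
      (∀ j < β * β, τ.nat AL j ≠ 0 → σ.nat AL j ≠ 0) ∧
      (WalksOk N s β pt (σ.nat AL) →
        2 * #{j ∈ range (β * β) | τ.nat AL j ≠ 0} ≤ #{j ∈ range (β * β) | σ.nat AL j ≠ 0} ∧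
        ∀ j < β * β, σ.nat AL j ≠ 0 → τ.nat AL j ≠ 0 ∨ ∃ x < s, τ.nat NB (vert β pt x j) ≠ 0)) := by
  have h100 := Good.hundred_le_bound W B
  set Λ := β * β * (s * s) with hΛ
  have s0 : 0 < s := by rw [hs]; positivity
  have hΛ0 : 0 < Λ := by positivity
  have hsB : s ≤ 2 ^ ℓ := hs ▸ Nat.pow_le_pow_right (by omega) ht
  have b0 : 2 * Λ ≤ B :=
    le_trans (by rw [mul_comm]; exact Nat.mul_le_mul_left _ (by omega)) b1
  refine Spec.bdd fun hB => ?_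
  refine Spec.mono (w := (N + 1) + ((N + 1) + (2 + ((t * (halveW ℓ T Λ N + 1) + 1) + ((N + 1) +
    (s * ((β * β + 1) + 3) + 3))))))
    (d := 1 + (1 + (1 + ((t * (halveD ℓ T + 1) + 1) + (1 + (s * (1 + 2) + 2)))))) ?_ ?_ ?_
    (fun _ _ _ h => h)
  rotate_left
  · have := Nat.mul_le_mul_right (halveW ℓ T Λ N + 1) ht
    rw [show β * β + 1 + 3 = β * β + 4 by omega]
    omega
  · have := Nat.mul_le_mul_right (halveD ℓ T + 1) ht
    omega
  refine Spec.seq (Spec.parNi N (by simp [h.nn]) (by omega) rfl (by simp; omega)) fun τ1 hA1 h1 => ?_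
  refine Spec.seq (Spec.parNi N (by simp [hA1.n NN rfl, h.nn]) (by omega) rfl
    (fun i hi _ => by rw [ev_ix]; omega)) fun τ2 hA2 h2 => ?_
  refine Spec.seq (Spec.setS rfl (by rw [ev_ofNat]; omega)) fun τ3 hA3 h3 => ?_
  have n3 : ∀ a, a ≠ SS → a ≠ LB → a ≠ QQ → τ3.nat a = σ.nat a := fun a ha hb hc => by
    rw [hA3.n a (by simp [setS, Prog.wN, hc]), hA2.n a (by simp [Prog.wN, hb]),
      hA1.n a (by simp [Prog.wN, ha])]
  have hD3 : HitData N ℓ s β pt τ3 := ((h.agree hA1 rfl).agree hA2 rfl).agree hA3 rfl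
  have ss3 : ∀ v < N, τ3.nat SS v ≠ 0 := fun v hv => by
    rw [hA3.n SS rfl, hA2.n SS rfl, h1, if_pos ⟨hv, by simp⟩]; simp
  have lb3 : ∀ v < N, τ3.nat LB v = v := fun v hv => by
    rw [hA3.n LB rfl, h2, if_pos ⟨hv, by simp⟩]; simp
  refine Spec.seq (Spec.loop_const (w := halveW ℓ T Λ N) (d := halveD ℓ T) t (fun k τ =>
    τ.nat QQ 0 = 2 ^ k ∧ (∀ v < N, τ.nat LB v < 2 ^ (ℓ - k)) ∧
    (∀ u < N, ∀ v < N, τ.nat SS u ≠ 0 → τ.nat SS v ≠ 0 → τ.nat LB u = τ.nat LB v → u = v) ∧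
    (WalksOk N s β pt (σ.nat AL) → (#{j ∈ range (β * β) | σ.nat AL j ≠ 0} * (s * s) : ℤ) ≤
      2 * (s * (2 ^ k : ℕ) * #(curSingles s β pt τ) - (2 ^ k : ℕ) ^ 2 * #(curPairs s β pt τ))))
    rfl ?_ ?_ ?_) fun τ4 hA4 ⟨hq4, hl4, hi4, hp4⟩ => ?_
  · refine ⟨by rw [h3]; simp, fun v hv => by rw [lb3 v hv]; simp; omega,
      fun u hu v hv _ _ he => by rwa [lb3 u hu, lb3 v hv] at he, fun hok => ?_⟩
    have := potential_start (M := β * β) (s := s) (al := fun j => τ3.nat AL j ≠ 0)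
      (pt := vert β pt) (S := fun v => τ3.nat SS v ≠ 0) (fun j hj ha x hx => ss3 _ ((hok j hj (by
        rwa [n3 AL (by decide) (by decide) (by decide)] at ha)).1 x hx))
    rw [← curPairs, ← curSingles] at this
    have e : #{j ∈ range (β * β) | τ3.nat AL j ≠ 0} = #{j ∈ range (β * β) | σ.nat AL j ≠ 0} := by
      rw [n3 AL (by decide) (by decide) (by decide)]
    have e' : #{j ∈ range (β * β) | σ.nat AL j ≠ 0} * (s * s) + 2 * #(curPairs s β pt τ3) ≤
        2 * (s * #(curSingles s β pt τ3)) := by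
      rw [← e]; convert this
    have e'' := (Nat.cast_le (α := ℤ)).2 e'
    push_cast at e'' ⊢
    linarith
  · intro k hk τ hA ⟨hq, hl, hi, hp⟩
    have hD : HitData N ℓ s β pt τ := hD3.agree hA rfl
    have hks : 2 ^ k < s := hs ▸ Nat.pow_lt_pow_right (by omega) hk
    have eal : τ.nat AL = σ.nat AL := by rw [hA.n AL rfl, n3 AL (by decide) (by decide) (by decide)]
    refine ⟨by simp [hq, hD.sp, hks], ?_⟩
    refine (halveP_spec hD hΛ0 hT b0 (by omega) hℓ (by omega) hq (le_trans (Nat.mul_le_mul_left _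
      (by omega)) b1) (by omega) (fun v hv => (hl v hv).trans_le
        (Nat.pow_le_pow_right (by omega) (by omega))) hi).mono le_rfl le_rfl ?_
    intro τ' hA' _ ⟨h1', h2', h3', h4'⟩
    refine ⟨by rw [h1']; ring, fun v hv => ?_, h3', fun hok => ?_⟩
    · rw [h2' v hv]
      have := hl v hv
      rw [show ℓ - k = (ℓ - (k + 1)) + 1 by omega, pow_succ] at this
      omega
    · have h5 := hp hok
      have h6 := h4' (eal ▸ hok)
      rw [show (2 ^ (k + 1) : ℕ) = 2 * 2 ^ k by ring]
      push_cast at h5 h6 ⊢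
      linarith
  · intro τ hA ⟨hq, _⟩
    rw [ev_lt, ev_sc, ev_sc, hq, (hD3.agree hA rfl).sp, hs]
    simp
  have hD4 : HitData N ℓ s β pt τ4 := hD3.agree (P := halveP) ⟨hA4.n, hA4.r⟩ rfl
  have n4 : ∀ a, halveP.wN a = false → a ≠ SS → a ≠ LB → a ≠ QQ → τ4.nat a = σ.nat a :=
    fun a hz ha hb hc => by rw [hA4.n a hz, n3 a ha hb hc]
  have nb4 := n4 NB rfl (by decide) (by decide) (by decide)
  have al4 := n4 AL rfl (by decide) (by decide) (by decide)
  have cnt : #{v ∈ range N | τ4.nat SS v ≠ 0} ≤ 2 ^ (ℓ - t) :=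
    card_le_of_labels hi4 fun v hv _ => hl4 v hv
  refine Spec.seq (Spec.parNi N (by simp [hD4.nn]) (by omega) rfl (fun i _ _ => by
    rw [ev_lt]; split_ifs <;> omega)) fun τ5 hA5 h5 => ?_
  have hD5 : HitData N ℓ s β pt τ5 := hD4.agree hA5 rfl
  have nb5 : ∀ v < N, (τ5.nat NB v ≠ 0 ↔ σ.nat NB v ≠ 0 ∨ τ4.nat SS v ≠ 0) := fun v hv => by
    rw [h5, if_pos ⟨hv, by simp⟩]
    simp only [ev_lt]
    rw [ev_ofNat, ev_add, ev_read, ev_read, ev_ix, nb4]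
    split_ifs with hc <;> omega
  have al5 : τ5.nat AL = σ.nat AL := by rw [hA5.n AL rfl, al4]
  have ss5 : τ5.nat SS = τ4.nat SS := hA5.n SS rfl
  refine (Spec.forP s (fun k τ => ∀ j < β * β, (τ.nat AL j ≠ 0 ↔ σ.nat AL j ≠ 0 ∧
    ∀ x < k, τ4.nat SS (vert β pt x j) = 0)) hD5.sp rfl rfl ?_ ?_ ?_).mono le_rfl le_rfl ?_
  · intro k τ τ' hn _ hI
    rw [hn AL (by decide)]; exact hI
  · intro j hj; rw [al5]; simp
  · intro k hk τ hA hxx hI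
    have hD : HitData N ℓ s β pt τ := hD5.agree hA rfl
    refine Spec.bdd fun hBτ => (Spec.parNi (β * β) (by simp [hD.bb]) b3 rfl ?_).mono le_rfl le_rfl ?_
    · intro i _ _
      rw [ev_mul, ev_no]
      calc _ ≤ NExp.ev τ i (.read AL ix) * 1 := Nat.mul_le_mul_left _ (Nat.sub_le _ _)
        _ ≤ B := by rw [mul_one]; exact hBτ _ _
    · intro τ' hA' _ h' j hj
      rw [h', if_pos ⟨hj, by simp⟩]
      simp only [ev_mul, ev_no, ev_read, ev_ix, ev_add, ev_sc, hxx, hD.bb, hD.pts, hA.n SS rfl, ss5,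
        ne_eq, mul_eq_zero, not_or]
      rw [← ne_eq, hI j hj, and_assoc]
      refine and_congr_right fun _ => ⟨fun ⟨a, b⟩ x hx => ?_, fun a => ⟨fun x hx => a x (by omega), ?_⟩⟩
      · rcases Nat.lt_succ_iff_lt_or_eq.1 hx with hx | rfl
        · exact a x hx
        · unfold vert; omega
      · have := a k (by omega)
        unfold vert at this
        rw [this]; simp
  · intro τ hA _ hI
    have nb : τ.nat NB = τ5.nat NB := hA.n NB rfl
    rw [nb]
    refine ⟨?_, fun v hv hn => (nb5 v hv).2 (Or.inl hn), fun j hj ha => ((hI j hj).1 ha).1,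
      fun hok => ⟨?_, fun j hj ha => ?_⟩⟩
    · calc #{v ∈ range N | τ5.nat NB v ≠ 0} ≤
          #({v ∈ range N | σ.nat NB v ≠ 0} ∪ {v ∈ range N | τ4.nat SS v ≠ 0}) := by
            refine card_le_card fun v hv => ?_
            simp only [mem_filter, mem_union, mem_range] at hv ⊢
            have := (nb5 v hv.1).1 hv.2
            tauto
        _ ≤ _ := (card_union_le _ _).trans (by omega)
    · have hhit := singles_le_pairs_add_hits (M := β * β) (s := s) (al := fun j => τ4.nat AL j ≠ 0)
        (pt := vert β pt) (S := fun v => τ4.nat SS v ≠ 0)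
      rw [← curPairs, ← curSingles] at hhit
      have hp := hp4 hok
      rw [← hs] at hp
      have e1 : (#{j ∈ range (β * β) | σ.nat AL j ≠ 0} : ℤ) ≤
          2 * (#(curSingles s β pt τ4) - #(curPairs s β pt τ4)) := by
        have : (0 : ℤ) < s * s := by positivity
        refine le_of_mul_le_mul_right ?_ this
        linarith
      have e2 : #{j ∈ range (β * β) | τ.nat AL j ≠ 0} + #{j ∈ range (β * β) | τ4.nat AL j ≠ 0 ∧
          ∃ x < s, τ4.nat SS (vert β pt x j) ≠ 0} ≤ #{j ∈ range (β * β) | σ.nat AL j ≠ 0} := by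
        rw [← card_union_of_disjoint]
        · refine card_le_card fun j hj => ?_
          simp only [mem_union, mem_filter, mem_range] at hj ⊢
          rcases hj with ⟨hj, ha⟩ | ⟨hj, ha, -⟩
          · exact ⟨hj, ((hI j hj).1 ha).1⟩
          · rw [al4] at ha; exact ⟨hj, ha⟩
        · rw [disjoint_filter]
          intro j hj ha ⟨_, x, hx, hx'⟩
          exact hx' (((hI j (mem_range.1 hj)).1 ha).2 x hx)
      have e3 : #(curSingles s β pt τ4) ≤ #(curPairs s β pt τ4) +
          #{j ∈ range (β * β) | τ4.nat AL j ≠ 0 ∧ ∃ x < s, τ4.nat SS (vert β pt x j) ≠ 0} := by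
        convert hhit
      omega
    · by_cases hall : ∀ x < s, τ4.nat SS (vert β pt x j) = 0
      · exact Or.inl ((hI j hj).2 ⟨ha, hall⟩)
      · push Not at hall
        obtain ⟨x, hx, hx'⟩ := hall
        exact Or.inr ⟨x, hx, (nb5 _ ((hok j hj ha).1 x hx)).2 (Or.inr hx')⟩

/-- There are at most `β ^ 2 ≤ 4 ^ ℓ` walks, and each round leaves at most half of them, so none is left
after `2 * ℓ + 1` rounds. The bound on the number of new hubs holds whether or not the walks are
as they should be, because the number of rounds is fixed. The vertex `0` is always included. -/
lemma hitP_spec {g T t : ℕ} (hNN : σ.nat NN 0 = N) (hbb : σ.nat BB 0 = β) (hgg : σ.nat HH 0 = g)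
    (hlg : σ.nat LG 0 = ℓ) (hee : σ.nat EE 0 = 2 ^ ℓ) (hpt : σ.nat PT = pt) (hβ : 0 < β)
    (hsg : s = 2 * g) (hT : β * β * (s * s) ≤ 2 ^ T) (hs : s = 2 ^ t) (ht : t ≤ ℓ) (hℓ : 1 ≤ ℓ)
    (hN0 : 0 < N) (hN : N ≤ 2 ^ ℓ) (hβN : β ≤ 2 ^ ℓ)
    (b1 : β * β * (s * s) * (3 * s) ≤ B) (b2 : 2 * 2 ^ ℓ ≤ B) (b3 : β * β ≤ B) :
    Spec W B hitP σ ((2 * ℓ + 1) * (ℓ * (halveW ℓ T (β * β * (s * s)) N + 1) + 3 * N +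
        s * (β * β + 4) + 12) + 2 * (β * β * (s * s)) + N + 12)
      ((2 * ℓ + 1) * (ℓ * (halveD ℓ T + 1) + 3 * s + 9) + 8) (fun τ =>
      #{v ∈ range N | τ.nat NB v ≠ 0} ≤ 1 + (2 * ℓ + 1) * 2 ^ (ℓ - t) ∧ τ.nat NB 0 ≠ 0 ∧
      (WalksOk N s β pt (σ.nat AL) →
        ∀ j < β * β, σ.nat AL j ≠ 0 → ∃ x < s, τ.nat NB (vert β pt x j) ≠ 0)) := by
  have h100 := Good.hundred_le_bound W B
  set Λ := β * β * (s * s) with hΛ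
  have s0 : 0 < s := by rw [hs]; positivity
  have hΛ0 : 0 < Λ := by positivity
  have hsB : s ≤ 2 ^ ℓ := hs ▸ Nat.pow_le_pow_right (by omega) ht
  have b0 : 2 * Λ ≤ B :=
    le_trans (by rw [mul_comm]; exact Nat.mul_le_mul_left _ (by omega)) b1
  have hℓ2 : ℓ < 2 ^ ℓ := Nat.lt_two_pow_self
  refine Spec.bdd fun hB => ?_
  refine Spec.mono (w := 2 + (2 + ((Λ + 1) + ((Λ + 1) + ((N + 1) + (2 + ((2 * ℓ + 1) *
    ((ℓ * (halveW ℓ T Λ N + 1) + 3 * N + s * (β * β + 4) + 9) + 3) + 3)))))))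
    (d := 1 + (1 + (1 + (1 + (1 + (1 + ((2 * ℓ + 1) * ((ℓ * (halveD ℓ T + 1) + 3 * s + 7) + 2) +
      2))))))) ?_ (by
        rw [show ℓ * (halveW ℓ T Λ N + 1) + 3 * N + s * (β * β + 4) + 9 + 3 =
          ℓ * (halveW ℓ T Λ N + 1) + 3 * N + s * (β * β + 4) + 12 by ring]; omega)
    (by
      rw [show ℓ * (halveD ℓ T + 1) + 3 * s + 7 + 2 = ℓ * (halveD ℓ T + 1) + 3 * s + 9 by ring]
      omega) (fun _ _ _ h => h)
  refine Spec.seq (Spec.setS rfl (by rw [ev_mul, ev_sc, ev_ofNat, hgg]; omega)) fun τ1 hA1 h1 => ?_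
  have sp1 : τ1.nat SP 0 = s := by rw [h1]; simp [hgg, hsg]
  have bb1 : τ1.nat BB 0 = β := by rw [hA1.n BB rfl, hbb]
  refine Spec.seq (Spec.setS rfl (by simp only [ev_mul, ev_sc, sp1, bb1]; omega)) fun τ2 hA2 h2 => ?_
  have len2 : τ2.nat LEN 0 = Λ := by rw [h2]; simp [sp1, bb1, hΛ]
  have sp2 : τ2.nat SP 0 = s := by rw [hA2.n SP rfl, sp1]
  have bb2 : τ2.nat BB 0 = β := by rw [hA2.n BB rfl, bb1]
  have pt2 : τ2.nat PT = pt := by rw [hA2.n PT rfl, hA1.n PT rfl, hpt]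
  refine Spec.bdd fun hB2 => Spec.seq (Spec.parNi Λ (by simp [len2]) (by omega) rfl
    (fun _ _ _ => hB2 _ _)) fun τ3 hA3 h3 => ?_
  refine Spec.bdd fun hB3 => Spec.seq (Spec.parNi Λ (by simp [hA3.n LEN rfl, len2]) (by omega) rfl
    (fun _ _ _ => hB3 _ _)) fun τ4 hA4 h4 => ?_
  have n4 : ∀ a, a ≠ SP → a ≠ LEN → a ≠ VX → a ≠ VY → τ4.nat a = σ.nat a := fun a ha hb hc hd => by
    rw [hA4.n a (by simp [Prog.wN, hd]), hA3.n a (by simp [Prog.wN, hc]),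
      hA2.n a (by simp [setS, Prog.wN, hb]), hA1.n a (by simp [setS, Prog.wN, ha])]
  have hD4 : HitData N ℓ s β pt τ4 := by
    refine ⟨?_, ?_, ?_, ?_, ?_, ?_, fun i hi => ?_, fun i hi => ?_⟩
    · rw [n4 NN (by decide) (by decide) (by decide) (by decide), hNN]
    · rw [n4 BB (by decide) (by decide) (by decide) (by decide), hbb]
    · rw [hA4.n SP rfl, hA3.n SP rfl, sp2]
    · rw [n4 EE (by decide) (by decide) (by decide) (by decide), hee]
    · rw [hA4.n LEN rfl, hA3.n LEN rfl, len2]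
    · rw [n4 PT (by decide) (by decide) (by decide) (by decide), hpt]
    · rw [hA4.n VX rfl, h3, if_pos ⟨hi, by simp⟩]
      simp [sp2, bb2, pt2]
    · rw [h4, if_pos ⟨hi, by simp⟩]
      simp [hA3.n SP rfl, hA3.n BB rfl, hA3.n PT rfl, sp2, bb2, pt2]
  refine Spec.seq (Spec.parNi N (by simp [hD4.nn]) (by omega) rfl (fun i _ _ => by
    rw [ev_eq]; split_ifs <;> omega)) fun τ5 hA5 h5 => ?_
  have nb5 : ∀ v < N, (τ5.nat NB v ≠ 0 ↔ v = 0) := fun v hv => by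
    rw [h5, if_pos ⟨hv, by simp⟩]
    simp only [ev_eq]
    rw [ev_ofNat, ev_ix]
    split_ifs with hc <;> omega
  have lg5 : τ5.nat LG 0 = ℓ := by
    rw [hA5.n LG rfl, n4 LG (by decide) (by decide) (by decide) (by decide), hlg]
  refine Spec.seq (Spec.setS rfl (by
    simp only [ev_mul, ev_add, ev_sc, ev_ofNat, lg5]; omega)) fun τ6 hA6 h6 => ?_
  have hD6 : HitData N ℓ s β pt τ6 := (hD4.agree hA5 rfl).agree hA6 rfl
  have al6 : τ6.nat AL = σ.nat AL := by
    rw [hA6.n AL rfl, hA5.n AL rfl, n4 AL (by decide) (by decide) (by decide) (by decide)]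
  have nb6 : τ6.nat NB = τ5.nat NB := hA6.n NB rfl
  refine (Spec.forP (2 * ℓ + 1) (fun r τ =>
    #{v ∈ range N | τ.nat NB v ≠ 0} ≤ 1 + r * 2 ^ (ℓ - t) ∧ τ.nat NB 0 ≠ 0 ∧
    (∀ j < β * β, τ.nat AL j ≠ 0 → σ.nat AL j ≠ 0) ∧
    (WalksOk N s β pt (σ.nat AL) → #{j ∈ range (β * β) | τ.nat AL j ≠ 0} * 2 ^ r ≤ β * β ∧
      ∀ j < β * β, σ.nat AL j ≠ 0 → τ.nat AL j ≠ 0 ∨ ∃ x < s, τ.nat NB (vert β pt x j) ≠ 0))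
    (by rw [h6]; simp [lg5]) rfl rfl ?_ ?_ ?_).mono le_rfl le_rfl ?_
  · intro r τ τ' hn _ hI
    rw [hn NB (by decide), hn AL (by decide)]; exact hI
  · rw [nb6, al6]
    refine ⟨?_, (nb5 0 hN0).2 rfl, fun _ _ h => h, fun _ => ⟨?_, fun _ _ h => Or.inl h⟩⟩
    · calc #{v ∈ range N | τ5.nat NB v ≠ 0} ≤ #{0} := by
            refine card_le_card fun v hv => ?_
            simp only [mem_filter, mem_range] at hv
            rw [mem_singleton]
            exact (nb5 v hv.1).1 hv.2
        _ ≤ _ := by simp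
    · simpa using (card_filter_le (range (β * β)) fun j => σ.nat AL j ≠ 0)
  · intro r hr τ hA hit ⟨hI1, hI2, hI3, hI4⟩
    have hD : HitData N ℓ s β pt τ := hD6.agree hA rfl
    refine (greedyP_spec hD hβ hT hs ht hℓ hN b1 b2 b3).mono le_rfl le_rfl ?_
    intro τ' hA' _ ⟨g1, g2, g3, g4⟩
    refine ⟨?_, g2 0 hN0 hI2, fun j hj ha => hI3 j hj (g3 j hj ha), fun hok => ?_⟩
    · rw [Nat.succ_mul]; omega
    · obtain ⟨i1, i2⟩ := hI4 hok
      obtain ⟨k1, k2⟩ := g4 (hok.mono hI3)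
      refine ⟨?_, fun j hj ha => ?_⟩
      · calc #{j ∈ range (β * β) | τ'.nat AL j ≠ 0} * 2 ^ (r + 1) =
              2 * #{j ∈ range (β * β) | τ'.nat AL j ≠ 0} * 2 ^ r := by ring
          _ ≤ _ := Nat.mul_le_mul_right _ k1
          _ ≤ _ := i1
      · rcases i2 j hj ha with h | ⟨x, hx, h⟩
        · exact k2 j hj h
        · exact Or.inr ⟨x, hx, g2 _ (by
            exact (hok j hj ha).1 x hx) h⟩
  · intro τ _ _ ⟨hI1, hI2, hI3, hI4⟩
    refine ⟨hI1, hI2, fun hok j hj ha => ?_⟩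
    obtain ⟨i1, i2⟩ := hI4 hok
    rcases i2 j hj ha with h | h
    · exfalso
      have c : 1 ≤ #{j ∈ range (β * β) | τ.nat AL j ≠ 0} :=
        card_pos.2 ⟨j, mem_filter.2 ⟨mem_range.2 hj, h⟩⟩
      have e1 : β * β ≤ 2 ^ (2 * ℓ) := by
        rw [two_mul, pow_add]; exact Nat.mul_le_mul hβN hβN
      have e2 : 2 ^ (2 * ℓ + 1) ≤ #{j ∈ range (β * β) | τ.nat AL j ≠ 0} * 2 ^ (2 * ℓ + 1) :=
        Nat.le_mul_of_pos_left _ c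
      rw [pow_succ] at e2 i1
      have : 0 < 2 ^ (2 * ℓ) := by positivity
      omega
    · exact h

/-- Lists the new hubs. -/
def compactP : Prog :=
  setS LEN (sc NN) ;;
  .parNat (sc LEN) 1 V ix (.lt 0 (.read NB ix)) ;;
  sumP ;;
  setS BB (.read V 0) ;;
  .parNat (sc NN) (.read NB ix) HB (sc BB - .read V ix) ix

/-- The suffix sums of the indicator of the new hubs give each of them its place in the list. The
vertex `0` comes first, since the places increase with the vertices. -/
lemma compactP_spec {T : ℕ} (hNN : σ.nat NN 0 = N) (hN0 : 0 < N) (hT : N ≤ 2 ^ T)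
    (hNB : 2 * N ≤ B) (h0 : σ.nat NB 0 ≠ 0) :
    Spec W B compactP σ ((T + 1) * (N + 4) + N + 5) (T * 3 + 6) (fun τ => ∃ β,
      τ.nat BB 0 = β ∧ β = #{v ∈ range N | σ.nat NB v ≠ 0} ∧ 0 < β ∧ τ.nat HB 0 = 0 ∧
      (∀ b < β, τ.nat HB b < N) ∧ ∀ v < N, σ.nat NB v ≠ 0 → ∃ b < β, τ.nat HB b = v) := by
  have h100 := Good.hundred_le_bound W B
  set p : ℕ → Prop := fun v => σ.nat NB v ≠ 0 with hp
  have hple : ∑ j ∈ range N, (if p j then 1 else 0) ≤ N := by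
    rw [← card_filter]
    exact (card_filter_le _ _).trans (by simp)
  refine Spec.mono (w := 2 + ((N + 1) + ((T * (N + 4) + 3) + (2 + (N + 1)))))
    (d := 1 + (1 + ((T * 3 + 2) + (1 + 1)))) ?_ (by rw [Nat.succ_mul]; omega) (by omega)
    (fun _ _ _ h => h)
  refine Spec.seq (Spec.setS rfl (by rw [ev_sc, hNN]; omega)) fun τ1 hA1 h1 => ?_
  have len1 : τ1.nat LEN 0 = N := by rw [h1, ev_sc, hNN]
  refine Spec.seq (Spec.parNi N (by simp [len1]) (by omega) rfl (fun i _ _ => by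
    rw [ev_lt]; split_ifs <;> omega)) fun τ2 hA2 h2 => ?_
  refine Spec.seq (sumP_spec (fun j => if p j then 1 else 0) (by rw [hA2.n LEN rfl, len1]) hT hNB
    (fun i hi => ?_) (by omega)) fun τ3 hA3 h3 => ?_
  · rw [h2, if_pos ⟨hi, by simp⟩, ev_lt]
    refine if_congr ?_ rfl rfl
    rw [ev_ofNat, ev_read, ev_ix, hA1.n NB rfl, Nat.pos_iff_ne_zero]
  have rk : ∀ v < N, τ3.nat V 0 - τ3.nat V v = Nat.count p v := fun v hv => by
    rw [h3 0 hN0, h3 v hv]; exact count_suffix p hv.le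
  have V0 : τ3.nat V 0 = Nat.count p N := by
    have := count_suffix p (le_refl N)
    rw [Ico_self, sum_empty, Nat.sub_zero] at this
    rw [h3 0 hN0, this]
  have cle : Nat.count p N ≤ N := Nat.count_le _
  refine Spec.seq (Spec.setS rfl (by rw [ev_read, ev_ofNat, V0]; omega)) fun τ4 hA4 h4 => ?_
  have bb4 : τ4.nat BB 0 = Nat.count p N := by rw [h4, ev_read, ev_ofNat, V0]
  have nb4 : τ4.nat NB = σ.nat NB := by
    rw [hA4.n NB rfl, hA3.n NB rfl, hA2.n NB rfl, hA1.n NB rfl]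
  have addr : ∀ i < N, (sc BB - .read V ix : NExp).ev τ4 i = Nat.count p i := fun i hi => by
    rw [ev_sub, ev_sc, ev_read, ev_ix, bb4, hA4.n V rfl, ← rk i hi, V0]
  refine (Spec.parN N (by
    simp [hA4.n NN rfl, hA3.n NN rfl, hA2.n NN rfl, hA1.n NN rfl, hNN]) (by omega) rfl ?_
    (fun i hi _ => by rw [ev_ix]; omega)).mono le_rfl le_rfl ?_
  · intro i j hi hj hgi hgj he
    rw [addr i hi, addr j hj] at he
    rw [ev_read, ev_ix, nb4] at hgi hgj
    exact Nat.count_injective (p := p) hgi hgj he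
  intro τ hA _ ⟨h5, _⟩
  have hb : ∀ v < N, p v → τ.nat HB (Nat.count p v) = v := fun v hv hpv => by
    have := h5 v hv (by rw [ev_read, ev_ix, nb4]; exact hpv)
    rwa [addr v hv, ev_ix] at this
  have lt : ∀ v < N, p v → Nat.count p v < Nat.count p N := fun v hv hpv =>
    Nat.count_strict_mono hpv hv
  refine ⟨Nat.count p N, by rw [hA.n BB rfl, bb4], by rw [Nat.count_eq_card_filter_range],
    (Nat.zero_le _).trans_lt (lt 0 hN0 h0), ?_, fun b hb' => ?_, fun v hv hpv => ?_⟩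
  · have := hb 0 hN0 h0
    rwa [Nat.count_zero] at this
  · obtain ⟨v, hv, hpv, rfl⟩ := exists_of_lt_count p hb'
    rw [hb v hv hpv]; exact hv
  · exact ⟨_, lt v hv hpv, hb v hv hpv⟩
end

end Par

/-! ### Passing to the next scale -/

namespace Par
open Finset

/-- Replaces the hubs for the distance `g` by hubs for the distance `4 * g`. -/
def scaleP : Prog :=
  setS LL (3 * sc HH) ;; layersP ;; pathsP ;; hitP ;; compactP ;; setS HH (4 * sc HH)

/-- State of the computation at the scale `g`: there are few hubs, the vertex `0` is one of them,
and in the absence of negative cycles they meet all shortest walks with at least `g` edges. -/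
structure ScaleInv (w : ℕ → ℕ → WithTop ℝ) (ℓ N M g : ℕ) (σ : Mem) : Prop where
  graph : GraphList w ℓ N M σ
  nn : σ.nat NN 0 = N
  ee : σ.nat EE 0 = 2 ^ ℓ
  hh : σ.nat HH 0 = g
  pos : 0 < σ.nat BB 0
  le : σ.nat BB 0 ≤ N
  few : σ.nat BB 0 * g ≤ 16 * ℓ * N
  zero : σ.nat HB 0 = 0
  lt : ∀ b < σ.nat BB 0, σ.nat HB b < N
  hubs : NoNeg N w → IsHubSet N w (fun v => ∃ b < σ.nat BB 0, σ.nat HB b = v) g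

/-- Sizes of the graph and of the words. -/
structure Sizes (B ℓ N M : ℕ) : Prop where
  pos : 1 ≤ ℓ
  le : N ≤ 2 ^ ℓ
  ge : 2 ^ ℓ ≤ 2 * N
  edges : M ≤ N * N
  word : 100 * (2 ^ ℓ) ^ 6 ≤ B

/-- The number `Λ` of index pairs of vertices on the walks is `4 (β g) ^ 2`, which is at most
`1024 (ℓ N) ^ 2` by the bound on the number of hubs. -/
lemma halveW_le {ℓ Λ N : ℕ} (hℓ : 1 ≤ ℓ) (hN : 1 ≤ N) (hΛ : Λ ≤ 1024 * (ℓ ^ 2 * N ^ 2)) :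
    halveW ℓ (4 * ℓ) Λ N ≤ 21000 * (ℓ ^ 4 * N ^ 2) := by
  have p1 : 1 ≤ ℓ ^ 2 * N ^ 2 := Nat.mul_pos (by positivity) (by positivity)
  have h1 : (2 * (4 * ℓ) + 2) * (Λ + 4) ≤ (10 * ℓ) * (1028 * (ℓ ^ 2 * N ^ 2)) :=
    Nat.mul_le_mul (by omega) (by omega)
  have h2 : N ≤ ℓ ^ 3 * N ^ 2 := by
    calc N = 1 * N ^ 1 := by ring
      _ ≤ ℓ ^ 3 * N ^ 2 := Nat.mul_le_mul (Nat.one_le_pow _ _ hℓ) (Nat.pow_le_pow_right hN (by omega))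
  have h3 : ℓ ^ 3 * N ^ 2 ≤ ℓ ^ 4 * N ^ 2 :=
    Nat.mul_le_mul_right _ (Nat.pow_le_pow_right hℓ (by omega))
  have e1 : (10 * ℓ) * (1028 * (ℓ ^ 2 * N ^ 2)) = 10280 * (ℓ ^ 3 * N ^ 2) := by ring
  have h4 : (ℓ + 1) * ((2 * (4 * ℓ) + 2) * (Λ + 4) + N + 8) ≤
      (2 * ℓ) * (10289 * (ℓ ^ 3 * N ^ 2)) := Nat.mul_le_mul (by omega) (by omega)
  have e2 : (2 * ℓ) * (10289 * (ℓ ^ 3 * N ^ 2)) = 20578 * (ℓ ^ 4 * N ^ 2) := by ring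
  unfold halveW
  omega

/-- The work of one scale. -/
lemma scale_work_le {ℓ N M g β : ℕ} (hℓ : 1 ≤ ℓ) (hg : 1 ≤ g) (hβ : 1 ≤ β) (hβN : β ≤ N)
    (hC : β * g ≤ 16 * ℓ * N) (hgN : g ≤ N) :
    2 + ((3 * g * (β * M + (ℓ + (2 * ℓ + 1) + 1) * (β * (M / ℓ + N) + 4) + 3 * (β * N) + 16) +
      2 * (β * N) + 7) + ((3 * g * (2 * (β * β) + 5) + 2 * (β * β) + 5) +
      (((2 * ℓ + 1) * (ℓ * (halveW ℓ (4 * ℓ) (β * β * (2 * g * (2 * g))) N + 1) + 3 * N +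
        2 * g * (β * β + 4) + 12) + 2 * (β * β * (2 * g * (2 * g))) + N + 12) +
      (((ℓ + 1) * (N + 4) + N + 5) + 2)))) ≤
      100000 * (ℓ * N * M + ℓ ^ 6 * N ^ 2) := by
  have hN : 1 ≤ N := by omega
  set a := ℓ ^ 6 * N ^ 2 with ha
  have mono : ∀ i ≤ 6, ∀ j ≤ 2, ℓ ^ i * N ^ j ≤ a := fun i hi j hj =>
    Nat.mul_le_mul (Nat.pow_le_pow_right hℓ hi) (Nat.pow_le_pow_right hN hj)
  have a1 : 1 ≤ a := by simpa using mono 0 (by omega) 0 (by omega)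
  have aN : N ≤ a := by simpa using mono 0 (by omega) 1 (by omega)
  have aN2 : N ^ 2 ≤ a := by simpa using mono 0 (by omega) 2 (by omega)
  have a12 := mono 1 (by omega) 2 (by omega)
  have a22 := mono 2 (by omega) 2 (by omega)
  have a11 := mono 1 (by omega) 1 (by omega)
  rw [pow_one] at a12 a11
  rw [pow_one] at a11
  have bN : β * N ≤ N ^ 2 := by rw [sq]; exact Nat.mul_le_mul_right _ hβN
  have bb : β * β ≤ N ^ 2 := by rw [sq]; exact Nat.mul_le_mul hβN hβN
  -- the layers
  have l1 : (ℓ + (2 * ℓ + 1) + 1) * (β * (M / ℓ + N) + 4) ≤ 5 * (β * M) + 5 * (β * (ℓ * N)) + 20 * ℓ := by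
    have := Nat.mul_div_le M ℓ
    calc (ℓ + (2 * ℓ + 1) + 1) * (β * (M / ℓ + N) + 4) ≤ (5 * ℓ) * (β * (M / ℓ + N) + 4) :=
          Nat.mul_le_mul_right _ (by omega)
      _ = 5 * (β * (ℓ * (M / ℓ))) + 5 * (β * (ℓ * N)) + 20 * ℓ := by ring
      _ ≤ _ := by gcongr
  have l2 : ℓ ≤ β * (ℓ * N) := by
    calc ℓ = 1 * (ℓ * 1) := by ring
      _ ≤ _ := by gcongr
  have l3 : β * N ≤ β * (ℓ * N) := Nat.mul_le_mul_left _ (Nat.le_mul_of_pos_left _ hℓ)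
  have l4 : 3 * g * (β * M + (ℓ + (2 * ℓ + 1) + 1) * (β * (M / ℓ + N) + 4) + 3 * (β * N) + 16) ≤
      288 * (ℓ * N * M) + 2112 * a := by
    calc _ ≤ 3 * g * (6 * (β * M) + 44 * (β * (ℓ * N))) := Nat.mul_le_mul_left _ (by omega)
      _ = 18 * (β * g * M) + 132 * (β * g * (ℓ * N)) := by ring
      _ ≤ 18 * (16 * ℓ * N * M) + 132 * (16 * ℓ * N * (ℓ * N)) := by gcongr
      _ = 288 * (ℓ * N * M) + 2112 * (ℓ ^ 2 * N ^ 2) := by ring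
      _ ≤ _ := by omega
  -- the walks
  have p1 : 3 * g * (2 * (β * β) + 5) ≤ 336 * a := by
    have : 1 ≤ β * β := Nat.mul_pos hβ hβ
    calc 3 * g * (2 * (β * β) + 5) ≤ 3 * g * (7 * (β * β)) := Nat.mul_le_mul_left _ (by omega)
      _ = 21 * (β * g * β) := by ring
      _ ≤ 21 * (16 * ℓ * N * N) := by gcongr
      _ = 336 * (ℓ * N ^ 2) := by ring
      _ ≤ _ := by omega
  -- the hitting set
  set Λ := β * β * (2 * g * (2 * g)) with hΛ
  have h1 : Λ ≤ 1024 * (ℓ ^ 2 * N ^ 2) := by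
    calc Λ = 4 * ((β * g) * (β * g)) := by rw [hΛ]; ring
      _ ≤ 4 * ((16 * ℓ * N) * (16 * ℓ * N)) := by gcongr
      _ = _ := by ring
  have h2 := halveW_le hℓ hN h1
  have h3 : 2 * g * (β * β + 4) ≤ 5120 * (ℓ ^ 2 * N ^ 2) := by
    have : 1 ≤ β * β := Nat.mul_pos hβ hβ
    calc 2 * g * (β * β + 4) ≤ 2 * g * (5 * (β * β)) := Nat.mul_le_mul_left _ (by omega)
      _ = 5 * (β * β * (2 * g * 1)) := by ring
      _ ≤ 5 * Λ := by rw [hΛ]; gcongr; omega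
      _ ≤ _ := by omega
  have c1 : ℓ ^ 2 * N ^ 2 ≤ ℓ ^ 5 * N ^ 2 :=
    Nat.mul_le_mul_right _ (Nat.pow_le_pow_right hℓ (by omega))
  have c2 : N ≤ ℓ ^ 5 * N ^ 2 := by
    calc N = 1 * N ^ 1 := by ring
      _ ≤ ℓ ^ 5 * N ^ 2 := Nat.mul_le_mul (Nat.one_le_pow _ _ hℓ) (Nat.pow_le_pow_right hN (by omega))
  have c3 : ℓ ≤ ℓ ^ 5 * N ^ 2 := by
    calc ℓ = ℓ ^ 1 * 1 := by ring
      _ ≤ ℓ ^ 5 * N ^ 2 := Nat.mul_le_mul (Nat.pow_le_pow_right hℓ (by omega)) (Nat.one_le_pow _ _ hN)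
  have h4 : ℓ * (halveW ℓ (4 * ℓ) Λ N + 1) ≤ 21001 * (ℓ ^ 5 * N ^ 2) := by
    calc ℓ * (halveW ℓ (4 * ℓ) Λ N + 1) ≤ ℓ * (21000 * (ℓ ^ 4 * N ^ 2)) + ℓ := by
          rw [Nat.mul_add, mul_one]; gcongr
      _ = 21000 * (ℓ ^ 5 * N ^ 2) + ℓ := by ring
      _ ≤ _ := by omega
  have h5 : (2 * ℓ + 1) * (ℓ * (halveW ℓ (4 * ℓ) Λ N + 1) + 3 * N + 2 * g * (β * β + 4) + 12) ≤
      87408 * a := by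
    calc _ ≤ (3 * ℓ) * (29136 * (ℓ ^ 5 * N ^ 2)) := Nat.mul_le_mul (by omega) (by omega)
      _ = 87408 * (ℓ ^ 6 * N ^ 2) := by ring
  have d1 : (ℓ + 1) * (N + 4) ≤ 10 * a := by
    calc (ℓ + 1) * (N + 4) ≤ (2 * ℓ) * (5 * N) := Nat.mul_le_mul (by omega) (by omega)
      _ = 10 * (ℓ * N) := by ring
      _ ≤ _ := by omega
  omega

section
variable {W B : ℕ} [hg : Good W B] {σ : Mem}

/-- The bound on the number of hubs makes the work of all scales equal: there are `O(g)` layers, each of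
them with `β = O(ℓ N / g)` rows. -/
lemma scaleP_spec {w : ℕ → ℕ → WithTop ℝ} {ℓ N M g t : ℕ} (hS : Sizes B ℓ N M)
    (h : ScaleInv w ℓ N M g σ) (hgt : 2 * g = 2 ^ t) (ht : t ≤ ℓ) :
    Spec W B scaleP σ (100000 * (ℓ * N * M + ℓ ^ 6 * N ^ 2)) (500 * (ℓ * g + ℓ ^ 4))
      (ScaleInv w ℓ N M (4 * g)) := by
  have h100 := Good.hundred_le_bound W B
  obtain ⟨pos, le, ge, edges, word⟩ := hS
  set E := 2 ^ ℓ with hE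
  have E1 : 1 ≤ E := Nat.one_le_two_pow
  have g1 : 1 ≤ g := by
    have : 0 < 2 ^ t := by positivity
    omega
  have gE : 2 * g ≤ E := hgt ▸ Nat.pow_le_pow_right (by omega) ht
  set β := σ.nat BB 0 with hβ
  have hβ0 := h.pos
  have hβN := h.le
  have hN0 : 0 < N := by omega
  have powE : ∀ i ≤ 6, E ^ i ≤ E ^ 6 := fun i hi => Nat.pow_le_pow_right E1 hi
  have E6 := powE 5 (by omega)
  have E3 := powE 3 (by omega)
  have E2 := powE 2 (by omega)
  have E4 := powE 1 (by omega)
  rw [pow_one] at E4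
  have sq : N * N ≤ E ^ 2 := by rw [pow_two]; exact Nat.mul_le_mul le le
  have bM : β * M ≤ E ^ 3 := by
    calc β * M ≤ E * (E * E) := Nat.mul_le_mul (by omega) (edges.trans (Nat.mul_le_mul le le))
      _ = E ^ 3 := by ring
  have bN : β * N ≤ E ^ 2 := by rw [pow_two]; exact Nat.mul_le_mul (by omega) le
  have bb : β * β ≤ E ^ 2 := by rw [pow_two]; exact Nat.mul_le_mul (by omega) (by omega)
  have hMl : M / ℓ ≤ M := Nat.div_le_self _ _
  have bMl : β * (M / ℓ + N) ≤ E ^ 3 + E ^ 2 := by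
    rw [Nat.mul_add]
    exact Nat.add_le_add ((Nat.mul_le_mul_left _ hMl).trans bM) bN
  have hTr : M / ℓ + N ≤ 2 ^ (2 * ℓ + 1) := by
    rw [pow_succ, mul_comm 2 ℓ, pow_mul, ← hE]
    have : N ≤ N * N := Nat.le_mul_self N
    omega
  have hΛ : β * β * (2 * g * (2 * g)) ≤ E ^ 4 := by
    calc _ ≤ E ^ 2 * (E * E) := Nat.mul_le_mul bb (Nat.mul_le_mul gE gE)
      _ = E ^ 4 := by ring
  have hTΛ : β * β * (2 * g * (2 * g)) ≤ 2 ^ (4 * ℓ) := by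
    rw [mul_comm 4 ℓ, pow_mul]; exact hΛ
  have bΛ : β * β * (2 * g * (2 * g)) * (3 * (2 * g)) ≤ B := by
    calc _ ≤ E ^ 4 * (3 * E) := Nat.mul_le_mul hΛ (by omega)
      _ = 3 * E ^ 5 := by ring
      _ ≤ B := by omega
  refine Spec.mono (w := 2 + ((3 * g * (β * M + (ℓ + (2 * ℓ + 1) + 1) * (β * (M / ℓ + N) + 4) +
      3 * (β * N) + 16) + 2 * (β * N) + 7) + ((3 * g * (2 * (β * β) + 5) + 2 * (β * β) + 5) +
      (((2 * ℓ + 1) * (ℓ * (halveW ℓ (4 * ℓ) (β * β * (2 * g * (2 * g))) N + 1) + 3 * N +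
        2 * g * (β * β + 4) + 12) + 2 * (β * β * (2 * g * (2 * g))) + N + 12) +
      (((ℓ + 1) * (N + 4) + N + 5) + 2)))))
    (d := 1 + ((3 * g * (3 * ℓ + 3 * (2 * ℓ + 1) + 13) + 5) + ((3 * g * 4 + 4) +
      (((2 * ℓ + 1) * (ℓ * (halveD ℓ (4 * ℓ) + 1) + 3 * (2 * g) + 9) + 8) + ((ℓ * 3 + 6) + 1)))))
    ?_ (scale_work_le pos g1 hβ0 hβN h.few (by omega)) ?_ (fun _ _ _ h => h)
  rotate_left
  · have e1 : 3 * g * (3 * ℓ + 3 * (2 * ℓ + 1) + 13) = 27 * (ℓ * g) + 48 * g := by ring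
    have e2 : g ≤ ℓ * g := Nat.le_mul_of_pos_left _ pos
    have e3 : (2 * ℓ + 1) * (ℓ * (halveD ℓ (4 * ℓ) + 1) + 3 * (2 * g) + 9) =
        48 * ℓ ^ 4 + 94 * ℓ ^ 3 + 79 * ℓ ^ 2 + 40 * ℓ + 9 + 12 * (ℓ * g) + 6 * g := by
      unfold halveD; ring
    have p : ∀ i ≤ 4, ℓ ^ i ≤ ℓ ^ 4 := fun i hi => Nat.pow_le_pow_right pos hi
    have p3 := p 3 (by omega)
    have p2 := p 2 (by omega)
    have p1 := p 1 (by omega)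
    rw [pow_one] at p1
    omega
  refine Spec.seq (Spec.setS rfl (by rw [ev_mul, ev_ofNat, ev_sc, h.hh]; omega)) fun τ1 hA1 h1 => ?_
  have L1 : τ1.nat LL 0 = 3 * g := by rw [h1, ev_mul, ev_ofNat, ev_sc, h.hh]
  have n1 : ∀ a, a ≠ LL → τ1.nat a = σ.nat a := fun a ha => hA1.n a (by simp [setS, Prog.wN, ha])
  have gr1 : GraphList w ℓ N M τ1 := h.graph.congr (by
    simp only [List.mem_cons, List.not_mem_nil, or_false, forall_eq_or_imp, forall_eq]
    refine ⟨?_, ?_, ?_, ?_, ?_, ?_, ?_, ?_⟩ <;> exact n1 _ (by decide)) (hA1.r WT rfl)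
  have hb1 : τ1.nat HB = σ.nat HB := n1 HB (by decide)
  refine Spec.seq (layersP_spec gr1 (by rw [n1 NN (by decide), h.nn])
    (by rw [n1 BB (by decide)]) L1 hTr (by omega) (by omega) (by omega) (by omega))
    fun τ2 hA2 ⟨h2, h2'⟩ => ?_
  rw [hb1] at h2 h2'
  have n2 : ∀ a, layersP.wN a = false → a ≠ LL → τ2.nat a = σ.nat a := fun a hz ha => by
    rw [hA2.n a hz, n1 a ha]
  have hb2 : τ2.nat HB = σ.nat HB := n2 HB rfl (by decide)
  refine Spec.seq (pathsP_spec (w := w) (g := g) (by rw [n2 NN rfl (by decide), h.nn])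
    (by rw [n2 BB rfl (by decide)]) (by rw [hA2.n LL rfl, L1])
    (by rw [n2 HH rfl (by decide), h.hh]) (by rw [hb2]; exact h.lt) (by rw [hb2]; exact h2)
    (by rw [hb2]; exact h2') (by omega)) fun τ3 hA3 h3 => ?_
  rw [hb2] at h3
  have n3 : ∀ a, pathsP.wN a = false → layersP.wN a = false → a ≠ LL → τ3.nat a = σ.nat a :=
    fun a hy hz ha => by rw [hA3.n a hy, n2 a hz ha]
  have paths : NoNeg N w → Paths N w (2 * g) (3 * g) β (σ.nat HB) (τ3.nat AL) (τ3.nat PT) :=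
    fun hnn => paths_of_isPath hnn (by omega) (by omega) h.lt fun a ha b hb =>
      ⟨(h3 a ha b hb).1, (h3 a ha b hb).2.2⟩
  refine Spec.seq (hitP_spec (s := 2 * g) (t := t) (T := 4 * ℓ) (pt := τ3.nat PT)
    (by rw [n3 NN rfl rfl (by decide), h.nn]) (by rw [n3 BB rfl rfl (by decide)])
    (by rw [n3 HH rfl rfl (by decide), h.hh])
    (by rw [n3 LG rfl rfl (by decide), h.graph.list.lgEq])
    (by rw [n3 EE rfl rfl (by decide), h.ee]) rfl hβ0 rfl hTΛ hgt ht pos hN0 le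
    (by omega) bΛ (by omega) (by omega)) fun τ4 hA4 ⟨h4, h4', h4''⟩ => ?_
  have n4 : ∀ a, hitP.wN a = false → pathsP.wN a = false → layersP.wN a = false → a ≠ LL →
      τ4.nat a = σ.nat a := fun a hx hy hz ha => by rw [hA4.n a hx, n3 a hy hz ha]
  refine Spec.seq (compactP_spec (T := ℓ) (by rw [n4 NN rfl rfl rfl (by decide), h.nn]) hN0 le
    (by omega) h4') fun τ5 hA5 ⟨β', c1, c2, c3, c4, c5, c6⟩ => ?_
  have n5 : ∀ a, compactP.wN a = false → hitP.wN a = false → pathsP.wN a = false →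
      layersP.wN a = false → a ≠ LL → τ5.nat a = σ.nat a :=
    fun a hw hx hy hz ha => by rw [hA5.n a hw, n4 a hx hy hz ha]
  refine (Spec.setS rfl (by
    rw [ev_mul, ev_ofNat, ev_sc, n5 HH rfl rfl rfl rfl (by decide), h.hh]; omega)).mono
    le_rfl le_rfl ?_
  intro τ hA _ hτ
  have e1 : τ.nat BB 0 = β' := by rw [hA.n BB rfl, c1]
  have e2 : τ.nat HB = τ5.nat HB := hA.n HB rfl
  refine ⟨h.graph.congr ?_ ?_, ?_, ?_, ?_, ?_, ?_, ?_, ?_, ?_, ?_⟩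
  · simp only [List.mem_cons, List.not_mem_nil, or_false, forall_eq_or_imp, forall_eq]
    refine ⟨?_, ?_, ?_, ?_, ?_, ?_, ?_, ?_⟩ <;>
      exact (hA.n _ rfl).trans (n5 _ rfl rfl rfl rfl (by decide))
  · rw [hA.r WT rfl, hA5.r WT rfl, hA4.r WT rfl, hA3.r WT rfl, hA2.r WT rfl, hA1.r WT rfl]
  · rw [hA.n NN rfl, n5 NN rfl rfl rfl rfl (by decide), h.nn]
  · rw [hA.n EE rfl, n5 EE rfl rfl rfl rfl (by decide), h.ee]
  · rw [hτ, ev_mul, ev_ofNat, ev_sc, n5 HH rfl rfl rfl rfl (by decide), h.hh]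
  · rw [e1]; exact c3
  · rw [e1, c2]; exact (card_filter_le _ _).trans (by simp)
  · rw [e1, show 4 * g = 2 * (2 * g) by ring, c2]
    -- the hitting set has at most `1 + (2 * ℓ + 1) * 2 ^ ℓ / (2 * g)` vertices
    have e3 : 2 ^ (ℓ - t) * (2 * g) = E := by
      rw [hgt, ← pow_add, Nat.sub_add_cancel ht]
    calc #{v ∈ range N | τ4.nat NB v ≠ 0} * (2 * (2 * g)) ≤
          (1 + (2 * ℓ + 1) * 2 ^ (ℓ - t)) * (2 * (2 * g)) := Nat.mul_le_mul_right _ h4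
      _ = 2 * (2 * g) + 2 * ((2 * ℓ + 1) * (2 ^ (ℓ - t) * (2 * g))) := by ring
      _ ≤ 2 * (2 * N) + 2 * ((2 * ℓ + 1) * (2 * N)) := by rw [e3]; gcongr; omega
      _ = 8 * N + 8 * (ℓ * N) := by ring
      _ ≤ 16 * (ℓ * N) := by
          have : N ≤ ℓ * N := Nat.le_mul_of_pos_left _ pos
          omega
      _ = 16 * ℓ * N := by ring
  · rw [e2, c4]
  · rw [e1, e2]; exact c5
  · intro hnn
    have hp := paths hnn
    have hok : WalksOk N (2 * g) β (τ3.nat PT) (τ3.nat AL) := fun j hj ha =>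
      ⟨hp.lt j hj ha, hp.inj j hj ha⟩
    refine IsHubSet.step hnn g1 (h.hubs hnn) ?_
    rintro a - b - ⟨a', ha', rfl⟩ ⟨b', hb', rfl⟩ k hk h5 h6
    obtain ⟨hal, hon⟩ := hp.on a' ha' b' hb' k hk h5 h6
    have hj : a' * β + b' < β * β := mul_add_lt hb' ha'
    obtain ⟨x, hx, hx'⟩ := h4'' hok _ hj hal
    have hlt := hp.lt _ hj hal x hx
    rw [e1, e2]
    exact ⟨_, hlt, c6 _ hlt hx', x, _, hon x hx, hx⟩
end

end Par

/-! ### Running through the scales -/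

namespace Par
open Finset

/-- Makes all vertices hubs. -/
def initP : Prog := setS BB (sc NN) ;; .parNat (sc NN) 1 HB ix ix ;; setS HH 1

/-- Thins out the hubs until the hub distance is close to `h / ℓ`. -/
def scalesP : Prog := .loop (.le (4 * sc HH * sc LG) (.read 0 2)) scaleP

section
variable {W B : ℕ} [hg : Good W B] {σ : Mem}

/-- At the scale `1` every vertex is a hub. -/
lemma initP_spec {w : ℕ → ℕ → WithTop ℝ} {ℓ N M : ℕ} (hG : GraphList w ℓ N M σ)
    (hnn : σ.nat NN 0 = N) (hee : σ.nat EE 0 = 2 ^ ℓ) (hN : 1 ≤ N) (b : N ≤ B) :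
    Spec W B initP σ (N + 5) 3 (ScaleInv w ℓ N M 1) := by
  have h100 := Good.hundred_le_bound W B
  refine Spec.mono (w := 2 + ((N + 1) + 2)) (d := 1 + (1 + 1)) ?_ (by omega) (by omega)
    (fun _ _ _ h => h)
  refine Spec.seq (Spec.setS rfl (by rw [ev_sc, hnn]; exact b)) fun τ1 hA1 h1 => ?_
  refine Spec.seq (Spec.parNi N (by rw [ev_sc, hA1.n NN rfl, hnn]) b rfl (fun i hi _ => by
    rw [ev_ix]; omega)) fun τ2 hA2 h2 => ?_
  refine (Spec.setS (e := 1) rfl (by rw [ev_ofNat]; omega)).mono le_rfl le_rfl fun τ hA _ h3 => ?_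
  have n : ∀ a, a ≠ BB → a ≠ HB → a ≠ HH → τ.nat a = σ.nat a := fun a ha hb hc => by
    rw [hA.n a (by simp [setS, Prog.wN, hc]), hA2.n a (by simp [Prog.wN, hb]),
      hA1.n a (by simp [setS, Prog.wN, ha])]
  have eB : τ.nat BB 0 = N := by rw [hA.n BB rfl, hA2.n BB rfl, h1, ev_sc, hnn]
  have eH : ∀ b < N, τ.nat HB b = b := fun b hb => by
    rw [hA.n HB rfl, h2, if_pos ⟨hb, by simp⟩, ev_ix]
  refine ⟨hG.congr ?_ ?_, ?_, ?_, ?_, ?_, ?_, ?_, ?_, ?_, ?_⟩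
  · simp only [List.mem_cons, List.not_mem_nil, or_false, forall_eq_or_imp, forall_eq]
    refine ⟨?_, ?_, ?_, ?_, ?_, ?_, ?_, ?_⟩ <;> exact n _ (by decide) (by decide) (by decide)
  · rw [hA.r WT rfl, hA2.r WT rfl, hA1.r WT rfl]
  · rw [n NN (by decide) (by decide) (by decide), hnn]
  · rw [n EE (by decide) (by decide) (by decide), hee]
  · rw [h3, ev_ofNat]
  · omega
  · omega
  · rw [eB]
    have := Nat.mul_le_mul_right N hG.list.pos
    nlinarith
  · exact eH 0 hN
  · rw [eB]; intro b hb; rw [eH b hb]; exact hb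
  · intro hnn
    rw [eB]
    exact isHubSet_all hnn fun v hv => ⟨v, hv, eH v hv⟩

/-- At most `ℓ` scales are passed, since `4 ^ i` exceeds `h < 2 ^ ℓ` after `ℓ` of them; the depths form a
geometric series, dominated by the last scale, where `g * ℓ` is about `h`. -/
lemma scalesP_spec {w : ℕ → ℕ → WithTop ℝ} {ℓ N M h : ℕ} (hS : Sizes B ℓ N M)
    (hI : ScaleInv w ℓ N M 1 σ) (hh : σ.nat 0 2 = h) (hN : h < N) :
    Spec W B scalesP σ (ℓ * (100000 * (ℓ * N * M + ℓ ^ 6 * N ^ 2) + 1) + 1)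
      (500 * (h + ℓ ^ 5) + ℓ + 1)
      (fun τ => ∃ g, ScaleInv w ℓ N M g τ ∧ 1 ≤ g ∧ h < 4 * g * ℓ ∧ g * ℓ ≤ h + ℓ) := by
  classical
  have hN2 := hS.le
  have pos := hS.pos
  have hex : ∃ i, h < 4 * 4 ^ i * ℓ := ⟨ℓ, by
    calc h < 2 ^ ℓ := by omega
      _ ≤ 4 ^ ℓ := Nat.pow_le_pow_left (by omega) ℓ
      _ ≤ 4 * 4 ^ ℓ * ℓ := by nlinarith [Nat.one_le_pow ℓ 4 (by omega)]⟩
  have hfind := Nat.find_spec hex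
  have hmin : ∀ i < Nat.find hex, 4 * 4 ^ i * ℓ ≤ h := fun i hi => not_lt.1 (Nat.find_min hex hi)
  set S := Nat.find hex with hSdef
  have hSℓ : ∀ i < S, 2 * i + 1 ≤ ℓ := fun i hi => by
    have h1 := hmin i hi
    have h2 : 2 ^ (2 * i + 1) ≤ 4 * 4 ^ i * ℓ := by
      rw [pow_succ, pow_mul]
      norm_num
      nlinarith [Nat.one_le_pow i 4 (by omega)]
    exact (Nat.pow_lt_pow_iff_right (a := 2) (by omega)).1 (by omega : 2 ^ (2 * i + 1) < 2 ^ ℓ) |>.le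
  have hS1 : S ≤ ℓ := by
    by_contra hc
    have := hSℓ ℓ (by omega)
    omega
  have hgeo : (∑ i ∈ range S, 4 ^ i) * ℓ ≤ h := by
    have e : ∀ k, ∑ i ∈ range k, 4 ^ i ≤ 4 ^ k := fun k => by
      induction k with
      | zero => simp
      | succ k ih => rw [sum_range_succ, pow_succ]; omega
    rcases Nat.eq_zero_or_pos S with h0 | h0
    · rw [h0]; simp
    · have := hmin (S - 1) (by omega)
      calc _ ≤ 4 ^ S * ℓ := Nat.mul_le_mul_right _ (e S)
        _ = 4 * 4 ^ (S - 1) * ℓ := by rw [← pow_succ', Nat.sub_add_cancel h0]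
        _ ≤ h := this
  refine (Spec.loop (P := scaleP) S (fun i => ScaleInv w ℓ N M (4 ^ i))
    (fun _ => 100000 * (ℓ * N * M + ℓ ^ 6 * N ^ 2)) (fun i => 500 * (ℓ * 4 ^ i + ℓ ^ 4)) rfl
    hI ?_ ?_).mono ?_ ?_ ?_
  · intro i hi τ hA hτ
    have e : τ.nat 0 2 = h := by rw [hA.n 0 rfl, hh]
    refine ⟨?_, ?_⟩
    · simp only [ev_le, ev_mul, ev_ofNat, ev_sc, ev_read, hτ.hh, hτ.graph.list.lgEq, e]
      rw [if_pos (hmin i hi)]; exact one_ne_zero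
    · show Spec W B scaleP τ _ _ (ScaleInv w ℓ N M (4 ^ (i + 1)))
      rw [pow_succ' 4 i]
      exact scaleP_spec hS hτ (t := 2 * i + 1) (by rw [pow_succ, pow_mul]; ring) (hSℓ i hi)
  · intro τ hA hτ
    have e : τ.nat 0 2 = h := by rw [hA.n 0 rfl, hh]
    simp only [ev_le, ev_mul, ev_ofNat, ev_sc, ev_read, hτ.hh, hτ.graph.list.lgEq, e]
    rw [if_neg (not_le.2 hfind)]
  · rw [sum_const, card_range, smul_eq_mul]
    exact Nat.add_le_add_right (Nat.mul_le_mul_right _ hS1) 1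
  · rw [sum_add_distrib, ← mul_sum, sum_add_distrib, ← mul_sum]
    simp only [sum_const, card_range, smul_eq_mul, mul_one]
    have h1 : S * ℓ ^ 4 ≤ ℓ ^ 5 := by rw [pow_succ ℓ 4, mul_comm (ℓ ^ 4)]; exact Nat.mul_le_mul_right _ hS1
    rw [mul_comm] at hgeo
    omega
  · intro τ _ _ hτ
    refine ⟨4 ^ S, hτ, Nat.one_le_pow _ _ (by omega), hfind, ?_⟩
    rcases Nat.eq_zero_or_pos S with h0 | h0
    · rw [h0]; omega
    · have := hmin (S - 1) (by omega)
      rw [← pow_succ', Nat.sub_add_cancel h0] at this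
      omega
end

end Par

/-! ### From the hubs to distances from the source -/

namespace Par
open Finset

/-- Least length of a concatenation of `2 ^ t` walks with at most `g` edges each, from `u` to `v`,
with all joints at the hubs `hb 0, …, hb (β - 1)`. -/
noncomputable def hubDist (N : ℕ) (w : ℕ → ℕ → WithTop ℝ) (g β : ℕ) (hb : ℕ → ℕ) :
    ℕ → ℕ → ℕ → WithTop ℝ
  | 0 => hopDist N w g
  | t + 1 => fun u v => (range β).inf fun b =>
      hubDist N w g β hb t u (hb b) + hubDist N w g β hb t (hb b) v

section pure
variable {N : ℕ} {w : ℕ → ℕ → WithTop ℝ} {g β : ℕ} {hb : ℕ → ℕ}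
local notation "D" => hopDist N w

/-- Hub-to-hub walks are walks, so that `hubDist` never underestimates a distance. -/
lemma le_hubDist (h : NoNeg N w) (hlt : ∀ b < β, hb b < N) (t : ℕ) {u v : ℕ} (hu : u < N)
    (hv : v < N) : D N u v ≤ hubDist N w g β hb t u v := by
  induction t generalizing u v with
  | zero => exact h.stable hu hv
  | succ t ih =>
    refine Finset.le_inf fun b hbm => ?_
    have hb' := hlt b (mem_range.1 hbm)
    exact (h.tri hu hv).trans (add_le_add (ih hu hb') (ih hb' hv))

/-- With hubs for the distance `g`, every distance from a hub is attained by a hub-to-hub walk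
followed by a walk with at most `g` edges. -/
lemma inf_hubDist (h : NoNeg N w) (hlt : ∀ b < β, hb b < N)
    (hH : IsHubSet N w (fun v => ∃ b < β, hb b = v) g) {t : ℕ} (ht : N < 2 ^ t) {a v : ℕ}
    (ha : a < β) (hv : v < N) :
    ((range β).inf fun b => hubDist N w g β hb t (hb a) (hb b) + D g (hb b) v) = D N (hb a) v := by
  refine le_antisymm ?_ (Finset.le_inf fun b hbm => ?_)
  · by_cases htop : D N (hb a) v = ⊤
    · rw [htop]; exact le_top
    obtain ⟨k, -, hk⟩ := exists_isHop htop
    obtain ⟨c, -, ⟨b, hb1, rfl⟩, i, j, hij, h1, h2⟩ := hH.chain h (hubDist N w g β hb)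
      (fun _ _ _ _ _ _ => le_rfl)
      (fun t _ _ _ _ _ _ _ hy _ => by
        obtain ⟨b, hb1, rfl⟩ := hy
        exact Finset.inf_le (f := fun b => hubDist N w g β hb t _ (hb b) +
          hubDist N w g β hb t (hb b) _) (mem_range.2 hb1))
      t (hlt a ha) hv ⟨a, ha, rfl⟩ hk
    have hjg : j < g := by
      rcases h2 with h2 | h2
      · exact h2
      · have := hij.left.le; omega
    refine (Finset.inf_le (mem_range.2 hb1)).trans ?_
    rw [← hij.add]
    exact add_le_add h1 ((hopDist_anti hjg.le _ _).trans hij.right.eq.le)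
  · have hb' := hlt b (mem_range.1 hbm)
    exact (h.tri (hlt a ha) hv).trans
      (add_le_add (le_hubDist h hlt t (hlt a ha) hb') (h.stable hb' hv))

lemma IsLMin.inf_eq {ev : ℕ → WithTop ℝ} {lo s a : ℕ} (h : IsLMin ev lo (lo + s) a) :
    (if a = 0 then ⊤ else ev (a - 1)) = (range s).inf fun j => ev (lo + j) := by
  rcases h with ⟨rfl, h⟩ | ⟨r, rfl, h1, h2, -, h4, -⟩
  · rw [if_pos rfl, eq_comm, eq_top_iff]
    exact Finset.le_inf fun j hj => (h _ (by omega) (by rw [mem_range] at hj; omega)).ge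
  · rw [if_neg (by omega), Nat.add_sub_cancel]
    refine le_antisymm (Finset.le_inf fun j hj => h4 _ (by omega) (by rw [mem_range] at hj; omega)) ?_
    obtain ⟨j, rfl⟩ := Nat.exists_eq_add_of_le h1
    exact Finset.inf_le (f := fun j => ev (lo + j)) (mem_range.2 (by omega))
end pure

lemma extVal_congr {f f' : ℕ → ℕ} {r r' : ℕ → ℝ} {p p' : ℕ} (hf : f p = f' p')
    (hr : r p = r' p') : extVal f r p = extVal f' r' p' := by
  rw [extVal, extVal, hf, hr]

/-- real: distances from the hubs along walks with boundedly many edges -/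
def DR : ℕ := 4
/-- finiteness of `DR` -/
def DP : ℕ := 47

/-- Lists the edges of the graph in which an edge leads from each of the first `BB` vertices to
each of the `NV` vertices. -/
def gridP : Prog :=
  setS ME (sc NV * sc BB) ;; setS DD (sc BB + 1) ;;
  .parNat (sc ME) 1 SRC ix (ix % sc BB) ;;
  .parNat (sc NV + 1) 1 ST ix (ix * sc BB) ;;
  blocksP

/-- The memory holds the list of all edges from the first `β` vertices to the vertices below `nv`. -/
structure Grid (ℓ nv β : ℕ) (σ : Mem) : Prop where
  list : EdgeList ℓ nv (nv * β) σ
  st : ∀ v ≤ nv, σ.nat ST v = v * β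
  src : ∀ r < nv * β, σ.nat SRC r = r % β

lemma Grid.congr {ℓ nv β : ℕ} {σ τ : Mem} (h : Grid ℓ nv β σ)
    (e : ∀ a ∈ [LG, NV, ME, ZB, ST, OWN, SRC], τ.nat a = σ.nat a) : Grid ℓ nv β τ := by
  refine ⟨h.list.congr fun a ha => e a ?_, ?_, ?_⟩
  · simp only [List.mem_cons, List.not_mem_nil, or_false] at ha ⊢; tauto
  · rw [e ST (by simp)]; exact h.st
  · rw [e SRC (by simp)]; exact h.src

section
variable {W B : ℕ} [hg : Good W B] {σ : Mem}

lemma gridP_spec {ℓ nv β : ℕ} (lg : σ.nat LG 0 = ℓ) (pos : 1 ≤ ℓ) (hnv : σ.nat NV 0 = nv)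
    (hβ : σ.nat BB 0 = β) (b0 : 0 < β) (b : (nv + 1) * (β + 1) ≤ B) :
    Spec W B gridP σ (3 * ((nv + 1) * (β + 1)) + 10) 6 (Grid ℓ nv β) := by
  have h100 := Good.hundred_le_bound W B
  have e0 : (nv + 1) * (β + 1) = nv * β + nv + β + 1 := by ring
  rw [e0] at b ⊢
  have e1 : nv * (β + 1) = nv * β + nv := by ring
  refine Spec.mono (w := 2 + (2 + ((nv * β + 1) + ((nv + 1 + 1) + (nv * (β + 1) + 3)))))
    (d := 1 + (1 + (1 + (1 + 2)))) ?_ (by omega) (by omega) (fun _ _ _ h => h)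
  refine Spec.seq (Spec.setS rfl (by rw [ev_mul, ev_sc, ev_sc, hnv, hβ]; omega)) fun τ1 hA1 h1 => ?_
  refine Spec.seq (Spec.setS rfl (by
    rw [ev_add, ev_sc, ev_ofNat, hA1.n BB rfl, hβ]; omega)) fun τ2 hA2 h2 => ?_
  have hme : τ2.nat ME 0 = nv * β := by rw [hA2.n ME rfl, h1, ev_mul, ev_sc, ev_sc, hnv, hβ]
  have hb2 : τ2.nat BB 0 = β := by rw [hA2.n BB rfl, hA1.n BB rfl, hβ]
  refine Spec.seq (Spec.parNi (nv * β) (by rw [ev_sc, hme]) (by omega) rfl (fun i hi _ => by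
    rw [ev_mod, ev_ix, ev_sc]; exact (Nat.mod_le _ _).trans (by omega))) fun τ3 hA3 h3 => ?_
  have hnv3 : τ3.nat NV 0 = nv := by rw [hA3.n NV rfl, hA2.n NV rfl, hA1.n NV rfl, hnv]
  have hb3 : τ3.nat BB 0 = β := by rw [hA3.n BB rfl, hb2]
  refine Spec.seq (Spec.parNi (nv + 1) (by rw [ev_add, ev_sc, ev_ofNat, hnv3]) (by omega) rfl
    (fun i hi _ => by
      rw [ev_mul, ev_ix, ev_sc, hb3]
      exact (Nat.mul_le_mul_right β (Nat.lt_succ_iff.1 hi)).trans (by omega))) fun τ4 hA4 h4 => ?_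
  have hst : ∀ v ≤ nv, τ4.nat ST v = v * β := fun v hv => by
    rw [h4, if_pos ⟨by omega, by simp⟩, ev_mul, ev_ix, ev_sc, hb3]
  refine (blocksP_spec (ℓ := ℓ) (M := nv * β) (dd := β + 1) (by
      rw [hA4.n LG rfl, hA3.n LG rfl, hA2.n LG rfl, hA1.n LG rfl, lg]) pos
    (by rw [hA4.n NV rfl, hnv3]) (by rw [hA4.n ME rfl, hA3.n ME rfl, hme]) (by
      rw [hA4.n DD rfl, hA3.n DD rfl, h2, ev_add, ev_sc, ev_ofNat, hA1.n BB rfl, hβ])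
    (fun v hv => by rw [hst v hv.le, hst (v + 1) hv, Nat.succ_mul]; omega) (hst nv le_rfl)
    (fun v hv => by rw [hst v hv.le, hst (v + 1) hv, Nat.succ_mul]; omega) (by omega)
    (by omega)).mono le_rfl le_rfl ?_
  intro τ hA _ hτ
  refine ⟨hτ, fun v hv => by rw [hA.n ST rfl, hst v hv], fun r hr => ?_⟩
  rw [hA.n SRC rfl, hA4.n SRC rfl, h3, if_pos ⟨hr, by simp⟩, ev_mod, ev_ix, ev_sc, hb2]

/-- On the list of all edges, a relaxation is a product of matrices over the tropical semiring. -/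
lemma Grid.relaxP_spec {ℓ nv β ρ N : ℕ} (hE : Grid ℓ nv β σ) (hρ : σ.nat ROWS 0 = ρ)
    (hβ : 1 ≤ β) (hρ0 : 1 ≤ ρ) (hnv : 1 ≤ nv) (hβN : β ≤ N) (hnvN : nv ≤ N) (hρN : ρ ≤ N)
    (hN : N ≤ 2 ^ ℓ) (b : 100 * (2 ^ ℓ) ^ 6 ≤ B) :
    Spec W B relaxP σ (6 * (ρ * (nv * β)) + 39 * (ℓ * (ρ * nv))) (9 * ℓ + 13)
      (fun τ => ∀ b < ρ, ∀ v < nv, extVal (τ.nat CP) (τ.real CR) (b * nv + v) =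
        (range β).inf fun j => extVal (σ.nat CP) (σ.real CR) (b * nv + j) +
          extVal (σ.nat WF) (σ.real WT) (v * β + j)) := by
  have pos := hE.list.pos
  set E := 2 ^ ℓ with hEE
  have E1 : 1 ≤ E := Nat.one_le_two_pow
  have powE : ∀ i ≤ 6, E ^ i ≤ E ^ 6 := fun i hi => Nat.pow_le_pow_right E1 hi
  have p1 := powE 1 (by omega)
  have p2 := powE 2 (by omega)
  have p3 := powE 3 (by omega)
  rw [pow_one] at p1
  have hdiv : nv * β / ℓ ≤ nv * β := Nat.div_le_self _ _
  have c1 : nv * β ≤ E ^ 2 := by rw [sq]; exact Nat.mul_le_mul (by omega) (by omega)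
  have c2 : ρ * (nv * β) ≤ E ^ 3 := by
    calc _ ≤ E * E ^ 2 := Nat.mul_le_mul (by omega) c1
      _ = E ^ 3 := by ring
  have c3 : ρ * nv ≤ E ^ 2 := by rw [sq]; exact Nat.mul_le_mul (by omega) (by omega)
  have c4 := Nat.mul_le_mul_left ρ hdiv
  have c5 : E ≤ E ^ 2 := Nat.le_self_pow (by omega) _
  have c6 : ℓ * (ρ * (nv * β / ℓ)) ≤ ρ * (nv * β) := by
    calc ℓ * (ρ * (nv * β / ℓ)) = ρ * (ℓ * (nv * β / ℓ)) := by ring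
      _ ≤ _ := Nat.mul_le_mul_left _ (Nat.mul_div_le _ _)
  have c7 : ρ * nv ≤ ℓ * (ρ * nv) := Nat.le_mul_of_pos_left _ pos
  have c8 : ℓ ≤ ℓ * (ρ * nv) := Nat.le_mul_of_pos_right _ (Nat.mul_pos hρ0 hnv)
  have hT : nv * β / ℓ + nv ≤ 2 ^ (2 * ℓ + 1) := by
    rw [pow_succ, mul_comm 2 ℓ, pow_mul, ← hEE]
    omega
  have hcost : ρ * (nv * β) + (ℓ + (2 * ℓ + 1) + 1) * (ρ * (nv * β / ℓ + nv) + 4) + 2 * (ρ * nv) +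
      12 ≤ 6 * (ρ * (nv * β)) + 39 * (ℓ * (ρ * nv)) := by
    have : (ℓ + (2 * ℓ + 1) + 1) * (ρ * (nv * β / ℓ + nv) + 4) ≤
        5 * (ℓ * (ρ * (nv * β / ℓ))) + 5 * (ℓ * (ρ * nv)) + 20 * ℓ := by
      calc _ ≤ (5 * ℓ) * (ρ * (nv * β / ℓ + nv) + 4) := Nat.mul_le_mul_right _ (by omega)
        _ = _ := by ring
    omega
  refine (Par.relaxP_spec hE.list hρ hT (by omega) (by rw [Nat.mul_add]; omega) (by omega)
    (by omega) ?_).mono hcost (by omega) ?_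
  · intro r hr
    rw [hE.src r hr]; exact (Nat.mod_lt _ hβ).trans_le (by omega)
  · intro τ _ _ h b hb v hv
    obtain ⟨a, h1, h2, h3⟩ := h b hb v hv
    rw [hE.st v hv.le, hE.st (v + 1) hv, Nat.succ_mul] at h1
    have h4 : extVal (τ.nat CP) (τ.real CR) (b * nv + v) =
        if a = 0 then ⊤ else edgeVal σ nv b (a - 1) := by
      by_cases ha : a = 0
      · rw [if_pos ha] at h2 ⊢; rw [extVal, if_neg (not_not.2 h2)]
      · rw [if_neg ha] at h2 ⊢; rw [extVal, if_pos (by omega), h3 ha]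
    rw [h4, h1.inf_eq]
    refine Finset.inf_congr rfl fun j hj => ?_
    rw [mem_range] at hj
    rw [edgeVal, hE.src _ (mul_add_lt hj hv), mod_mul_add hj, extVal, extVal]
    by_cases hf : σ.nat WF (v * β + j) = 0 <;> by_cases hc : σ.nat CP (b * nv + j) = 0 <;>
      simp [hf, hc]
end

end Par

/-! ### Squaring the matrix of hub distances, and checking the potential -/

namespace Par
open Finset

/-- Saves the distances from the hubs, and keeps those between the hubs. -/
def hubMatP : Prog :=
  .parNat (sc BB * sc NN) 1 DP ix (.read CP ix) ;;
  .parReal (sc BB * sc NN) 1 DR ix (.read CR ix) ;;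
  .parNat (sc BB * sc BB) 1 CP ix (.read DP (ix / sc BB * sc NN + .read HB (ix % sc BB))) ;;
  .parReal (sc BB * sc BB) 1 CR ix (.read DR (ix / sc BB * sc NN + .read HB (ix % sc BB)))

/-- Squares the matrix of hub distances over the tropical semiring. -/
def squareP : Prog :=
  .parNat (sc BB * sc BB) 1 WF ix (.read CP (ix % sc BB * sc BB + ix / sc BB)) ;;
  .parReal (sc BB * sc BB) 1 WT ix (.read CR (ix % sc BB * sc BB + ix / sc BB)) ;;
  relaxP

/-- Squares the matrix of hub distances so often that it becomes transitive. -/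
def squaresP : Prog :=
  setS ROWS (sc BB) ;; setS NV (sc BB) ;; setS LL (sc LG + 1) ;; gridP ;; forP KK LL squareP

/-- Computes distances from the source, from the matrix of hub distances and the saved distances
from the hubs. -/
def sourceP : Prog :=
  setS NV (sc NN) ;; setS ROWS 1 ;; gridP ;;
  .parNat (sc ME) 1 WF ix (.read DP (ix % sc BB * sc NN + ix / sc BB)) ;;
  .parReal (sc ME) 1 WT ix (.read DR (ix % sc BB * sc NN + ix / sc BB)) ;;
  relaxP

/-- Answers whether some edge violates the inequality of a feasible potential. -/
def checkP : Prog :=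
  .parReal (.read 0 1) 1 XC ix (.read CR (.read 1 ix + 1) + .read 0 ix) ;;
  setS LEN (.read 0 1 + 1) ;;
  .parNat (sc LEN) 1 V ix (.lt ix (.read 0 1) * .no (.realLe CR (.read 2 ix + 1) XC ix)) ;;
  sumP ;;
  .parNat 1 1 0 3 (.lt 0 (.read V 0))

section
variable {W B : ℕ} [hg : Good W B] {σ : Mem}

lemma hubMatP_spec {N β : ℕ} (hNN : σ.nat NN 0 = N) (hβ : σ.nat BB 0 = β) (hβN : β ≤ N)
    (hHB : ∀ b < β, σ.nat HB b < N) (b : N * N ≤ B) :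
    Spec W B hubMatP σ (4 * (β * N) + 4) 4 (fun τ =>
      (∀ a < β, ∀ v < N, extVal (τ.nat DP) (τ.real DR) (a * N + v) =
        extVal (σ.nat CP) (σ.real CR) (a * N + v)) ∧
      ∀ a < β, ∀ b < β, extVal (τ.nat CP) (τ.real CR) (a * β + b) =
        extVal (σ.nat CP) (σ.real CR) (a * N + σ.nat HB b)) := by
  have hbb : β * β ≤ β * N := Nat.mul_le_mul_left _ hβN
  have hbN : β * N ≤ N * N := Nat.mul_le_mul_right _ hβN
  refine Spec.mono (w := (β * N + 1) + ((β * N + 1) + ((β * β + 1) + (β * β + 1))))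
    (d := 1 + (1 + (1 + 1))) ?_ (by omega) (by omega) (fun _ _ _ h => h)
  refine Spec.seq (Spec.bdd fun hB => Spec.parNi (β * N) (by rw [ev_mul, ev_sc, ev_sc, hβ, hNN])
    (by omega) rfl fun i _ _ => hB _ _) fun τ1 hA1 h1 => ?_
  refine Spec.seq (Spec.parRi (β * N) (by
    rw [ev_mul, ev_sc, ev_sc, hA1.n BB rfl, hA1.n NN rfl, hβ, hNN]) (by omega) rfl)
    fun τ2 hA2 h2 => ?_
  have n2 : ∀ a, a ≠ DP → τ2.nat a = σ.nat a := fun a ha => by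
    rw [hA2.n a rfl, hA1.n a (by simp [Prog.wN, ha])]
  refine Spec.seq (Spec.bdd fun hB => Spec.parNi (β * β) (by
    rw [ev_mul, ev_sc, n2 BB (by decide), hβ])
    (by omega) rfl fun i _ _ => hB _ _) fun τ3 hA3 h3 => ?_
  have n3 : ∀ a, a ≠ DP → a ≠ CP → τ3.nat a = σ.nat a := fun a ha hb => by
    rw [hA3.n a (by simp [Prog.wN, hb]), n2 a ha]
  refine (Spec.parRi (β * β) (by rw [ev_mul, ev_sc, n3 BB (by decide) (by decide), hβ])
    (by omega) rfl).mono le_rfl le_rfl fun τ hA _ h4 => ?_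
  have dp : ∀ q < β * N, τ2.nat DP q = σ.nat CP q := fun q hq => by
    rw [hA2.n DP rfl, h1, if_pos ⟨hq, by simp⟩, ev_read, ev_ix]
  have dr : ∀ q < β * N, τ2.real DR q = σ.real CR q := fun q hq => by
    rw [h2, if_pos ⟨hq, by simp⟩, rev_read, ev_ix, hA1.r CR rfl]
  refine ⟨fun a ha v hv => ?_, fun a ha b hb => ?_⟩
  · have hlt := mul_add_lt hv ha
    refine extVal_congr ?_ ?_
    · rw [hA.n DP rfl, hA3.n DP rfl, dp _ hlt]
    · rw [hA.r DR rfl, hA3.r DR rfl, dr _ hlt]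
  · have hlt := mul_add_lt (hHB b hb) ha
    have hlt' := mul_add_lt hb ha
    refine extVal_congr ?_ ?_
    · rw [hA.n CP rfl, h3, if_pos ⟨hlt', by simp⟩]
      simp only [ev_read, ev_add, ev_mul, ev_div, ev_mod, ev_ix, ev_sc, n2 BB (by decide),
        n2 NN (by decide), n2 HB (by decide), hβ, hNN, div_mul_add hb, mod_mul_add hb, dp _ hlt]
    · rw [h4, if_pos ⟨hlt', by simp⟩]
      simp only [ev_read, rev_read, ev_add, ev_mul, ev_div, ev_mod, ev_ix, ev_sc,
        n3 BB (by decide) (by decide), n3 NN (by decide) (by decide),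
        n3 HB (by decide) (by decide), hβ, hNN, div_mul_add hb, mod_mul_add hb, hA3.r DR rfl,
        dr _ hlt]

lemma squareP_spec {ℓ β N : ℕ} {Q : ℕ → ℕ → WithTop ℝ} (hE : Grid ℓ β β σ)
    (hρ : σ.nat ROWS 0 = β) (hβ : σ.nat BB 0 = β) (β1 : 1 ≤ β) (hβN : β ≤ N) (hN : N ≤ 2 ^ ℓ)
    (b : 100 * (2 ^ ℓ) ^ 6 ≤ B)
    (hQ : ∀ a < β, ∀ c < β, extVal (σ.nat CP) (σ.real CR) (a * β + c) = Q a c) :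
    Spec W B squareP σ (6 * (β * (β * β)) + 43 * (ℓ * (β * β))) (9 * ℓ + 15)
      (fun τ => ∀ a < β, ∀ c < β, extVal (τ.nat CP) (τ.real CR) (a * β + c) =
        (range β).inf fun b => Q a b + Q b c) := by
  have pos := hE.list.pos
  have c1 : β * β ≤ ℓ * (β * β) := Nat.le_mul_of_pos_left _ pos
  have c2 : 1 ≤ β * β := Nat.mul_pos β1 β1
  have hbB : β * β ≤ B := by
    have h1 : β * β ≤ (2 ^ ℓ) ^ 2 := by rw [sq]; exact Nat.mul_le_mul (by omega) (by omega)
    have h2 : (2 ^ ℓ) ^ 2 ≤ (2 ^ ℓ) ^ 6 := Nat.pow_le_pow_right (Nat.one_le_two_pow) (by omega)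
    omega
  refine Spec.mono (w := (β * β + 1) + ((β * β + 1) +
    (6 * (β * (β * β)) + 39 * (ℓ * (β * β))))) (d := 1 + (1 + (9 * ℓ + 13))) ?_ (by omega)
    (by omega) (fun _ _ _ h => h)
  refine Spec.seq (Spec.bdd fun hB => Spec.parNi (β * β) (by rw [ev_mul, ev_sc, hβ])
    hbB rfl fun i _ _ => hB _ _) fun τ1 hA1 h1 => ?_
  refine Spec.seq (Spec.parRi (β * β) (by rw [ev_mul, ev_sc, hA1.n BB rfl, hβ]) hbB rfl)
    fun τ2 hA2 h2 => ?_
  have n2 : ∀ a, a ≠ WF → τ2.nat a = σ.nat a := fun a ha => by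
    rw [hA2.n a rfl, hA1.n a (by simp [Prog.wN, ha])]
  refine ((hE.congr (τ := τ2) ?_).relaxP_spec (by rw [n2 ROWS (by decide), hρ]) β1 β1 β1 hβN hβN
    hβN hN b).mono le_rfl le_rfl ?_
  · simp only [List.mem_cons, List.not_mem_nil, or_false, forall_eq_or_imp, forall_eq]
    refine ⟨?_, ?_, ?_, ?_, ?_, ?_, ?_⟩ <;> exact n2 _ (by decide)
  · intro τ _ _ h a ha c hc
    rw [h a ha c hc]
    refine Finset.inf_congr rfl fun j hj => ?_
    rw [mem_range] at hj
    have hlt := mul_add_lt hj hc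
    rw [n2 CP (by decide), hA2.r CR rfl, hA1.r CR rfl, hQ a ha j hj, ← hQ j hj c hc]
    congr 1
    refine extVal_congr ?_ ?_
    · rw [hA2.n WF rfl, h1, if_pos ⟨hlt, by simp⟩]
      simp only [ev_read, ev_add, ev_mul, ev_div, ev_mod, ev_ix, ev_sc, hβ, div_mul_add hj,
        mod_mul_add hj]
    · rw [h2, if_pos ⟨hlt, by simp⟩]
      simp only [rev_read, ev_add, ev_mul, ev_div, ev_mod, ev_ix, ev_sc, hA1.n BB rfl, hβ,
        div_mul_add hj, mod_mul_add hj, hA1.r CR rfl]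

/-- After `ℓ + 1` squarings, concatenations of `2 ^ (ℓ + 1) > N` walks have been taken into account. -/
lemma squaresP_spec {w : ℕ → ℕ → WithTop ℝ} {ℓ β N g : ℕ} {hb : ℕ → ℕ} (lg : σ.nat LG 0 = ℓ)
    (pos : 1 ≤ ℓ) (hβ : σ.nat BB 0 = β) (β1 : 1 ≤ β) (hβN : β ≤ N)
    (hN : N ≤ 2 ^ ℓ) (b : 100 * (2 ^ ℓ) ^ 6 ≤ B)
    (hQ : ∀ a < β, ∀ c < β, extVal (σ.nat CP) (σ.real CR) (a * β + c) =
      hopDist N w g (hb a) (hb c)) :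
    Spec W B squaresP σ (12 * (ℓ * β ^ 3) + 200 * (ℓ ^ 2 * β ^ 2)) (70 * ℓ ^ 2)
      (fun τ => ∀ a < β, ∀ c < β, extVal (τ.nat CP) (τ.real CR) (a * β + c) =
        hubDist N w g β hb (ℓ + 1) (hb a) (hb c)) := by
  set E := 2 ^ ℓ with hE
  have E1 : 1 ≤ E := Nat.one_le_two_pow
  have hℓE : ℓ < E := Nat.lt_two_pow_self
  have p1 : E ^ 1 ≤ E ^ 6 := Nat.pow_le_pow_right E1 (by omega)
  have p2 : E ^ 2 ≤ E ^ 6 := Nat.pow_le_pow_right E1 (by omega)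
  rw [pow_one] at p1
  have bb : (β + 1) * (β + 1) ≤ 4 * E ^ 2 := by
    calc _ ≤ (2 * E) * (2 * E) := Nat.mul_le_mul (by omega) (by omega)
      _ = _ := by ring
  refine Spec.mono (w := 2 + (2 + (2 + ((3 * ((β + 1) * (β + 1)) + 10) +
    ((ℓ + 1) * ((6 * (β * (β * β)) + 43 * (ℓ * (β * β))) + 3) + 3)))))
    (d := 1 + (1 + (1 + (6 + ((ℓ + 1) * ((9 * ℓ + 15) + 2) + 2))))) ?_ ?_ ?_ (fun _ _ _ h => h)
  rotate_left
  · have c1 : (ℓ + 1) * ((6 * (β * (β * β)) + 43 * (ℓ * (β * β))) + 3) ≤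
        12 * (ℓ * β ^ 3) + 92 * (ℓ ^ 2 * β ^ 2) := by
      have : 1 ≤ ℓ * (β * β) := Nat.mul_pos pos (Nat.mul_pos β1 β1)
      calc _ ≤ (2 * ℓ) * ((6 * (β * (β * β)) + 43 * (ℓ * (β * β))) + 3 * (ℓ * (β * β))) :=
            Nat.mul_le_mul (by omega) (by omega)
        _ = _ := by ring
    have c2 : (β + 1) * (β + 1) ≤ 4 * (ℓ ^ 2 * β ^ 2) := by
      calc _ ≤ (2 * (ℓ * β)) * (2 * (ℓ * β)) := by
            have : β ≤ ℓ * β := Nat.le_mul_of_pos_left _ pos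
            exact Nat.mul_le_mul (by omega) (by omega)
        _ = _ := by ring
    have c3 : 1 ≤ ℓ ^ 2 * β ^ 2 := Nat.mul_pos (by positivity) (by positivity)
    omega
  · have c1 : (ℓ + 1) * ((9 * ℓ + 15) + 2) = 9 * ℓ ^ 2 + 26 * ℓ + 17 := by ring
    have c2 : ℓ ≤ ℓ ^ 2 := Nat.le_self_pow (by omega) _
    have c3 : 1 ≤ ℓ ^ 2 := Nat.one_le_pow _ _ pos
    omega
  refine Spec.seq (Spec.setS rfl (by rw [ev_sc, hβ]; omega)) fun τ0 hA0 h0 => ?_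
  refine Spec.seq (Spec.setS rfl (by rw [ev_sc, hA0.n BB rfl, hβ]; omega)) fun τ1 hA1 h1 => ?_
  refine Spec.seq (Spec.setS rfl (by rw [ev_add, ev_ofNat, ev_sc, hA1.n LG rfl, hA0.n LG rfl, lg]; omega))
    fun τ2 hA2 h2 => ?_
  refine Spec.seq (gridP_spec (ℓ := ℓ) (nv := β) (β := β) (by rw [hA2.n LG rfl, hA1.n LG rfl, hA0.n LG rfl, lg]) pos
    (by rw [hA2.n NV rfl, h1, ev_sc, hA0.n BB rfl, hβ]) (by rw [hA2.n BB rfl, hA1.n BB rfl, hA0.n BB rfl, hβ]) β1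
    (by omega)) fun τ3 hA3 h3 => ?_
  have n3 : ∀ a, gridP.wN a = false → a ≠ LL → a ≠ NV → τ3.nat a = τ0.nat a := fun a h h' h'' => by
    rw [hA3.n a h, hA2.n a (by simp [setS, Prog.wN, h']), hA1.n a (by simp [setS, Prog.wN, h''])]
  refine (Spec.forP (ℓ + 1) (fun t τ => ∀ a < β, ∀ c < β,
    extVal (τ.nat CP) (τ.real CR) (a * β + c) = hubDist N w g β hb t (hb a) (hb c))
    (by rw [hA3.n LL rfl, h2, ev_add, ev_sc, ev_ofNat, hA1.n LG rfl, hA0.n LG rfl, lg]) rfl rfl ?_ ?_ ?_).mono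
    le_rfl le_rfl (fun _ _ _ h => h)
  · intro t τ τ' hn hr h
    rw [hn CP (by decide), hr]; exact h
  · rw [n3 CP rfl (by decide) (by decide), hA0.n CP rfl, hA3.r CR rfl, hA2.r CR rfl, hA1.r CR rfl,
      hA0.r CR rfl]
    exact hQ
  · intro t ht τ hA _ hI
    refine squareP_spec (h3.congr ?_) (by rw [hA.n ROWS rfl, n3 ROWS rfl (by decide) (by decide), h0,
      ev_sc, hβ])
      (by rw [hA.n BB rfl, n3 BB rfl (by decide) (by decide), hA0.n BB rfl, hβ]) β1 hβN hN b
      (Q := fun a c => hubDist N w g β hb t (hb a) (hb c)) hI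
    simp only [List.mem_cons, List.not_mem_nil, or_false, forall_eq_or_imp, forall_eq]
    refine ⟨?_, ?_, ?_, ?_, ?_, ?_, ?_⟩ <;> exact hA.n _ rfl

/-- The source is the first hub, so the row `0` of the hub matrix is multiplied by the matrix of saved
distances from the hubs. -/
lemma sourceP_spec {ℓ β N : ℕ} {Q : ℕ → WithTop ℝ} {D : ℕ → ℕ → WithTop ℝ} (lg : σ.nat LG 0 = ℓ)
    (pos : 1 ≤ ℓ) (hNN : σ.nat NN 0 = N) (hβ : σ.nat BB 0 = β) (β1 : 1 ≤ β) (hβN : β ≤ N)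
    (hN : N ≤ 2 ^ ℓ) (b : 100 * (2 ^ ℓ) ^ 6 ≤ B)
    (hQ : ∀ c < β, extVal (σ.nat CP) (σ.real CR) c = Q c)
    (hD : ∀ c < β, ∀ v < N, extVal (σ.nat DP) (σ.real DR) (c * N + v) = D c v) :
    Spec W B sourceP σ (100 * (ℓ * N ^ 2)) (40 * ℓ)
      (fun τ => ∀ v < N, extVal (τ.nat CP) (τ.real CR) v =
        (range β).inf fun c => Q c + D c v) := by
  set E := 2 ^ ℓ with hE
  have E1 : 1 ≤ E := Nat.one_le_two_pow
  have p1 : E ^ 1 ≤ E ^ 6 := Nat.pow_le_pow_right E1 (by omega)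
  have p2 : E ^ 2 ≤ E ^ 6 := Nat.pow_le_pow_right E1 (by omega)
  rw [pow_one] at p1
  have bb : (N + 1) * (β + 1) ≤ 4 * E ^ 2 := by
    calc _ ≤ (2 * E) * (2 * E) := Nat.mul_le_mul (by omega) (by omega)
      _ = _ := by ring
  have bN : N * β ≤ E ^ 2 := by rw [sq]; exact Nat.mul_le_mul (by omega) (by omega)
  refine Spec.mono (w := 2 + (2 + ((3 * ((N + 1) * (β + 1)) + 10) + ((N * β + 1) + ((N * β + 1) +
    (6 * (1 * (N * β)) + 39 * (ℓ * (1 * N))))))))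
    (d := 1 + (1 + (6 + (1 + (1 + (9 * ℓ + 13)))))) ?_ ?_ (by omega) (fun _ _ _ h => h)
  rotate_left
  · have c1 : (N + 1) * (β + 1) ≤ 4 * N ^ 2 := by
      calc _ ≤ (2 * N) * (2 * N) := Nat.mul_le_mul (by omega) (by omega)
        _ = _ := by ring
    have c2 : N * β ≤ N ^ 2 := by rw [sq]; exact Nat.mul_le_mul_left _ hβN
    have c3 : N ^ 2 ≤ ℓ * N ^ 2 := Nat.le_mul_of_pos_left _ pos
    have c4 : ℓ * N ≤ ℓ * N ^ 2 := Nat.mul_le_mul_left _ (Nat.le_self_pow (by omega) _)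
    have c5 : 1 ≤ N ^ 2 := Nat.one_le_pow _ _ (by omega)
    rw [one_mul, one_mul]
    omega
  refine Spec.seq (Spec.setS rfl (by rw [ev_sc, hNN]; omega)) fun τ1 hA1 h1 => ?_
  refine Spec.seq (Spec.setS (e := 1) rfl (by rw [ev_ofNat]; omega)) fun τ2 hA2 h2 => ?_
  refine Spec.seq (gridP_spec (ℓ := ℓ) (nv := N) (β := β) (by rw [hA2.n LG rfl, hA1.n LG rfl, lg])
    pos (by rw [hA2.n NV rfl, h1, ev_sc, hNN]) (by rw [hA2.n BB rfl, hA1.n BB rfl, hβ]) β1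
    (by omega)) fun τ3 hA3 h3 => ?_
  have n3 : ∀ a, gridP.wN a = false → a ≠ ROWS → a ≠ NV → τ3.nat a = σ.nat a := fun a h h' h'' => by
    rw [hA3.n a h, hA2.n a (by simp [setS, Prog.wN, h']), hA1.n a (by simp [setS, Prog.wN, h''])]
  have me3 := h3.list.meEq
  refine Spec.seq (Spec.bdd fun hB => Spec.parNi (N * β) (by rw [ev_sc, me3])
    (by omega) rfl fun i _ _ => hB _ _) fun τ4 hA4 h4 => ?_
  refine Spec.seq (Spec.parRi (N * β) (by rw [ev_sc, hA4.n ME rfl, me3]) (by omega) rfl)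
    fun τ5 hA5 h5 => ?_
  have n5 : ∀ a, a ≠ WF → τ5.nat a = τ3.nat a := fun a ha => by
    rw [hA5.n a rfl, hA4.n a (by simp [Prog.wN, ha])]
  refine ((h3.congr (τ := τ5) ?_).relaxP_spec (ρ := 1) (by
    rw [n5 ROWS (by decide), hA3.n ROWS rfl, h2, ev_ofNat]) β1 le_rfl (by omega) hβN le_rfl
    (by omega) hN b).mono le_rfl le_rfl ?_
  · simp only [List.mem_cons, List.not_mem_nil, or_false, forall_eq_or_imp, forall_eq]
    refine ⟨?_, ?_, ?_, ?_, ?_, ?_, ?_⟩ <;> exact n5 _ (by decide)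
  · intro τ _ _ h v hv
    have h' := h 0 (by omega) v hv
    rw [zero_mul, zero_add] at h'
    rw [h']
    refine Finset.inf_congr rfl fun j hj => ?_
    rw [mem_range] at hj
    have hlt := mul_add_lt hj hv
    rw [zero_add, n5 CP (by decide), n3 CP rfl (by decide) (by decide), hA5.r CR rfl, hA4.r CR rfl,
      hA3.r CR rfl, hA2.r CR rfl, hA1.r CR rfl, hQ j hj, ← hD j hj v hv]
    congr 1
    refine extVal_congr ?_ ?_
    · rw [hA5.n WF rfl, h4, if_pos ⟨hlt, by simp⟩]
      simp only [ev_read, ev_add, ev_mul, ev_div, ev_mod, ev_ix, ev_sc,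
        n3 BB rfl (by decide) (by decide), n3 NN rfl (by decide) (by decide),
        n3 DP rfl (by decide) (by decide), hβ, hNN, div_mul_add hj, mod_mul_add hj]
    · have r3 : τ3.real DR = σ.real DR := by rw [hA3.r DR rfl, hA2.r DR rfl, hA1.r DR rfl]
      rw [h5, if_pos ⟨hlt, by simp⟩]
      simp only [rev_read, ev_add, ev_mul, ev_div, ev_mod, ev_ix, ev_sc, hA4.n BB rfl,
        hA4.n NN rfl, n3 BB rfl (by decide) (by decide), n3 NN rfl (by decide) (by decide),
        hβ, hNN, div_mul_add hj, mod_mul_add hj, hA4.r DR rfl, r3]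

/-- The machine counts the edges that violate the inequality of a potential; the answer is
whether their number is positive. -/
lemma checkP_spec {n m T : ℕ} (G : WeightedDigraph n m) (hm : σ.nat 0 1 = m)
    (hs : ∀ e : Fin m, σ.nat 1 e = G.src e) (ht : ∀ e : Fin m, σ.nat 2 e = G.tgt e)
    (hw : ∀ e : Fin m, σ.real 0 e = G.weight e) (hT : m + 1 ≤ 2 ^ T) (b : 2 * (m + 1) ≤ B) :
    Spec W B checkP σ (T * (m + 5) + 2 * m + 11) (T * 3 + 6) (fun τ =>
      ((∀ e, σ.real CR (G.tgt e + 1) ≤ σ.real CR (G.src e + 1) + G.weight e) → τ.answer = 0) ∧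
      ((∃ e, ¬ σ.real CR (G.tgt e + 1) ≤ σ.real CR (G.src e + 1) + G.weight e) →
        τ.answer = 1)) := by
  classical
  have h100 := Good.hundred_le_bound W B
  set f : ℕ → ℕ := fun i => if h : i < m then
    (if σ.real CR (G.tgt ⟨i, h⟩ + 1) ≤ σ.real CR (G.src ⟨i, h⟩ + 1) + G.weight ⟨i, h⟩ then 0 else 1)
    else 0 with hf
  have f1 : ∀ i, f i ≤ 1 := fun i => by simp only [hf]; split_ifs <;> omega
  refine Spec.mono (w := (m + 1) + (2 + ((m + 1 + 1) + ((T * (m + 1 + 4) + 3) + (1 + 1)))))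
    (d := 1 + (1 + (1 + ((T * 3 + 2) + 1)))) ?_
    (by rw [show m + 1 + 4 = m + 5 by ring]; omega) (by omega) (fun _ _ _ h => h)
  refine Spec.seq (Spec.parRi m (by rw [ev_read, ev_ofNat, hm]) (by omega) rfl) fun τ1 hA1 h1 => ?_
  refine Spec.seq (Spec.setS rfl (by
    rw [ev_add, ev_read, ev_ofNat, hA1.n 0 rfl, hm]; omega)) fun τ2 hA2 h2 => ?_
  have n2 : ∀ a, a ≠ LEN → τ2.nat a = σ.nat a := fun a ha => by
    rw [hA2.n a (by simp [setS, Prog.wN, ha]), hA1.n a rfl]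
  have len2 : τ2.nat LEN 0 = m + 1 := by
    rw [h2, ev_add, ev_read, ev_ofNat, hA1.n 0 rfl, hm]
  refine Spec.seq (Spec.parNi (m + 1) (by rw [ev_sc, len2]) (by omega) rfl ?_) fun τ3 hA3 h3 => ?_
  · intro i _ _
    simp only [ev_mul, ev_lt, ev_no, ev_realLe]
    split_ifs <;> omega
  have hV : ∀ i < m + 1, τ3.nat V i = f i := by
    intro i hi
    rw [h3, if_pos ⟨hi, by simp⟩]
    simp only [ev_mul, ev_lt, ev_no, ev_realLe, ev_ix, ev_read, ev_ofNat, ev_add,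
      n2 0 (by decide), n2 2 (by decide), hm]
    by_cases him : i < m
    · have e1 : τ2.real XC i = σ.real CR (G.src ⟨i, him⟩ + 1) + G.weight ⟨i, him⟩ := by
        rw [hA2.r XC rfl, h1, if_pos ⟨him, by simp⟩]
        simp only [rev_add, rev_read, ev_read, ev_ix, ev_add, ev_ofNat, hs ⟨i, him⟩, hw ⟨i, him⟩]
      have e2 : τ2.real CR = σ.real CR := by rw [hA2.r CR rfl, hA1.r CR rfl]
      rw [if_pos him, e1, e2, ht ⟨i, him⟩]
      simp only [hf, him, dif_pos]
      split_ifs <;> rfl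
    · rw [if_neg him, zero_mul]; simp only [hf, him, dif_neg, not_false_iff]
  refine Spec.seq (sumP_spec f (by rw [hA3.n LEN rfl, len2]) hT b hV ?_) fun τ4 hA4 h4 => ?_
  · calc _ ≤ ∑ _j ∈ range (m + 1), 1 := sum_le_sum fun i _ => f1 i
      _ ≤ B := by simp; omega
  refine (Spec.parN (k := 1) (g := 1) (p := 3) 1 (by rw [ev_ofNat]) (by omega) rfl
    (by intro i j hi hj _ _ _; omega) ?_).mono le_rfl le_rfl ?_
  · intro i _ _; rw [ev_lt]; split_ifs <;> omega
  · intro τ _ _ ⟨h5, _⟩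
    have h6 : τ.answer = if 0 < ∑ j ∈ range (m + 1), f j then 1 else 0 := by
      have h7 := h5 0 (by omega) (by simp)
      simp only [ev_lt, ev_ofNat, ev_read, h4 0 (by omega), ← range_eq_Ico] at h7
      exact h7
    rw [h6]
    refine ⟨fun h => ?_, fun ⟨e, he⟩ => ?_⟩
    · rw [sum_eq_zero, if_neg (lt_irrefl _)]
      intro i _
      simp only [hf]
      split_ifs with h7 h8
      · rfl
      · exact absurd (h _) h8
      · rfl
    · rw [if_pos]
      refine lt_of_lt_of_le ?_ (single_le_sum (fun i _ => Nat.zero_le (f i))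
        (mem_range.2 (show (e : ℕ) < m + 1 by omega)))
      simp only [hf, e.2, dif_pos]
      rw [if_neg he]; exact one_pos
end

end Par

/-! ### Negative cycles and potentials -/

namespace Par
open Finset

section potential
variable {n m : ℕ} {G : WeightedDigraph n m}

/-- Around a cycle, the differences of the potential cancel. -/
lemma not_hasNegativeCycle_of_potential (p : Fin n → ℝ)
    (h : ∀ e, p (G.tgt e) ≤ p (G.src e) + G.weight e) : ¬ G.HasNegativeCycle := by
  rintro ⟨k, e, h1, -, h3⟩
  have h4 : ∑ i, p (G.tgt (e i)) = ∑ i, p (G.src (e i)) := by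
    rw [← Equiv.sum_comp (Equiv.addRight (1 : Fin (k + 1))) fun i => p (G.src (e i))]
    exact sum_congr rfl fun i _ => by rw [h1]; rfl
  have h5 : ∑ i, p (G.tgt (e i)) ≤ ∑ i, (p (G.src (e i)) + G.weight (e i)) :=
    sum_le_sum fun i _ => h (e i)
  rw [sum_add_distrib] at h5
  linarith

/-- A simple closed walk of negative weight avoids the source, which has no incoming edges, so it is a
negative cycle of `G`. -/
lemma noNeg_wmat (h : ¬ G.HasNegativeCycle) : NoNeg (n + 1) (wmat G) := by
  by_contra hn
  obtain ⟨k, x, h1, h2, h3, h4⟩ := exists_simple_of_not_noNeg hn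
  have hfin : ∀ i < k + 1, wmat G (x i) (x (i + 1)) ≠ ⊤ := fun i hi htop => by
    rw [WithTop.sum_eq_top.2 ⟨i, mem_range.2 hi, htop⟩] at h4
    exact absurd h4 (by simp)
  have hpos : ∀ i < k + 1, 1 ≤ x i := by
    have key : ∀ i < k + 1, 1 ≤ x (i + 1) := fun i hi => by
      rcases wmat_cases G (hfin i hi) with ⟨-, h, -⟩ | ⟨e, -, h⟩ <;> omega
    rintro (_ | i) hi
    · rw [← h2]; exact key k (by omega)
    · exact key i (by omega)
  have hedge : ∀ i : Fin (k + 1), ∃ e, x i = G.src e + 1 ∧ x (i + 1) = G.tgt e + 1 := fun i => by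
    rcases wmat_cases G (hfin i i.2) with ⟨h, -⟩ | h
    · have := hpos i i.2; omega
    · exact h
  choose e he he' using hedge
  refine h ⟨k, e, fun i => ?_, fun i j hij => ?_, ?_⟩
  · have h5 : x (i + 1) = x ((i + 1 : Fin (k + 1)) : ℕ) := by
      rw [Fin.val_add_one]
      split_ifs with hl
      · rw [hl, Fin.val_last, h2]
      · rfl
    rw [he', he] at h5
    exact Fin.ext (by omega)
  · have h5 : x i = x j := by rw [he, he]; exact congrArg (fun a : Fin n => (a : ℕ) + 1) hij
    by_contra hne
    rcases Nat.lt_or_gt_of_ne (fun h' => hne (Fin.ext h')) with hlt | hlt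
    · exact h3 i j hlt (by omega) h5
    · exact h3 j i hlt (by omega) h5.symm
  · have h6 : ∑ i ∈ range (k + 1), wmat G (x i) (x (i + 1)) =
        ((∑ i, G.weight (e i) : ℝ) : WithTop ℝ) := by
      rw [sum_range, WithTop.coe_sum]
      exact sum_congr rfl fun i _ => by rw [he, he', wmat_edge]
    rw [h6] at h4
    exact_mod_cast h4

lemma hopDist_source_ne_top {v : ℕ} (hv : v < n + 1) :
    hopDist (n + 1) (wmat G) (n + 1) 0 v ≠ ⊤ := by
  rcases Nat.eq_zero_or_pos v with rfl | h0
  · refine ne_top_of_le_ne_top (b := 0) (by simp) ?_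
    exact (hopDist_anti (Nat.zero_le _) 0 0).trans (hopDist_self_zero 0).le
  · refine ne_top_of_le_ne_top (b := 0) (by simp) ?_
    refine (hopDist_anti (j := 1) (by omega) 0 v).trans
      ((hopDist_succ_le_edge (x := 0) (by omega) 0 0 v).trans ?_)
    rw [hopDist_self_zero, wmat_source G h0 (by omega), add_zero]

/-- In the absence of negative cycles, the distances from the source form a potential. -/
lemma hopDist_source_edge (h : NoNeg (n + 1) (wmat G)) (e : Fin m) :
    hopDist (n + 1) (wmat G) (n + 1) 0 (G.tgt e + 1) ≤
      hopDist (n + 1) (wmat G) (n + 1) 0 (G.src e + 1) + (G.weight e : ℝ) := by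
  have h1 := (G.src e).2
  have h2 := (G.tgt e).2
  rw [← wmat_edge G e]
  exact (h.stable (k := n + 1 + 1) (by omega) (by omega)).trans
    (hopDist_succ_le_edge (by omega) _ _ _)
end potential

/-! ### The whole program -/

/-- Computes distances from the source by means of the hubs, and checks that they form a potential. -/
def finishP : Prog := setS LL (sc HH) ;; layersP ;; hubMatP ;; squaresP ;; sourceP ;; checkP

/-- Decides whether the input graph has a negative cycle. -/
def mainP : Prog := logP ;; matrixP ;; listP ;; initP ;; scalesP ;; finishP

section
variable {W B : ℕ} [hg : Good W B] {σ : Mem}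

/-- If the computed values pass the test, they are a potential and there is no negative cycle. If there
is no negative cycle, they are the distances from the source, which pass the test. Nothing has to be
known about the computed values in the presence of negative cycles. -/
lemma finishP_spec {n m ℓ M g β : ℕ} (G : WeightedDigraph n m) (hS : Sizes B ℓ (n + 1) M)
    (h : ScaleInv (wmat G) ℓ (n + 1) M g σ) (g1 : 1 ≤ g) (gN : g ≤ n + 1) (hβ : σ.nat BB 0 = β)
    (hm : σ.nat 0 1 = m) (hs : ∀ e : Fin m, σ.nat 1 e = G.src e)
    (ht : ∀ e : Fin m, σ.nat 2 e = G.tgt e) (hw : ∀ e : Fin m, σ.real 0 e = G.weight e) :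
    Spec W B finishP σ
      (101000 * (ℓ * (n + 1) * M + ℓ ^ 6 * (n + 1) ^ 2) + 12 * (ℓ * β ^ 3))
      (25 * (ℓ * g) + 150 * ℓ ^ 2) (fun τ =>
        (G.HasNegativeCycle → τ.answer = 1) ∧ (¬ G.HasNegativeCycle → τ.answer = 0)) := by
  have h100 := Good.hundred_le_bound W B
  have hmn := card_edges_le G
  obtain ⟨pos, le, ge, edges, word⟩ := hS
  have hpos := h.pos
  have hle := h.le
  have hfew := h.few
  have hHB := h.lt
  have hhub := h.hubs
  rw [hβ] at hpos hle hfew hHB hhub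
  have hmN : m + 1 ≤ (n + 1) ^ 2 := by nlinarith
  set N := n + 1 with hN
  set E := 2 ^ ℓ with hE
  have E1 : 1 ≤ E := Nat.one_le_two_pow
  have powE : ∀ i ≤ 6, E ^ i ≤ E ^ 6 := fun i hi => Nat.pow_le_pow_right E1 hi
  have E3 := powE 3 (by omega)
  have E2 := powE 2 (by omega)
  have E4 := powE 1 (by omega)
  rw [pow_one] at E4
  have sq' : N * N ≤ E ^ 2 := by rw [pow_two]; exact Nat.mul_le_mul le le
  have sqN : N ^ 2 ≤ E ^ 2 := Nat.pow_le_pow_left le 2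
  have bM : β * M ≤ E ^ 3 := by
    calc β * M ≤ E * (E * E) := Nat.mul_le_mul (by omega) (edges.trans (Nat.mul_le_mul le le))
      _ = E ^ 3 := by ring
  have bN : β * N ≤ E ^ 2 := by rw [pow_two]; exact Nat.mul_le_mul (by omega) le
  have bMl : β * (M / ℓ + N) ≤ E ^ 3 + E ^ 2 := by
    rw [Nat.mul_add]
    exact Nat.add_le_add ((Nat.mul_le_mul_left _ (Nat.div_le_self _ _)).trans bM) bN
  have hTr : M / ℓ + N ≤ 2 ^ (2 * ℓ + 1) := by
    rw [pow_succ, mul_comm 2 ℓ, pow_mul, ← hE]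
    have := Nat.div_le_self M ℓ
    have : N ≤ N * N := Nat.le_mul_self N
    omega
  have hTc : m + 1 ≤ 2 ^ (2 * ℓ) := by
    rw [mul_comm 2 ℓ, pow_mul, ← hE]; omega
  refine Spec.mono (w := 2 + ((g * (β * M + (ℓ + (2 * ℓ + 1) + 1) * (β * (M / ℓ + N) + 4) +
      3 * (β * N) + 16) + 2 * (β * N) + 7) + ((4 * (β * N) + 4) +
      ((12 * (ℓ * β ^ 3) + 200 * (ℓ ^ 2 * β ^ 2)) + (100 * (ℓ * N ^ 2) +
      ((2 * ℓ) * (m + 5) + 2 * m + 11))))))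
    (d := 1 + ((g * (3 * ℓ + 3 * (2 * ℓ + 1) + 13) + 5) + (4 + (70 * ℓ ^ 2 + (40 * ℓ +
      ((2 * ℓ) * 3 + 6)))))) ?_ ?_ ?_ (fun _ _ _ h => h)
  rotate_left
  · have h1 := scale_work_le (M := M) pos g1 hpos hle hfew gN
    set X := β * M + (ℓ + (2 * ℓ + 1) + 1) * (β * (M / ℓ + N) + 4) + 3 * (β * N) + 16 with hX
    have h2 : g * X ≤ 3 * g * X := Nat.mul_le_mul_right _ (by omega)
    have h3 : ℓ ^ 2 * β ^ 2 ≤ ℓ ^ 6 * N ^ 2 :=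
      Nat.mul_le_mul (Nat.pow_le_pow_right pos (by omega)) (Nat.pow_le_pow_left hle 2)
    have h4 : ℓ ^ 1 * N ^ 2 ≤ ℓ ^ 6 * N ^ 2 :=
      Nat.mul_le_mul_right _ (Nat.pow_le_pow_right pos (by omega))
    have h5 : N ^ 2 ≤ ℓ * N ^ 2 := Nat.le_mul_of_pos_left _ pos
    have h6 : β * N ≤ N ^ 2 := by rw [sq]; exact Nat.mul_le_mul_right _ hle
    have h7 : (2 * ℓ) * (m + 5) ≤ 10 * (ℓ * N ^ 2) := by
      calc (2 * ℓ) * (m + 5) ≤ (2 * ℓ) * (5 * N ^ 2) := Nat.mul_le_mul_left _ (by omega)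
        _ = _ := by ring
    rw [pow_one] at h4
    omega
  · have c1 : g * (3 * ℓ + 3 * (2 * ℓ + 1) + 13) = 9 * (ℓ * g) + 16 * g := by ring
    have c2 : g ≤ ℓ * g := Nat.le_mul_of_pos_left _ pos
    have c3 : ℓ ≤ ℓ ^ 2 := Nat.le_self_pow (by omega) _
    omega
  refine Spec.seq (Spec.setS rfl (by rw [ev_sc, h.hh]; omega)) fun τ1 hA1 h1 => ?_
  have n1 : ∀ a, a ≠ LL → τ1.nat a = σ.nat a := fun a ha => hA1.n a (by simp [setS, Prog.wN, ha])
  have gr1 : GraphList (wmat G) ℓ N M τ1 := h.graph.congr (by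
    simp only [List.mem_cons, List.not_mem_nil, or_false, forall_eq_or_imp, forall_eq]
    refine ⟨?_, ?_, ?_, ?_, ?_, ?_, ?_, ?_⟩ <;> exact n1 _ (by decide)) (hA1.r WT rfl)
  refine Spec.seq (layersP_spec gr1 (by rw [n1 NN (by decide), h.nn])
    (by rw [n1 BB (by decide), hβ]) (by rw [h1, ev_sc, h.hh]) hTr (by omega) (by omega) (by omega)
    (by omega)) fun τ2 hA2 ⟨h2, _⟩ => ?_
  rw [n1 HB (by decide)] at h2
  have n2 : ∀ a, layersP.wN a = false → a ≠ LL → τ2.nat a = σ.nat a := fun a hz ha => by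
    rw [hA2.n a hz, n1 a ha]
  refine Spec.seq (hubMatP_spec (by rw [n2 NN rfl (by decide), h.nn])
    (by rw [n2 BB rfl (by decide), hβ]) hle (by rw [n2 HB rfl (by decide)]; exact hHB) (by omega))
    fun τ3 hA3 ⟨h3, h3'⟩ => ?_
  have n3 : ∀ a, hubMatP.wN a = false → layersP.wN a = false → a ≠ LL → τ3.nat a = σ.nat a :=
    fun a hy hz ha => by rw [hA3.n a hy, n2 a hz ha]
  rw [n2 HB rfl (by decide)] at h3'
  refine Spec.seq (squaresP_spec (w := wmat G) (g := g) (hb := σ.nat HB)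
    (by rw [n3 LG rfl rfl (by decide), h.graph.list.lgEq]) pos
    (by rw [n3 BB rfl rfl (by decide), hβ]) hpos hle le word
    (fun a ha c hc => by rw [h3' a ha c hc, h2 a ha _ (hHB c hc)])) fun τ4 hA4 h4 => ?_
  have n4 : ∀ a, squaresP.wN a = false → hubMatP.wN a = false → layersP.wN a = false → a ≠ LL →
      τ4.nat a = σ.nat a := fun a hx hy hz ha => by rw [hA4.n a hx, n3 a hy hz ha]
  refine Spec.seq (sourceP_spec (β := β) (Q := fun c => hubDist N (wmat G) g β (σ.nat HB) (ℓ + 1)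
      (σ.nat HB 0) (σ.nat HB c)) (D := fun c v => hopDist N (wmat G) g (σ.nat HB c) v)
    (by rw [n4 LG rfl rfl rfl (by decide), h.graph.list.lgEq]) pos
    (by rw [n4 NN rfl rfl rfl (by decide), h.nn]) (by rw [n4 BB rfl rfl rfl (by decide), hβ])
    hpos hle le word (fun c hc => by simpa using h4 0 hpos c hc) (fun c hc v hv => by
      rw [hA4.n DP rfl, hA4.r DR rfl, h3 c hc v hv, h2 c hc v hv])) fun τ5 hA5 h5 => ?_
  have n5 : ∀ a, sourceP.wN a = false → squaresP.wN a = false → hubMatP.wN a = false →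
      layersP.wN a = false → a ≠ LL → τ5.nat a = σ.nat a :=
    fun a hw hx hy hz ha => by rw [hA5.n a hw, n4 a hx hy hz ha]
  have r5 : τ5.real 0 = σ.real 0 := by
    rw [hA5.r 0 rfl, hA4.r 0 rfl, hA3.r 0 rfl, hA2.r 0 rfl, hA1.r 0 rfl]
  refine (checkP_spec G (by rw [n5 0 rfl rfl rfl rfl (by decide), hm])
    (by rw [n5 1 rfl rfl rfl rfl (by decide)]; exact hs)
    (by rw [n5 2 rfl rfl rfl rfl (by decide)]; exact ht) (by rw [r5]; exact hw) hTc
    (by omega)).mono le_rfl le_rfl ?_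
  intro τ _ _ ⟨h6, h6'⟩
  constructor
  · intro hc
    refine h6' ?_
    by_contra! hp
    exact not_hasNegativeCycle_of_potential (fun v => τ5.real CR (v + 1)) hp hc
  · intro hc
    have hnn := noNeg_wmat hc
    have h7 : ∀ v < N, (τ5.real CR v : WithTop ℝ) = hopDist N (wmat G) N 0 v := by
      intro v hv
      have h8 := h5 v hv
      rw [inf_hubDist hnn hHB (hhub hnn) (lt_of_le_of_lt le
        (Nat.pow_lt_pow_right (by omega) (Nat.lt_succ_self ℓ))) hpos hv, h.zero] at h8
      rw [← h8, extVal, if_pos]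
      intro h0
      rw [extVal, if_neg (not_not.2 h0)] at h8
      exact hopDist_source_ne_top hv h8.symm
    refine h6 fun e => ?_
    have h9 := hopDist_source_edge hnn e
    rw [← h7 _ (by have := (G.tgt e).2; omega), ← h7 _ (by have := (G.src e).2; omega)] at h9
    exact_mod_cast h9

/-- The number of words that the program needs. -/
lemma sizes_clog {n M : ℕ} (hn : 2 ≤ n) (hM : M ≤ (n + 1) * (n + 1)) :
    Sizes (100 * (2 ^ Nat.clog 2 (n + 1)) ^ 6) (Nat.clog 2 (n + 1)) (n + 1) M := by
  have h1 := Nat.pow_pred_clog_lt_self (b := 2) (by omega) (x := n + 1) (by omega)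
  have h2 : 0 < Nat.clog 2 (n + 1) := Nat.clog_pos (by omega) (by omega)
  refine ⟨h2, Nat.le_pow_clog (by omega) _, ?_, hM, le_rfl⟩
  obtain ⟨k, hk⟩ := Nat.exists_eq_succ_of_ne_zero h2.ne'
  rw [hk] at h1 ⊢
  rw [Nat.pred_succ] at h1
  rw [pow_succ]; omega

/-- The bound on the words is at most `(n + 1) ^ 17`, and expressions of `250` operations raise it at
most to the power `250`, where `17 * 250 = 4250`. -/
lemma good_clog {n : ℕ} (hn : 2 ≤ n) :
    Good ((n + 1) ^ 4251) (100 * (2 ^ Nat.clog 2 (n + 1)) ^ 6) := by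
  have h1 := (sizes_clog hn (le_refl ((n + 1) * (n + 1)))).ge
  set E := 2 ^ Nat.clog 2 (n + 1) with hE
  have hE1 : 1 ≤ E ^ 6 := Nat.one_le_pow _ _ Nat.one_le_two_pow
  refine ⟨by omega, ?_⟩
  have h2 : E ≤ (n + 1) ^ 2 := by nlinarith
  have h3 : 100 ≤ (n + 1) ^ 5 := by
    calc 100 ≤ 3 ^ 5 := by norm_num
      _ ≤ _ := Nat.pow_le_pow_left (by omega) 5
  have h4 : 100 * E ^ 6 ≤ (n + 1) ^ 17 := by
    calc 100 * E ^ 6 ≤ (n + 1) ^ 5 * ((n + 1) ^ 2) ^ 6 :=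
          Nat.mul_le_mul h3 (Nat.pow_le_pow_left h2 6)
      _ = (n + 1) ^ 17 := by rw [← pow_mul, ← pow_add]
  have h5 : ∀ k, 17 * 250 < k → ((n + 1) ^ 17) ^ 250 < (n + 1) ^ k := fun k hk => by
    rw [← pow_mul]; exact Nat.pow_lt_pow_right (by omega) hk
  exact (Nat.pow_le_pow_left h4 250).trans_lt (h5 _ (by norm_num))

lemma input_bdd {n m h B : ℕ} (G : WeightedDigraph n m) (hh : h ≤ n) (b : (n + 1) ^ 2 ≤ B) :
    Bdd B (input G h) := by
  have := card_edges_le G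
  intro a p
  have hm : m ≤ B := by nlinarith
  have hn : n ≤ B := by nlinarith
  simp only [input]
  split_ifs with h1 h2 h3 h4 h5 h6 h7 h8
  all_goals omega

/-- The hub distance `g` that is reached satisfies `h < 4 * g * ℓ`, so that the number of hubs, at most
`16 * ℓ * (n + 1) / g`, is at most `64 * ℓ ^ 2 * (n + 1) / (h + 1)`. -/
lemma mainP_spec {n m h : ℕ} (G : WeightedDigraph n m) (hn : 2 ≤ n) (hh : h ≤ n) {ℓ : ℕ}
    (hℓ : ℓ = Nat.clog 2 (n + 1)) (b : 100 * (2 ^ ℓ) ^ 6 ≤ B) :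
    Spec W B mainP (input G h)
      (1000000 * (ℓ ^ 2 * (n + 1) * m + ℓ ^ 7 * (n + 1) ^ 2) +
        12 * (ℓ * (64 * ℓ ^ 2 * (n + 1) / (h + 1)) ^ 3))
      (1000 * (h + ℓ ^ 5)) (fun τ =>
        (G.HasNegativeCycle → τ.answer = 1) ∧ (¬ G.HasNegativeCycle → τ.answer = 0)) := by
  have h100 := Good.hundred_le_bound W B
  have hmn := card_edges_le G
  have hS0 : ∀ M ≤ (n + 1) * (n + 1), Sizes B ℓ (n + 1) M := fun M hM => by
    have := sizes_clog hn hM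
    rw [← hℓ] at this
    exact ⟨this.pos, this.le, this.ge, this.edges, b⟩
  obtain ⟨pos, le, ge, -, -⟩ := hS0 0 (Nat.zero_le _)
  set N := n + 1 with hN
  set E := 2 ^ ℓ with hE
  have E1 : 1 ≤ E := Nat.one_le_two_pow
  have powE : ∀ i ≤ 6, E ^ i ≤ E ^ 6 := fun i hi => Nat.pow_le_pow_right E1 hi
  have E2 := powE 2 (by omega)
  have E4 := powE 1 (by omega)
  rw [pow_one] at E4
  have sqN : N ^ 2 ≤ E ^ 2 := Nat.pow_le_pow_left le 2
  have mN : m + 2 * n + 1 ≤ N ^ 2 := by rw [hN]; nlinarith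
  set len := (n + 1) * (n + 2) + 1 with hlen
  have len1 : len ≤ 2 * N ^ 2 := by rw [hlen, hN]; nlinarith
  have lenT : len ≤ 2 ^ (2 * ℓ + 1) := by
    rw [pow_succ, mul_comm 2 ℓ, pow_mul, ← hE]; omega
  set β' := 64 * ℓ ^ 2 * N / (h + 1) with hβ'
  set M' := m + 2 * n + 1 with hM'
  refine Spec.mono (w := (ℓ * 5 + 7) + ((m + 2 * n + 5) + (((2 * ℓ + 1) * (len + 4) + 10 * len + 30) +
      ((N + 5) + ((ℓ * (100000 * (ℓ * N * M' + ℓ ^ 6 * N ^ 2) + 1) + 1) +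
      (101000 * (ℓ * N * M' + ℓ ^ 6 * N ^ 2) + 12 * (ℓ * β' ^ 3)))))))
    (d := (ℓ * 3 + 4) + (3 + (((2 * ℓ + 1) * 3 + 20) + (3 + ((500 * (h + ℓ ^ 5) + ℓ + 1) +
      (25 * (h + ℓ) + 150 * ℓ ^ 2)))))) ?_ ?_ ?_ (fun _ _ _ h => h)
  rotate_left
  · have p : ∀ i ≤ 7, ℓ ^ i * N ^ 2 ≤ ℓ ^ 7 * N ^ 2 := fun i hi =>
      Nat.mul_le_mul_right _ (Nat.pow_le_pow_right pos hi)
    have p0 := p 0 (by omega)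
    have p1 := p 1 (by omega)
    have p2 := p 2 (by omega)
    have p6 := p 6 (by omega)
    rw [pow_zero, one_mul] at p0
    rw [pow_one] at p1
    have hNN : N ≤ N ^ 2 := Nat.le_self_pow (by omega) _
    have hℓN : ℓ ≤ ℓ * N ^ 2 := Nat.le_mul_of_pos_right _ (by positivity)
    have c1 : (2 * ℓ + 1) * (len + 4) ≤ 18 * (ℓ * N ^ 2) := by
      calc _ ≤ (3 * ℓ) * (6 * N ^ 2) := Nat.mul_le_mul (by omega) (by omega)
        _ = _ := by ring
    have c2 : ℓ * (ℓ * N * M') ≤ ℓ ^ 2 * N * m + 2 * (ℓ ^ 2 * N ^ 2) := by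
      calc ℓ * (ℓ * N * M') ≤ ℓ * (ℓ * N * (m + 2 * N)) := by gcongr; omega
        _ = _ := by ring
    have c3 : ℓ * N * M' ≤ ℓ * (ℓ * N * M') := Nat.le_mul_of_pos_left _ pos
    have c4 : ℓ * (100000 * (ℓ * N * M' + ℓ ^ 6 * N ^ 2) + 1) =
        100000 * (ℓ * (ℓ * N * M')) + 100000 * (ℓ ^ 7 * N ^ 2) + ℓ := by ring
    omega
  · have p : ∀ i ≤ 5, ℓ ^ i ≤ ℓ ^ 5 := fun i hi => Nat.pow_le_pow_right pos hi
    have p0 := p 0 (by omega)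
    have p1 := p 1 (by omega)
    have p2 := p 2 (by omega)
    rw [pow_zero] at p0
    rw [pow_one] at p1
    omega
  have hlog := logP_spec (W := W) (B := B) (σ := input G h) (n := n) (by simp [input]) (by omega)
  rw [← hℓ] at hlog
  refine Spec.seq hlog fun τ1 hA1 ⟨h1, h1', h1''⟩ => ?_
  have s1 : ∀ e : Fin m, τ1.nat 1 e = G.src e := fun e => by rw [hA1.n 1 rfl]; simp [input]
  have t1 : ∀ e : Fin m, τ1.nat 2 e = G.tgt e := fun e => by rw [hA1.n 2 rfl]; simp [input]
  have w1 : ∀ p, τ1.real 0 p = if h : p < m then G.weight ⟨p, h⟩ else 0 := fun p => by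
    rw [hA1.r 0 rfl]; simp [input]
  have c0 : τ1.nat 0 0 = n := by rw [hA1.n 0 rfl]; simp [input]
  have c1 : τ1.nat 0 1 = m := by rw [hA1.n 0 rfl]; simp [input]
  have c2 : τ1.nat 0 2 = h := by rw [hA1.n 0 rfl]; simp [input]
  refine Spec.seq (matrixP_spec G h1 c0 c1 s1 t1 (fun q => by
    rw [hA1.n MX rfl]; simp [input, MX]) (by omega)) fun τ2 hA2 h2 => ?_
  refine Spec.seq (listP_spec (ℓ := ℓ) G (by rw [hA2.n NN rfl, h1]) (by rw [hA2.n LG rfl, h1'])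
    pos h2 (by rw [hA2.r 0 rfl]; exact w1) hlen lenT (by omega)) fun τ3 hA3 ⟨M, hM, h3, _⟩ => ?_
  have hS := hS0 M (by rw [← sq]; omega)
  refine Spec.seq (initP_spec h3 (by rw [hA3.n NN rfl, hA2.n NN rfl, h1])
    (by rw [hA3.n EE rfl, hA2.n EE rfl, h1'']) (by omega) (by omega)) fun τ4 hA4 h4 => ?_
  refine Spec.seq ((scalesP_spec hS h4 (by
    rw [hA4.n 0 rfl, hA3.n 0 rfl, hA2.n 0 rfl, c2]) (by omega)).mono (by gcongr) le_rfl
    (fun _ _ _ h => h)) fun τ5 hA5 ⟨g, h5, g1, g2, g3⟩ => ?_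
  have n5 : ∀ a, scalesP.wN a = false → initP.wN a = false → listP.wN a = false →
      matrixP.wN a = false → τ5.nat a = τ1.nat a := fun a hw hx hy hz => by
    rw [hA5.n a hw, hA4.n a hx, hA3.n a hy, hA2.n a hz]
  have gN : g ≤ N := by
    by_contra hc
    have e1 : (h + 2) * ℓ ≤ g * ℓ := Nat.mul_le_mul_right _ (by omega)
    have e2 : h ≤ h * ℓ := Nat.le_mul_of_pos_right _ pos
    rw [add_mul] at e1
    omega
  have hβ : τ5.nat BB 0 ≤ β' := by
    rw [hβ', Nat.le_div_iff_mul_le (by omega)]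
    calc τ5.nat BB 0 * (h + 1) ≤ τ5.nat BB 0 * (4 * g * ℓ) := Nat.mul_le_mul_left _ g2
      _ = 4 * ℓ * (τ5.nat BB 0 * g) := by ring
      _ ≤ 4 * ℓ * (16 * ℓ * N) := Nat.mul_le_mul_left _ h5.few
      _ = 64 * ℓ ^ 2 * N := by ring
  refine (finishP_spec G hS h5 g1 gN rfl (by rw [n5 0 rfl rfl rfl rfl, c1])
    (by rw [n5 1 rfl rfl rfl rfl]; exact s1) (by rw [n5 2 rfl rfl rfl rfl]; exact t1)
    (by
      rw [hA5.r 0 rfl, hA4.r 0 rfl, hA3.r 0 rfl, hA2.r 0 rfl]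
      intro e; rw [w1]; simp)).mono (by gcongr) (by rw [mul_comm ℓ g]; omega) (fun _ _ _ h => h)
end

/-! ### The bounds in terms of real logarithms -/

lemma clog_le_log {n : ℕ} (hn : 2 ≤ n) : (Nat.clog 2 (n + 1) : ℝ) ≤ 5 * Real.log n := by
  have h1 := (sizes_clog hn (le_refl ((n + 1) * (n + 1)))).ge
  set ℓ := Nat.clog 2 (n + 1)
  have h2 : 2 ^ ℓ ≤ n ^ 3 := by
    have : 4 * n ≤ n ^ 3 := by
      calc 4 * n ≤ (n * n) * n := Nat.mul_le_mul_right _ (Nat.mul_le_mul hn hn)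
        _ = n ^ 3 := by ring
    omega
  have h3 : ((2 : ℝ) ^ ℓ) ≤ (n : ℝ) ^ 3 := by exact_mod_cast h2
  have h4 := Real.log_le_log (by positivity) h3
  rw [Real.log_pow, Real.log_pow] at h4
  have h5 := Real.log_two_gt_d9
  have h6 : (0 : ℝ) ≤ ℓ := Nat.cast_nonneg _
  push_cast at h4
  nlinarith

/-- The term `ℓ ^ 7 n ^ 2` is at most of the order of `n ^ 2 h log ^ 11 n`, since `1 ≤ h` and `1 ≤ ℓ`. -/
lemma work_le {n m ℓ : ℕ} {h : ℝ} (hn : 2 ≤ n) (h1 : 1 ≤ h) (hℓ : 1 ≤ ℓ)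
    (hlog : (ℓ : ℝ) ≤ 5 * Real.log n) :
    ((2000 * (1000000 * (ℓ ^ 2 * (n + 1) * m + ℓ ^ 7 * (n + 1) ^ 2) +
      12 * (ℓ * (64 * ℓ ^ 2 * (n + 1) / (⌊h⌋₊ + 1)) ^ 3)) : ℕ) : ℝ) ≤
    10 ^ 18 * ((m : ℝ) * (n : ℝ) * Real.log n ^ 2 + (n : ℝ) ^ 3 / h ^ 3 * Real.log n ^ 7 +
      (n : ℝ) ^ 2 * h * Real.log n ^ 11) := by
  have hN : ((n : ℝ) + 1) ≤ 2 * n := by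
    have : (2 : ℝ) ≤ n := by exact_mod_cast hn
    linarith
  have hℓ' : (1 : ℝ) ≤ ℓ := by exact_mod_cast hℓ
  set x : ℝ := (ℓ : ℝ) with hx
  set L := Real.log n with hL
  have hL0 : 0 ≤ L := by linarith
  have a1 : x ^ 2 * (n + 1) * m ≤ 50 * (m * n * L ^ 2) := by
    calc x ^ 2 * (n + 1) * m ≤ (5 * L) ^ 2 * (2 * n) * m := by gcongr
      _ = _ := by ring
  have a2 : x ^ 7 * (n + 1) ^ 2 ≤ 200000000 * (n ^ 2 * h * L ^ 11) := by
    calc x ^ 7 * ((n : ℝ) + 1) ^ 2 ≤ x ^ 11 * (n + 1) ^ 2 := by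
          gcongr ?_ * _
          exact pow_le_pow_right₀ hℓ' (by norm_num)
      _ ≤ (5 * L) ^ 11 * (2 * n) ^ 2 := by gcongr
      _ = 195312500 * (n ^ 2 * 1 * L ^ 11) := by ring
      _ ≤ 200000000 * (n ^ 2 * h * L ^ 11) := by gcongr; norm_num
  have a3 : ((64 * ℓ ^ 2 * (n + 1) / (⌊h⌋₊ + 1) : ℕ) : ℝ) ≤ 128 * x ^ 2 * n / h := by
    refine Nat.cast_div_le.trans ?_
    push_cast
    have := (Nat.lt_floor_add_one h).le
    calc 64 * x ^ 2 * ((n : ℝ) + 1) / (⌊h⌋₊ + 1) ≤ 64 * x ^ 2 * (2 * n) / h := by gcongr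
      _ = _ := by ring
  have a4 : x * ((64 * ℓ ^ 2 * (n + 1) / (⌊h⌋₊ + 1) : ℕ) : ℝ) ^ 3 ≤
      200000000000 * (n ^ 3 / h ^ 3 * L ^ 7) := by
    calc _ ≤ x * (128 * x ^ 2 * n / h) ^ 3 := by gcongr
      _ = 2097152 * (n ^ 3 / h ^ 3 * x ^ 7) := by ring
      _ ≤ 2097152 * (n ^ 3 / h ^ 3 * (5 * L) ^ 7) := by gcongr
      _ = 163840000000 * (n ^ 3 / h ^ 3 * L ^ 7) := by ring
      _ ≤ _ := by gcongr; norm_num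
  have b1 : 0 ≤ (m : ℝ) * n * L ^ 2 := by positivity
  have b2 : 0 ≤ (n : ℝ) ^ 3 / h ^ 3 * L ^ 7 := by positivity
  have b3 : 0 ≤ (n : ℝ) ^ 2 * h * L ^ 11 := by positivity
  rw [Nat.cast_mul, Nat.cast_add, Nat.cast_mul 12, Nat.cast_mul ℓ, Nat.cast_pow]
  push_cast at a1 a2 a4 ⊢
  linarith

lemma depth_le {n ℓ : ℕ} {h : ℝ} (h1 : 1 ≤ h) (hℓ : 1 ≤ ℓ) (hlog : (ℓ : ℝ) ≤ 5 * Real.log n) :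
    ((2000 * (1000 * (⌊h⌋₊ + ℓ ^ 5)) : ℕ) : ℝ) ≤ 10 ^ 18 * (h + Real.log n ^ 11) := by
  have hℓ' : (1 : ℝ) ≤ ℓ := by exact_mod_cast hℓ
  have a1 : (ℓ : ℝ) ^ 5 ≤ 48828125 * Real.log n ^ 11 := by
    calc (ℓ : ℝ) ^ 5 ≤ (ℓ : ℝ) ^ 11 := pow_le_pow_right₀ hℓ' (by norm_num)
      _ ≤ (5 * Real.log n) ^ 11 := by gcongr
      _ = _ := by ring
  have a2 : (⌊h⌋₊ : ℝ) ≤ h := Nat.floor_le (by linarith)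
  have a3 : 0 ≤ Real.log n ^ 11 := by
    have : 0 ≤ Real.log n := by linarith
    positivity
  push_cast
  linarith

end Par

/-- One program `P`, with words of `O(log n)` bits and one constant `K`, serves all graphs and all
parameters `h`. -/
theorem mainTheorem6 :
    ∃ (P : Par.Prog) (c : ℕ) (K : ℝ), ∀ (n m : ℕ), 2 ≤ n →
      ∀ (G : WeightedDigraph n m) (h : ℝ), 1 ≤ h → h ≤ (n : ℝ) →
        ∃ (τ : Par.Mem) (work depth : ℕ),
          Par.Run ((n + 1) ^ c) P (Par.input G ⌊h⌋₊) τ work depth ∧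
          (G.HasNegativeCycle → τ.answer = 1) ∧
          (¬ G.HasNegativeCycle → τ.answer = 0) ∧
          (work : ℝ) ≤ K * ((m : ℝ) * (n : ℝ) * Real.log n ^ 2
            + (n : ℝ) ^ 3 / h ^ 3 * Real.log n ^ 7
            + (n : ℝ) ^ 2 * h * Real.log n ^ 11) ∧
          (depth : ℝ) ≤ K * (h + Real.log n ^ 11) := by
  refine ⟨Par.mainP, 4251, 10 ^ 18, fun n m hn G h h1 hle => ?_⟩
  set ℓ := Nat.clog 2 (n + 1) with hℓ
  have : Par.Good ((n + 1) ^ 4251) (100 * (2 ^ ℓ) ^ 6) := Par.good_clog hn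
  have hS := Par.sizes_clog hn (le_refl ((n + 1) * (n + 1)))
  rw [← hℓ] at hS
  have hfl : ⌊h⌋₊ ≤ n := Nat.floor_le_of_le hle
  have hin : (n + 1) ^ 2 ≤ 100 * (2 ^ ℓ) ^ 6 := by
    have e1 : (n + 1) ^ 2 ≤ (2 ^ ℓ) ^ 2 := Nat.pow_le_pow_left hS.le 2
    have e2 : (2 ^ ℓ) ^ 2 ≤ (2 ^ ℓ) ^ 6 := Nat.pow_le_pow_right Nat.one_le_two_pow (by omega)
    omega
  obtain ⟨τ, work, depth, hrun, hwork, hdepth, -, hyes, hno⟩ :=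
    Par.mainP_spec (W := (n + 1) ^ 4251) G hn hfl hℓ le_rfl (Par.input_bdd G hfl hin)
  have hlog := Par.clog_le_log hn
  exact ⟨τ, work, depth, hrun, hyes, hno,
    (Nat.cast_le.2 hwork).trans (Par.work_le hn h1 hS.pos hlog),
    (Nat.cast_le.2 hdepth).trans (Par.depth_le h1 hS.pos hlog)⟩
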